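/- **Setting.** Let $M$ be a smooth manifold of dimension $m\ge 3$ with a conformal structure of signature $(p,q)$, $p+q=m$. A $\lambda$-density is a function $f$ of linear frames with $f(uA)=|\det A|^{\lambda}f(u)$; a symbol of degree $k$ is a symmetric contravariant $k$-tensor field $S$ with coefficients in the $\delta$-densities, $\delta=\mu-\lambda$; $S$ is trace-free if its contraction with a metric of the conformal structure vanishes. Put $\gamma_{n}=\frac{m+n-m\delta}{m}$ and assume that $\delta$ is not critical, i.e. $\gamma_{2k-l}\ne0$ for all $k,l\in\mathbb N$ with $2\le l\le k+1$. Let $P\to M$ be the principal $H$-bundle, $H\cong CO(p,q)\ltimes\mathbb R^{m*}$, with the normal Cartan connection $\omega$ (values in $\mathfrak g=so(p+1,q+1)=\mathfrak g_{-1}\oplus\mathfrak g_0\oplus\mathfrak g_1$) of the conformal structure, and let $p^*$ denote the lift of densities and symbols to equivariant functions on $P$. For a trace-free symbol $S$ of degree $k$ let $\hat S=S_k+\dots+S_0$ be the function with $S_k=p^*S$, with values in the tree-like subspace generated from the trace-free symmetric tensors $I_{k,0}$ by the maps $\gamma(h)$, $h\in\mathfrak g_1$, where $$\gamma(h)(x_1\otimes\cdots\otimes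 x_k)=\lambda\sum_i \mathrm{tr}([h,x_i])\,x_1\otimes\cdots(i)\cdots\otimes x_k+\sum_{i<j}x_1\otimes\cdots(i)\cdots\otimes[[h,x_i],x_j]\otimes\cdots\otimes x_k ,$$ such that $(C^\flat+N^\omega)\hat S=\alpha_{k,0}\hat S$. Here $C^\flat$ is the Casimir operator, $\alpha_{k,0}$ its eigenvalue on $I_{k,0}$, and $N^\omega=-2\sum_i\gamma(\varepsilon^i)L_{\omega^{-1}(e_i)}$ with Killing-dual bases $(e_i)$, $(\varepsilon^i)$ of $\mathfrak g_{-1}$, $\mathfrak g_1$. The natural and conformally invariant quantization $Q_M$ is defined by $$p^*\big(Q_M(g,S)(f)\big)=\sum_{n=0}^k\langle S_n,(\nabla^\omega)^n p^*f\rangle,\qquad (\nabla^\omega)^nF(X_1,\dots,X_n)=L_{\omega^{-1}(X_1)}\cdots L_{\omega^{-1}(X_n)}F .$$ **Notation on $M$.** Let $g$ be any metric of the conformal structure, $\nabla$ its Levi-Civita connection, $R(X,Y)=[\nabla_X,\nabla_Y]-\nabla_{[X,Y]}$, $\mathrm{Ric}(X,Y)=\mathrm{tr}(Z\mapsto R(X,Z)Y)$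 (with this sign, $\mathrm{Ric}$ is negative definite on round spheres), $\mathrm R$ the $g$-trace of $\mathrm{Ric}$, $$r=\frac{1}{2-m}\mathrm{Ric},\qquad \Gamma=\frac{-1}{m-2}\Big(\mathrm{Ric}-\frac{g\,\mathrm R}{2(m-1)}\Big).$$ $\nabla_s$ is the symmetrized covariant derivative, $\vee$ the symmetric product with $(A\vee B)(X,\dots,X)=A(X,\dots,X)B(X,\dots,X)$, $\mathrm{Div}$ the divergence of symbols, $i(r)$ contraction with $r$, and $$T_1T=(-\lambda m-j)(j+1)\,\Gamma\vee T,\qquad T_2S'=(m\gamma_{2k-2}-k+j)(k-j+1)\,i(r)S'$$ for a symmetric covariant $j$-tensor $T$ with values in the $\lambda$-densities and a symbol $S'$ of degree $j$. Further $$C_{k,0}=1,\qquad C_{k,l}=\frac{(\lambda+\frac{k-1}{m})\cdots(\lambda+\frac{k-l}{m})}{\gamma_{2k-2}\cdots\gamma_{2k-l-1}}\binom kl\quad(l\ge1).$$ **Theorem.** For every trace-free symbol $S$ of degree $k$ and every $\lambda$-density $f$ the function $\hat S$ exists and is unique, it determines a unique $\mu$-density $Q_M(g,S)(f)$, and $$Q_M(g,S)(f)=\sum_{l=0}^{k}C_{k,l}\Big\langle\pi_{l}\Big(\sum_{j=0}^{l}(\mathrm{Div}+T_{2})^{j}\Big)S,\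 \pi_{k-l}\Big(\sum_{j=0}^{k-l}(\nabla_s+T_{1})^{j}\Big)f\Big\rangle ,$$ where $\pi_d$ is the projection on the operators that change the number of indices by $d$ in absolute value ($\nabla_s,\mathrm{Div}$ change it by $1$ and $T_1,T_2$ by $2$). The formula remains true if $\Gamma$ is replaced by $r$ in $T_1$. In particular, for $k=2$, $$Q_M(g,S)(f)=\langle S,(\nabla_{s}^{2}-m\lambda r)f\rangle+C_{2,1}\langle \mathrm{Div} S,\nabla_{s}f\rangle+C_{2,2}\langle(\mathrm{Div}^{2}+m\gamma_{2}i(r))S,f\rangle,$$ and for $k=3$, $$\begin{aligned}Q_M(g,S)(f)={}&\langle S,(\nabla_{s}^{3}-(3m\lambda+2)r\vee\nabla_{s}-\lambda m(\nabla_{s}r))f\rangle+C_{3,1}\langle \mathrm{Div} S,(\nabla_{s}^{2}-m\lambda r)f\rangle\\&+C_{3,2}\langle(\mathrm{Div}^{2}+m\gamma_{4}i(r))S,\nabla_{s}f\rangle\\&+C_{3,3}\langle(\mathrm{Div}^{3}+(3\gamma_{4}m-2)i(r)\mathrm{Div}+m\gamma_{4}i(\nabla_{s}r))S,f\rangle.\end{aligned}$$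 -/

import Mathlib

open Set Topology
open scoped Manifold ContDiff

noncomputable section

namespace ConformalQuantization

/-! ### The algebra `so(p+1,q+1)` and the group `H` -/

/-- The model space `ℝ^m`. -/
abbrev Euc (m : ℕ) := EuclideanSpace ℝ (Fin m)

/-- The canonical metric of signature `(p, m - p)` on `ℝ^m` is `diag (eta p)`. -/
def eta {m : ℕ} (p : ℕ) (i : Fin m) : ℝ := if (i : ℕ) < p then 1 else -1

/-- Indices `0; 1, …, m; ∞` of `ℝ^{m+2}`. -/
abbrev Idx (m : ℕ) := Unit ⊕ (Fin m ⊕ Unit)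

abbrev iZero {m : ℕ} : Idx m := Sum.inl ()
abbrev iMid {m : ℕ} (i : Fin m) : Idx m := Sum.inr (Sum.inl i)
abbrev iInf {m : ℕ} : Idx m := Sum.inr (Sum.inr ())

/-- The form `-2 x_0 x_∞ + ∑ η_i x_i²` of signature `(p+1, q+1)`, `q = m - p`. -/
def formJ (m p : ℕ) : Matrix (Idx m) (Idx m) ℝ := Matrix.of fun a b =>
  match a, b with
  | Sum.inl _, Sum.inr (Sum.inr _) => -1
  | Sum.inr (Sum.inr _), Sum.inl _ => -1
  | Sum.inr (Sum.inl i), Sum.inr (Sum.inl j) => if i = j then eta p i else 0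
  | _, _ => 0

/-- `𝔤 = so(p+1,q+1)`, as the matrices `A` with `Aᵀ J + J A = 0`. -/
abbrev soAlg (m p : ℕ) : Submodule ℝ (Matrix (Idx m) (Idx m) ℝ) :=
  skewAdjointMatricesSubmodule (formJ m p)

/-- The matrix of `v ∈ 𝔤₋₁ = ℝ^m`, i.e. `(0, v♭, 0; 0, 0, v; 0, 0, 0)`. -/
def minusMat (m p : ℕ) (v : Fin m → ℝ) : Matrix (Idx m) (Idx m) ℝ := Matrix.of fun a b =>
  match a, b with
  | Sum.inl _, Sum.inr (Sum.inl i) => eta p i * v i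
  | Sum.inr (Sum.inl i), Sum.inr (Sum.inr _) => v i
  | _, _ => 0

/-- The matrix of `ξ ∈ 𝔤₁ = ℝ^{m*}`, i.e. `(0, 0, 0; ξ♯, 0, 0; 0, ξ, 0)`. -/
def plusMat (m p : ℕ) (ξ : Fin m → ℝ) : Matrix (Idx m) (Idx m) ℝ := Matrix.of fun a b =>
  match a, b with
  | Sum.inr (Sum.inl i), Sum.inl _ => eta p i * ξ i
  | Sum.inr (Sum.inr _), Sum.inr (Sum.inl i) => ξ i
  | _, _ => 0

theorem minusMat_mem (m p : ℕ) (v : Fin m → ℝ) : minusMat m p v ∈ soAlg m p := by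
  rw [mem_skewAdjointMatricesSubmodule,
    Matrix.IsSkewAdjoint, Matrix.IsAdjointPair]
  ext a b
  rcases a with a | a | a <;> rcases b with b | b | b <;>
    simp [Matrix.mul_apply, formJ, minusMat, Matrix.transpose_apply, Fintype.sum_sum_type,
      mul_comm]

/-- The inclusion of `𝔤₋₁` in `𝔤`. -/
def gMinus {m p : ℕ} (v : Fin m → ℝ) : soAlg m p := ⟨minusMat m p v, minusMat_mem m p v⟩

/-- The `𝔤₋₁`-component of an element of `𝔤`. -/
def minusPart {m : ℕ} (X : Matrix (Idx m) (Idx m) ℝ) (i : Fin m) : ℝ := X (iMid i) iInf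

/-- The `𝔤₀`-component of an element of `𝔤`, as an element of `co(p,q) ⊆ gl(m)`: the matrix of
its adjoint action on `𝔤₋₁ = ℝ^m`. -/
def zeroPart {m : ℕ} (X : Matrix (Idx m) (Idx m) ℝ) : Matrix (Fin m) (Fin m) ℝ :=
  Matrix.of fun i j => X (iMid i) (iMid j) - X iInf iInf * (if i = j then 1 else 0)

/-- The bracket `[v, ξ] = v ⊗ ξ + ξ(v) I - ξ♯ ⊗ v♭ ∈ co(p,q)` of `v ∈ 𝔤₋₁` and `ξ ∈ 𝔤₁`. -/
def br {m : ℕ} (p : ℕ) (v ξ : Fin m → ℝ) : Matrix (Fin m) (Fin m) ℝ :=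
  Matrix.of fun i j => v i * ξ j + (∑ a, ξ a * v a) * (if i = j then 1 else 0)
    - (eta p i * ξ i) * (eta p j * v j)

/-- `br` is the bracket of `so(p+1,q+1)`. -/
theorem zeroPart_lie {m p : ℕ} (v ξ : Fin m → ℝ) :
    zeroPart (minusMat m p v * plusMat m p ξ - plusMat m p ξ * minusMat m p v) = br p v ξ := by
  ext i j
  simp [zeroPart, br, Matrix.mul_apply, minusMat, plusMat,
    Fintype.sum_sum_type]
  split_ifs <;> ring

/-- The group `H ≅ CO(p,q) ⋉ ℝ^{m*}`: the isometries of the form that preserve the ray of the null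
vector `e_∞`. These are the matrices
`(a⁻¹, 0, 0; a⁻¹Aξ♯, A, 0; |ξ|²/(2a), ξ, a)` with `A ∈ O(p,q)`, taken modulo `±I`: the
representative with `a > 0` is chosen. -/
def groupH (m p : ℕ) : Subgroup (Matrix (Idx m) (Idx m) ℝ)ˣ where
  carrier := {h | (h : Matrix (Idx m) (Idx m) ℝ).transpose * formJ m p * h = formJ m p ∧
    ∃ a : ℝ, 0 < a ∧ (h : Matrix (Idx m) (Idx m) ℝ).mulVec (Pi.single iInf 1)
      = a • Pi.single iInf 1}
  one_mem' := ⟨by simp, 1, one_pos, by rw [Units.val_one, Matrix.one_mulVec, one_smul]⟩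
  mul_mem' := by
    rintro h h' ⟨h1, a, ha, h2⟩ ⟨h1', a', ha', h2'⟩
    refine ⟨?_, a * a', mul_pos ha ha', ?_⟩
    · rw [Units.val_mul, Matrix.transpose_mul]
      calc _ = (h' : Matrix (Idx m) (Idx m) ℝ).transpose *
            ((h : Matrix (Idx m) (Idx m) ℝ).transpose * formJ m p * h) * h' := by
              simp only [Matrix.mul_assoc]
        _ = _ := by rw [h1, h1']
    · rw [Units.val_mul, ← Matrix.mulVec_mulVec, h2', Matrix.mulVec_smul, h2, smul_smul, mul_comm]
  inv_mem' := by
    rintro h ⟨h1, a, ha, h2⟩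
    refine ⟨?_, a⁻¹, inv_pos.2 ha, ?_⟩
    · have e1 : (h : Matrix (Idx m) (Idx m) ℝ) * (↑h⁻¹ : Matrix (Idx m) (Idx m) ℝ) = 1 := by simp
      have e2 : (↑h⁻¹ : Matrix (Idx m) (Idx m) ℝ).transpose *
          (h : Matrix (Idx m) (Idx m) ℝ).transpose = 1 := by
        rw [← Matrix.transpose_mul, e1, Matrix.transpose_one]
      calc _ = (↑h⁻¹ : Matrix (Idx m) (Idx m) ℝ).transpose *
            ((h : Matrix (Idx m) (Idx m) ℝ).transpose * formJ m p * h) *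
              (↑h⁻¹ : Matrix (Idx m) (Idx m) ℝ) := by rw [h1]
        _ = ((↑h⁻¹ : Matrix (Idx m) (Idx m) ℝ).transpose *
            (h : Matrix (Idx m) (Idx m) ℝ).transpose) * formJ m p *
              ((h : Matrix (Idx m) (Idx m) ℝ) * (↑h⁻¹ : Matrix (Idx m) (Idx m) ℝ)) := by
              simp only [Matrix.mul_assoc]
        _ = _ := by rw [e1, e2, Matrix.one_mul, Matrix.mul_one]
    · have e1 : (↑h⁻¹ : Matrix (Idx m) (Idx m) ℝ) * (h : Matrix (Idx m) (Idx m) ℝ) = 1 := by simp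
      have h3 := congrArg (fun w => a⁻¹ • (↑h⁻¹ : Matrix (Idx m) (Idx m) ℝ).mulVec w) h2
      simp only [Matrix.mulVec_mulVec, e1, Matrix.one_mulVec, Matrix.mulVec_smul, smul_smul,
        inv_mul_cancel₀ ha.ne', one_smul] at h3
      exact h3.symm

/-! ### Metrics, densities and symbols on a manifold, as functions of linear frames

A tensor (density) of type `V` is a `GL(m)`-equivariant `V`-valued function of the linear frames
`v = (v_1, …, v_m)` of the tangent spaces. It is smooth if its components in the coordinate frames
of every chart of the smooth structure are. -/

section Fields

variable {m : ℕ} {M : Type*} [TopologicalSpace M] [ChartedSpace (Euc m) M]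

/-- The coordinate frame `(∂_1, …, ∂_m)` of the chart `φ` at the point with coordinates `y`. -/
def coordFrame (φ : OpenPartialHomeomorph M (Euc m)) (y : Euc m) (i : Fin m) :
    TangentSpace (𝓡 m) (φ.symm y) :=
  mfderiv (𝓡 m) (𝓡 m) φ.symm y (EuclideanSpace.single i (1 : ℝ))

/-- The frame `v A`. -/
def changeFrame {x : M} (v : Fin m → TangentSpace (𝓡 m) x) (A : Matrix (Fin m) (Fin m) ℝ) :
    Fin m → TangentSpace (𝓡 m) x := fun j => ∑ i, A i j • v i

variable (m M)

/-- A smooth pseudo-Riemannian metric of signature `(p, m - p)`. -/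
structure Metric (p : ℕ) where
  toFun : (x : M) → TangentSpace (𝓡 m) x →ₗ[ℝ] TangentSpace (𝓡 m) x →ₗ[ℝ] ℝ
  symm : ∀ x v w, toFun x v w = toFun x w v
  signature : ∀ x, ∃ v : Fin m → TangentSpace (𝓡 m) x, ∀ i j,
    toFun x (v i) (v j) = if i = j then eta p i else 0
  smooth : ∀ φ ∈ IsManifold.maximalAtlas (𝓡 m) ∞ M, ∀ i j, ContDiffOn ℝ ∞
    (fun y => toFun (φ.symm y) (coordFrame φ y i) (coordFrame φ y j)) φ.target

/-- A smooth `lam`-density: `f(v A) = |det A|^lam f(v)`. (Only the values at frames carry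
information; tuples that are not frames get the value `0`.) -/
structure Density (lam : ℝ) where
  toFun : (x : M) → (Fin m → TangentSpace (𝓡 m) x) → ℝ
  equivariant : ∀ x (v : Fin m → TangentSpace (𝓡 m) x), LinearIndependent ℝ v →
    ∀ A : Matrix (Fin m) (Fin m) ℝ, A.det ≠ 0 →
      toFun x (changeFrame v A) = |A.det| ^ lam * toFun x v
  support : ∀ x (v : Fin m → TangentSpace (𝓡 m) x), ¬ LinearIndependent ℝ v → toFun x v = 0
  smooth : ∀ φ ∈ IsManifold.maximalAtlas (𝓡 m) ∞ M, ContDiffOn ℝ ∞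
    (fun y => toFun (φ.symm y) (coordFrame φ y)) φ.target

/-- A smooth symbol of degree `k`: a symmetric contravariant `k`-tensor field with coefficients in
the `δ`-densities, given by its components in the linear frames. -/
structure Symb (δ : ℝ) (k : ℕ) where
  toFun : (x : M) → (Fin m → TangentSpace (𝓡 m) x) → (Fin k → Fin m) → ℝ
  symm : ∀ x v (s : Equiv.Perm (Fin k)) (i : Fin k → Fin m), toFun x v (i ∘ s) = toFun x v i
  equivariant : ∀ x (v : Fin m → TangentSpace (𝓡 m) x), LinearIndependent ℝ v →
    ∀ A : Matrix (Fin m) (Fin m) ℝ, A.det ≠ 0 → ∀ i : Fin k → Fin m,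
      toFun x (changeFrame v A) i
        = |A.det| ^ δ * ∑ j : Fin k → Fin m, (∏ a, A⁻¹ (i a) (j a)) * toFun x v j
  support : ∀ x (v : Fin m → TangentSpace (𝓡 m) x), ¬ LinearIndependent ℝ v → toFun x v = 0
  smooth : ∀ φ ∈ IsManifold.maximalAtlas (𝓡 m) ∞ M, ∀ i, ContDiffOn ℝ ∞
    (fun y => toFun (φ.symm y) (coordFrame φ y) i) φ.target

variable {m M}

/-- `S` is trace-free: the contraction of `g` with any two slots of `S` vanishes. -/
def Symb.IsTraceFree {δ : ℝ} {k p : ℕ} (S : Symb m M δ k) (g : Metric m M p) : Prop :=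
  ∀ (x : M) (v : Fin m → TangentSpace (𝓡 m) x), LinearIndependent ℝ v →
    ∀ (a b : Fin k), a ≠ b → ∀ idx : Fin k → Fin m,
      ∑ i, ∑ j, g.toFun x (v i) (v j) *
        S.toFun x v (Function.update (Function.update idx a i) b j) = 0

end Fields

/-! ### Conformal Cartan geometries -/

/-- A principal `H`-bundle `P → M` with a Cartan connection `ω` with values in `so(p+1,q+1)`. -/
structure CartanGeometry (m p : ℕ) (M : Type*) [TopologicalSpace M] [ChartedSpace (Euc m) M]
    (F : Type*) [NormedAddCommGroup F] [NormedSpace ℝ F]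
    (P : Type*) [TopologicalSpace P] [ChartedSpace F P] [IsManifold 𝓘(ℝ, F) ∞ P] where
  /-- the bundle projection -/
  proj : P → M
  /-- the right action of `H` -/
  act : P → groupH m p → P
  act_one : ∀ u, act u 1 = u
  act_mul : ∀ u h h', act u (h * h') = act (act u h) h'
  proj_act : ∀ u h, proj (act u h) = proj u
  /-- the action is free, and transitive on the fibres -/
  simply_transitive : ∀ u v, proj u = proj v → ∃! h, act u h = v
  contMDiff_proj : ContMDiff 𝓘(ℝ, F) (𝓡 m) ∞ proj
  /-- the action `P × H → P` is smooth (tested on smoothly parametrized families) -/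
  contMDiff_act : ∀ (n : ℕ) (c : Euc n → P) (h : Euc n → groupH m p),
    ContMDiff (𝓡 n) 𝓘(ℝ, F) ∞ c →
    (∀ a b, ContDiff ℝ ∞ fun t => ((h t : (Matrix (Idx m) (Idx m) ℝ)ˣ) :
      Matrix (Idx m) (Idx m) ℝ) a b) →
    ContMDiff (𝓡 n) 𝓘(ℝ, F) ∞ fun t => act (c t) (h t)
  /-- the bundle is locally trivial: there are smooth local sections -/
  local_section : ∀ x : M, ∃ U : Set M, IsOpen U ∧ x ∈ U ∧ ∃ s : M → P,
    ContMDiffOn (𝓡 m) 𝓘(ℝ, F) ∞ s U ∧ ∀ y ∈ U, proj (s y) = y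
  /-- the connection form; each `ω_u : T_u P → 𝔤` is a linear bijection -/
  conn : (u : P) → TangentSpace 𝓘(ℝ, F) u ≃ₗ[ℝ] soAlg m p
  /-- `ω` is smooth: so are the vector fields `ω⁻¹(X)`, `X ∈ 𝔤` -/
  contMDiff_conn : ∀ X : soAlg m p, ContMDiff 𝓘(ℝ, F) 𝓘(ℝ, F).tangent ∞
    fun u => (⟨u, (conn u).symm X⟩ : TangentBundle 𝓘(ℝ, F) P)
  /-- `R_h^* ω = Ad(h⁻¹) ω` -/
  equivariant : ∀ (u : P) (h : groupH m p) (ζ : TangentSpace 𝓘(ℝ, F) u),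
    ((conn (act u h) (mfderiv 𝓘(ℝ, F) 𝓘(ℝ, F) (fun v => act v h) u ζ) : soAlg m p) :
        Matrix (Idx m) (Idx m) ℝ)
      = ((h⁻¹ : groupH m p) : (Matrix (Idx m) (Idx m) ℝ)ˣ) *
        (conn u ζ : Matrix (Idx m) (Idx m) ℝ) * ((h : (Matrix (Idx m) (Idx m) ℝ)ˣ))
  /-- `ω(X^*) = X`, where `X^*` is the velocity of `t ↦ u · exp(tX)`, for `X` in the Lie algebra of
  `H` -/
  fundamental : ∀ (u : P) (X : soAlg m p) (c : ℝ → groupH m p),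
    (∀ t : ℝ, ((c t : (Matrix (Idx m) (Idx m) ℝ)ˣ) : Matrix (Idx m) (Idx m) ℝ)
      = NormedSpace.exp (t • (X : Matrix (Idx m) (Idx m) ℝ))) →
    HasMFDerivAt 𝓘(ℝ, ℝ) 𝓘(ℝ, F) (fun t => act u (c t)) 0
      (ContinuousLinearMap.toSpanSingleton ℝ ((conn (act u (c 0))).symm X))

section Cartan

variable {m p : ℕ} {M : Type*} [TopologicalSpace M] [ChartedSpace (Euc m) M]
  {F : Type*} [NormedAddCommGroup F] [NormedSpace ℝ F]
  {P : Type*} [TopologicalSpace P] [ChartedSpace F P] [IsManifold 𝓘(ℝ, F) ∞ P]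

/-- The vector field `ω⁻¹(X)` on `P`. -/
def CartanGeometry.vf (C : CartanGeometry m p M F P) (X : soAlg m p) (u : P) :
    TangentSpace 𝓘(ℝ, F) u := (C.conn u).symm X

/-- The basis vector `e_a` of `𝔤₋₁`. -/
def eVec {m p : ℕ} (a : Fin m) : soAlg m p := gMinus (Pi.single a 1)

/-- The linear frame of `T_{π(u)} M` determined by `u ∈ P`, i.e. `a ↦ π_* ω_u⁻¹(e_a)`; this is the
projection `p : P → P₀ ⊆ P¹M`. -/
def CartanGeometry.frame (C : CartanGeometry m p M F P) (u : P) (a : Fin m) :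
    TangentSpace (𝓡 m) (C.proj u) :=
  mfderiv 𝓘(ℝ, F) (𝓡 m) C.proj u (C.vf (eVec a) u)

/-- `g` is a metric of the conformal structure defined by `P`: all the frames of `P₀` are conformal
frames of `g`. -/
def CartanGeometry.IsMetric (C : CartanGeometry m p M F P) (g : Metric m M p) : Prop :=
  ∀ u : P, ∃ s : ℝ, 0 < s ∧ ∀ a b, g.toFun (C.proj u) (C.frame u a) (C.frame u b)
    = s * (if a = b then eta p a else 0)

/-- The curvature `Ω = dω + ½[ω, ω]` evaluated on `ω⁻¹(X)` and `ω⁻¹(Y)`, that is,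
`[X, Y] - ω([ω⁻¹(X), ω⁻¹(Y)])`. -/
def CartanGeometry.curvature (C : CartanGeometry m p M F P) (X Y : soAlg m p) (u : P) :
    Matrix (Idx m) (Idx m) ℝ :=
  ((X : Matrix (Idx m) (Idx m) ℝ) * Y - (Y : Matrix (Idx m) (Idx m) ℝ) * X)
    - (C.conn u (VectorField.mlieBracket 𝓘(ℝ, F) (C.vf X) (C.vf Y) u) : soAlg m p)

/-- The Cartan connection is normal: it is torsion-free (`Ω_{-1} = 0`), and `Ω_0` has vanishing
Ricci-type trace `∑_a K^a_{c a b}`. -/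
def CartanGeometry.IsNormal (C : CartanGeometry m p M F P) : Prop :=
  (∀ (u : P) (a b i : Fin m),
    minusPart (C.curvature (eVec a) (eVec b) u) i = 0) ∧
  (∀ (u : P) (b c : Fin m),
    ∑ a, zeroPart (C.curvature (eVec a) (eVec b) u) a c = 0)

/-- `L_{ω⁻¹(e_a)}` on functions on `P`. -/
def CartanGeometry.lieD (C : CartanGeometry m p M F P) (a : Fin m) (f : P → ℝ) (u : P) : ℝ :=
  mfderiv 𝓘(ℝ, F) 𝓘(ℝ, ℝ) f u (C.vf (eVec a) u)

/-- `(∇^ω)^n f (e_{i_1}, …, e_{i_n}) = L_{ω⁻¹(e_{i_1})} ∘ ⋯ ∘ L_{ω⁻¹(e_{i_n})} f`. -/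
def CartanGeometry.nablaPow (C : CartanGeometry m p M F P) (f : P → ℝ) :
    (n : ℕ) → (Fin n → Fin m) → P → ℝ
  | 0, _ => f
  | n + 1, i => C.lieD (i 0) (C.nablaPow f n (Fin.tail i))

/-- The lift `p^* f` of a density to `P`. -/
def CartanGeometry.liftD (C : CartanGeometry m p M F P) {lam : ℝ} (f : Density m M lam) (u : P) :
    ℝ := f.toFun (C.proj u) (C.frame u)

/-- The lift `p^* S` of a symbol to `P`. -/
def CartanGeometry.liftS (C : CartanGeometry m p M F P) {δ : ℝ} {k : ℕ} (S : Symb m M δ k)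
    (u : P) : (Fin k → Fin m) → ℝ := S.toFun (C.proj u) (C.frame u)

end Cartan

/-! ### The representations `⊗^n 𝔤₋₁ ⊗ Δ^δ`, the map `γ`, the Casimir operator -/

/-- The components of an element of `⊗^n 𝔤₋₁ ⊗ Δ^δ(ℝ^m)` (in the canonical basis). -/
abbrev Ten (m n : ℕ) := (Fin n → Fin m) → ℝ

section Algebra

variable {m : ℕ}

/-- The action `ρ_*(B)` of `B ∈ gl(m)` on `⊗^n ℝ^m ⊗ Δ^δ(ℝ^m)`. -/
def rho (δ : ℝ) {n : ℕ} (B : Matrix (Fin m) (Fin m) ℝ) (T : Ten m n) : Ten m n := fun i =>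
  ∑ a, ∑ j, B (i a) j * T (Function.update i a j) - δ * B.trace * T i

/-- The map `γ(h)`, `h ∈ 𝔤₁`: on a product `x_1 ⊗ ⋯ ⊗ x_{n+1}` it is
`λ ∑_i tr([h, x_i]) x_1 ⊗ ⋯ (i) ⋯ ⊗ x_{n+1}
  + ∑_{i < j} x_1 ⊗ ⋯ (i) ⋯ ⊗ [[h, x_i], x_j] ⊗ ⋯ ⊗ x_{n+1}`,
where `(i)` means that `x_i` is omitted; note `[h, x] = - br x h`. -/
def gammaMap (p : ℕ) (lam : ℝ) {n : ℕ} (h : Fin m → ℝ) (T : Ten m (n + 1)) : Ten m n := fun idx =>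
  lam * ∑ i : Fin (n + 1), ∑ a : Fin m,
      (-(br p (Pi.single a 1) h)).trace * T (i.insertNth a idx)
  + ∑ i : Fin (n + 1), ∑ j : Fin n, if i < i.succAbove j then
      ∑ a : Fin m, ∑ b : Fin m, (-(br p (Pi.single a 1) h)) (idx j) b *
        T (i.insertNth a (Function.update idx j b)) else 0

/-- The element `e_i ⊗ e_j♭ - e_j ⊗ e_i♭` of `so(p,q)`. -/
def rot (p : ℕ) (i j : Fin m) : Matrix (Fin m) (Fin m) ℝ := Matrix.of fun a b =>
  (if a = i then 1 else 0) * (if b = j then eta p j else 0)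
    - (if a = j then 1 else 0) * (if b = i then eta p i else 0)

/-- The covectors `ε^i ∈ 𝔤₁` dual to the basis `e_i` of `𝔤₋₁` with respect to the Killing form,
normalized as `K(X, Y) = -½ tr(XY)` on `so(p+1,q+1)`: these are minus the canonical covectors. -/
def killingDual (i : Fin m) : Fin m → ℝ := -Pi.single i 1

/-- The Casimir operator `C^♭ = ∑_i ρ_*([e_i, ε^i]) + ∑_j ρ_*(A_j) ρ_*(A_j^*)`, with `(A_j)` a basis
of `𝔤₀` and `(A_j^*)` its Killing-dual basis: for `K` as above the identity of `co(p,q)` is dual to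
minus itself, and `rot i j`, `i < j`, is dual to `η_i η_j rot i j`. -/
def casimir (p : ℕ) (δ : ℝ) {n : ℕ} (T : Ten m n) : Ten m n :=
  ∑ i, rho δ (br p (Pi.single i 1) (killingDual i)) T - rho δ 1 (rho δ 1 T)
    + ∑ i, ∑ j, if i < j then
        (eta p i * eta p j) • rho δ (rot p i j) (rho δ (rot p i j) T) else 0

/-- The irreducible component `I_{n,0}`: the symmetric trace-free tensors. -/
def traceFree (p : ℕ) (n : ℕ) : Submodule ℝ (Ten m n) :=
  Submodule.span ℝ {T | (∀ (s : Equiv.Perm (Fin n)) i, T (i ∘ s) = T i) ∧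
    ∀ (a b : Fin n), a ≠ b → ∀ idx : Fin n → Fin m,
      ∑ i, eta p i * T (Function.update (Function.update idx a i) b i) = 0}

/-- `tree p lam d n` is the part `tree^d(I_{n+d,0})`, contained in the tensors of degree `n`, of the
tree-like subspace: `tree^0(I) = I`, `tree^{d+1}(I) = γ(𝔤₁)(tree^d(I))`. -/
def tree (p : ℕ) (lam : ℝ) : (d n : ℕ) → Submodule ℝ (Ten m n)
  | 0, n => traceFree p n
  | d + 1, n => Submodule.span ℝ
      {T | ∃ (h : Fin m → ℝ), ∃ T' ∈ tree p lam d (n + 1), T = gammaMap p lam h T'}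

end Algebra

/-! ### The quantization -/

section Quantization

variable {m p : ℕ} {M : Type*} [TopologicalSpace M] [ChartedSpace (Euc m) M]
  {F : Type*} [NormedAddCommGroup F] [NormedSpace ℝ F]
  {P : Type*} [TopologicalSpace P] [ChartedSpace F P] [IsManifold 𝓘(ℝ, F) ∞ P]

/-- `N^ω = -2 ∑_i γ(ε^i) L_{ω⁻¹(e_i)}`. -/
def CartanGeometry.opN (C : CartanGeometry m p M F P) (lam : ℝ) {n : ℕ} (T : P → Ten m (n + 1))
    (u : P) : Ten m n :=
  (-2 : ℝ) • ∑ i, gammaMap p lam (killingDual i) (fun idx => C.lieD i (fun v => T v idx) u)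

/-- `T = T_k + T_{k-1} + ⋯ + T_0` is the function `T̂` associated with `T_k = T₀` with values in
`I_{k,0}`: it takes its values in the tree-like subspace and satisfies `C^ω(T̂) = α_{k,0} T̂`, where
`C^ω = C^♭ + N^ω` and `α_{k,0}` is the eigenvalue of `C^♭` on `I_{k,0}`. -/
structure CartanGeometry.IsModification (C : CartanGeometry m p M F P) (lam δ : ℝ) (k : ℕ)
    (T₀ : P → Ten m k) (T : (n : ℕ) → P → Ten m n) : Prop where
  top : T k = T₀
  above : ∀ n, k < n → T n = 0
  smooth : ∀ n idx, ContMDiff 𝓘(ℝ, F) 𝓘(ℝ, ℝ) ∞ fun u => T n u idx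
  mem_tree : ∀ n ≤ k, ∀ u, T n u ∈ tree p lam (k - n) n
  eigen : ∃ α : ℝ, (∀ v ∈ traceFree (m := m) p k, casimir p δ v = α • v) ∧
    ∀ n u, casimir p δ (T n u) + C.opN lam (T (n + 1)) u = α • T n u

/-- `Q_ω(T_k + ⋯ + T_0)(f) = ∑_n ⟨T_n, (∇^ω)^n f⟩`. -/
def CartanGeometry.opQ (C : CartanGeometry m p M F P) (k : ℕ) (T : (n : ℕ) → P → Ten m n)
    (f : P → ℝ) (u : P) : ℝ :=
  ∑ n ∈ Finset.range (k + 1), ∑ i : Fin n → Fin m, T n u i * C.nablaPow f n i u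

/-- `h = Q_M(g, S)(f)`, that is, `p^* h = Q_ω(R(p^* S))(p^* f)`, where `R(p^* S)` is the modification
of `p^* S` and `ω` is the Cartan connection `C`. -/
def CartanGeometry.IsQuantization (C : CartanGeometry m p M F P) {lam mu : ℝ} {k : ℕ}
    (S : Symb m M (mu - lam) k) (f : Density m M lam) (h : Density m M mu) : Prop :=
  ∃ T : (n : ℕ) → P → Ten m n, C.IsModification lam (mu - lam) k (C.liftS S) T ∧
    ∀ u, C.liftD h u = C.opQ k T (C.liftD f) u

end Quantization

/-! ### The numbers of the formula -/

/-- `γ_n = (m + n - m δ)/m`. -/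
def gam (m : ℕ) (δ : ℝ) (n : ℤ) : ℝ := (m + n - m * δ) / m

/-- `δ` is critical if `γ_{2k-l} = 0` for some `k, l` with `2 ≤ l ≤ k+1`. -/
def IsCritical (m : ℕ) (δ : ℝ) : Prop :=
  ∃ k l : ℕ, 2 ≤ l ∧ l ≤ k + 1 ∧ gam m δ (2 * k - l) = 0

/-- `C_{k,l} = (λ + (k-1)/m) ⋯ (λ + (k-l)/m) / (γ_{2k-2} ⋯ γ_{2k-l-1}) * binom k l`. -/
def coeffC (m : ℕ) (lam δ : ℝ) (k l : ℕ) : ℝ :=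
  (∏ i ∈ Finset.Icc 1 l, (lam + ((k : ℝ) - i) / m)) /
    (∏ i ∈ Finset.Icc 1 l, gam m δ (2 * k - 1 - i)) * (k.choose l : ℝ)

/-! ### Tensor calculus in a chart

All the objects below are families of component functions of the coordinates `y`. -/

section Chart

variable {m : ℕ}

/-- Graded tensors: for each `j`, the components of a tensor with `j` indices. -/
abbrev GField (m : ℕ) := (j : ℕ) → Euc m → (Fin j → Fin m) → ℝ

/-- The graded tensor with the single component `t` in degree `k`. -/
def GField.single (k : ℕ) (t : Euc m → (Fin k → Fin m) → ℝ) : GField m := fun j y i =>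
  if h : k = j then t y (i ∘ Fin.cast h) else 0

/-- `∂_c`. -/
def pd (c : Fin m) (u : Euc m → ℝ) (y : Euc m) : ℝ :=
  fderiv ℝ u y (EuclideanSpace.single c (1 : ℝ))

/-- The Christoffel symbols `Γ^a_{bc}` of the Levi-Civita connection of `G`. -/
def christoffel (G : Euc m → Matrix (Fin m) (Fin m) ℝ) (a b c : Fin m) (y : Euc m) : ℝ :=
  (1 / 2) * ∑ d, (G y)⁻¹ a d *
    (pd b (fun z => G z c d) y + pd c (fun z => G z b d) y - pd d (fun z => G z b c) y)

/-- The component `R^i_{jkl}` of the curvature: `R(∂_k, ∂_l) ∂_j = ∑_i R^i_{jkl} ∂_i`, with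
`R(X, Y) = ∇_X ∇_Y - ∇_Y ∇_X - ∇_{[X,Y]}`. -/
def riem (G : Euc m → Matrix (Fin m) (Fin m) ℝ) (i j k l : Fin m) (y : Euc m) : ℝ :=
  pd k (christoffel G i l j) y - pd l (christoffel G i k j) y
    + ∑ a, (christoffel G i k a y * christoffel G a l j y
      - christoffel G i l a y * christoffel G a k j y)

/-- The Ricci tensor, with the sign convention `Ric(X, Y) = tr (Z ↦ R(X, Z) Y)` (so that it is
negative definite on round spheres). -/
def ricci (G : Euc m → Matrix (Fin m) (Fin m) ℝ) (a b : Fin m) (y : Euc m) : ℝ :=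
  ∑ i, riem G i b a i y

/-- The scalar curvature `R`, the `G`-trace of `ricci`. -/
def scal (G : Euc m → Matrix (Fin m) (Fin m) ℝ) (y : Euc m) : ℝ :=
  ∑ a, ∑ b, (G y)⁻¹ a b * ricci G a b y

/-- `r = Ric / (2 - m)`. -/
def rTen (G : Euc m → Matrix (Fin m) (Fin m) ℝ) (a b : Fin m) (y : Euc m) : ℝ :=
  ricci G a b y / (2 - m)

/-- The deformation tensor `Γ = -1/(m-2) (Ric - R g / (2(m-1)))`. -/
def defTen (G : Euc m → Matrix (Fin m) (Fin m) ℝ) (a b : Fin m) (y : Euc m) : ℝ :=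
  -1 / ((m : ℝ) - 2) * (ricci G a b y - G y a b * scal G y / (2 * ((m : ℝ) - 1)))

/-- Symmetrization (the mean over all permutations). -/
def symmetrize {j : ℕ} (t : (Fin j → Fin m) → ℝ) (i : Fin j → Fin m) : ℝ :=
  (1 / (j.factorial : ℝ)) * ∑ s : Equiv.Perm (Fin j), t (i ∘ s)

/-- The covariant derivative `∇_c` of covariant tensors with values in the `lam`-densities. -/
def nablaCo (G : Euc m → Matrix (Fin m) (Fin m) ℝ) (lam : ℝ) {j : ℕ}
    (t : Euc m → (Fin j → Fin m) → ℝ) (c : Fin m) (y : Euc m) (i : Fin j → Fin m) : ℝ :=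
  pd c (fun z => t z i) y
    - ∑ a, ∑ d, christoffel G d c (i a) y * t y (Function.update i a d)
    - lam * (∑ d, christoffel G d c d y) * t y i

/-- The covariant derivative `∇_c` of contravariant tensors with values in the `δ`-densities. -/
def nablaContra (G : Euc m → Matrix (Fin m) (Fin m) ℝ) (δ : ℝ) {j : ℕ}
    (t : Euc m → (Fin j → Fin m) → ℝ) (c : Fin m) (y : Euc m) (i : Fin j → Fin m) : ℝ :=
  pd c (fun z => t z i) y
    + ∑ a, ∑ d, christoffel G (i a) c d y * t y (Function.update i a d)
    - δ * (∑ d, christoffel G d c d y) * t y i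

/-- The symmetrized covariant derivative `∇_s`, of degree `1`. -/
def nablaS (G : Euc m → Matrix (Fin m) (Fin m) ℝ) (lam : ℝ) (t : GField m) : GField m
  | 0 => 0
  | j + 1 => fun y => symmetrize fun i => nablaCo G lam (t j) (i 0) y (Fin.tail i)

/-- `B ∨ T` for a symmetric covariant 2-tensor `B`, normalized by
`(B ∨ T)(X, …, X) = B(X, X) T(X, …, X)`. It is of degree `2`. -/
def vee2 (B : Fin m → Fin m → Euc m → ℝ) (t : GField m) : GField m
  | 0 => 0
  | 1 => 0
  | j + 2 => fun y => symmetrize fun i => B (i 0) (i 1) y * t j y (Fin.tail (Fin.tail i))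

/-- The operator `T₁ T = (-λ m - j)(j + 1) B ∨ T` on the tensors `T` with `j` indices, where `B` is
the deformation tensor `Γ` (or `r`). -/
def opT1 (B : Fin m → Fin m → Euc m → ℝ) (lam : ℝ) (t : GField m) : GField m :=
  vee2 B fun j => ((-lam * m - j) * (j + 1)) • t j

/-- The divergence, of degree `-1`. -/
def opDiv (G : Euc m → Matrix (Fin m) (Fin m) ℝ) (δ : ℝ) (t : GField m) : GField m := fun j y i =>
  ∑ c, nablaContra G δ (t (j + 1)) c y (Fin.cons c i)

/-- The contraction `i(B)` with a covariant 2-tensor `B`, of degree `-2`. -/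
def contr2 (B : Fin m → Fin m → Euc m → ℝ) (t : GField m) : GField m := fun j y i =>
  ∑ a, ∑ b, B a b y * t (j + 2) y (Fin.cons a (Fin.cons b i))

/-- The operator `T₂ S = (m γ_{2k-2} - k + j)(k - j + 1) i(r) S` on the tensors `S` with `j`
indices. -/
def opT2 (G : Euc m → Matrix (Fin m) (Fin m) ℝ) (δ : ℝ) (k : ℕ) (t : GField m) : GField m :=
  contr2 (rTen G) fun j => ((m * gam m δ (2 * k - 2) - k + j) * (k - j + 1)) • t j

/-- The full contraction of the components with `n` indices. -/
def pair (n : ℕ) (S t : GField m) (y : Euc m) : ℝ := ∑ i, S n y i * t n y i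

/-- `∇_s r`, a symmetric covariant 3-tensor. -/
def nablaR (G : Euc m → Matrix (Fin m) (Fin m) ℝ) : GField m :=
  nablaS G 0 (GField.single 2 fun y i => rTen G (i 0) (i 1) y)

/-- The right-hand side `∑_l C_{k,l} ⟨π_l(∑_{j ≤ l} (Div + T₂)^j) S, π_{k-l}(∑_{j ≤ k-l} (∇_s + T₁)^j) f⟩`
in a chart. Since `S` has degree `k` and `f` degree `0`, the projections `π_l` and `π_{k-l}` amount
to taking the components with `k - l` indices. -/
def formula (G : Euc m → Matrix (Fin m) (Fin m) ℝ) (B : Fin m → Fin m → Euc m → ℝ)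
    (lam δ : ℝ) (k : ℕ) (S f : GField m) (y : Euc m) : ℝ :=
  ∑ l ∈ Finset.range (k + 1), coeffC m lam δ k l *
    pair (k - l)
      (∑ j ∈ Finset.range (l + 1), (fun t => opDiv G δ t + opT2 G δ k t)^[j] S)
      (∑ j ∈ Finset.range (k - l + 1), (fun t => nablaS G lam t + opT1 B lam t)^[j] f) y

/-- The explicit formula at the second order. -/
def formula2 (G : Euc m → Matrix (Fin m) (Fin m) ℝ) (lam δ : ℝ) (S f : GField m) (y : Euc m) : ℝ :=
  pair 2 S (nablaS G lam (nablaS G lam f) - (m * lam) • vee2 (rTen G) f) y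
  + coeffC m lam δ 2 1 * pair 1 (opDiv G δ S) (nablaS G lam f) y
  + coeffC m lam δ 2 2 *
      pair 0 (opDiv G δ (opDiv G δ S) + (m * gam m δ 2) • contr2 (rTen G) S) f y

/-- The explicit formula at the third order. -/
def formula3 (G : Euc m → Matrix (Fin m) (Fin m) ℝ) (lam δ : ℝ) (S f : GField m) (y : Euc m) : ℝ :=
  (pair 3 S (nablaS G lam (nablaS G lam (nablaS G lam f))
      - (3 * m * lam + 2) • vee2 (rTen G) (nablaS G lam f)) y
    - lam * m * (pair 3 S (nablaR G) y * f 0 y Fin.elim0))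
  + coeffC m lam δ 3 1 *
      pair 2 (opDiv G δ S) (nablaS G lam (nablaS G lam f) - (m * lam) • vee2 (rTen G) f) y
  + coeffC m lam δ 3 2 *
      pair 1 (opDiv G δ (opDiv G δ S) + (m * gam m δ 4) • contr2 (rTen G) S) (nablaS G lam f) y
  + coeffC m lam δ 3 3 *
      (pair 0 (opDiv G δ (opDiv G δ (opDiv G δ S))
          + (3 * gam m δ 4 * m - 2) • contr2 (rTen G) (opDiv G δ S)) f y
        + m * gam m δ 4 * (pair 3 S (nablaR G) y * f 0 y Fin.elim0))

end Chart

section Components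

variable {m : ℕ} {M : Type*} [TopologicalSpace M] [ChartedSpace (Euc m) M]

/-- The components of a metric in a chart. -/
def Metric.comp {p : ℕ} (g : Metric m M p) (φ : OpenPartialHomeomorph M (Euc m)) (y : Euc m) :
    Matrix (Fin m) (Fin m) ℝ :=
  Matrix.of fun i j => g.toFun (φ.symm y) (coordFrame φ y i) (coordFrame φ y j)

/-- The component of a density in a chart. -/
def Density.comp {lam : ℝ} (f : Density m M lam) (φ : OpenPartialHomeomorph M (Euc m))
    (y : Euc m) : ℝ := f.toFun (φ.symm y) (coordFrame φ y)

/-- A density in a chart, as a graded tensor of degree `0`. -/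
def Density.graded {lam : ℝ} (f : Density m M lam) (φ : OpenPartialHomeomorph M (Euc m)) :
    GField m := GField.single 0 fun y _ => f.comp φ y

/-- A symbol of degree `k` in a chart, as a graded tensor of degree `k`. -/
def Symb.graded {δ : ℝ} {k : ℕ} (S : Symb m M δ k) (φ : OpenPartialHomeomorph M (Euc m)) :
    GField m := GField.single k fun y i => S.toFun (φ.symm y) (coordFrame φ y) i

end Components

end ConformalQuantization

end

/-! Everything takes place on symmetric trace-free tensors. Against them, the part of `[[h, x], y]`
that carries the metric is a trace and vanishes, so `γ(h)` is a scalar times contraction with `h`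
(`gammaMap_stf`). Contraction preserves this class of tensors, hence the tree-like subspace consists
of such tensors (`tree_le_stf`), and the Casimir operator is a scalar in each degree
(`casimir_stf`). The equation `(C^♭ + N^ω) Ŝ = α Ŝ` is therefore a recursion: `S_n`, times a
difference of two eigenvalues, is a multiple of the invariant divergence of `S_{n+1}`. The
differences are `-2 l m γ_{2k-1-l}` (`casEig_sub`) and do not vanish for noncritical `δ`. This gives
existence, uniqueness and `S_n = C_{k,k-n} (Div^ω)^{k-n} p^*S` (`DivChain.isModification`,
`IsModification.unique`).

In general neither the iterated invariant divergences nor the iterated derivatives of a density are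
equivariant on `P`. Commuting a vertical derivation past `ω⁻¹(e_a)` (`L_comm_vert`) measures the
failure: besides the action of `𝔤₀` there is a contraction with the `𝔤₁`-component (`DivChain.vert`,
`sum_mul_L_nablaPow`). In `Q_ω` the two kinds of contraction cancel, by the same recursion
`coeffC_succ` of the numbers `C_{k,l}` that solves the eigenvalue equation (`DivChain.L_opQ`).

For the explicit formula, chart coordinates are regarded as functions on `P`. Their second
derivatives along the `ω⁻¹(e_a)` define connection coefficients, on which a vertical direction acts
only through its `𝔤₁`-component (`LM_vert_chr`). The function `scale` compares the frame of a point
of `P` with the metric `g`. A suitable element of `exp 𝔤₁` moves any local section to one along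
which the derivatives of `scale` in the directions `e_b` vanish (`exists_gaugeSection`). There the
absence of torsion and the uniqueness of the Levi-Civita connection identify the coefficients with
the Christoffel symbols (`GaugeSection.chr_eq`). One further derivative and the trace condition on
the curvature determine the `𝔤₁`-component `ξ` of the connection form along the section: `Ric =
(m-1) ξ - ξᵀ` up to a multiple of the metric. Contracted with symmetric trace-free tensors, `ξ` thus
acts as `-r` (`sum_xi`).

A covariant derivative on `M` is now a derivative along `ω⁻¹(e_a)` plus a vertical correction that
is known. So the iterated divergences satisfy `s_n = Div s_{n+1} + T₂ s_{n+2}`, and the iterated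
derivatives satisfy `t_{n+2} = ∇_s t_{n+1} + T₁ t_n` after pairing with trace-free tensors
(`divTen_trS`, `sum_mul_nablaPow`). The partial geometric series of `Div + T₂` and `∇_s + T₁` obey
the same recursions (`exists_factors`). Equality up to traces survives differentiation because the
derivative can be moved to the test tensor by integration by parts (`formula_eq`).

The adapted section meets the fibre of `u` at a point of `u · exp 𝔤₁`, and `L_opQ` carries the value
back to `u`. Thus at every point of `P` the function `Q_ω` is `|det|^μ` times a function of the
coordinates, which is what characterizes the lift of a density (`exists_liftD_eq`). The tensors `Γ`
and `r` differ by a multiple of `g`, invisible to trace-free symbols (`defTen_contract`). The cases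
`k = 2, 3` unroll the two recursions. -/

noncomputable section

namespace ConformalQuantization

/-! ### Symmetric trace-free tensors, derivations, and the bracket of `𝔤₋₁` with `𝔤₁` -/

section TensorAlgebra

variable {m : ℕ}

/-- The symmetric tensors that are trace-free with respect to `G`. -/
def stf (G : Matrix (Fin m) (Fin m) ℝ) (n : ℕ) : Submodule ℝ (Ten m n) where
  carrier := {T | (∀ (s : Equiv.Perm (Fin n)) i, T (i ∘ s) = T i) ∧
    ∀ (a b : Fin n), a ≠ b → ∀ idx : Fin n → Fin m,
      ∑ i, ∑ j, G i j * T (Function.update (Function.update idx a i) b j) = 0}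
  zero_mem' := by simp
  add_mem' := by
    rintro S T ⟨hS, hS'⟩ ⟨hT, hT'⟩
    refine ⟨fun s i => by simp [hS s i, hT s i], fun a b hab idx => ?_⟩
    simp [mul_add, Finset.sum_add_distrib, hS' a b hab idx, hT' a b hab idx]
  smul_mem' := by
    rintro c T ⟨hT, hT'⟩
    refine ⟨fun s i => by simp [hT s i], fun a b hab idx => ?_⟩
    have := hT' a b hab idx
    simp only [Pi.smul_apply, smul_eq_mul, mul_left_comm _ c, ← Finset.mul_sum, this, mul_zero]

/-- The matrix of the canonical metric. -/
def etaMat (m p : ℕ) : Matrix (Fin m) (Fin m) ℝ := Matrix.diagonal (eta p)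

theorem eta_mul_self (p : ℕ) (i : Fin m) : eta p i * eta p i = 1 := by
  unfold eta; split_ifs <;> norm_num

theorem traceFree_eq_stf (p n : ℕ) : traceFree p n = stf (etaMat m p) n := by
  apply le_antisymm
  · refine Submodule.span_le.2 fun T hT => ⟨hT.1, fun a b hab idx => ?_⟩
    simpa [etaMat, Matrix.diagonal_apply] using hT.2 a b hab idx
  · intro T hT
    refine Submodule.subset_span ⟨hT.1, fun a b hab idx => ?_⟩
    simpa [etaMat, Matrix.diagonal_apply] using hT.2 a b hab idx

/-- `decomposeFin.symm (0, s)` fixes `0` and acts as `s` on the successors. Symmetry in all slots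
thereby gives symmetry in the remaining ones when the first index is frozen. -/
theorem cons_comp_cons (n : ℕ) (s : Equiv.Perm (Fin n)) (c : Fin m) (i : Fin n → Fin m) :
    (Fin.cons c (i ∘ s) : Fin (n + 1) → Fin m)
      = (Fin.cons c i : Fin (n + 1) → Fin m) ∘ (Equiv.Perm.decomposeFin.symm (0, s)) := by
  funext a
  refine Fin.cases ?_ (fun a => ?_) a <;> simp

variable {G : Matrix (Fin m) (Fin m) ℝ} {n : ℕ}

theorem stf_cons {T : Ten m (n + 1)} (hT : T ∈ stf G (n + 1)) (c : Fin m) :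
    (fun i => T (Fin.cons c i)) ∈ stf G n := by
  refine ⟨fun s i => ?_, fun a b hab idx => ?_⟩
  · simp only [cons_comp_cons]; exact hT.1 _ _
  · simpa [Fin.cons_update] using
      hT.2 a.succ b.succ (by simpa using hab) (Fin.cons c idx)

theorem stf_trace {T : Ten m (n + 2)} (hT : T ∈ stf G (n + 2)) (idx : Fin n → Fin m) :
    ∑ i, ∑ j, G i j * T (Fin.cons i (Fin.cons j idx)) = 0 := by
  rcases Nat.eq_zero_or_pos m with rfl | hm
  · simp
  rw [← hT.2 0 1 (by simp) (Fin.cons ⟨0, hm⟩ (Fin.cons ⟨0, hm⟩ idx))]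
  refine Finset.sum_congr rfl fun i _ => Finset.sum_congr rfl fun j _ => ?_
  rw [Fin.update_cons_zero, show (1 : Fin (n + 2)) = Fin.succ 0 from rfl, ← Fin.cons_update,
    Fin.update_cons_zero]

/-- The transposition of slot `0` with slot `b + 1` exchanges the two entries. -/
theorem stf_cons_update {T : Ten m (n + 1)} (hT : T ∈ stf G (n + 1)) (x y : Fin m)
    (i : Fin n → Fin m) (b : Fin n) :
    T (Fin.cons x (Function.update i b y)) = T (Fin.cons y (Function.update i b x)) := by
  rw [← hT.1 (Equiv.swap 0 b.succ) (Fin.cons y (Function.update i b x))]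
  congr 1
  funext a
  refine Fin.cases ?_ (fun a => ?_) a
  · simp
  · by_cases h : a = b
    · subst h; simp [-Fin.cons_update]
    · rw [Function.comp_apply, Equiv.swap_apply_of_ne_of_ne (Fin.succ_ne_zero _)
        (by simpa using h)]
      simp [h, -Fin.cons_update]

theorem stf_swap {T : Ten m (n + 2)} (hT : T ∈ stf G (n + 2)) (x y : Fin m) (idx : Fin n → Fin m) :
    T (Fin.cons x (Fin.cons y idx)) = T (Fin.cons y (Fin.cons x idx)) := by
  simpa only [Fin.update_cons_zero] using stf_cons_update hT x y (Fin.cons x idx) 0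

theorem stf_trace_update {T : Ten m (n + 1)} (hT : T ∈ stf G (n + 1)) (i : Fin n → Fin m)
    (b : Fin n) : ∑ x, ∑ y, G x y * T (Fin.cons x (Function.update i b y)) = 0 := by
  have := hT.2 0 b.succ (Fin.succ_ne_zero b).symm (Fin.cons (i b) i)
  simpa only [Fin.update_cons_zero, ← Fin.cons_update] using this

/-- Conjugating by the transposition of `0` and `a` brings a trace over slots `a`, `b` to one that
involves slot `0`, so only the latter need be checked. -/
theorem mem_stf_of_cons {T : Ten m (n + 1)}
    (hs : ∀ (s : Equiv.Perm (Fin (n + 1))) i, T (i ∘ s) = T i)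
    (ht : ∀ (b : Fin n) (i : Fin n → Fin m),
      ∑ x, ∑ y, G x y * T (Fin.cons x (Function.update i b y)) = 0) : T ∈ stf G (n + 1) := by
  refine ⟨hs, fun a b hab idx => ?_⟩
  have h2 : Equiv.swap 0 a b ≠ 0 := by
    intro h
    have := congrArg (Equiv.swap 0 a) h
    simp at this
    exact hab this.symm
  obtain ⟨b', hb'⟩ := Fin.exists_succ_eq.2 h2
  rw [← ht b' (Fin.tail (idx ∘ Equiv.swap 0 a))]
  refine Finset.sum_congr rfl fun x _ => Finset.sum_congr rfl fun y _ => ?_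
  rw [← hs (Equiv.swap 0 a) (Function.update _ b y)]
  congr 2
  have hb : b = Equiv.swap 0 a b'.succ := by rw [hb']; simp
  funext c
  refine Fin.cases ?_ (fun c => ?_) c
  · simp [Function.update_of_ne hab]
  · by_cases hc : c = b'
    · subst hc; simp [hb]
    · have h3 : Equiv.swap 0 a c.succ ≠ b := by
        rw [hb]; intro h; exact hc (Fin.succ_injective _ ((Equiv.swap 0 a).injective h))
      have h4 : Equiv.swap 0 a c.succ ≠ a := by
        intro h
        have := congrArg (Equiv.swap 0 a) h
        simp at this
      simp [Function.update_of_ne hc, Function.update_of_ne h3, Function.update_of_ne h4, Fin.tail]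

/-- Contraction of the first slot with a covector. -/
def ic (h : Fin m → ℝ) (T : Ten m (n + 1)) : Ten m n := fun i => ∑ a, h a * T (Fin.cons a i)

theorem ic_mem_stf {T : Ten m (n + 1)} (hT : T ∈ stf G (n + 1)) (h : Fin m → ℝ) :
    ic h T ∈ stf G n := by
  have : ic h T = ∑ a, h a • fun i => T (Fin.cons a i) := by
    funext i; simp [ic]
  rw [this]
  exact Submodule.sum_mem _ fun a _ => Submodule.smul_mem _ _ (stf_cons hT a)

/-- The derivation of the tensor algebra that extends a matrix `B`. -/
def der (B : Matrix (Fin m) (Fin m) ℝ) (T : Ten m n) : Ten m n := fun i =>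
  ∑ a, ∑ j, B (i a) j * T (Function.update i a j)

theorem rho_eq (δ : ℝ) (B : Matrix (Fin m) (Fin m) ℝ) (T : Ten m n) :
    rho δ B T = der B T - (δ * B.trace) • T := by
  funext i; simp [rho, der]

theorem der_cons (B : Matrix (Fin m) (Fin m) ℝ) (T : Ten m (n + 1)) (c : Fin m)
    (i : Fin n → Fin m) : der B T (Fin.cons c i)
      = ∑ j, B c j * T (Fin.cons j i) + der B (fun i => T (Fin.cons c i)) i := by
  simp [der, Fin.sum_univ_succ, Fin.update_cons_zero, ← Fin.cons_update]

/-- The map `(i, j) ↦ (update i b j, i b)` is an involution. It is the change of variables behind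
every transposition of a one-slot action. -/
theorem sum_update_swap (b : Fin n) (f : (Fin n → Fin m) → Fin m → ℝ) :
    ∑ i : Fin n → Fin m, ∑ j, f i j
      = ∑ i : Fin n → Fin m, ∑ j, f (Function.update i b j) (i b) := by
  rw [← Finset.sum_product', ← Finset.sum_product']
  refine Finset.sum_nbij' (fun q => (Function.update q.1 b q.2, q.1 b))
    (fun q => (Function.update q.1 b q.2, q.1 b)) ?_ ?_ ?_ ?_ ?_ <;> simp

theorem sum_mul_der (B : Matrix (Fin m) (Fin m) ℝ) (S T : Ten m n) :
    ∑ i, S i * der B T i = ∑ i, der B.transpose S i * T i := by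
  simp only [der, Finset.mul_sum, Finset.sum_mul]
  rw [Finset.sum_comm]
  conv_rhs => rw [Finset.sum_comm]
  refine Finset.sum_congr rfl fun b _ => ?_
  rw [sum_update_swap b]
  refine Finset.sum_congr rfl fun i _ => Finset.sum_congr rfl fun j _ => ?_
  simp; ring

theorem sum_cons (f : (Fin (n + 1) → Fin m) → ℝ) :
    ∑ i, f i = ∑ a, ∑ i : Fin n → Fin m, f (Fin.cons a i) := by
  rw [← (Fin.consEquiv fun _ => Fin m).sum_comp, Fintype.sum_prod_type]
  rfl

variable {p : ℕ}

theorem br_single (a : Fin m) (h : Fin m → ℝ) (i j : Fin m) :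
    br p (Pi.single a 1) h i j = (if i = a then h j else 0) + (if i = j then h a else 0)
      - (if j = a then eta p i * h i * eta p j else 0) := by
  simp [br, Pi.single_apply]

theorem trace_br (a : Fin m) (h : Fin m → ℝ) : (br p (Pi.single a 1) h).trace = m * h a := by
  simp [Matrix.trace, br_single, Finset.sum_add_distrib, Finset.sum_sub_distrib]
  rw [mul_right_comm, eta_mul_self, one_mul]; ring

/-- Of the three terms of the bracket `v ⊗ ξ + ξ(v) - ξ♯ ⊗ v♭`, the first gives the contraction by
symmetry, the second gives it directly, and the third is a trace and vanishes. This is the only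
place where the shape of `so(p+1,q+1)` meets trace-freeness. -/
theorem sum_br_slot {T : Ten m (n + 1)} (hT : T ∈ stf (etaMat m p) (n + 1)) (h : Fin m → ℝ)
    (i : Fin n → Fin m) (b : Fin n) :
    ∑ a, ∑ j, br p (Pi.single a 1) h (i b) j * T (Fin.cons a (Function.update i b j))
      = 2 * ic h T i := by
  have e1 : ∑ a, ∑ j, (if i b = a then h j else 0) * T (Fin.cons a (Function.update i b j))
      = ic h T i := by
    simp only [ite_mul, zero_mul]
    rw [Finset.sum_comm]
    refine Finset.sum_congr rfl fun j _ => ?_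
    rw [Finset.sum_ite_eq]
    simp [stf_cons_update hT (i b) j, -Fin.cons_update]
  have e2 : ∑ a, ∑ j, (if i b = j then h a else 0) * T (Fin.cons a (Function.update i b j))
      = ic h T i := by
    simp [ic, -Fin.cons_update]
  have e3 : ∑ a, ∑ j, (if j = a then eta p (i b) * h (i b) * eta p j else 0) *
      T (Fin.cons a (Function.update i b j)) = 0 := by
    have := stf_trace_update hT i b
    simp only [etaMat, Matrix.diagonal_apply, ite_mul, zero_mul, Finset.sum_ite_eq,
      Finset.mem_univ, if_true] at this
    simp only [ite_mul, zero_mul, Finset.sum_ite_eq', Finset.mem_univ, if_true, mul_assoc,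
      ← Finset.mul_sum, this, mul_zero]
  simp only [br_single, sub_mul, add_mul, Finset.sum_sub_distrib, Finset.sum_add_distrib, e1, e2,
    e3]
  ring

theorem sum_der_br {T : Ten m (n + 1)} (hT : T ∈ stf (etaMat m p) (n + 1)) (h : Fin m → ℝ)
    (i : Fin n → Fin m) :
    ∑ a, der (br p (Pi.single a 1) h) (fun i => T (Fin.cons a i)) i = 2 * n * ic h T i := by
  simp only [der]
  rw [Finset.sum_comm]
  simp only [sum_br_slot hT h i]
  simp; ring

/-- The summed slot contributes `m`, because the last two terms of the bracket cancel there; each of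
the other `n` slots contributes `2`, and the density weight `-mδ`. This number is the increment that
builds up the factors `γ` in the vertical derivatives of the divergences. -/
theorem sum_rho_br (δ : ℝ) {T : Ten m (n + 1)} (hT : T ∈ stf (etaMat m p) (n + 1)) (h : Fin m → ℝ)
    (i : Fin n → Fin m) :
    ∑ a, rho δ (br p (Pi.single a 1) h) T (Fin.cons a i)
      = (m + 2 * n - m * δ) * ic h T i := by
  have e1 : ∑ a, ∑ j, br p (Pi.single a 1) h a j * T (Fin.cons j i) = m * ic h T i := by
    rw [Finset.sum_comm, ic, Finset.mul_sum]
    refine Finset.sum_congr rfl fun j _ => ?_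
    rw [← Finset.sum_mul, ← mul_assoc]
    congr 1
    simp only [br_single, if_true, Finset.sum_sub_distrib, Finset.sum_add_distrib]
    simp
    rw [mul_right_comm, eta_mul_self]; ring
  have e2 : ∑ a, (δ * (m * h a)) * T (Fin.cons a i) = δ * m * ic h T i := by
    rw [ic, Finset.mul_sum]; exact Finset.sum_congr rfl fun j _ => by ring
  simp only [rho_eq, Pi.sub_apply, der_cons, trace_br, Finset.sum_sub_distrib,
    Finset.sum_add_distrib, Pi.smul_apply, smul_eq_mul, e1, e2, sum_der_br hT h i]
  ring

end TensorAlgebra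

/-! ### The map `γ`, the Casimir eigenvalues and the numbers `C_{k,l}` -/

section GammaCasimir

variable {m : ℕ} {n p : ℕ} {G : Matrix (Fin m) (Fin m) ℝ}

theorem stf_insertNth {T : Ten m (n + 1)} (hT : T ∈ stf G (n + 1)) (k : Fin (n + 1)) (a : Fin m)
    (idx : Fin n → Fin m) : T (k.insertNth a idx) = T (Fin.cons a idx) := by
  rw [← hT.1 k.cycleRange (Fin.cons a idx), Fin.cons_comp_cycleRange]

/-- For the `j`-th remaining factor, `i < i.succAbove j` means `i ≤ j`, which leaves `j + 1` choices
of the omitted factor. -/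
theorem sum_lt_succAbove (n : ℕ) (c : ℝ) :
    ∑ i : Fin (n + 1), ∑ j : Fin n, (if i < i.succAbove j then c else 0) = n * (n + 1) / 2 * c := by
  have h : ∀ j : Fin n, ∑ i : Fin (n + 1), (if i < i.succAbove j then c else 0)
      = ((j : ℕ) + 1 : ℝ) * c := by
    intro j
    simp only [Fin.lt_succAbove_iff_le_castSucc]
    rw [← Finset.sum_filter, Finset.sum_const,
      show Finset.filter (fun i => i ≤ j.castSucc) Finset.univ = Finset.Iic j.castSucc by
        ext; simp, Fin.card_Iic]
    simp
  rw [Finset.sum_comm]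
  simp only [h, ← Finset.sum_mul]
  congr 1
  rw [Fin.sum_univ_eq_sum_range (fun j => ((j : ℕ) + 1 : ℝ)) n]
  clear h
  induction n with
  | zero => simp
  | succ n ih => rw [Finset.sum_range_succ, ih]; push_cast; ring

theorem sum_comm_four {ι κ : Type*} [Fintype ι] [Fintype κ] (f : ι → ι → κ → κ → ℝ) :
    ∑ x, ∑ y, ∑ a, ∑ b, f x y a b = ∑ a, ∑ b, ∑ x, ∑ y, f x y a b := by
  have h1 : ∀ x, ∑ y, ∑ a, ∑ b, f x y a b = ∑ a, ∑ b, ∑ y, f x y a b := fun x => by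
    rw [Finset.sum_comm]
    exact Finset.sum_congr rfl fun a _ => Finset.sum_comm
  simp only [h1]
  rw [Finset.sum_comm]
  exact Finset.sum_congr rfl fun a _ => Finset.sum_comm

/-- Each of the `n + 1` omitted factors contributes `-m λ`, and each of the `n(n+1)/2` pairs
contributes `-2`. Hence `γ(h)` is contraction with `h` up to a scalar. -/
theorem gammaMap_stf (lam : ℝ) (h : Fin m → ℝ) {T : Ten m (n + 1)}
    (hT : T ∈ stf (etaMat m p) (n + 1)) :
    gammaMap p lam h T = (-((n + 1) * (lam * m + n)) : ℝ) • ic h T := by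
  funext idx
  have e1 : ∀ i : Fin (n + 1), ∑ a : Fin m,
      (-(br p (Pi.single a 1) h)).trace * T (i.insertNth a idx) = -(m * ic h T idx) := by
    intro i
    simp only [Matrix.trace_neg, trace_br, stf_insertNth hT]
    rw [ic, Finset.mul_sum, ← Finset.sum_neg_distrib]
    exact Finset.sum_congr rfl fun a _ => by ring
  have e2 : ∀ (i : Fin (n + 1)) (j : Fin n), ∑ a : Fin m, ∑ b : Fin m,
      (-(br p (Pi.single a 1) h)) (idx j) b *
        T (i.insertNth a (Function.update idx j b)) = -(2 * ic h T idx) := by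
    intro i j
    rw [← sum_br_slot hT h idx j]
    simp only [Matrix.neg_apply, stf_insertNth hT, neg_mul, Finset.sum_neg_distrib]
  simp only [gammaMap, e1, e2, sum_lt_succAbove]
  simp
  ring

/-- Terms where both factors hit the same slot involve `B²`; the others are a product over two
distinct slots. The Casimir sum treats the two kinds differently. -/
theorem der_der (B : Matrix (Fin m) (Fin m) ℝ) (T : Ten m n) (i : Fin n → Fin m) :
    der B (der B T) i = ∑ a, ∑ b, if b = a then
        ∑ k, ∑ j, B (i a) j * B j k * T (Function.update i a k)
      else ∑ j, ∑ k, B (i a) j * B (i b) k * T (Function.update (Function.update i a j) b k) := by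
  simp only [der]
  refine Finset.sum_congr rfl fun a _ => ?_
  simp only [Finset.mul_sum]
  rw [Finset.sum_comm]
  refine Finset.sum_congr rfl fun b _ => ?_
  split_ifs with h
  · subst h
    rw [Finset.sum_comm]
    simp [mul_assoc]
  · refine Finset.sum_congr rfl fun j _ => Finset.sum_congr rfl fun k _ => ?_
    rw [Function.update_of_ne h]; ring

/-- Completeness relation for the basis of `so(p,q)`, each element being counted twice. Acting on
two slots, the first term takes a trace and the second interchanges the slots. -/
theorem sum_rot_mul_rot (c j d k : Fin m) :
    ∑ x, ∑ y, eta p x * eta p y * (rot p x y c j * rot p x y d k)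
      = 2 * ((if c = d then if j = k then eta p c * eta p j else 0 else 0)
        - (if c = k then if j = d then 1 else 0 else 0)) := by
  have h : ∀ x y, eta p x * eta p y * (rot p x y c j * rot p x y d k)
      = (if c = x then 1 else 0) * ((if j = y then 1 else 0) *
          ((if d = x then 1 else 0) * (if k = y then 1 else 0) *
            (eta p x * eta p y * (eta p y * eta p y))))
        - (if c = x then 1 else 0) * ((if j = y then 1 else 0) *
          ((if d = y then 1 else 0) * (if k = x then 1 else 0) *
            ((eta p x * eta p x) * (eta p y * eta p y))))
        - (if c = y then 1 else 0) * ((if j = x then 1 else 0) *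
          ((if d = x then 1 else 0) * (if k = y then 1 else 0) *
            ((eta p x * eta p x) * (eta p y * eta p y))))
        + (if c = y then 1 else 0) * ((if j = x then 1 else 0) *
          ((if d = y then 1 else 0) * (if k = x then 1 else 0) *
            (eta p x * eta p y * (eta p x * eta p x)))) := by
    intro x y
    have e : ∀ (a b : Fin m) (z : ℝ), (if a = b then z else 0) = (if a = b then 1 else 0) * z := by
      intro a b z; simp
    simp only [rot, Matrix.of_apply]
    rw [e j y, e j x, e k y, e k x]
    ring
  have e : ∀ f : Fin m → Fin m → ℝ, ∑ x, ∑ y,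
      (if c = x then (1 : ℝ) else 0) * ((if j = y then 1 else 0) * f x y) = f c j := fun f => by simp
  have e' : ∀ f : Fin m → Fin m → ℝ, ∑ x, ∑ y,
      (if c = y then (1 : ℝ) else 0) * ((if j = x then 1 else 0) * f x y) = f j c := fun f => by simp
  simp only [h, Finset.sum_add_distrib, Finset.sum_sub_distrib, e, e', eta_mul_self]
  simp only [eq_comm (a := d), eq_comm (a := k) (b := c), eq_comm (a := k) (b := j)]
  split_ifs <;> ring

theorem trace_rot (i j : Fin m) : (rot p i j).trace = 0 := by
  simp [rot, Matrix.trace, Finset.sum_sub_distrib]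
  simp [eq_comm]
  split_ifs with h <;> simp_all

theorem rot_swap (i j : Fin m) : rot p j i = -rot p i j := by
  ext a b; simp [rot]

theorem der_neg (B : Matrix (Fin m) (Fin m) ℝ) (T : Ten m n) : der (-B) T = -der B T := by
  funext i; simp [der]

/-- Each of the `n` coincident pairs of slots gives `-2(m-1)`. For each of the `n(n-1)` distinct
pairs the trace vanishes and the interchange gives `-2`. -/
theorem sum_der_rot {T : Ten m n} (hT : T ∈ stf (etaMat m p) n) (i : Fin n → Fin m) :
    ∑ x, ∑ y, eta p x * eta p y * der (rot p x y) (der (rot p x y) T) i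
      = -2 * (n * (m + n - 2)) * T i := by
  have hd : ∀ a b : Fin n, ∑ x, ∑ y, eta p x * eta p y * (if b = a then
        ∑ k, ∑ j, rot p x y (i a) j * rot p x y j k * T (Function.update i a k)
      else ∑ j, ∑ k, rot p x y (i a) j * rot p x y (i b) k *
        T (Function.update (Function.update i a j) b k))
      = if b = a then -2 * (m - 1) * T i else -2 * T i := by
    intro a b
    split_ifs with hab
    · calc _ = ∑ k, ∑ j, (∑ x, ∑ y, eta p x * eta p y * (rot p x y (i a) j * rot p x y j k)) *
            T (Function.update i a k) := by
            simp only [Finset.mul_sum, Finset.sum_mul]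
            rw [sum_comm_four]
            refine Finset.sum_congr rfl fun _ _ => Finset.sum_congr rfl fun _ _ =>
              Finset.sum_congr rfl fun _ _ => Finset.sum_congr rfl fun _ _ => ?_
            ring
        _ = _ := by
            simp only [sum_rot_mul_rot]
            simp [mul_sub, sub_mul, Finset.sum_sub_distrib, mul_ite, ite_mul,
              eta_mul_self]
            ring
    · calc _ = ∑ j, ∑ k, (∑ x, ∑ y, eta p x * eta p y *
            (rot p x y (i a) j * rot p x y (i b) k)) *
            T (Function.update (Function.update i a j) b k) := by
            simp only [Finset.mul_sum, Finset.sum_mul]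
            rw [sum_comm_four]
            refine Finset.sum_congr rfl fun _ _ => Finset.sum_congr rfl fun _ _ =>
              Finset.sum_congr rfl fun _ _ => Finset.sum_congr rfl fun _ _ => ?_
            ring
        _ = _ := by
            have ht := hT.2 a b (Ne.symm hab) i
            simp only [etaMat, Matrix.diagonal_apply, ite_mul, zero_mul, Finset.sum_ite_eq,
              Finset.mem_univ, if_true] at ht
            have hsw : T (Function.update (Function.update i a (i b)) b (i a)) = T i := by
              rw [← hT.1 (Equiv.swap a b) i]
              congr 1
              funext c
              by_cases h1 : c = b
              · subst h1; simp
              · by_cases h2 : c = a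
                · subst h2; simp [Function.update_of_ne h1]
                · simp [Function.update_of_ne h1, Function.update_of_ne h2,
                    Equiv.swap_apply_of_ne_of_ne h2 h1]
            simp only [sum_rot_mul_rot]
            have e1 : ∑ j, ∑ k, (if i a = i b then if j = k then eta p (i a) * eta p j else 0
                else 0) * T (Function.update (Function.update i a j) b k) = 0 := by
              by_cases h : i a = i b
              · simp [h, mul_assoc, ← Finset.mul_sum, ht]
              · simp [h]
            have e2 : ∑ j, ∑ k, (if i a = k then if j = i b then (1 : ℝ) else 0
                else 0) * T (Function.update (Function.update i a j) b k) = T i := by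
              rw [Finset.sum_comm]
              simp [hsw]
            simp only [mul_assoc, ← Finset.mul_sum, sub_mul, Finset.sum_sub_distrib, e1, e2]
            ring
  calc _ = ∑ a : Fin n, ∑ b : Fin n, if b = a then -2 * ((m : ℝ) - 1) * T i else -2 * T i := by
        simp only [← hd, der_der, Finset.mul_sum]
        rw [sum_comm_four]
    _ = ∑ a : Fin n, (∑ b : Fin n, -2 * T i + ∑ b : Fin n, if b = a then
          -2 * ((m : ℝ) - 1) * T i + 2 * T i else 0) := by
        refine Finset.sum_congr rfl fun a _ => ?_
        rw [← Finset.sum_add_distrib]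
        refine Finset.sum_congr rfl fun b _ => ?_
        split_ifs <;> ring
    _ = _ := by simp; ring

/-- The eigenvalue of the Casimir operator on `I_{n,0}`. -/
def casEig (m : ℕ) (δ : ℝ) (n : ℕ) : ℝ :=
  -m * (n - δ * m) - (n - δ * m) ^ 2 - n * (m + n - 2)

theorem der_one (T : Ten m n) : der (1 : Matrix (Fin m) (Fin m) ℝ) T = (n : ℝ) • T := by
  funext i; simp [der, Matrix.one_apply]

theorem sum_lt_eq_half {f : Fin m → Fin m → ℝ} (hf : ∀ i j, f j i = f i j) (h0 : ∀ i, f i i = 0) :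
    ∑ i, ∑ j, (if i < j then f i j else 0) = (∑ i, ∑ j, f i j) / 2 := by
  have h : ∑ i, ∑ j, f i j = ∑ i, ∑ j, (if i < j then f i j else 0)
      + ∑ i, ∑ j, (if j < i then f i j else 0) := by
    simp only [← Finset.sum_add_distrib]
    refine Finset.sum_congr rfl fun i _ => Finset.sum_congr rfl fun j _ => ?_
    rcases lt_trichotomy i j with h | h | h
    · simp [h, h.not_gt]
    · subst h; simp [h0]
    · simp [h, h.not_gt]
  have h' : ∑ i, ∑ j, (if j < i then f i j else 0) = ∑ i, ∑ j, (if i < j then f i j else 0) := by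
    rw [Finset.sum_comm]
    simp only [hf]
  rw [h, h']; ring

/-- Three scalars add up: `∑ [e_i, ε^i]` is `-m` times the identity, the identity acts by `n - δm`,
and the rotations act by half of `sum_der_rot`. -/
theorem casimir_stf (δ : ℝ) {T : Ten m n} (hT : T ∈ stf (etaMat m p) n) :
    casimir p δ T = casEig m δ n • T := by
  have h1 : ∀ T : Ten m n, rho δ 1 T = (n - δ * m : ℝ) • T := by
    intro T
    rw [rho_eq, der_one, Matrix.trace_one, ← sub_smul, Fintype.card_fin]
  have h2 : ∑ i, rho δ (br p (Pi.single i 1) (killingDual i)) T = (-m * (n - δ * m) : ℝ) • T := by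
    have hb : ∑ i : Fin m, br p (Pi.single i 1) (killingDual i)
        = (-m : ℝ) • (1 : Matrix (Fin m) (Fin m) ℝ) := by
      ext a b
      simp [Matrix.sum_apply, br_single, killingDual, Finset.sum_add_distrib,
        Finset.sum_sub_distrib, Pi.single_apply, Matrix.one_apply]
      split_ifs <;> simp_all [eta_mul_self]
    have hlin : ∀ B : Fin m → Matrix (Fin m) (Fin m) ℝ, ∑ i, rho δ (B i) T
        = rho δ (∑ i, B i) T := by
      intro B
      funext idx
      simp only [rho, Finset.sum_apply, Matrix.sum_apply, Matrix.trace_sum, Finset.sum_sub_distrib,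
        Finset.sum_mul, Finset.mul_sum]
      congr 1
      rw [Finset.sum_comm]
      exact Finset.sum_congr rfl fun a _ => Finset.sum_comm
    rw [hlin, hb]
    have : rho δ ((-m : ℝ) • (1 : Matrix (Fin m) (Fin m) ℝ)) T = (-m : ℝ) • rho δ 1 T := by
      funext idx
      simp only [rho, Matrix.smul_apply, Matrix.trace_smul, smul_eq_mul, Pi.smul_apply, mul_sub,
        Finset.mul_sum]
      congr 1
      · simp only [mul_assoc]
      · ring
    rw [this, h1, smul_smul]
  have h3 : ∑ i, ∑ j, (if i < j then
        (eta p i * eta p j) • rho δ (rot p i j) (rho δ (rot p i j) T) else 0)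
      = (-(n * (m + n - 2)) : ℝ) • T := by
    funext idx
    have hr : ∀ (i j) (T : Ten m n), rho δ (rot p i j) T = der (rot p i j) T := by
      intro i j T; rw [rho_eq, trace_rot]; simp
    have : ∀ i j : Fin m, (if i < j then
        (eta p i * eta p j) • rho δ (rot p i j) (rho δ (rot p i j) T) else 0) idx
        = if i < j then eta p i * eta p j * der (rot p i j) (der (rot p i j) T) idx else 0 := by
      intro i j; split_ifs <;> simp [hr]
    simp only [Finset.sum_apply, this]
    have hn : ∀ (B : Matrix (Fin m) (Fin m) ℝ) (T : Ten m n), der B (-T) = -der B T := by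
      intro B T; funext i; simp [der]
    rw [sum_lt_eq_half (f := fun i j => eta p i * eta p j * der (rot p i j) (der (rot p i j) T) idx),
      sum_der_rot hT]
    · simp; ring
    · intro i j
      simp only [rot_swap i j, der_neg, hn, neg_neg, mul_comm (eta p j)]
    · intro i
      have : rot p i i = 0 := by ext a b; simp [rot]
      simp [this, der]
  rw [casimir, h1, h1, h2, h3, smul_smul, ← sub_smul, ← add_smul, casEig]
  congr 1
  ring

/-- By `gammaMap_stf` each step of the tree is a contraction, which preserves symmetry and
trace-freeness; so the Casimir operator is a scalar on each degree of the tree. -/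
theorem tree_le_stf (lam : ℝ) (d n : ℕ) : tree p lam d n ≤ stf (etaMat m p) n := by
  induction d generalizing n with
  | zero => exact (traceFree_eq_stf p n).le
  | succ d ih =>
    refine Submodule.span_le.2 ?_
    rintro _ ⟨h, T', hT', rfl⟩
    rw [gammaMap_stf lam h (ih _ hT')]
    exact Submodule.smul_mem _ _ (ic_mem_stf (ih _ hT') h)

/-- Noncriticality means precisely that the eigenvalues below the top degree differ from the top
one. -/
theorem casEig_sub (hm : m ≠ 0) (δ : ℝ) {k l : ℕ} (hl : l ≤ k) :
    casEig m δ k - casEig m δ (k - l) = -2 * l * (m * gam m δ (2 * k - 1 - l)) := by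
  have : (m : ℝ) ≠ 0 := Nat.cast_ne_zero.2 hm
  rw [casEig, casEig, gam, Nat.cast_sub hl]
  push_cast
  field_simp
  ring

theorem gam_ne_zero {δ : ℝ} (hcrit : ¬ IsCritical m δ) {k l : ℕ} (h1 : 1 ≤ l) (hl : l ≤ k) :
    gam m δ (2 * k - 1 - l) ≠ 0 := by
  intro h
  refine hcrit ⟨k, l + 1, by omega, by omega, ?_⟩
  rw [← h]; congr 1; push_cast; ring

theorem coeffC_zero (lam δ : ℝ) (k : ℕ) : coeffC m lam δ k 0 = 1 := by simp [coeffC]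

/-- The recursion is stated without denominators because it serves twice: it solves the eigenvalue
equation, and it cancels the `𝔤₁`-terms in the vertical derivative of the quantization. -/
theorem coeffC_succ (hm : m ≠ 0) (lam : ℝ) {δ : ℝ} (hcrit : ¬ IsCritical m δ) {k l : ℕ}
    (hl : l + 1 ≤ k) :
    coeffC m lam δ k (l + 1) * ((l + 1) * (m * gam m δ (2 * k - 1 - (l + 1 : ℕ))))
      = coeffC m lam δ k l * ((k - l : ℝ) * (lam * m + (k - (l + 1)))) := by
  have hm' : (m : ℝ) ≠ 0 := Nat.cast_ne_zero.2 hm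
  have hg := gam_ne_zero hcrit (Nat.succ_pos l) hl
  have hch : ((k.choose (l + 1) : ℕ) : ℝ) * (l + 1) = (k.choose l : ℕ) * (k - l : ℝ) := by
    have := Nat.choose_succ_right_eq k l
    have h2 := congrArg (Nat.cast : ℕ → ℝ) this
    push_cast [Nat.cast_sub (show l ≤ k by omega)] at h2
    exact h2
  have hP : ∏ i ∈ Finset.Icc 1 l, gam m δ (2 * k - 1 - i) ≠ 0 := by
    refine Finset.prod_ne_zero_iff.2 fun i hi => ?_
    rw [Finset.mem_Icc] at hi
    exact gam_ne_zero hcrit hi.1 (by omega)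
  rw [coeffC, coeffC, Finset.prod_Icc_succ_top (by omega), Finset.prod_Icc_succ_top (by omega)]
  field_simp
  rw [show ((l + 1 : ℕ) : ℝ) = l + 1 by push_cast; ring]
  linear_combination (∏ x ∈ Finset.Icc 1 l, (lam * m + ((k : ℝ) - x)) / m) *
    (lam * m + (k - (l + 1))) * hch

end GammaCasimir

/-! ### Levi-Civita calculus in a chart -/

section ChartCalculus

variable {m : ℕ} {n : ℕ}

theorem mem_stf_zero {G : Matrix (Fin m) (Fin m) ℝ} (T : Ten m 0) : T ∈ stf G 0 :=
  ⟨fun _ _ => congrArg T (Subsingleton.elim _ _), fun a => a.elim0⟩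

theorem mem_stf_one {G : Matrix (Fin m) (Fin m) ℝ} (T : Ten m 1) : T ∈ stf G 1 :=
  ⟨fun s _ => congrArg T (by rw [Subsingleton.elim s 1]; rfl),
    fun a b h => absurd (Subsingleton.elim a b) h⟩

/-- For a symmetric tensor the trace over the first two slots controls all the others. -/
theorem mem_stf_of_cons_cons {G : Matrix (Fin m) (Fin m) ℝ} {T : Ten m (n + 2)}
    (hs : ∀ (s : Equiv.Perm (Fin (n + 2))) i, T (i ∘ s) = T i)
    (ht : ∀ i : Fin n → Fin m, ∑ x, ∑ y, G x y * T (Fin.cons x (Fin.cons y i)) = 0) :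
    T ∈ stf G (n + 2) := by
  refine mem_stf_of_cons hs fun b i => ?_
  rw [← ht (Fin.tail (i ∘ Equiv.swap 0 b))]
  refine Finset.sum_congr rfl fun x _ => Finset.sum_congr rfl fun y _ => ?_
  congr 1
  rw [← hs (Equiv.Perm.decomposeFin.symm (0, Equiv.swap 0 b)), ← cons_comp_cons]
  congr 2
  funext c
  refine Fin.cases ?_ (fun c => ?_) c
  · simp
  · by_cases hc : c.succ = b
    · subst hc; simp [Fin.tail, Function.update_of_ne (Fin.succ_ne_zero c).symm]
    · rw [Function.comp_apply, Equiv.swap_apply_of_ne_of_ne (Fin.succ_ne_zero _) hc,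
        Function.update_of_ne hc, Fin.cons_succ, Fin.tail, Function.comp_apply,
        Equiv.swap_apply_of_ne_of_ne (Fin.succ_ne_zero _) hc]

theorem der_comp_perm (B : Matrix (Fin m) (Fin m) ℝ) (T : Ten m n) (s : Equiv.Perm (Fin n))
    (i : Fin n → Fin m) : der B T (i ∘ s) = der B (fun i => T (i ∘ s)) i := by
  simp only [der]
  conv_rhs => rw [← Equiv.sum_comp s]
  refine Finset.sum_congr rfl fun a _ => Finset.sum_congr rfl fun j _ => ?_
  rw [Function.comp_apply, Function.update_comp_equiv, Equiv.symm_apply_apply]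

theorem der_mem_sym {B : Matrix (Fin m) (Fin m) ℝ} {T : Ten m n}
    (hs : ∀ (s : Equiv.Perm (Fin n)) i, T (i ∘ s) = T i) (s : Equiv.Perm (Fin n))
    (i : Fin n → Fin m) : der B T (i ∘ s) = der B T i := by
  rw [der_comp_perm]; simp only [hs]

theorem der_sum_smul {ι : Type*} (s : Finset ι) (B : Matrix (Fin m) (Fin m) ℝ) (c : ι → ℝ)
    (T : ι → Ten m n) (i : Fin n → Fin m) :
    ∑ x ∈ s, c x * der B (T x) i = der B (fun i => ∑ x ∈ s, c x * T x i) i := by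
  simp only [der, Finset.mul_sum]
  rw [Finset.sum_comm]
  refine Finset.sum_congr rfl fun a _ => ?_
  rw [Finset.sum_comm]
  refine Finset.sum_congr rfl fun j _ => Finset.sum_congr rfl fun x _ => ?_
  ring

variable {G : Euc m → Matrix (Fin m) (Fin m) ℝ}

/-- The matrix of the Levi-Civita connection in the direction `∂_c`. -/
def chrMat (G : Euc m → Matrix (Fin m) (Fin m) ℝ) (c : Fin m) (y : Euc m) :
    Matrix (Fin m) (Fin m) ℝ := Matrix.of fun a d => christoffel G a c d y

theorem nablaContra_eq (δ : ℝ) (t : Euc m → Ten m n) (c : Fin m) (y : Euc m)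
    (i : Fin n → Fin m) : nablaContra G δ t c y i = pd c (fun z => t z i) y
      + der (chrMat G c y) (t y) i - δ * (chrMat G c y).trace * t y i := rfl

theorem nablaCo_eq (lam : ℝ) (t : Euc m → Ten m n) (c : Fin m) (y : Euc m)
    (i : Fin n → Fin m) : nablaCo G lam t c y i = pd c (fun z => t z i) y
      - der (chrMat G c y).transpose (t y) i - lam * (chrMat G c y).trace * t y i := rfl

variable {Ω : Set (Euc m)}

/-- The components of `G` form a smooth nondegenerate symmetric matrix on `Ω`. -/
structure IsMetricOn (G : Euc m → Matrix (Fin m) (Fin m) ℝ) (Ω : Set (Euc m)) : Prop where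
  isOpen : IsOpen Ω
  smooth : ∀ i j, ContDiffOn ℝ ∞ (fun y => G y i j) Ω
  symm : ∀ y ∈ Ω, ∀ i j, G y i j = G y j i
  det : ∀ y ∈ Ω, (G y).det ≠ 0

theorem pd_congr {f g : Euc m → ℝ} (hΩ : IsOpen Ω) (h : ∀ y ∈ Ω, f y = g y) {y : Euc m}
    (hy : y ∈ Ω) (c : Fin m) : pd c f y = pd c g y := by
  unfold pd
  rw [Filter.EventuallyEq.fderiv_eq (Filter.eventuallyEq_of_mem (hΩ.mem_nhds hy) h)]

theorem diffAt_of_contDiffOn {f : Euc m → ℝ} (hΩ : IsOpen Ω) (hf : ContDiffOn ℝ ∞ f Ω) {y : Euc m}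
    (hy : y ∈ Ω) : DifferentiableAt ℝ f y :=
  (hf.contDiffAt (hΩ.mem_nhds hy)).differentiableAt (by simp)

theorem pd_add {f g : Euc m → ℝ} {y : Euc m} (hf : DifferentiableAt ℝ f y)
    (hg : DifferentiableAt ℝ g y) (c : Fin m) :
    pd c (fun z => f z + g z) y = pd c f y + pd c g y := by
  unfold pd; rw [fderiv_fun_add hf hg]; rfl

theorem pd_mul {f g : Euc m → ℝ} {y : Euc m} (hf : DifferentiableAt ℝ f y)
    (hg : DifferentiableAt ℝ g y) (c : Fin m) :
    pd c (fun z => f z * g z) y = pd c f y * g y + f y * pd c g y := by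
  unfold pd; rw [fderiv_fun_mul hf hg]; simp; ring

theorem pd_const_mul {f : Euc m → ℝ} {y : Euc m} (hf : DifferentiableAt ℝ f y) (a : ℝ)
    (c : Fin m) : pd c (fun z => a * f z) y = a * pd c f y := by
  unfold pd; rw [fderiv_const_mul hf]; rfl

theorem pd_sum {ι : Type*} {s : Finset ι} {f : ι → Euc m → ℝ} {y : Euc m}
    (hf : ∀ i ∈ s, DifferentiableAt ℝ (f i) y) (c : Fin m) :
    pd c (fun z => ∑ i ∈ s, f i z) y = ∑ i ∈ s, pd c (f i) y := by
  unfold pd; rw [fderiv_fun_sum hf]; simp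

theorem contDiffOn_pd {f : Euc m → ℝ} (hΩ : IsOpen Ω) (hf : ContDiffOn ℝ ∞ f Ω) (c : Fin m) :
    ContDiffOn ℝ ∞ (pd c f) Ω :=
  (hf.fderiv_of_isOpen hΩ (by simp)).clm_apply contDiffOn_const

theorem IsMetricOn.inv_smooth (hG : IsMetricOn G Ω) (i j : Fin m) :
    ContDiffOn ℝ ∞ (fun y => (G y)⁻¹ i j) Ω := by
  have hdet : ∀ f : Euc m → Matrix (Fin m) (Fin m) ℝ, (∀ i j, ContDiffOn ℝ ∞ (fun y => f y i j) Ω) →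
      ContDiffOn ℝ ∞ (fun y => (f y).det) Ω := by
    intro f hf
    simp only [Matrix.det_apply']
    exact ContDiffOn.sum fun s _ => contDiffOn_const.mul (contDiffOn_prod fun a _ => hf _ _)
  -- Cramer's rule: the entry is a quotient of determinants, which are polynomials in the entries of
  -- `G`.
  have : ∀ y ∈ Ω, (G y)⁻¹ i j = ((G y).det)⁻¹ * ((G y).transpose.updateCol j (Pi.single i 1)).det := by
    intro y _
    rw [Matrix.inv_def, Matrix.smul_apply, Matrix.adjugate_def, Ring.inverse_eq_inv']
    simp [Matrix.cramer_apply]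
  refine ContDiffOn.congr ?_ this
  refine ((hdet _ hG.smooth).inv hG.det).mul (hdet _ fun a b => ?_)
  by_cases h : b = j
  · subst h; simp; exact contDiffOn_const
  · simp [Matrix.updateCol_ne h]; exact hG.smooth _ _

theorem IsMetricOn.christoffel_smooth (hG : IsMetricOn G Ω) (a b c : Fin m) :
    ContDiffOn ℝ ∞ (christoffel G a b c) Ω := by
  unfold christoffel
  refine contDiffOn_const.mul (ContDiffOn.sum fun d _ => (hG.inv_smooth a d).mul ?_)
  exact ((contDiffOn_pd hG.isOpen (hG.smooth _ _) _).add
    (contDiffOn_pd hG.isOpen (hG.smooth _ _) _)).sub (contDiffOn_pd hG.isOpen (hG.smooth _ _) _)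

theorem IsMetricOn.ricci_smooth (hG : IsMetricOn G Ω) (a b : Fin m) :
    ContDiffOn ℝ ∞ (ricci G a b) Ω := by
  have hc := hG.christoffel_smooth
  unfold ricci riem
  refine ContDiffOn.sum fun i _ => ContDiffOn.add (ContDiffOn.sub ?_ ?_)
    (ContDiffOn.sum fun d _ => ((hc _ _ _).mul (hc _ _ _)).sub ((hc _ _ _).mul (hc _ _ _)))
  · exact contDiffOn_pd hG.isOpen (hc _ _ _) _
  · exact contDiffOn_pd hG.isOpen (hc _ _ _) _

theorem IsMetricOn.rTen_smooth (hG : IsMetricOn G Ω) (a b : Fin m) :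
    ContDiffOn ℝ ∞ (rTen G a b) Ω := by
  unfold rTen
  exact (hG.ricci_smooth a b).div_const _

theorem IsMetricOn.defTen_smooth (hG : IsMetricOn G Ω) (a b : Fin m) :
    ContDiffOn ℝ ∞ (defTen G a b) Ω := by
  unfold defTen scal
  refine contDiffOn_const.mul ((hG.ricci_smooth a b).sub (ContDiffOn.div_const
    ((hG.smooth a b).mul (ContDiffOn.sum fun a _ => ContDiffOn.sum fun b _ =>
      (hG.inv_smooth a b).mul (hG.ricci_smooth a b))) _))

theorem IsMetricOn.pd_symm (hG : IsMetricOn G Ω) {y : Euc m} (hy : y ∈ Ω) (a b c : Fin m) :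
    pd c (fun z => G z a b) y = pd c (fun z => G z b a) y :=
  pd_congr hG.isOpen (fun z hz => hG.symm z hz a b) hy c

theorem IsMetricOn.christoffel_symm (hG : IsMetricOn G Ω) {y : Euc m} (hy : y ∈ Ω)
    (a b c : Fin m) : christoffel G a b c y = christoffel G a c b y := by
  unfold christoffel
  congr 1
  refine Finset.sum_congr rfl fun d _ => ?_
  rw [hG.pd_symm hy b c d]; ring

/-- Lowering the index removes the inverse matrix and leaves Koszul's formula, from which both
compatibility with `G` and uniqueness follow. -/
theorem IsMetricOn.sum_mul_christoffel (hG : IsMetricOn G Ω) {y : Euc m} (hy : y ∈ Ω)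
    (e b c : Fin m) : ∑ a, G y e a * christoffel G a b c y
      = (1 / 2) * (pd b (fun z => G z c e) y + pd c (fun z => G z b e) y
        - pd e (fun z => G z b c) y) := by
  unfold christoffel
  set X : Fin m → ℝ := fun d => pd b (fun z => G z c d) y + pd c (fun z => G z b d) y
        - pd d (fun z => G z b c) y with hX
  have h : (G y * (G y)⁻¹).mulVec X e = X e := by
    rw [Matrix.mul_nonsing_inv _ (isUnit_iff_ne_zero.2 (hG.det y hy)), Matrix.one_mulVec]
  rw [← Matrix.mulVec_mulVec] at h
  simp only [Matrix.mulVec, dotProduct] at h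
  rw [show (1 / 2) * (pd b (fun z => G z c e) y + pd c (fun z => G z b e) y
        - pd e (fun z => G z b c) y) = 1 / 2 * X e from rfl, ← h, Finset.mul_sum]
  exact Finset.sum_congr rfl fun a _ => by ring

theorem IsMetricOn.pd_eq (hG : IsMetricOn G Ω) {y : Euc m} (hy : y ∈ Ω) (a b c : Fin m) :
    pd c (fun z => G z a b) y = ∑ e, christoffel G e c a y * G y e b
      + ∑ e, christoffel G e c b y * G y a e := by
  have h1 := hG.sum_mul_christoffel hy b c a
  have h2 := hG.sum_mul_christoffel hy a c b
  have e1 : ∑ e, christoffel G e c a y * G y e b = ∑ e, G y b e * christoffel G e c a y :=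
    Finset.sum_congr rfl fun e _ => by rw [hG.symm y hy e b]; ring
  have e2 : ∑ e, christoffel G e c b y * G y a e = ∑ e, G y a e * christoffel G e c b y :=
    Finset.sum_congr rfl fun e _ => by ring
  rw [e1, e2, h1, h2, hG.pd_symm hy b a c, hG.pd_symm hy c b a, hG.pd_symm hy c a b]
  ring

/-- Uniqueness of the Levi-Civita connection. -/
theorem IsMetricOn.eq_christoffel (hG : IsMetricOn G Ω) {y : Euc m} (hy : y ∈ Ω)
    (K : Fin m → Fin m → Fin m → ℝ) (hs : ∀ a b c, K a b c = K a c b)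
    (hK : ∀ a b c, pd c (fun z => G z a b) y = ∑ e, K e c a * G y e b + ∑ e, K e c b * G y a e)
    (a b c : Fin m) : K a b c = christoffel G a b c y := by
  have h : ∀ e, ∑ a, G y e a * K a b c = ∑ a, G y e a * christoffel G a b c y := by
    intro e
    -- Koszul's combination of the three compatibility identities: by the symmetry of `K` everything
    -- cancels except twice the lowered `K`.
    rw [hG.sum_mul_christoffel hy, hK c e b, hK b e c, hK b c e]
    have e1 : ∀ b c e, ∑ a, K a b c * G y a e = ∑ a, G y e a * K a b c := fun b c e =>
      Finset.sum_congr rfl fun a _ => by rw [hG.symm y hy a e]; ring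
    have e2 : ∀ b c e, ∑ a, K a b c * G y e a = ∑ a, G y e a * K a b c := fun b c e =>
      Finset.sum_congr rfl fun a _ => by ring
    have e3 : ∀ b c e, ∑ a, G y e a * K a b c = ∑ a, G y e a * K a c b := fun b c e =>
      Finset.sum_congr rfl fun a _ => by rw [hs]
    rw [e1, e1, e1, e2, e2, e2, e3 c b e, e3 e b c, e3 e c b]
    ring
  have h2 : (G y).mulVec (fun a => K a b c) = (G y).mulVec (fun a => christoffel G a b c y) :=
    funext h
  have h3 := congrArg ((G y)⁻¹.mulVec) h2
  simp only [Matrix.mulVec_mulVec, Matrix.nonsing_inv_mul _ (isUnit_iff_ne_zero.2 (hG.det y hy)),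
    Matrix.one_mulVec] at h3
  exact congrFun h3 a

/-- Smooth families of tensors on `Ω`. -/
def SmoothTen (Ω : Set (Euc m)) (t : Euc m → Ten m n) : Prop :=
  ∀ i, ContDiffOn ℝ ∞ (fun y => t y i) Ω

theorem SmoothTen.diffAt {t : Euc m → Ten m n} (ht : SmoothTen Ω t) (hΩ : IsOpen Ω) {y : Euc m}
    (hy : y ∈ Ω) (i : Fin n → Fin m) : DifferentiableAt ℝ (fun z => t z i) y :=
  diffAt_of_contDiffOn hΩ (ht i) hy

theorem IsMetricOn.smooth_der (hG : IsMetricOn G Ω) {t : Euc m → Ten m n} (ht : SmoothTen Ω t)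
    (c : Fin m) : SmoothTen Ω fun y => der (chrMat G c y) (t y) := fun _ =>
  ContDiffOn.sum fun _ _ => ContDiffOn.sum fun _ _ => (hG.christoffel_smooth _ _ _).mul (ht _)

theorem IsMetricOn.smooth_trace (hG : IsMetricOn G Ω) (c : Fin m) :
    ContDiffOn ℝ ∞ (fun y => (chrMat G c y).trace) Ω :=
  ContDiffOn.sum fun _ _ => hG.christoffel_smooth _ _ _

theorem IsMetricOn.smooth_nablaContra (hG : IsMetricOn G Ω) (δ : ℝ) {t : Euc m → Ten m n}
    (ht : SmoothTen Ω t) (c : Fin m) : SmoothTen Ω (nablaContra G δ t c) := fun i =>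
  ((contDiffOn_pd hG.isOpen (ht i) c).add (hG.smooth_der ht c i)).sub
    ((contDiffOn_const.mul (hG.smooth_trace c)).mul (ht i))

theorem IsMetricOn.smooth_nablaCo (hG : IsMetricOn G Ω) (lam : ℝ) {t : Euc m → Ten m n}
    (ht : SmoothTen Ω t) (c : Fin m) : SmoothTen Ω (nablaCo G lam t c) := fun i =>
  ((contDiffOn_pd hG.isOpen (ht i) c).sub (ContDiffOn.sum fun _ _ => ContDiffOn.sum fun _ _ =>
    (hG.christoffel_smooth _ _ _).mul (ht _))).sub
    ((contDiffOn_const.mul (hG.smooth_trace c)).mul (ht i))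

/-- The Levi-Civita connection preserves the symmetric trace-free tensors. -/
theorem IsMetricOn.nablaContra_mem_stf (hG : IsMetricOn G Ω) (δ : ℝ) {t : Euc m → Ten m n}
    (ht : SmoothTen Ω t) (hst : ∀ y ∈ Ω, t y ∈ stf (G y) n) (c : Fin m) {y : Euc m} (hy : y ∈ Ω) :
    nablaContra G δ t c y ∈ stf (G y) n := by
  have hsym : ∀ (s : Equiv.Perm (Fin n)) i,
      nablaContra G δ t c y (i ∘ s) = nablaContra G δ t c y i := by
    intro s i
    simp only [nablaContra_eq]
    rw [der_mem_sym (hst y hy).1, (hst y hy).1,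
      pd_congr hG.isOpen (fun z hz => (hst z hz).1 s i) hy]
  match n, t, ht, hst, hsym with
  | 0, _, _, _, _ => exact mem_stf_zero _
  | 1, _, _, _, _ => exact mem_stf_one _
  | n + 2, t, ht, hst, hsym =>
    refine mem_stf_of_cons_cons hsym fun i => ?_
    have h0 : ∀ z ∈ Ω, ∑ a, ∑ b, G z a b * t z (Fin.cons a (Fin.cons b i)) = 0 := fun z hz =>
      stf_trace (hst z hz) i
    -- The vanishing trace is differentiated; metric compatibility turns the derivative of `G` into
    -- the Christoffel terms of the two contracted slots.
    have h1 : pd c (fun z => ∑ a, ∑ b, G z a b * t z (Fin.cons a (Fin.cons b i))) y = 0 := by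
      rw [pd_congr hG.isOpen h0 hy]; simp [pd]
    have hd : ∀ a b, DifferentiableAt ℝ (fun z => G z a b * t z (Fin.cons a (Fin.cons b i))) y :=
      fun a b => (diffAt_of_contDiffOn hG.isOpen (hG.smooth a b) hy).mul (ht.diffAt hG.isOpen hy _)
    rw [pd_sum fun a _ => DifferentiableAt.fun_sum fun b _ => hd a b] at h1
    simp only [pd_sum fun b _ => hd _ b] at h1
    simp only [pd_mul (diffAt_of_contDiffOn hG.isOpen (hG.smooth _ _) hy)
      (ht.diffAt hG.isOpen hy _), hG.pd_eq hy] at h1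
    -- On the slots that are not contracted, the connection acts on the trace itself, which is zero.
    have h2 : ∑ a, ∑ b, G y a b * der (chrMat G c y) (fun i => t y (Fin.cons a (Fin.cons b i))) i
        = 0 := by
      rw [← Finset.sum_product', der_sum_smul]
      have : (fun i => ∑ x ∈ (Finset.univ : Finset (Fin m)) ×ˢ Finset.univ,
          G y x.1 x.2 * t y (Fin.cons x.1 (Fin.cons x.2 i))) = 0 := by
        funext i
        rw [Finset.sum_product' (f := fun a b => G y a b * t y (Fin.cons a (Fin.cons b i)))]
        exact stf_trace (hst y hy) i
      rw [this]; simp [der]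
    simp only [nablaContra_eq, der_cons, mul_sub, mul_add, Finset.sum_sub_distrib,
      Finset.sum_add_distrib, h2]
    have h3 : ∑ a, ∑ b, G y a b * (δ * (chrMat G c y).trace * t y (Fin.cons a (Fin.cons b i)))
        = 0 := by
      simp only [mul_left_comm (G y _ _), ← Finset.mul_sum, stf_trace (hst y hy) i, mul_zero]
    rw [h3]
    simp only [add_mul, Finset.sum_add_distrib] at h1
    have e1 : ∑ a, ∑ b, G y a b * ∑ j, chrMat G c y a j * t y (Fin.cons j (Fin.cons b i))
        = ∑ a, ∑ b, (∑ e, christoffel G e c a y * G y e b) * t y (Fin.cons a (Fin.cons b i)) := by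
      simp only [Finset.mul_sum, Finset.sum_mul]
      rw [Finset.sum_comm]
      conv_rhs => rw [Finset.sum_comm]
      refine Finset.sum_congr rfl fun b _ => ?_
      rw [Finset.sum_comm]
      refine Finset.sum_congr rfl fun j _ => Finset.sum_congr rfl fun a _ => ?_
      simp only [chrMat, Matrix.of_apply]; ring
    have e2 : ∑ a, ∑ b, G y a b * ∑ j, chrMat G c y b j * t y (Fin.cons a (Fin.cons j i))
        = ∑ a, ∑ b, (∑ e, christoffel G e c b y * G y a e) * t y (Fin.cons a (Fin.cons b i)) := by
      simp only [Finset.mul_sum, Finset.sum_mul]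
      refine Finset.sum_congr rfl fun b _ => ?_
      rw [Finset.sum_comm]
      refine Finset.sum_congr rfl fun j _ => Finset.sum_congr rfl fun a _ => ?_
      simp only [chrMat, Matrix.of_apply]; ring
    rw [e1, e2]
    linarith

/-- The divergence of a single tensor field. -/
def divTen (G : Euc m → Matrix (Fin m) (Fin m) ℝ) (δ : ℝ) (t : Euc m → Ten m (n + 1)) :
    Euc m → Ten m n := fun y i => ∑ c, nablaContra G δ t c y (Fin.cons c i)

theorem IsMetricOn.smooth_divTen (hG : IsMetricOn G Ω) (δ : ℝ) {t : Euc m → Ten m (n + 1)}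
    (ht : SmoothTen Ω t) : SmoothTen Ω (divTen G δ t) := fun _ =>
  ContDiffOn.sum fun c _ => hG.smooth_nablaContra δ ht c _

theorem IsMetricOn.divTen_mem_stf (hG : IsMetricOn G Ω) (δ : ℝ) {t : Euc m → Ten m (n + 1)}
    (ht : SmoothTen Ω t) (hst : ∀ y ∈ Ω, t y ∈ stf (G y) (n + 1)) {y : Euc m} (hy : y ∈ Ω) :
    divTen G δ t y ∈ stf (G y) n := by
  have : divTen G δ t y = ∑ c, fun i => nablaContra G δ t c y (Fin.cons c i) := by
    funext i; simp [divTen]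
  rw [this]
  exact Submodule.sum_mem _ fun c _ => stf_cons (hG.nablaContra_mem_stf δ ht hst c hy) c

/-- Integration by parts, for weights that add up to `1`. -/
theorem IsMetricOn.sum_mul_nablaCo (hG : IsMetricOn G Ω) (lam : ℝ) {T : Euc m → Ten m (n + 1)}
    (hT : SmoothTen Ω T) {t : Euc m → Ten m n} (ht : SmoothTen Ω t) {y : Euc m} (hy : y ∈ Ω) :
    ∑ c, ∑ j, T y (Fin.cons c j) * nablaCo G lam t c y j
      = ∑ c, pd c (fun z => ∑ j, T z (Fin.cons c j) * t z j) y
        - ∑ j, divTen G (1 - lam) T y j * t y j := by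
  have e1 : ∀ c, pd c (fun z => ∑ j, T z (Fin.cons c j) * t z j) y
      = ∑ j, pd c (fun z => T z (Fin.cons c j)) y * t y j
        + ∑ j, T y (Fin.cons c j) * pd c (fun z => t z j) y := by
    intro c
    rw [pd_sum (f := fun j z => T z (Fin.cons c j) * t z j)
      fun j _ => (hT.diffAt hG.isOpen hy _).mul (ht.diffAt hG.isOpen hy _),
      ← Finset.sum_add_distrib]
    exact Finset.sum_congr rfl fun j _ => pd_mul (hT.diffAt hG.isOpen hy _)
      (ht.diffAt hG.isOpen hy _) c
  have e2 : ∀ c, ∑ j, T y (Fin.cons c j) * der (chrMat G c y).transpose (t y) j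
      = ∑ j, der (chrMat G c y) (fun j => T y (Fin.cons c j)) j * t y j := fun c => by
    rw [sum_mul_der]; rfl
  -- Since the connection is symmetric, `Γ^c_{cd} = Γ^c_{dc}` is the trace of the connection matrix.
  -- This compensates exactly for the total weight `1`.
  have e3 : ∑ c, ∑ j, (∑ d, chrMat G c y c d * T y (Fin.cons d j)) * t y j
      = ∑ c, ∑ j, (chrMat G c y).trace * T y (Fin.cons c j) * t y j := by
    rw [Finset.sum_comm]
    conv_rhs => rw [Finset.sum_comm]
    refine Finset.sum_congr rfl fun j _ => ?_
    rw [← Finset.sum_mul, ← Finset.sum_mul, Finset.sum_comm]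
    congr 1
    refine Finset.sum_congr rfl fun d _ => ?_
    rw [← Finset.sum_mul]
    congr 1
    exact Finset.sum_congr rfl fun c _ => hG.christoffel_symm hy _ _ _
  have e4 : ∑ j, divTen G (1 - lam) T y j * t y j
      = ∑ c, ∑ j, nablaContra G (1 - lam) T c y (Fin.cons c j) * t y j := by
    simp only [divTen, Finset.sum_mul]; rw [Finset.sum_comm]
  rw [e4]
  simp only [nablaCo_eq, nablaContra_eq, der_cons, e1, mul_sub, Finset.sum_sub_distrib, e2, sub_mul,
    add_mul, Finset.sum_add_distrib, e3, one_mul]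
  have e5 : ∑ c, ∑ j, T y (Fin.cons c j) * (lam * (chrMat G c y).trace * t y j)
      = ∑ c, ∑ j, lam * (chrMat G c y).trace * T y (Fin.cons c j) * t y j :=
    Finset.sum_congr rfl fun c _ => Finset.sum_congr rfl fun j _ => by ring
  rw [e5]
  ring

theorem sum_mul_symmetrize {S : Ten m n} (hs : ∀ (s : Equiv.Perm (Fin n)) i, S (i ∘ s) = S i)
    (t : Ten m n) : ∑ i, S i * symmetrize t i = ∑ i, S i * t i := by
  have h : ∀ s : Equiv.Perm (Fin n), ∑ i, S i * t (i ∘ s) = ∑ i, S i * t i := by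
    intro s
    rw [← (Equiv.arrowCongr s (Equiv.refl (Fin m))).sum_comp]
    refine Finset.sum_congr rfl fun i _ => ?_
    have : (Equiv.arrowCongr s (Equiv.refl (Fin m))) i = i ∘ s.symm := rfl
    rw [this, hs s.symm i]
    congr 2
    funext a; simp
  simp only [symmetrize, Finset.mul_sum]
  rw [Finset.sum_comm]
  have : ∀ s : Equiv.Perm (Fin n), ∑ i, S i * (1 / (n.factorial : ℝ) * t (i ∘ s))
      = 1 / (n.factorial : ℝ) * ∑ i, S i * t i := by
    intro s
    rw [← h s, Finset.mul_sum]
    exact Finset.sum_congr rfl fun i _ => by ring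
  simp only [this, Finset.sum_const, Finset.card_univ, Fintype.card_perm, Fintype.card_fin,
    nsmul_eq_mul]
  have hf : (n.factorial : ℝ) ≠ 0 := Nat.cast_ne_zero.2 n.factorial_ne_zero
  field_simp

end ChartCalculus

/-! ### The right-hand side of the formula as the solution of two recursions -/

section ChartFormula

variable {m : ℕ} {n k : ℕ} {G : Euc m → Matrix (Fin m) (Fin m) ℝ} {Ω : Set (Euc m)}
  {B : Fin m → Fin m → Euc m → ℝ} {lam δ : ℝ}

/-- All components of the graded tensor are smooth on `Ω`. -/
def SmoothG (Ω : Set (Euc m)) (t : GField m) : Prop := ∀ n, SmoothTen Ω (t n)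

theorem nablaS_succ (t : GField m) (n : ℕ) (y : Euc m) : nablaS G lam t (n + 1) y
    = symmetrize fun i => nablaCo G lam (t n) (i 0) y (Fin.tail i) := rfl

theorem opT1_succ_succ (t : GField m) (n : ℕ) (y : Euc m) : opT1 B lam t (n + 2) y
    = symmetrize fun i => B (i 0) (i 1) y *
      ((-lam * m - n) * (n + 1) * t n y (Fin.tail (Fin.tail i))) := rfl

theorem opDiv_apply (t : GField m) (n : ℕ) : opDiv G δ t n = divTen G δ (t (n + 1)) := rfl

theorem smoothTen_symmetrize {t : Euc m → Ten m n} (ht : SmoothTen Ω t) :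
    SmoothTen Ω fun y => symmetrize (t y) := fun _ =>
  contDiffOn_const.mul (ContDiffOn.sum fun _ _ => ht _)

theorem IsMetricOn.smooth_nablaS (hG : IsMetricOn G Ω) (lam : ℝ) {t : GField m}
    (ht : SmoothG Ω t) : SmoothG Ω (nablaS G lam t) := by
  intro n
  cases n with
  | zero => exact fun _ => contDiffOn_const
  | succ n =>
    exact smoothTen_symmetrize (t := fun y i => nablaCo G lam (t n) (i 0) y (Fin.tail i))
      fun i => hG.smooth_nablaCo lam (ht n) (i 0) (Fin.tail i)

theorem smooth_opT1 (hB : ∀ a b, ContDiffOn ℝ ∞ (B a b) Ω) (lam : ℝ) {t : GField m}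
    (ht : SmoothG Ω t) : SmoothG Ω (opT1 B lam t) := by
  intro n
  match n with
  | 0 => exact fun _ => contDiffOn_const
  | 1 => exact fun _ => contDiffOn_const
  | n + 2 =>
    exact smoothTen_symmetrize (t := fun y i => B (i 0) (i 1) y *
      ((-lam * m - n) * (n + 1) * t n y (Fin.tail (Fin.tail i))))
      fun i => (hB _ _).mul (contDiffOn_const.mul (ht n _))

theorem IsMetricOn.smooth_opDiv (hG : IsMetricOn G Ω) (δ : ℝ) {t : GField m}
    (ht : SmoothG Ω t) : SmoothG Ω (opDiv G δ t) := fun _ => hG.smooth_divTen δ (ht _)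

theorem IsMetricOn.smooth_opT2 (hG : IsMetricOn G Ω) (δ : ℝ) (k : ℕ) {t : GField m}
    (ht : SmoothG Ω t) : SmoothG Ω (opT2 G δ k t) := fun n i => by
  unfold opT2 contr2
  exact ContDiffOn.sum fun a _ => ContDiffOn.sum fun b _ =>
    (hG.rTen_smooth a b).mul (contDiffOn_const.mul (ht (n + 2) _))

theorem SmoothG.add {s t : GField m} (hs : SmoothG Ω s) (ht : SmoothG Ω t) :
    SmoothG Ω (fun n => s n + t n) := fun n i => (hs n i).add (ht n i)

theorem SmoothG.sum {ι : Type*} {s : Finset ι} {t : ι → GField m} (ht : ∀ j, SmoothG Ω (t j)) :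
    SmoothG Ω (∑ j ∈ s, t j) := by
  intro n i
  simp only [Finset.sum_apply]
  exact ContDiffOn.sum fun j _ => ht j n i

theorem der_sum {ι : Type*} (s : Finset ι) (A : Matrix (Fin m) (Fin m) ℝ)
    (T : ι → Ten m n) (i : Fin n → Fin m) :
    der A (∑ x ∈ s, T x) i = ∑ x ∈ s, der A (T x) i := by
  have := der_sum_smul s A (fun _ => 1) T i
  simp only [one_mul] at this
  rw [this]
  congr 1
  funext i; simp

theorem IsMetricOn.nablaCo_sum (hG : IsMetricOn G Ω) {ι : Type*} {s : Finset ι}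
    {t : ι → Euc m → Ten m n} (ht : ∀ j, SmoothTen Ω (t j)) (c : Fin m) {y : Euc m} (hy : y ∈ Ω)
    (i : Fin n → Fin m) :
    nablaCo G lam (∑ j ∈ s, t j) c y i = ∑ j ∈ s, nablaCo G lam (t j) c y i := by
  simp only [nablaCo_eq, Finset.sum_sub_distrib, ← Finset.mul_sum, ← der_sum, Finset.sum_apply]
  rw [pd_sum fun j _ => (ht j).diffAt hG.isOpen hy i]

theorem IsMetricOn.nablaContra_sum (hG : IsMetricOn G Ω) {ι : Type*} {s : Finset ι}
    {t : ι → Euc m → Ten m n} (ht : ∀ j, SmoothTen Ω (t j)) (c : Fin m) {y : Euc m} (hy : y ∈ Ω)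
    (i : Fin n → Fin m) :
    nablaContra G δ (∑ j ∈ s, t j) c y i = ∑ j ∈ s, nablaContra G δ (t j) c y i := by
  simp only [nablaContra_eq, Finset.sum_sub_distrib, Finset.sum_add_distrib, ← Finset.mul_sum,
    ← der_sum, Finset.sum_apply]
  rw [pd_sum fun j _ => (ht j).diffAt hG.isOpen hy i]

theorem symmetrize_sum {ι : Type*} (s : Finset ι) (t : ι → Ten m n) (i : Fin n → Fin m) :
    symmetrize (fun i => ∑ j ∈ s, t j i) i = ∑ j ∈ s, symmetrize (t j) i := by
  simp only [symmetrize, ← Finset.mul_sum]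
  rw [Finset.sum_comm]

theorem IsMetricOn.cov_sum (hG : IsMetricOn G Ω) {ι : Type*} {s : Finset ι}
    {t : ι → GField m} (ht : ∀ j, SmoothG Ω (t j)) (n : ℕ) {y : Euc m} (hy : y ∈ Ω)
    (i : Fin n → Fin m) : (nablaS G lam (∑ j ∈ s, t j) + opT1 B lam (∑ j ∈ s, t j)) n y i
      = ∑ j ∈ s, (nablaS G lam (t j) + opT1 B lam (t j)) n y i := by
  simp only [Pi.add_apply, Finset.sum_add_distrib]
  congr 1
  · cases n with
    | zero => simp [nablaS]
    | succ n =>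
      simp only [nablaS_succ, Finset.sum_apply]
      rw [← symmetrize_sum]
      congr 1
      funext i
      exact hG.nablaCo_sum (fun j => ht j n) _ hy _
  · match n with
    | 0 => simp [opT1, vee2]
    | 1 => simp [opT1, vee2]
    | n + 2 =>
      simp only [opT1_succ_succ, Finset.sum_apply]
      rw [← symmetrize_sum]
      congr 1
      funext i
      simp only [Finset.mul_sum]

theorem IsMetricOn.contra_sum (hG : IsMetricOn G Ω) {ι : Type*} {s : Finset ι}
    {t : ι → GField m} (ht : ∀ j, SmoothG Ω (t j)) (n : ℕ) {y : Euc m} (hy : y ∈ Ω)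
    (i : Fin n → Fin m) : (opDiv G δ (∑ j ∈ s, t j) + opT2 G δ k (∑ j ∈ s, t j)) n y i
      = ∑ j ∈ s, (opDiv G δ (t j) + opT2 G δ k (t j)) n y i := by
  simp only [Pi.add_apply, Finset.sum_add_distrib]
  congr 1
  · simp only [opDiv]
    rw [Finset.sum_comm]
    refine Finset.sum_congr rfl fun c _ => ?_
    rw [Finset.sum_apply]
    exact hG.nablaContra_sum (fun j => ht j (n + 1)) _ hy _
  · simp only [opT2, contr2, Finset.sum_apply, Pi.smul_apply, smul_eq_mul, Finset.mul_sum]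
    rw [Finset.sum_comm]
    conv_rhs => rw [Finset.sum_comm]
    rw [Finset.sum_comm]
    refine Finset.sum_congr rfl fun c _ => ?_
    conv_rhs => rw [Finset.sum_comm]

/-- Telescoping of a geometric series. Additivity of `Op` is only assumed pointwise on `Ω` and for
smooth tensors, since derivatives are additive only there. -/
theorem sum_iterate {Op : GField m → GField m} (hsm : ∀ t, SmoothG Ω t → SmoothG Ω (Op t))
    (hadd : ∀ (s : Finset ℕ) (t : ℕ → GField m), (∀ j, SmoothG Ω (t j)) → ∀ n, ∀ y ∈ Ω, ∀ i,
      Op (∑ j ∈ s, t j) n y i = ∑ j ∈ s, Op (t j) n y i) {S : GField m} (hS : SmoothG Ω S)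
    (N n : ℕ) {y : Euc m} (hy : y ∈ Ω) (i : Fin n → Fin m) :
    (∑ j ∈ Finset.range N, Op^[j] S) n y i + Op^[N] S n y i
      = S n y i + Op (∑ j ∈ Finset.range N, Op^[j] S) n y i := by
  have h : ∀ j, SmoothG Ω (Op^[j] S) := by
    intro j
    induction j with
    | zero => exact hS
    | succ j ih => rw [Function.iterate_succ_apply']; exact hsm _ ih
  rw [hadd _ _ h n y hy i]
  simp only [Finset.sum_apply, ← Function.iterate_succ_apply' Op]
  rw [← Finset.sum_range_succ (fun j => Op^[j] S n y i), Finset.sum_range_succ']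
  simp [add_comm]

theorem symmetrize_zero : symmetrize (0 : Ten m n) = 0 := by
  funext i; simp [symmetrize]

theorem nablaCo_zero (c : Fin m) (y : Euc m) (i : Fin n → Fin m) :
    nablaCo G lam (0 : Euc m → Ten m n) c y i = 0 := by
  simp [nablaCo, pd]

theorem nablaContra_zero (c : Fin m) (y : Euc m) (i : Fin n → Fin m) :
    nablaContra G δ (0 : Euc m → Ten m n) c y i = 0 := by
  simp [nablaContra, pd]

/-- Both operators raise the degree by at least one, so `j` iterations leave nothing below degree
`j`; in the same way `Div + T₂` empties the top degrees. -/
theorem cov_support {t : GField m} {j : ℕ} (h : ∀ n < j, t n = 0) :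
    ∀ n < j + 1, (nablaS G lam t + opT1 B lam t) n = 0 := by
  intro n hn
  funext y i
  have e1 : nablaS G lam t n y i = 0 := by
    cases n with
    | zero => rfl
    | succ n =>
      rw [nablaS_succ, h n (by omega)]
      simp only [nablaCo_zero]
      exact congrFun symmetrize_zero i
  have e2 : opT1 B lam t n y i = 0 := by
    match n with
    | 0 => rfl
    | 1 => rfl
    | n + 2 =>
      rw [opT1_succ_succ, h n (by omega)]
      simp only [Pi.zero_apply, mul_zero]
      exact congrFun symmetrize_zero i
  simp [e1, e2]

theorem contra_support {t : GField m} {j : ℕ} (h : ∀ n, k < n + j → t n = 0) :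
    ∀ n, k < n + (j + 1) → (opDiv G δ t + opT2 G δ k t) n = 0 := by
  intro n hn
  funext y i
  simp only [Pi.add_apply, opDiv, opT2, contr2, h (n + 1) (by omega), h (n + 2) (by omega),
    nablaContra_zero]
  simp

theorem cov_iterate_support {t : GField m} (j : ℕ) :
    ∀ n < j, (fun t => nablaS G lam t + opT1 B lam t)^[j] t n = 0 := by
  induction j with
  | zero => intro n hn; omega
  | succ j ih => rw [Function.iterate_succ_apply']; exact cov_support ih

theorem contra_iterate_support {t : GField m} (ht : ∀ n, k < n → t n = 0) (j : ℕ) :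
    ∀ n, k < n + j → (fun t => opDiv G δ t + opT2 G δ k t)^[j] t n = 0 := by
  induction j with
  | zero => exact ht
  | succ j ih => rw [Function.iterate_succ_apply']; exact contra_support ih

/-- The two factors of the formula, described by their recursions. -/
theorem IsMetricOn.exists_factors (hG : IsMetricOn G Ω)
    (hB : ∀ a b, ContDiffOn ℝ ∞ (B a b) Ω) (lam δ : ℝ) {S f : GField m} (hS : SmoothG Ω S)
    (hf : SmoothG Ω f) (hSk : ∀ n, n ≠ k → S n = 0) (hf0 : ∀ n, n ≠ 0 → f n = 0) :
    ∃ W U : GField m, SmoothG Ω W ∧ SmoothG Ω U ∧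
      (∀ y ∈ Ω, W k y = S k y) ∧ (∀ n, k < n → W n = 0) ∧
      (∀ n < k, ∀ y ∈ Ω, W n y = opDiv G δ W n y + opT2 G δ k W n y) ∧
      (∀ y ∈ Ω, U 0 y = f 0 y) ∧
      (∀ n < k, ∀ y ∈ Ω, U (n + 1) y = nablaS G lam U (n + 1) y + opT1 B lam U (n + 1) y) ∧
      ∀ y, formula G B lam δ k S f y
        = ∑ l ∈ Finset.range (k + 1), coeffC m lam δ k l * ∑ i, W (k - l) y i * U (k - l) y i := by
  set OpW : GField m → GField m := fun t => opDiv G δ t + opT2 G δ k t with hOpW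
  set OpU : GField m → GField m := fun t => nablaS G lam t + opT1 B lam t with hOpU
  have hW := fun N n y (hy : y ∈ Ω) i => sum_iterate (Op := OpW)
    (fun t ht => (hG.smooth_opDiv δ ht).add (hG.smooth_opT2 δ k ht))
    (fun s t ht n y hy i => hG.contra_sum ht n hy i) hS N n hy i
  have hU := fun N n y (hy : y ∈ Ω) i => sum_iterate (Op := OpU)
    (fun t ht => (hG.smooth_nablaS lam ht).add (smooth_opT1 hB lam ht))
    (fun s t ht n y hy i => hG.cov_sum ht n hy i) hf N n hy i
  have sW : ∀ j, SmoothG Ω (OpW^[j] S) := by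
    intro j
    induction j with
    | zero => exact hS
    | succ j ih =>
      rw [Function.iterate_succ_apply']
      exact (hG.smooth_opDiv δ ih).add (hG.smooth_opT2 δ k ih)
  have sU : ∀ j, SmoothG Ω (OpU^[j] f) := by
    intro j
    induction j with
    | zero => exact hf
    | succ j ih =>
      rw [Function.iterate_succ_apply']
      exact (hG.smooth_nablaS lam ih).add (smooth_opT1 hB lam ih)
  have zW : ∀ j n, k < n + j → OpW^[j] S n = 0 := fun j => 
    contra_iterate_support (fun n hn => hSk n (by omega)) j
  have zU : ∀ j, ∀ n < j, OpU^[j] f n = 0 := fun j => cov_iterate_support j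
  refine ⟨∑ j ∈ Finset.range (k + 1), OpW^[j] S, ∑ j ∈ Finset.range (k + 1), OpU^[j] f,
    SmoothG.sum sW, SmoothG.sum sU, ?_, ?_, ?_, ?_, ?_, ?_⟩
  · intro y _
    rw [Finset.sum_apply, Finset.sum_apply, Finset.sum_eq_single 0]
    · rfl
    · intro j _ hj; rw [zW j k (by omega)]; rfl
    · simp
  · intro n hn
    rw [Finset.sum_apply]
    exact Finset.sum_eq_zero fun j _ => zW j n (by omega)
  · intro n hn y hy
    funext i
    have := hW (k + 1) n y hy i
    rw [zW (k + 1) n (by omega), hSk n (by omega)] at this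
    simp only [Pi.zero_apply, zero_add, add_zero] at this
    exact this
  · intro y _
    rw [Finset.sum_apply, Finset.sum_apply, Finset.sum_eq_single 0]
    · rfl
    · intro j _ hj; rw [zU j 0 (by omega)]; rfl
    · simp
  · intro n hn y hy
    funext i
    have := hU (k + 1) (n + 1) y hy i
    rw [zU (k + 1) (n + 1) (by omega), hf0 (n + 1) (by omega)] at this
    simp only [Pi.zero_apply, zero_add, add_zero] at this
    exact this
  · intro y
    refine Finset.sum_congr rfl fun l hl => ?_
    rw [Finset.mem_range] at hl
    congr 1
    -- The factors do not depend on `l`: iterates beyond the `l`-th have no component in degree `k -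
    -- l`, so the truncated series may be replaced by the full one, and likewise for the other
    -- factor.
    have e1 : (∑ j ∈ Finset.range (l + 1), OpW^[j] S) (k - l)
        = (∑ j ∈ Finset.range (k + 1), OpW^[j] S) (k - l) := by
      rw [Finset.sum_apply, Finset.sum_apply]
      refine Finset.sum_subset (Finset.range_mono (by omega)) fun j _ hj => ?_
      rw [Finset.mem_range] at hj
      exact zW j _ (by omega)
    have e2 : (∑ j ∈ Finset.range (k - l + 1), OpU^[j] f) (k - l)
        = (∑ j ∈ Finset.range (k + 1), OpU^[j] f) (k - l) := by
      rw [Finset.sum_apply, Finset.sum_apply]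
      refine Finset.sum_subset (Finset.range_mono (by omega)) fun j _ hj => ?_
      rw [Finset.mem_range] at hj
      exact zU j _ (by omega)
    unfold pair
    rw [e1, e2]

/-- Symmetry of a tensor. -/
def IsSym (T : Ten m n) : Prop := ∀ (s : Equiv.Perm (Fin n)) i, T (i ∘ s) = T i

theorem sum_mul_nablaS {T : Ten m (n + 1)} (hT : IsSym T) (U : GField m) (y : Euc m) :
    ∑ i, T i * nablaS G lam U (n + 1) y i
      = ∑ c, ∑ j, T (Fin.cons c j) * nablaCo G lam (U n) c y j := by
  rw [nablaS_succ, sum_mul_symmetrize hT, sum_cons]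
  simp

theorem sum_mul_opT1 {T : Ten m (n + 2)} (hT : IsSym T) (U : GField m) (y : Euc m) :
    ∑ i, T i * opT1 B lam U (n + 2) y i = (-lam * m - n) * (n + 1) *
      ∑ j, (∑ a, ∑ b, B a b y * T (Fin.cons a (Fin.cons b j))) * U n y j := by
  rw [opT1_succ_succ, sum_mul_symmetrize hT, sum_cons]
  simp only [sum_cons (n := n)]
  simp only [Fin.cons_zero, Fin.cons_one, Fin.tail_cons, Finset.sum_mul, Finset.mul_sum]
  conv_rhs => rw [Finset.sum_comm]
  refine Finset.sum_congr rfl fun a _ => ?_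
  conv_rhs => rw [Finset.sum_comm]
  refine Finset.sum_congr rfl fun b _ => Finset.sum_congr rfl fun j _ => ?_
  ring

theorem sum_sum_cons_mem_stf {G : Matrix (Fin m) (Fin m) ℝ} {T : Ten m (n + 2)}
    (hT : T ∈ stf G (n + 2)) (b : Fin m → Fin m → ℝ) :
    (fun j => ∑ x, ∑ y, b x y * T (Fin.cons x (Fin.cons y j))) ∈ stf G n := by
  have : (fun j => ∑ x, ∑ y, b x y * T (Fin.cons x (Fin.cons y j)))
      = ∑ x, ∑ y, b x y • fun j => T (Fin.cons x (Fin.cons y j)) := by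
    funext j; simp
  rw [this]
  exact Submodule.sum_mem _ fun x _ => Submodule.sum_mem _ fun y _ =>
    Submodule.smul_mem _ _ (stf_cons (stf_cons hT x) y)

/-- Tensors that agree only when paired with trace-free ones have unrelated derivatives a priori.
Integration by parts moves the derivative to the test tensor, and both freezing a slot and taking
the divergence keep it symmetric and trace-free. -/
theorem IsMetricOn.sum_nablaCo_congr (hG : IsMetricOn G Ω) {t u : Euc m → Ten m n}
    (ht : SmoothTen Ω t) (hu : SmoothTen Ω u)
    (h : ∀ T : Euc m → Ten m n, SmoothTen Ω T → (∀ y ∈ Ω, T y ∈ stf (G y) n) → ∀ y ∈ Ω,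
      ∑ j, T y j * t y j = ∑ j, T y j * u y j)
    {T : Euc m → Ten m (n + 1)} (hT : SmoothTen Ω T) (hst : ∀ y ∈ Ω, T y ∈ stf (G y) (n + 1))
    {y : Euc m} (hy : y ∈ Ω) :
    ∑ c, ∑ j, T y (Fin.cons c j) * nablaCo G lam t c y j
      = ∑ c, ∑ j, T y (Fin.cons c j) * nablaCo G lam u c y j := by
  rw [hG.sum_mul_nablaCo lam hT ht hy, hG.sum_mul_nablaCo lam hT hu hy]
  congr 1
  · refine Finset.sum_congr rfl fun c _ => pd_congr hG.isOpen (fun z hz => ?_) hy c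
    exact h (fun z j => T z (Fin.cons c j)) (fun i => hT _) (fun z hz => stf_cons (hst z hz) c) z hz
  · exact h _ (hG.smooth_divTen _ hT) (fun z hz => hG.divTen_mem_stf _ hT hst hz) y hy

/-- The formula computes the sum of the contractions of families that satisfy the recursions up to
trace terms. -/
theorem IsMetricOn.formula_eq (hG : IsMetricOn G Ω)
    (hB : ∀ a b, ContDiffOn ℝ ∞ (B a b) Ω)
    (hBr : ∀ y ∈ Ω, ∀ n, ∀ T ∈ stf (G y) (n + 2), ∀ j : Fin n → Fin m,
      ∑ a, ∑ b, B a b y * T (Fin.cons a (Fin.cons b j))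
        = ∑ a, ∑ b, rTen G a b y * T (Fin.cons a (Fin.cons b j)))
    {S f s t : GField m} (hS : SmoothG Ω S)
    (hf : SmoothG Ω f) (hSk : ∀ n, n ≠ k → S n = 0) (hf0 : ∀ n, n ≠ 0 → f n = 0)
    (hs : SmoothG Ω s) (ht : SmoothG Ω t) (hst : ∀ n ≤ k, ∀ y ∈ Ω, s n y ∈ stf (G y) n)
    (hsk : ∀ y ∈ Ω, s k y = S k y)
    (hs1 : ∀ n, n + 1 = k → ∀ y ∈ Ω, ∀ i, s n y i = divTen G δ (s (n + 1)) y i)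
    (hs2 : ∀ n, n + 2 ≤ k → ∀ y ∈ Ω, ∀ i, s n y i = divTen G δ (s (n + 1)) y i +
      ((m * gam m δ (2 * k - 2) - k + (n + 2 : ℕ)) * (k - (n + 2 : ℕ) + 1)) *
        ∑ a, ∑ b, rTen G a b y * s (n + 2) y (Fin.cons a (Fin.cons b i)))
    (ht0 : ∀ y ∈ Ω, t 0 y = f 0 y)
    (ht1 : 1 ≤ k → ∀ y ∈ Ω, ∀ c j, t 1 y (Fin.cons c j) = nablaCo G lam (t 0) c y j)
    (ht2 : ∀ n, n + 2 ≤ k → ∀ y ∈ Ω, ∀ T ∈ stf (G y) (n + 2),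
      ∑ c, ∑ j, T (Fin.cons c j) * t (n + 2) y (Fin.cons c j)
        = ∑ c, ∑ j, T (Fin.cons c j) * nablaCo G lam (t (n + 1)) c y j
          + (-lam * m - n) * (n + 1) *
            ∑ j, (∑ a, ∑ b, rTen G a b y * T (Fin.cons a (Fin.cons b j))) * t n y j)
    {y : Euc m} (hy : y ∈ Ω) :
    formula G B lam δ k S f y
      = ∑ l ∈ Finset.range (k + 1), coeffC m lam δ k l *
          ∑ i, s (k - l) y i * t (k - l) y i := by
  obtain ⟨W, U, sW, sU, hWk, hWz, hW, hU0, hU, hform⟩ :=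
    hG.exists_factors hB lam δ hS hf hSk hf0
  rw [hform]
  -- On the contravariant side the recursion holds exactly, so the two families coincide, by descent
  -- from degree `k`.
  have hsW : ∀ l, l ≤ k → ∀ z ∈ Ω, s (k - l) z = W (k - l) z := by
    have hdiv : ∀ n, (∀ z ∈ Ω, s n z = W n z) → ∀ n', n' + 1 = n → ∀ z ∈ Ω, ∀ i,
        divTen G δ (s (n' + 1)) z i = divTen G δ (W (n' + 1)) z i := by
      rintro _ h n' rfl z hz i
      refine Finset.sum_congr rfl fun c _ => ?_
      rw [nablaContra_eq, nablaContra_eq, h z hz,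
        pd_congr hG.isOpen (fun z hz => by rw [h z hz]) hz c]
    intro l
    induction l using Nat.strong_induction_on with
    | _ l ih =>
      intro hl z hz
      rcases Nat.eq_zero_or_pos l with rfl | hl0
      · rw [Nat.sub_zero, hsk z hz, hWk z hz]
      have ih1 := ih (l - 1) (by omega) (by omega)
      rw [show k - (l - 1) = k - l + 1 by omega] at ih1
      funext i
      rw [hW (k - l) (by omega) z hz]
      rcases Nat.lt_or_ge l 2 with h2 | h2
      -- Just below the top the term with `T₂` would involve degree `k + 1`, where `W` vanishes.
      · rw [hs1 (k - l) (by omega) z hz i, hdiv _ ih1 _ rfl z hz i]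
        simp [opDiv_apply, opT2, contr2, hWz (k - l + 2) (by omega)]
      · have ih2 := ih (l - 2) (by omega) (by omega)
        rw [show k - (l - 2) = k - l + 2 by omega] at ih2
        rw [hs2 (k - l) (by omega) z hz i, hdiv _ ih1 _ rfl z hz i, ih2 z hz]
        simp only [Pi.add_apply, opDiv_apply, opT2, contr2, Pi.smul_apply, smul_eq_mul,
          Finset.mul_sum]
        congr 1
        refine Finset.sum_congr rfl fun a _ => Finset.sum_congr rfl fun b _ => ?_
        ring
  have hsym : ∀ {n : ℕ} {z : Euc m} {T : Ten m n}, T ∈ stf (G z) n → IsSym T := fun h => h.1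
  -- On the covariant side only pairings agree. The claim is about all smooth trace-free test
  -- fields, not test tensors at one point, so that the induction can differentiate it.
  have key : ∀ n ≤ k, ∀ T : Euc m → Ten m n, SmoothTen Ω T → (∀ z ∈ Ω, T z ∈ stf (G z) n) →
      ∀ z ∈ Ω, ∑ j, T z j * t n z j = ∑ j, T z j * U n z j := by
    intro n
    induction n using Nat.strong_induction_on with
    | _ n ih =>
      intro hn T hT hTs z hz
      match n, ih, hn, T, hT, hTs with
      | 0, _, _, T, _, _ => rw [ht0 z hz, hU0 z hz]
      | 1, ih, hn, T, hT, hTs =>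
        have e : ∀ j, U 1 z j = nablaS G lam U 1 z j := fun j => by
          rw [hU 0 (by omega) z hz]; simp [opT1, vee2]
        simp only [e]
        rw [sum_mul_nablaS (hsym (hTs z hz)), sum_cons]
        simp only [ht1 hn z hz]
        exact hG.sum_nablaCo_congr (ht 0) (sU 0) (ih 0 (by omega) (by omega)) hT hTs hz
      | n + 2, ih, hn, T, hT, hTs =>
        rw [sum_cons, ht2 n hn z hz _ (hTs z hz),
          hG.sum_nablaCo_congr (ht (n + 1)) (sU (n + 1)) (ih (n + 1) (by omega) (by omega)) hT hTs
            hz]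
        simp only [hU (n + 1) (by omega) z hz, Pi.add_apply, mul_add, Finset.sum_add_distrib]
        rw [sum_mul_nablaS (hsym (hTs z hz)), sum_mul_opT1 (hsym (hTs z hz))]
        simp only [hBr z hz n _ (hTs z hz)]
        have h := ih n (by omega) (by omega) (fun z j => ∑ a, ∑ b, rTen G a b z *
          T z (Fin.cons a (Fin.cons b j)))
          (fun j => ContDiffOn.sum fun a _ => ContDiffOn.sum fun b _ =>
            (hG.rTen_smooth a b).mul (hT _))
          (fun z hz => sum_sum_cons_mem_stf (hTs z hz) _) z hz
        rw [h]
        ring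
  refine Finset.sum_congr rfl fun l hl => ?_
  rw [Finset.mem_range] at hl
  rw [← hsW l (by omega) y hy, key (k - l) (by omega) (s (k - l)) (hs _) (hst _ (by omega)) y hy]

/-- The two tensors differ by a multiple of `G`, whose contraction with a trace-free tensor is zero.
-/
theorem defTen_contract {y : Euc m} {T : Ten m (n + 2)} (hT : T ∈ stf (G y) (n + 2))
    (j : Fin n → Fin m) : ∑ a, ∑ b, defTen G a b y * T (Fin.cons a (Fin.cons b j))
        = ∑ a, ∑ b, rTen G a b y * T (Fin.cons a (Fin.cons b j)) := by
  have h := stf_trace hT j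
  have e : ∀ a b, defTen G a b y = rTen G a b y
      + (scal G y / (2 * ((m : ℝ) - 1)) / ((m : ℝ) - 2)) * G y a b := by
    intro a b
    rw [defTen, rTen, show (2 - m : ℝ) = -((m : ℝ) - 2) by ring, div_neg]
    ring
  simp only [e, add_mul, Finset.sum_add_distrib, mul_assoc, ← Finset.mul_sum, h, mul_zero,
    add_zero]

end ChartFormula

/-! ### The explicit formulas of orders two and three -/

section LowOrder

variable {m : ℕ} {n k : ℕ} {G : Euc m → Matrix (Fin m) (Fin m) ℝ} {Ω : Set (Euc m)}
  {B : Fin m → Fin m → Euc m → ℝ} {lam δ : ℝ}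

theorem nablaCo_congr (hΩ : IsOpen Ω) {t u : Euc m → Ten m n} (h : ∀ z ∈ Ω, t z = u z) {y : Euc m}
    (hy : y ∈ Ω) (c : Fin m) (i : Fin n → Fin m) :
    nablaCo G lam t c y i = nablaCo G lam u c y i := by
  rw [nablaCo_eq, nablaCo_eq, h y hy, pd_congr hΩ (fun z hz => by rw [h z hz]) hy c]

theorem nablaContra_congr (hΩ : IsOpen Ω) {t u : Euc m → Ten m n} (h : ∀ z ∈ Ω, t z = u z)
    {y : Euc m} (hy : y ∈ Ω) (c : Fin m) (i : Fin n → Fin m) :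
    nablaContra G δ t c y i = nablaContra G δ u c y i := by
  rw [nablaContra_eq, nablaContra_eq, h y hy, pd_congr hΩ (fun z hz => by rw [h z hz]) hy c]

theorem nablaS_congr (hΩ : IsOpen Ω) {t u : GField m} (h : ∀ z ∈ Ω, t n z = u n z) {y : Euc m}
    (hy : y ∈ Ω) : nablaS G lam t (n + 1) y = nablaS G lam u (n + 1) y := by
  simp only [nablaS_succ, nablaCo_congr hΩ h hy]

theorem opDiv_congr (hΩ : IsOpen Ω) {t u : GField m} (h : ∀ z ∈ Ω, t (n + 1) z = u (n + 1) z)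
    {y : Euc m} (hy : y ∈ Ω) : opDiv G δ t n y = opDiv G δ u n y := by
  funext i
  simp only [opDiv, nablaContra_congr hΩ h hy]

theorem IsMetricOn.nablaCo_add (hG : IsMetricOn G Ω) {t u : Euc m → Ten m n}
    (ht : SmoothTen Ω t) (hu : SmoothTen Ω u) (c : Fin m) {y : Euc m} (hy : y ∈ Ω)
    (i : Fin n → Fin m) :
    nablaCo G lam (fun z => t z + u z) c y i = nablaCo G lam t c y i + nablaCo G lam u c y i := by
  simp only [nablaCo_eq, Pi.add_apply]
  rw [pd_add (ht.diffAt hG.isOpen hy i) (hu.diffAt hG.isOpen hy i)]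
  simp only [der, Pi.add_apply, mul_add, Finset.sum_add_distrib]
  ring

theorem IsMetricOn.nablaContra_add (hG : IsMetricOn G Ω) {t u : Euc m → Ten m n}
    (ht : SmoothTen Ω t) (hu : SmoothTen Ω u) (c : Fin m) {y : Euc m} (hy : y ∈ Ω)
    (i : Fin n → Fin m) : nablaContra G δ (fun z => t z + u z) c y i
      = nablaContra G δ t c y i + nablaContra G δ u c y i := by
  simp only [nablaContra_eq, Pi.add_apply]
  rw [pd_add (ht.diffAt hG.isOpen hy i) (hu.diffAt hG.isOpen hy i)]
  simp only [der, Pi.add_apply, mul_add, Finset.sum_add_distrib]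
  ring

theorem symmetrize_smul (a : ℝ) (t : Ten m n) : symmetrize (fun i => a * t i)
    = fun i => a * symmetrize t i := by
  funext i; simp only [symmetrize, ← Finset.mul_sum]; ring

theorem isSym_cons {T : Ten m (n + 1)} (hT : IsSym T) (c : Fin m) :
    IsSym fun i => T (Fin.cons c i) := fun s i => by
  simp only [cons_comp_cons]; exact hT _ _

theorem isSym_divTen (hΩ : IsOpen Ω) {T : Euc m → Ten m (n + 1)} (hT : ∀ y ∈ Ω, IsSym (T y))
    {y : Euc m} (hy : y ∈ Ω) : IsSym (divTen G δ T y) := by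
  intro s i
  refine Finset.sum_congr rfl fun c _ => ?_
  rw [cons_comp_cons, nablaContra_eq, nablaContra_eq, der_mem_sym (hT y hy), hT y hy,
    pd_congr hΩ (fun z hz => hT z hz _ _) hy]

/-- Integration by parts again: against a symmetric field the symmetrization may be dropped even
under a derivative. -/
theorem IsMetricOn.sum_nablaCo_symmetrize (hG : IsMetricOn G Ω) {T : Euc m → Ten m (n + 1)}
    (hT : SmoothTen Ω T) (hs : ∀ y ∈ Ω, IsSym (T y)) {t : Euc m → Ten m n} (ht : SmoothTen Ω t)
    {y : Euc m} (hy : y ∈ Ω) :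
    ∑ c, ∑ j, T y (Fin.cons c j) * nablaCo G lam (fun z => symmetrize (t z)) c y j
      = ∑ c, ∑ j, T y (Fin.cons c j) * nablaCo G lam t c y j := by
  rw [hG.sum_mul_nablaCo lam hT ht hy, hG.sum_mul_nablaCo lam hT (smoothTen_symmetrize ht) hy]
  congr 1
  · refine Finset.sum_congr rfl fun c _ => pd_congr hG.isOpen (fun z hz => ?_) hy c
    exact sum_mul_symmetrize (S := fun j => T z (Fin.cons c j)) (isSym_cons (hs z hz) c) _
  · exact sum_mul_symmetrize (isSym_divTen hG.isOpen hs hy) _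

theorem sum_fin_zero (F : (Fin 0 → Fin m) → ℝ) : ∑ i, F i = F Fin.elim0 := by
  rw [Fintype.sum_unique]; exact congrArg F (Subsingleton.elim _ _)

theorem opT1_one (t : GField m) (y : Euc m) : opT1 B lam t 1 y = 0 := rfl

/-- The recursions are unrolled with `T₁ = -λm r ∨ ·` in degree `0` and `T₂ = m γ_2 i(r)` in degree
`2`. With `r` in place of `Γ` this is an identity for every `S` of degree `2`, trace-free or not. -/
theorem IsMetricOn.formula_two (hG : IsMetricOn G Ω) (lam δ : ℝ) {S f : GField m}
    (hS : SmoothG Ω S) (hf : SmoothG Ω f) (hSk : ∀ n, n ≠ 2 → S n = 0)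
    (hf0 : ∀ n, n ≠ 0 → f n = 0) {y : Euc m} (hy : y ∈ Ω) :
    formula G (rTen G) lam δ 2 S f y = formula2 G lam δ S f y := by
  obtain ⟨W, U, sW, sU, hWk, hWz, hW, hU0, hU, hform⟩ :=
    hG.exists_factors hG.rTen_smooth lam δ hS hf hSk hf0
  have u1 : ∀ z ∈ Ω, U 1 z = nablaS G lam f 1 z := fun z hz => by
    rw [hU 0 (by omega) z hz, opT1_one, add_zero, nablaS_congr hG.isOpen hU0 hz]
  have u2 : U 2 y = (nablaS G lam (nablaS G lam f) - (m * lam) • vee2 (rTen G) f) 2 y := by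
    rw [hU 1 (by omega) y hy, nablaS_congr hG.isOpen u1 hy, opT1_succ_succ]
    funext i
    have := congrFun (symmetrize_smul (-(m * lam)) fun i : Fin 2 → Fin m =>
      rTen G (i 0) (i 1) y * f 0 y (Fin.tail (Fin.tail i))) i
    simp only [Pi.add_apply, Pi.sub_apply, Pi.smul_apply, smul_eq_mul, vee2, hU0 y hy]
    rw [sub_eq_add_neg (nablaS G lam (nablaS G lam f) 2 y i), ← neg_mul, ← this]
    congr 2
    funext i
    push_cast; ring
  have w1 : ∀ z ∈ Ω, W 1 z = opDiv G δ S 1 z := fun z hz => by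
    rw [hW 1 (by omega) z hz, opDiv_congr hG.isOpen hWk hz]
    have : opT2 G δ 2 W 1 z = 0 := by
      funext i; simp [opT2, contr2, hWz 3 (by omega)]
    rw [this, add_zero]
  have w0 : W 0 y = (opDiv G δ (opDiv G δ S) + (m * gam m δ 2) • contr2 (rTen G) S) 0 y := by
    rw [hW 0 (by omega) y hy, opDiv_congr hG.isOpen w1 hy]
    funext i
    simp only [Pi.add_apply, opT2, contr2, Pi.smul_apply, smul_eq_mul, hWk y hy, Finset.mul_sum]
    congr 1
    refine Finset.sum_congr rfl fun a _ => Finset.sum_congr rfl fun b _ => ?_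
    rw [show (2 * ((2 : ℕ) : ℤ) - 2) = 2 by norm_num]
    push_cast; ring
  rw [hform, Finset.sum_range_succ, Finset.sum_range_succ, Finset.sum_range_one]
  simp only [coeffC_zero, one_mul, Nat.sub_zero,
    hWk y hy, u1 y hy, u2, w1 y hy, w0, hU0 y hy]
  rfl

/-- For `G = 0` the trace condition is void, so the lemmas on `stf` also cover plain symmetric
tensors. -/
theorem IsSym.mem_stf {T : Ten m n} (hT : IsSym T) : T ∈ stf 0 n :=
  ⟨hT, fun a b _ idx => by simp⟩

theorem IsSym.rotate {T : Ten m (n + 3)} (hT : IsSym T) (a b c : Fin m) (i : Fin n → Fin m) :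
    T (Fin.cons a (Fin.cons b (Fin.cons c i))) = T (Fin.cons c (Fin.cons a (Fin.cons b i))) := by
  rw [stf_swap hT.mem_stf c a]
  exact stf_swap (stf_cons hT.mem_stf a) b c _

theorem sum_fin_one (F : (Fin 1 → Fin m) → ℝ) : ∑ i, F i = ∑ c, F (Fin.cons c Fin.elim0) := by
  rw [sum_cons]; simp only [sum_fin_zero]

/-- The product rule for the divergence of `i(r) S`, for a symmetric symbol of degree `3`. -/
theorem IsMetricOn.divTen_contr_three (hG : IsMetricOn G Ω) (δ : ℝ) {S : Euc m → Ten m 3}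
    (hS : SmoothTen Ω S) {r : Euc m → Ten m 2} (hr : SmoothTen Ω r)
    {y : Euc m} (hy : y ∈ Ω) :
    divTen G δ (fun z (i : Fin 1 → Fin m) => ∑ j, r z j * S z (Fin.cons (i 0) j)) y Fin.elim0
      = ∑ j, r y j * divTen G δ S y j
        + ∑ c, ∑ j, S y (Fin.cons c j) * nablaCo G 0 r c y j := by
  simp only [divTen, nablaContra_eq, nablaCo_eq, der_cons]
  have e1 : ∀ c : Fin m, pd c (fun z => ∑ j, r z j * S z (Fin.cons c j)) y
      = ∑ j, pd c (fun z => r z j) y * S y (Fin.cons c j)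
        + ∑ j, r y j * pd c (fun z => S z (Fin.cons c j)) y := by
    intro c
    rw [pd_sum (f := fun j z => r z j * S z (Fin.cons c j))
      fun j _ => (hr.diffAt hG.isOpen hy _).mul (hS.diffAt hG.isOpen hy _),
      ← Finset.sum_add_distrib]
    exact Finset.sum_congr rfl fun j _ => pd_mul (hr.diffAt hG.isOpen hy _)
      (hS.diffAt hG.isOpen hy _) c
  have e2 : ∀ c, ∑ j, S y (Fin.cons c j) * der (chrMat G c y).transpose (r y) j
      = ∑ j, der (chrMat G c y) (fun j => S y (Fin.cons c j)) j * r y j := fun c => by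
    rw [sum_mul_der]; rfl
  have e3 : ∀ (c : Fin m) (t : Ten m 0) (i : Fin 0 → Fin m), der (chrMat G c y) t i = 0 :=
    fun c t i => by simp [der]
  simp only [Fin.cons_zero, e1, e3, mul_sub, mul_add,
    Finset.sum_sub_distrib, Finset.sum_add_distrib, e2]
  simp only [Finset.mul_sum]
  have c1 : ∀ F : (Fin 2 → Fin m) → Fin m → ℝ, ∑ j, ∑ c, F j c = ∑ c, ∑ j, F j c :=
    fun F => Finset.sum_comm
  simp only [c1]
  have c2 : ∀ c : Fin m, ∑ j : Fin m, ∑ i, chrMat G c y c j * (r y i * S y (Fin.cons j i))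
      = ∑ i, ∑ j : Fin m, r y i * (chrMat G c y c j * S y (Fin.cons j i)) := fun c => by
    rw [Finset.sum_comm]
    exact Finset.sum_congr rfl fun i _ => Finset.sum_congr rfl fun j _ => by ring
  simp only [c2]
  have c3 : ∀ c : Fin m, ∑ i, ∑ j : Fin m, r y i * (chrMat G c y c j * S y (Fin.cons j i))
      = ∑ j : Fin m, ∑ i, r y i * (chrMat G c y c j * S y (Fin.cons j i)) := fun c =>
    Finset.sum_comm
  simp only [c3]
  simp only [← Finset.sum_add_distrib, ← Finset.sum_sub_distrib]
  refine Finset.sum_congr rfl fun c _ => ?_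
  simp only [zero_mul, mul_zero, sub_zero, add_zero, Finset.sum_add_distrib,
    Finset.sum_sub_distrib]
  have e4 : ∑ i, der (chrMat G c y) (fun j => S y (Fin.cons c j)) i * r y i
      = ∑ i, r y i * der (chrMat G c y) (fun j => S y (Fin.cons c j)) i :=
    Finset.sum_congr rfl fun i _ => mul_comm _ _
  have e5 : ∑ i, pd c (fun z => r z i) y * S y (Fin.cons c i)
      = ∑ i, S y (Fin.cons c i) * pd c (fun z => r z i) y :=
    Finset.sum_congr rfl fun i _ => mul_comm _ _
  have e6 : ∑ i, δ * (chrMat G c y).trace * (r y i * S y (Fin.cons c i))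
      = ∑ i, r y i * (δ * (chrMat G c y).trace * S y (Fin.cons c i)) :=
    Finset.sum_congr rfl fun i _ => by ring
  rw [e4, e5, e6]
  ring

/-- The product rule creates the terms in `∇_s r`. The coefficient of `r ∨ ∇_s f` is `-λm` from
differentiating `r f` plus `2(-λm-1)` from `T₁` in degree `1`. That of `i(r) Div S` is `m γ_4` from
the divergence of `i(r) S` plus `2(m γ_4 - 1)` from `T₂` in degree `2`. -/
theorem IsMetricOn.formula_three (hG : IsMetricOn G Ω) (lam δ : ℝ) {S f : GField m}
    (hS : SmoothG Ω S) (hf : SmoothG Ω f) (hSk : ∀ n, n ≠ 3 → S n = 0)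
    (hSs : ∀ y ∈ Ω, IsSym (S 3 y))
    (hf0 : ∀ n, n ≠ 0 → f n = 0) {y : Euc m} (hy : y ∈ Ω) :
    formula G (rTen G) lam δ 3 S f y = formula3 G lam δ S f y := by
  obtain ⟨W, U, sW, sU, hWk, hWz, hW, hU0, hU, hform⟩ :=
    hG.exists_factors hG.rTen_smooth lam δ hS hf hSk hf0
  have hr := hG.rTen_smooth
  set rf : Euc m → Ten m 2 := fun z i => rTen G (i 0) (i 1) z * f 0 z Fin.elim0 with hrf
  set rT : Euc m → Ten m 2 := fun z i => rTen G (i 0) (i 1) z with hrT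
  have srT : SmoothTen Ω rT := fun i => hr _ _
  have srf : SmoothTen Ω rf := fun i => (hr _ _).mul (hf 0 _)
  have u1 : ∀ z ∈ Ω, U 1 z = nablaS G lam f 1 z := fun z hz => by
    rw [hU 0 (by omega) z hz, opT1_one, add_zero, nablaS_congr hG.isOpen hU0 hz]
  have hel : ∀ (z : Euc m) (i : Fin 0 → Fin m), f 0 z i = f 0 z Fin.elim0 := fun z i =>
    congrArg _ (Subsingleton.elim _ _)
  have u2 : ∀ z ∈ Ω, U 2 z = nablaS G lam (nablaS G lam f) 2 z
      + symmetrize (fun i => -(m * lam) * rf z i) := by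
    intro z hz
    rw [hU 1 (by omega) z hz, nablaS_congr hG.isOpen u1 hz, opT1_succ_succ]
    congr 2
    funext i
    rw [hU0 z hz, hel z (Fin.tail (Fin.tail i))]
    simp only [hrf]
    push_cast
    ring
  have u2' : U 2 y = (nablaS G lam (nablaS G lam f) - (m * lam) • vee2 (rTen G) f) 2 y := by
    rw [u2 y hy]
    funext i
    rw [symmetrize_smul]
    simp only [Pi.add_apply, Pi.sub_apply, Pi.smul_apply, smul_eq_mul, vee2, hrf, hel]
    ring
  have s2 : SmoothTen Ω (nablaS G lam (nablaS G lam f) 2) :=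
    hG.smooth_nablaS lam (hG.smooth_nablaS lam hf) 2
  have srf' : SmoothTen Ω fun z i => -(m * lam) * rf z i := fun i => contDiffOn_const.mul (srf i)
  -- Leibniz rule with the weights split: `r` carries weight `0` and the density all of `lam`.
  have prod : ∀ (c : Fin m) (j : Fin 2 → Fin m), nablaCo G lam (fun z i => -(m * lam) * rf z i) c y j
      = -(m * lam) * (nablaCo G 0 rT c y j * f 0 y Fin.elim0
        + rT y j * nablaCo G lam (f 0) c y Fin.elim0) := by
    intro c j
    simp only [nablaCo_eq]
    have hd := (srT.diffAt hG.isOpen hy j).mul ((hf 0).diffAt hG.isOpen hy Fin.elim0)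
    have e0 : pd c (fun z => -(m * lam) * rf z j) y = -(m * lam) *
        (pd c (fun z => rT z j) y * f 0 y Fin.elim0 + rT y j * pd c (fun z => f 0 z Fin.elim0) y) := by
      rw [← pd_mul (srT.diffAt hG.isOpen hy j) ((hf 0).diffAt hG.isOpen hy Fin.elim0)]
      exact pd_const_mul hd _ _
    have e1 : der (chrMat G c y).transpose (f 0 y) Fin.elim0 = 0 := by simp [der]
    have e2 : der (chrMat G c y).transpose (fun i => -(m * lam) * rf y i) j
        = -(m * lam) * (der (chrMat G c y).transpose (rT y) j * f 0 y Fin.elim0) := by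
      simp only [der, hrf, hrT, Finset.mul_sum, Finset.sum_mul]
      exact Finset.sum_congr rfl fun _ _ => Finset.sum_congr rfl fun _ _ => by ring
    rw [e0, e1, e2]
    simp only [hrf, hrT]
    ring
  have hS3 := hSs y hy
  have su1 : ∀ (i : Fin 1 → Fin m), nablaS G lam f 1 y i = nablaCo G lam (f 0) (i 0) y Fin.elim0 := by
    intro i
    have e0 : ∀ i : Fin 1 → Fin m, nablaCo G lam (f 0) (i 0) y (Fin.tail i)
      = nablaCo G lam (f 0) (i 0) y Fin.elim0 := fun i => congrArg _ (Subsingleton.elim _ _)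
    rw [nablaS_succ]
    simp only [symmetrize, e0]
    simp
  have hR : ∑ j, (∑ a, ∑ b, rTen G a b y * S 3 y (Fin.cons a (Fin.cons b j))) * nablaS G lam f 1 y j
      = ∑ c, ∑ j, S 3 y (Fin.cons c j) * (rT y j * nablaCo G lam (f 0) c y Fin.elim0) := by
    rw [sum_fin_one]
    refine Finset.sum_congr rfl fun c _ => ?_
    rw [sum_cons, Finset.sum_mul]
    refine Finset.sum_congr rfl fun a _ => ?_
    rw [sum_fin_one, Finset.sum_mul]
    refine Finset.sum_congr rfl fun b _ => ?_
    rw [su1, hS3.rotate a b c]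
    simp [hrT]; ring
  have e2 : ∑ i, S 3 y i * nablaR G 3 y i
      = ∑ c, ∑ j, S 3 y (Fin.cons c j) * nablaCo G 0 rT c y j := by
    unfold nablaR
    rw [sum_mul_nablaS hS3]
    refine Finset.sum_congr rfl fun c _ => Finset.sum_congr rfl fun j _ => ?_
    congr 2
  have e3 : ∑ i, S 3 y i * vee2 (rTen G) (nablaS G lam f) 3 y i
      = ∑ c, ∑ j, S 3 y (Fin.cons c j) * (rT y j * nablaCo G lam (f 0) c y Fin.elim0) := by
    have hv : vee2 (rTen G) (nablaS G lam f) 3 y = symmetrize fun i =>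
      rTen G (i 0) (i 1) y * nablaS G lam f 1 y (Fin.tail (Fin.tail i)) := rfl
    rw [← hR, hv, sum_mul_symmetrize hS3, sum_cons]
    simp only [Finset.sum_mul]
    conv_rhs => rw [Finset.sum_comm]
    refine Finset.sum_congr rfl fun a _ => ?_
    rw [sum_cons]
    conv_rhs => rw [Finset.sum_comm]
    refine Finset.sum_congr rfl fun j _ => Finset.sum_congr rfl fun b _ => ?_
    simp; ring
  have top : ∑ i, S 3 y i * U 3 y i = ∑ i, S 3 y i * nablaS G lam (nablaS G lam (nablaS G lam f)) 3 y i
      - (3 * m * lam + 2) * ∑ i, S 3 y i * vee2 (rTen G) (nablaS G lam f) 3 y i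
      - lam * m * (∑ i, S 3 y i * nablaR G 3 y i * f 0 y Fin.elim0) := by
    rw [hU 2 (by omega) y hy, ← Finset.sum_mul, e2, e3]
    simp only [Pi.add_apply, mul_add, Finset.sum_add_distrib]
    rw [sum_mul_nablaS hS3, sum_mul_nablaS hS3, sum_mul_opT1 hS3]
    have e1 : ∑ c, ∑ j, S 3 y (Fin.cons c j) * nablaCo G lam (U 2) c y j
        = ∑ c, ∑ j, S 3 y (Fin.cons c j) * nablaCo G lam (nablaS G lam (nablaS G lam f) 2) c y j
          + ∑ c, ∑ j, S 3 y (Fin.cons c j) *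
            nablaCo G lam (fun z i => -(m * lam) * rf z i) c y j := by
      rw [← hG.sum_nablaCo_symmetrize (hS 3) hSs srf' hy, ← Finset.sum_add_distrib]
      refine Finset.sum_congr rfl fun c _ => ?_
      rw [← Finset.sum_add_distrib]
      refine Finset.sum_congr rfl fun j _ => ?_
      rw [nablaCo_congr hG.isOpen u2 hy, hG.nablaCo_add s2 (smoothTen_symmetrize srf') c hy]
      ring
    rw [e1, u1 y hy, hR]
    have e4 : ∑ c, ∑ j, S 3 y (Fin.cons c j) * nablaCo G lam (fun z i => -(m * lam) * rf z i) c y j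
        = -(m * lam) * ((∑ c, ∑ j, S 3 y (Fin.cons c j) * nablaCo G 0 rT c y j) * f 0 y Fin.elim0
          + ∑ c, ∑ j, S 3 y (Fin.cons c j) * (rT y j * nablaCo G lam (f 0) c y Fin.elim0)) := by
      simp only [prod, Finset.mul_sum, Finset.sum_mul, ← Finset.sum_add_distrib]
      exact Finset.sum_congr rfl fun c _ => Finset.sum_congr rfl fun j _ => by ring
    rw [e4]
    push_cast
    ring
  have w2 : ∀ z ∈ Ω, W 2 z = opDiv G δ S 2 z := fun z hz => by
    rw [hW 2 (by omega) z hz, opDiv_congr hG.isOpen hWk hz]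
    have : opT2 G δ 3 W 2 z = 0 := by
      funext i; simp [opT2, contr2, hWz 4 (by omega)]
    rw [this, add_zero]
  -- The free index is put first, so that the product rule for the divergence of `i(r) S` applies;
  -- symmetry of `S` permits it.
  set rS : Euc m → Ten m 1 := fun z i => ∑ j, rT z j * S 3 z (Fin.cons (i 0) j) with hrS
  have srS : SmoothTen Ω rS := fun i => ContDiffOn.sum fun j _ => (srT j).mul (hS 3 _)
  have hrS' : ∀ z ∈ Ω, contr2 (rTen G) S 1 z = rS z := by
    intro z hz
    funext i
    simp only [contr2, hrS, hrT]
    rw [sum_cons]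
    refine Finset.sum_congr rfl fun a _ => ?_
    rw [sum_fin_one]
    refine Finset.sum_congr rfl fun b _ => ?_
    have : i = Fin.cons (i 0) Fin.elim0 := by
      funext x; rw [Subsingleton.elim x 0]; rfl
    conv_lhs => rw [this, (hSs z hz).rotate a b (i 0)]
    simp
  have hg4 : (2 * ((3 : ℕ) : ℤ) - 2) = 4 := by norm_num
  have w1 : ∀ z ∈ Ω, W 1 z = opDiv G δ (opDiv G δ S) 1 z + fun i => (m * gam m δ 4) * rS z i := by
    intro z hz
    rw [hW 1 (by omega) z hz, opDiv_congr hG.isOpen w2 hz]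
    congr 1
    funext i
    rw [← hrS' z hz]
    simp only [opT2, contr2, Pi.smul_apply, smul_eq_mul, hWk z hz, Finset.mul_sum, hg4]
    refine Finset.sum_congr rfl fun a _ => Finset.sum_congr rfl fun b _ => ?_
    push_cast; ring
  have w1' : W 1 y = (opDiv G δ (opDiv G δ S) + (m * gam m δ 4) • contr2 (rTen G) S) 1 y := by
    rw [w1 y hy]
    funext i
    simp only [Pi.add_apply, Pi.smul_apply, smul_eq_mul, hrS' y hy]
  have w0 : W 0 y Fin.elim0 = (opDiv G δ (opDiv G δ (opDiv G δ S))
      + (3 * gam m δ 4 * m - 2) • contr2 (rTen G) (opDiv G δ S)) 0 y Fin.elim0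
      + m * gam m δ 4 * ∑ i, S 3 y i * nablaR G 3 y i := by
    rw [hW 0 (by omega) y hy, e2]
    have d1 : opDiv G δ W 0 y Fin.elim0 = opDiv G δ (opDiv G δ (opDiv G δ S)) 0 y Fin.elim0
        + m * gam m δ 4 * divTen G δ rS y Fin.elim0 := by
      rw [opDiv_apply, opDiv_apply]
      simp only [divTen, Finset.mul_sum]
      rw [← Finset.sum_add_distrib]
      refine Finset.sum_congr rfl fun c _ => ?_
      rw [nablaContra_congr hG.isOpen w1 hy, hG.nablaContra_add
        (hG.smooth_opDiv δ (hG.smooth_opDiv δ hS) 1) (fun i => contDiffOn_const.mul (srS i)) c hy]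
      congr 1
      simp only [nablaContra_eq]
      rw [pd_const_mul (srS.diffAt hG.isOpen hy _)]
      simp only [der, mul_add, mul_sub, Finset.mul_sum]
      congr 1
      · congr 1
        exact Finset.sum_congr rfl fun _ _ => Finset.sum_congr rfl fun _ _ => by ring
      · ring
    have d2 := hG.divTen_contr_three δ (hS 3) srT hy
    have d3 : contr2 (rTen G) (opDiv G δ S) 0 y Fin.elim0
        = ∑ j, rT y j * divTen G δ (S 3) y j := by
      simp only [contr2, opDiv_apply, hrT]
      rw [sum_cons]
      refine Finset.sum_congr rfl fun a _ => ?_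
      rw [sum_fin_one]
      exact Finset.sum_congr rfl fun b _ => by simp
    have d4 : opT2 G δ 3 W 0 y Fin.elim0
        = ((m * gam m δ 4 - 1) * 2) * contr2 (rTen G) (opDiv G δ S) 0 y Fin.elim0 := by
      simp only [opT2, contr2, Pi.smul_apply, smul_eq_mul, w2 y hy, Finset.mul_sum, hg4]
      refine Finset.sum_congr rfl fun a _ => Finset.sum_congr rfl fun b _ => ?_
      push_cast; ring
    simp only [Pi.add_apply, Pi.smul_apply, smul_eq_mul]
    rw [d1, d4, d3, d2]
    ring
  rw [hform, Finset.sum_range_succ, Finset.sum_range_succ, Finset.sum_range_succ,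
    Finset.sum_range_one]
  have t0 : ∑ i, W (3 - 3) y i * U (3 - 3) y i = W 0 y Fin.elim0 * f 0 y Fin.elim0 := by
    rw [Nat.sub_self, sum_fin_zero (fun i : Fin 0 → Fin m => W 0 y i * U 0 y i), hU0 y hy]
  rw [t0, w0]
  simp only [coeffC_zero, one_mul, Nat.sub_zero, hWk y hy, top]
  unfold formula3
  simp only [pair, sum_fin_zero, u2', w2 y hy,
    w1', u1 y hy]
  simp only [Pi.sub_apply, Pi.smul_apply, smul_eq_mul, mul_sub, Finset.sum_sub_distrib,
    ← Finset.sum_mul, mul_left_comm (S 3 y _), ← Finset.mul_sum]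
  ring

end LowOrder

/-! ### The derivations `L_{ω⁻¹(X)}` on functions on `P` -/

section Derivations

variable {m p : ℕ} {M : Type*} [TopologicalSpace M] [ChartedSpace (Euc m) M]
  {F : Type*} [NormedAddCommGroup F] [NormedSpace ℝ F]
  {P : Type*} [TopologicalSpace P] [ChartedSpace F P] [IsManifold 𝓘(ℝ, F) ∞ P]
  (C : CartanGeometry m p M F P) {O : Set P} {Φ Ψ : P → ℝ} {u : P} {X Y : soAlg m p}

/-- `Φ` is smooth on the open set `O`. -/
structure CartanGeometry.Sm (_C : CartanGeometry m p M F P) (O : Set P) (Φ : P → ℝ) : Prop where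
  isOpen : IsOpen O
  smooth : ContMDiffOn 𝓘(ℝ, F) 𝓘(ℝ, ℝ) ∞ Φ O

/-- The derivative `L_{ω⁻¹(X)} Φ`. -/
def CartanGeometry.L (C : CartanGeometry m p M F P) (X : soAlg m p) (Φ : P → ℝ) (u : P) : ℝ :=
  mfderiv 𝓘(ℝ, F) 𝓘(ℝ, ℝ) Φ u (C.vf X u)

theorem CartanGeometry.lieD_eq (a : Fin m) : C.lieD a Φ = C.L (eVec a) Φ := rfl

variable {C}

theorem CartanGeometry.Sm.contMDiffAt (h : C.Sm O Φ) (hu : u ∈ O) :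
    ContMDiffAt 𝓘(ℝ, F) 𝓘(ℝ, ℝ) ∞ Φ u := h.smooth.contMDiffAt (h.isOpen.mem_nhds hu)

theorem CartanGeometry.Sm.mdiffAt (h : C.Sm O Φ) (hu : u ∈ O) :
    MDifferentiableAt 𝓘(ℝ, F) 𝓘(ℝ, ℝ) Φ u := (h.contMDiffAt hu).mdifferentiableAt (by simp)

theorem CartanGeometry.Sm.mono {O' : Set P} (h : C.Sm O Φ) (hO : IsOpen O') (hs : O' ⊆ O) :
    C.Sm O' Φ := ⟨hO, h.smooth.mono hs⟩

theorem CartanGeometry.Sm.congr (h : C.Sm O Φ) (he : ∀ v ∈ O, Ψ v = Φ v) : C.Sm O Ψ :=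
  ⟨h.isOpen, h.smooth.congr he⟩

/-- Smooth functions compose with smooth functions of several variables. -/
theorem CartanGeometry.Sm.comp {E : Type*} [NormedAddCommGroup E] [NormedSpace ℝ E] {f : E → ℝ}
    {s : Set E} {Θ : P → E} (hO : IsOpen O) (hf : ContDiffOn ℝ ∞ f s)
    (hΘ : ContMDiffOn 𝓘(ℝ, F) 𝓘(ℝ, E) ∞ Θ O) (hs : ∀ v ∈ O, Θ v ∈ s) :
    C.Sm O (fun v => f (Θ v)) :=
  ⟨hO, hf.contMDiffOn.comp hΘ hs⟩

theorem CartanGeometry.Sm.pi {ι : Type*} [Fintype ι] {Θ : ι → P → ℝ} (h : ∀ i, C.Sm O (Θ i)) :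
    ContMDiffOn 𝓘(ℝ, F) 𝓘(ℝ, ι → ℝ) ∞ (fun v i => Θ i v) O :=
  contMDiffOn_pi_space.2 fun i => (h i).smooth

theorem CartanGeometry.Sm.const (C : CartanGeometry m p M F P) (hO : IsOpen O) (c : ℝ) :
    C.Sm O fun _ => c := ⟨hO, contMDiffOn_const⟩

theorem CartanGeometry.Sm.add (h : C.Sm O Φ) (h' : C.Sm O Ψ) : C.Sm O fun v => Φ v + Ψ v :=
  ⟨h.isOpen, h.smooth.add h'.smooth⟩

theorem CartanGeometry.Sm.mul (h : C.Sm O Φ) (h' : C.Sm O Ψ) : C.Sm O fun v => Φ v * Ψ v :=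
  ⟨h.isOpen, h.smooth.mul h'.smooth⟩

theorem CartanGeometry.Sm.const_mul (h : C.Sm O Φ) (c : ℝ) : C.Sm O fun v => c * Φ v :=
  (Sm.const C h.isOpen c).mul h

theorem CartanGeometry.Sm.sum {ι : Type*} (s : Finset ι) {Θ : ι → P → ℝ} (hO : IsOpen O)
    (h : ∀ i ∈ s, C.Sm O (Θ i)) : C.Sm O fun v => ∑ i ∈ s, Θ i v :=
  ⟨hO, contMDiffOn_finsetSum fun i hi => (h i hi).smooth⟩

theorem CartanGeometry.L_congr (h : Φ =ᶠ[𝓝 u] Ψ) : C.L X Φ u = C.L X Ψ u := by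
  have := h.mfderiv_eq (I := 𝓘(ℝ, F)) (I' := 𝓘(ℝ, ℝ))
  simp only [CartanGeometry.L]
  rw [this]
  rfl

theorem CartanGeometry.L_congr_on (hO : IsOpen O) (hu : u ∈ O) (h : ∀ v ∈ O, Φ v = Ψ v) :
    C.L X Φ u = C.L X Ψ u :=
  CartanGeometry.L_congr (Filter.eventually_of_mem (hO.mem_nhds hu) h)

theorem CartanGeometry.L_add_left : C.L (X + Y) Φ u = C.L X Φ u + C.L Y Φ u := by
  simp [CartanGeometry.L, CartanGeometry.vf]
  rfl

theorem CartanGeometry.L_smul_left (c : ℝ) : C.L (c • X) Φ u = c * C.L X Φ u := by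
  simp [CartanGeometry.L, CartanGeometry.vf]
  rfl

theorem CartanGeometry.L_sum_left {ι : Type*} (s : Finset ι) (Z : ι → soAlg m p) :
    C.L (∑ i ∈ s, Z i) Φ u = ∑ i ∈ s, C.L (Z i) Φ u := by
  simp [CartanGeometry.L, CartanGeometry.vf]
  rfl

variable (C) in
/-- Every tangent vector is the velocity of a smooth curve. -/
theorem CartanGeometry.exists_curve (_C : CartanGeometry m p M F P) (u : P)
    (ζ : TangentSpace 𝓘(ℝ, F) u) :
    ∃ γ : ℝ → P, ContMDiff 𝓘(ℝ, ℝ) 𝓘(ℝ, F) ∞ γ ∧ γ 0 = u ∧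
      ∀ Φ : P → ℝ, MDifferentiableAt 𝓘(ℝ, F) 𝓘(ℝ, ℝ) Φ u →
        HasDerivAt (fun s => Φ (γ s)) (mfderiv 𝓘(ℝ, F) 𝓘(ℝ, ℝ) Φ u ζ) 0 := by
  set e := extChartAt 𝓘(ℝ, F) u with he
  let v : F := ζ
  have ho : IsOpen e.target := isOpen_extChartAt_target u
  obtain ⟨r, hr, hball⟩ := Metric.isOpen_iff.1 ho (e u) (mem_extChartAt_target u)
  obtain ⟨c, hc, hcv⟩ : ∃ c : ℝ, 0 < c ∧ c * ‖v‖ < r := by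
    refine ⟨r / (2 * (‖v‖ + 1)), by positivity, ?_⟩
    rw [div_mul_eq_mul_div, div_lt_iff₀ (by positivity)]
    nlinarith [norm_nonneg v]
  -- The factor `c sin (s / c)` has derivative `1` at `0` and is bounded by `c`, so the curve has
  -- the right velocity and never leaves a ball in the image of the chart.
  let β : ℝ → F := fun s => e u + (c * Real.sin (s / c)) • v
  have hβ : ContDiff ℝ ∞ β := by
    refine contDiff_const.add (ContDiff.smul ?_ contDiff_const)
    exact contDiff_const.mul (Real.contDiff_sin.comp (contDiff_id.div_const c))
  have hβt : ∀ s, β s ∈ e.target := fun s => hball <| by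
    simp only [β, Metric.mem_ball, dist_self_add_left, norm_smul, norm_mul, Real.norm_eq_abs,
      abs_of_pos hc]
    refine lt_of_le_of_lt ?_ hcv
    have := Real.abs_sin_le_one (s / c)
    calc c * |Real.sin (s / c)| * ‖v‖ ≤ c * 1 * ‖v‖ := by gcongr
      _ = c * ‖v‖ := by ring
  have hβ0 : β 0 = e u := by simp [β]
  refine ⟨fun s => e.symm (β s), ?_, ?_, ?_⟩
  · exact (contMDiffOn_extChartAt_symm (I := 𝓘(ℝ, F)) (n := ∞) u).comp_contMDiff hβ.contMDiff hβt
  · simp only [hβ0]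
    exact extChartAt_to_inv u
  · intro Φ hΦ
    have h1 := hΦ.hasMFDerivAt.2
    simp only [modelWithCornersSelf_coe, Set.range_id] at h1
    have h2 : HasFDerivAt (fun z => Φ (e.symm z)) (mfderiv 𝓘(ℝ, F) 𝓘(ℝ, ℝ) Φ u : F →L[ℝ] ℝ)
      (β 0) := by
      rw [hβ0]; exact hasFDerivWithinAt_univ.1 h1
    have h3 : HasDerivAt β v 0 := by
      have h4 : HasDerivAt (fun s : ℝ => c * Real.sin (s / c)) 1 0 := by
        have := ((Real.hasDerivAt_sin (0 / c)).comp (0 : ℝ)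
          ((hasDerivAt_id (0 : ℝ)).div_const c)).const_mul c
        refine this.congr_deriv ?_
        simp [hc.ne']
      exact ((h4.smul_const v).const_add (e u)).congr_deriv (one_smul ℝ v)
    exact h2.comp_hasDerivAt (0 : ℝ) h3

omit [IsManifold 𝓘(ℝ, F) ∞ P] in
theorem hasDerivAt_along {γ : ℝ → P} {t : ℝ} {ζ : TangentSpace 𝓘(ℝ, F) (γ t)}
    (hγ : HasMFDerivAt 𝓘(ℝ, ℝ) 𝓘(ℝ, F) γ t (ContinuousLinearMap.toSpanSingleton ℝ ζ))
    (hΦ : MDifferentiableAt 𝓘(ℝ, F) 𝓘(ℝ, ℝ) Φ (γ t)) :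
    HasDerivAt (fun s => Φ (γ s)) (mfderiv 𝓘(ℝ, F) 𝓘(ℝ, ℝ) Φ (γ t) ζ) t := by
  let A : F →L[ℝ] ℝ := mfderiv 𝓘(ℝ, F) 𝓘(ℝ, ℝ) Φ (γ t)
  let z : F := ζ
  have h : HasFDerivAt (fun s => Φ (γ s)) (A.comp (ContinuousLinearMap.toSpanSingleton ℝ z)) t :=
    hasMFDerivAt_iff_hasFDerivAt.1 (hΦ.hasMFDerivAt.comp t hγ)
  have h2 : HasDerivAt (fun s => Φ (γ s)) (A z) t := by
    refine h.hasDerivAt.congr_deriv ?_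
    rw [ContinuousLinearMap.comp_apply, ContinuousLinearMap.toSpanSingleton_apply, one_smul]
  exact h2

variable (C) in
theorem CartanGeometry.exists_curve_L (u : P) (X : soAlg m p) :
    ∃ γ : ℝ → P, ContMDiff 𝓘(ℝ, ℝ) 𝓘(ℝ, F) ∞ γ ∧ γ 0 = u ∧
      ∀ Φ : P → ℝ, MDifferentiableAt 𝓘(ℝ, F) 𝓘(ℝ, ℝ) Φ u →
        HasDerivAt (fun s => Φ (γ s)) (C.L X Φ u) 0 := C.exists_curve u (C.vf X u)

/-- The value of `L` at a point is the derivative along a fixed curve, so this rule and those that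
follow reduce to calculus in one variable. -/
theorem CartanGeometry.Sm.L_add (h : C.Sm O Φ) (h' : C.Sm O Ψ) (hu : u ∈ O) :
    C.L X (fun v => Φ v + Ψ v) u = C.L X Φ u + C.L X Ψ u := by
  obtain ⟨γ, -, rfl, hγ⟩ := C.exists_curve_L u X
  exact (hγ _ ((h.add h').mdiffAt hu)).unique ((hγ _ (h.mdiffAt hu)).add (hγ _ (h'.mdiffAt hu)))

theorem CartanGeometry.Sm.L_mul (h : C.Sm O Φ) (h' : C.Sm O Ψ) (hu : u ∈ O) :
    C.L X (fun v => Φ v * Ψ v) u = C.L X Φ u * Ψ u + Φ u * C.L X Ψ u := by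
  obtain ⟨γ, -, rfl, hγ⟩ := C.exists_curve_L u X
  exact (hγ _ ((h.mul h').mdiffAt hu)).unique ((hγ _ (h.mdiffAt hu)).mul (hγ _ (h'.mdiffAt hu)))

variable (C) in
theorem CartanGeometry.L_const (c : ℝ) : C.L X (fun _ => c) u = 0 := by
  obtain ⟨γ, -, rfl, hγ⟩ := C.exists_curve_L u X
  exact (hγ _ mdifferentiableAt_const).unique (hasDerivAt_const _ _)

theorem CartanGeometry.Sm.L_const_mul (h : C.Sm O Φ) (hu : u ∈ O) (c : ℝ) :
    C.L X (fun v => c * Φ v) u = c * C.L X Φ u := by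
  rw [(Sm.const C h.isOpen c).L_mul h hu, C.L_const]; ring

theorem CartanGeometry.Sm.L_sum {ι : Type*} (s : Finset ι) {Θ : ι → P → ℝ}
    (hO : IsOpen O) (h : ∀ i ∈ s, C.Sm O (Θ i)) (hu : u ∈ O) :
    C.L X (fun v => ∑ i ∈ s, Θ i v) u = ∑ i ∈ s, C.L X (Θ i) u := by
  obtain ⟨γ, -, rfl, hγ⟩ := C.exists_curve_L u X
  exact (hγ _ ((Sm.sum s hO h).mdiffAt hu)).unique
    (HasDerivAt.fun_sum fun i hi => hγ _ ((h i hi).mdiffAt hu))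

/-- The derivative is the fibre component of the tangent map of `Φ` composed with the smooth field
`ω⁻¹(X)`. -/
theorem CartanGeometry.Sm.L (h : C.Sm O Φ) (X : soAlg m p) : C.Sm O (C.L X Φ) := by
  refine ⟨h.isOpen, ?_⟩
  have h1 := h.smooth.contMDiffOn_tangentMapWithin (m := ∞) (by simp) h.isOpen.uniqueMDiffOn
  have h2 := h1.comp (C.contMDiff_conn X).contMDiffOn (s := O) (fun v hv => hv)
  have h3 := (contMDiff_snd_tangentBundle_modelSpace (n := ∞) ℝ 𝓘(ℝ, ℝ)).comp_contMDiffOn h2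
  refine h3.congr fun v hv => ?_
  show _ = mfderivWithin 𝓘(ℝ, F) 𝓘(ℝ, ℝ) Φ O v (C.vf X v)
  rw [mfderivWithin_of_isOpen h.isOpen hv]
  rfl

end Derivations

/-! ### One-parameter subgroups of `H` and the commutator with vertical derivations -/

section Flow

variable {m p : ℕ}

theorem formJ_mul_self : formJ m p * formJ m p = 1 := by
  ext a b
  rcases a with a | a | a <;> rcases b with b | b | b <;>
    simp [Matrix.mul_apply, formJ, Fintype.sum_sum_type, Matrix.one_apply]
  split_ifs with h
  · subst h
    simp only [eta]
    split_ifs <;> norm_num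
  · rfl

theorem soAlg_transpose (X : soAlg m p) :
    (X : Matrix (Idx m) (Idx m) ℝ).transpose * formJ m p = -(formJ m p * X) := by
  have h := X.2
  rw [mem_skewAdjointMatricesSubmodule, Matrix.IsSkewAdjoint, Matrix.IsAdjointPair] at h
  rw [h, mul_neg]

theorem soAlg_iZero_iInf (X : soAlg m p) : (X : Matrix (Idx m) (Idx m) ℝ) iZero iInf = 0 := by
  have h := congrFun (congrFun (soAlg_transpose X) iInf) iInf
  simp [Matrix.mul_apply, formJ, Fintype.sum_sum_type] at h
  linarith

/-- The relation `Xᵀ = J (-X) J⁻¹` exponentiates to `exp(tX)ᵀ = J exp(-tX) J⁻¹`. -/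
theorem exp_transpose_formJ (X : soAlg m p) (t : ℝ) :
    (NormedSpace.exp (t • (X : Matrix (Idx m) (Idx m) ℝ))).transpose * formJ m p *
      NormedSpace.exp (t • (X : Matrix (Idx m) (Idx m) ℝ)) = formJ m p := by
  have hJ : IsUnit (formJ m p) := ⟨⟨formJ m p, formJ m p, formJ_mul_self, formJ_mul_self⟩, rfl⟩
  have hJi : (formJ m p)⁻¹ = formJ m p := Matrix.inv_eq_left_inv formJ_mul_self
  have h1 : (t • (X : Matrix (Idx m) (Idx m) ℝ)).transpose
      = formJ m p * (-(t • (X : Matrix (Idx m) (Idx m) ℝ))) * (formJ m p)⁻¹ := by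
    rw [hJi, Matrix.transpose_smul]
    have h2 := congrArg (fun A => t • (A * formJ m p)) (soAlg_transpose X)
    simp only [Matrix.mul_assoc, formJ_mul_self, Matrix.mul_one] at h2
    rw [h2]
    simp [Matrix.mul_assoc]
  rw [← Matrix.exp_transpose, h1, Matrix.exp_conj _ _ hJ, hJi, Matrix.mul_assoc, Matrix.mul_assoc,
    Matrix.mul_assoc, ← Matrix.mul_assoc (formJ m p) (formJ m p), formJ_mul_self, Matrix.one_mul,
    ← Matrix.exp_add_of_commute _ _
      (Commute.neg_left (Commute.refl (t • (X : Matrix (Idx m) (Idx m) ℝ)))), neg_add_cancel,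
    NormedSpace.exp_zero, Matrix.mul_one]

open scoped Matrix.Norms.Operator in
theorem hasDerivAt_exp_entry {ι : Type*} [Fintype ι] [DecidableEq ι] (X : Matrix ι ι ℝ) (t : ℝ)
    (a b : ι) : HasDerivAt (fun s : ℝ => NormedSpace.exp (s • X) a b)
      ((NormedSpace.exp (t • X) * X) a b) t := by
  have h := hasDerivAt_exp_smul_const X t
  have h2 : HasFDerivAt (fun A : Matrix ι ι ℝ => A a b)
    (LinearMap.toContinuousLinearMap (Matrix.entryLinearMap ℝ ℝ a b)) (NormedSpace.exp (t • X)) :=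
    (LinearMap.toContinuousLinearMap (Matrix.entryLinearMap ℝ ℝ a b)).hasFDerivAt
  exact h2.comp_hasDerivAt t h

open scoped Matrix.Norms.Operator in
theorem contDiff_exp_entry {ι : Type*} [Fintype ι] [DecidableEq ι] (X : Matrix ι ι ℝ)
    (a b : ι) : ContDiff ℝ ∞ (fun s : ℝ => NormedSpace.exp (s • X) a b) := by
  have h1 : ContDiff ℝ ∞ (fun A : Matrix ι ι ℝ => A a b) :=
    (LinearMap.toContinuousLinearMap (Matrix.entryLinearMap ℝ ℝ a b)).contDiff
  have h2 : ContDiff ℝ ∞ (NormedSpace.exp : Matrix ι ι ℝ → Matrix ι ι ℝ) :=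
    contDiff_iff_contDiffAt.2 fun A => (NormedSpace.exp_analytic (𝕂 := ℝ) A).contDiffAt
  exact h1.comp (h2.comp (contDiff_id.smul contDiff_const))

open scoped Matrix.Norms.Operator in
theorem exp_mul_of_mul_eq_smul {ι : Type*} [Fintype ι] [DecidableEq ι] {X E : Matrix ι ι ℝ} {a : ℝ}
    (h : X * E = a • E) : NormedSpace.exp X * E = Real.exp a • E := by
  have hp : ∀ n : ℕ, X ^ n * E = a ^ n • E := by
    intro n
    induction n with
    | zero => simp
    | succ n ih => rw [pow_succ, Matrix.mul_assoc, h, Matrix.mul_smul, ih, smul_smul, pow_succ']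
  have h1 := (NormedSpace.exp_series_hasSum_exp' (𝕂 := ℝ) X).mul_right E
  have h2 := (NormedSpace.exp_series_hasSum_exp' (𝕂 := ℝ) a).smul_const E
  rw [Real.exp_eq_exp_ℝ]
  refine h1.unique ?_
  have he : (fun n : ℕ => ((n.factorial : ℝ)⁻¹ • X ^ n) * E)
      = fun n : ℕ => ((n.factorial : ℝ)⁻¹ • a ^ n) • E := by
    funext n
    rw [Matrix.smul_mul, hp, smul_smul, smul_eq_mul]
  rw [he]
  exact h2

/-- `X` lies in the Lie algebra of `H`. -/
def IsVert (X : soAlg m p) : Prop := ∀ i, minusPart (X : Matrix (Idx m) (Idx m) ℝ) i = 0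

theorem IsVert.mul_single {X : soAlg m p} (hX : IsVert X) :
    (X : Matrix (Idx m) (Idx m) ℝ) * Matrix.single iInf iInf 1
      = (X : Matrix (Idx m) (Idx m) ℝ) iInf iInf • Matrix.single iInf iInf 1 := by
  ext a b
  rcases b with b | b | b
  · simp [Matrix.mul_apply]
  · simp [Matrix.mul_apply]
  · rcases a with a | a | a
    · simpa [Matrix.mul_apply, Matrix.single_apply] using soAlg_iZero_iInf X
    · simpa [Matrix.mul_apply, Matrix.single_apply, minusPart] using hX a
    · simp [Matrix.mul_apply, Matrix.single_apply]

/-- The one-parameter subgroup of `H` generated by `X`. -/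
theorem IsVert.exists_flow {X : soAlg m p} (hX : IsVert X) : ∃ c : ℝ → groupH m p,
    ∀ t : ℝ, ((c t : (Matrix (Idx m) (Idx m) ℝ)ˣ) : Matrix (Idx m) (Idx m) ℝ)
      = NormedSpace.exp (t • (X : Matrix (Idx m) (Idx m) ℝ)) := by
  have hu : ∀ t : ℝ, IsUnit (NormedSpace.exp (t • (X : Matrix (Idx m) (Idx m) ℝ))) :=
    fun t => Matrix.isUnit_exp _
  -- A vertical `X` has `e_∞` as an eigenvector, so the exponential multiplies it by a positive
  -- number and preserves the ray.
  refine ⟨fun t => ⟨(hu t).unit, ?_, Real.exp (t * (X : Matrix (Idx m) (Idx m) ℝ) iInf iInf),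
    Real.exp_pos _, ?_⟩, fun t => rfl⟩
  · exact exp_transpose_formJ X t
  · have h1 : (t • (X : Matrix (Idx m) (Idx m) ℝ)) * Matrix.single iInf iInf 1
        = (t * (X : Matrix (Idx m) (Idx m) ℝ) iInf iInf) • Matrix.single iInf iInf 1 := by
      rw [Matrix.smul_mul, hX.mul_single, smul_smul]
    have h2 := exp_mul_of_mul_eq_smul h1
    ext a
    have h3 := congrFun (congrFun h2 a) iInf
    simp only [Matrix.mul_apply, Matrix.single_apply, Matrix.smul_apply] at h3
    simp only [IsUnit.unit_spec, Matrix.mulVec_single_one, Matrix.col_apply, Pi.smul_apply,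
      Pi.single_apply, smul_eq_mul]
    simpa [eq_comm] using h3

theorem coe_inv_flow {X : soAlg m p} {c : ℝ → groupH m p}
    (hc : ∀ t : ℝ, ((c t : (Matrix (Idx m) (Idx m) ℝ)ˣ) : Matrix (Idx m) (Idx m) ℝ)
      = NormedSpace.exp (t • (X : Matrix (Idx m) (Idx m) ℝ))) (t : ℝ) :
    (((c t)⁻¹ : groupH m p) : (Matrix (Idx m) (Idx m) ℝ)ˣ)
      = NormedSpace.exp (t • ((-X : soAlg m p) : Matrix (Idx m) (Idx m) ℝ)) := by
  have h1 : ((((c t)⁻¹ : groupH m p) : (Matrix (Idx m) (Idx m) ℝ)ˣ) : Matrix (Idx m) (Idx m) ℝ) *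
      ((c t : (Matrix (Idx m) (Idx m) ℝ)ˣ) : Matrix (Idx m) (Idx m) ℝ) = 1 := by
    simp
  have h2 : ((c t : (Matrix (Idx m) (Idx m) ℝ)ˣ) : Matrix (Idx m) (Idx m) ℝ) *
      NormedSpace.exp (t • ((-X : soAlg m p) : Matrix (Idx m) (Idx m) ℝ)) = 1 := by
    rw [hc, Submodule.coe_neg, smul_neg, ← Matrix.exp_add_of_commute _ _
      (Commute.neg_right (Commute.refl (t • (X : Matrix (Idx m) (Idx m) ℝ)))), add_neg_cancel,
      NormedSpace.exp_zero]
  exact left_inv_eq_right_inv h1 h2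

theorem flow_zero {X : soAlg m p} {c : ℝ → groupH m p}
    (hc : ∀ t : ℝ, ((c t : (Matrix (Idx m) (Idx m) ℝ)ˣ) : Matrix (Idx m) (Idx m) ℝ)
      = NormedSpace.exp (t • (X : Matrix (Idx m) (Idx m) ℝ))) : c 0 = 1 := by
  refine Subtype.ext (Units.ext ?_)
  rw [hc, zero_smul, NormedSpace.exp_zero]
  rfl

theorem flow_add {X : soAlg m p} {c : ℝ → groupH m p}
    (hc : ∀ t : ℝ, ((c t : (Matrix (Idx m) (Idx m) ℝ)ˣ) : Matrix (Idx m) (Idx m) ℝ)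
      = NormedSpace.exp (t • (X : Matrix (Idx m) (Idx m) ℝ))) (s t : ℝ) :
    c (s + t) = c s * c t := by
  refine Subtype.ext (Units.ext ?_)
  rw [hc, add_smul, Matrix.exp_add_of_commute _ _
    ((Commute.refl (X : Matrix (Idx m) (Idx m) ℝ)).smul_left s |>.smul_right t), ← hc, ← hc]
  rfl

/-- A linear projection onto `so(p+1,q+1)`. -/
theorem exists_proj_soAlg : ∃ π : Matrix (Idx m) (Idx m) ℝ →ₗ[ℝ] soAlg m p,
    ∀ X : soAlg m p, π X = X := by
  obtain ⟨π, hπ⟩ := (soAlg m p).subtype.exists_leftInverse_of_injective (Submodule.ker_subtype _)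
  exact ⟨π, fun X => congrArg (fun g => g X) hπ⟩

/-- The commutator in `so(p+1,q+1)`. -/
def soBr (X Y : soAlg m p) : soAlg m p :=
  ⟨(X : Matrix (Idx m) (Idx m) ℝ) * Y - (Y : Matrix (Idx m) (Idx m) ℝ) * X, by
    have hX := soAlg_transpose X
    have hY := soAlg_transpose Y
    rw [mem_skewAdjointMatricesSubmodule, Matrix.IsSkewAdjoint, Matrix.IsAdjointPair,
      Matrix.transpose_sub, Matrix.transpose_mul, Matrix.transpose_mul, Matrix.sub_mul,
      Matrix.mul_assoc, Matrix.mul_assoc, hX, hY, mul_neg, mul_neg, ← Matrix.mul_assoc,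
      ← Matrix.mul_assoc, hX, hY, neg_sub, Matrix.mul_sub]
    simp only [Matrix.neg_mul, Matrix.mul_assoc]
    abel⟩

section Vertical

variable {M : Type*} [TopologicalSpace M] [ChartedSpace (Euc m) M]
  {F : Type*} [NormedAddCommGroup F] [NormedSpace ℝ F]
  {P : Type*} [TopologicalSpace P] [ChartedSpace F P] [IsManifold 𝓘(ℝ, F) ∞ P]
  {C : CartanGeometry m p M F P} {O : Set P} {Φ Ψ : P → ℝ} {u : P} {X Y : soAlg m p}

/-- The axiom on fundamental fields gives the velocity at time `0` only; the group law moves it to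
every time. -/
theorem CartanGeometry.hasDerivAt_flow {c : ℝ → groupH m p}
    (hc : ∀ t : ℝ, ((c t : (Matrix (Idx m) (Idx m) ℝ)ˣ) : Matrix (Idx m) (Idx m) ℝ)
      = NormedSpace.exp (t • (X : Matrix (Idx m) (Idx m) ℝ))) (t : ℝ)
    (hΦ : MDifferentiableAt 𝓘(ℝ, F) 𝓘(ℝ, ℝ) Φ (C.act u (c t))) :
    HasDerivAt (fun s => Φ (C.act u (c s))) (C.L X Φ (C.act u (c t))) t := by
  have h1 := C.fundamental (C.act u (c t)) X c hc
  have h0 : C.act (C.act u (c t)) (c 0) = C.act u (c t) := by rw [flow_zero hc, C.act_one]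
  have h2 : HasDerivAt (fun s => Φ (C.act (C.act u (c t)) (c s)))
      (C.L X Φ (C.act (C.act u (c t)) (c 0))) 0 :=
    hasDerivAt_along h1 (by rw [h0]; exact hΦ)
  rw [h0] at h2
  have h3 : HasDerivAt (fun s => Φ (C.act (C.act u (c t)) (c (s - t))))
      (C.L X Φ (C.act u (c t))) t := by
    have h4 : HasDerivAt (fun s => Φ (C.act (C.act u (c t)) (c s)))
      (C.L X Φ (C.act u (c t))) (t - t) := by rw [sub_self]; exact h2
    exact h4.comp_sub_const t t
  refine h3.congr_of_eventuallyEq (Filter.Eventually.of_forall fun s => ?_)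
  simp only
  rw [← C.act_mul, ← flow_add hc, add_sub_cancel]

/-- `Ad(h⁻¹)X` is obtained as a value of the connection form, so its membership in `𝔤` needs no
computation. -/
theorem CartanGeometry.exists_ad (C : CartanGeometry m p M F P) (u : P) (h : groupH m p)
    (X : soAlg m p) : ∃ Z : soAlg m p,
      (Z : Matrix (Idx m) (Idx m) ℝ) = ((h⁻¹ : groupH m p) : (Matrix (Idx m) (Idx m) ℝ)ˣ) *
        (X : Matrix (Idx m) (Idx m) ℝ) * ((h : (Matrix (Idx m) (Idx m) ℝ)ˣ)) ∧
      mfderiv 𝓘(ℝ, F) 𝓘(ℝ, F) (fun v => C.act v h) u (C.vf X u) = C.vf Z (C.act u h) := by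
  refine ⟨C.conn (C.act u h) (mfderiv 𝓘(ℝ, F) 𝓘(ℝ, F) (fun v => C.act v h) u (C.vf X u)), ?_, ?_⟩
  · rw [C.equivariant, CartanGeometry.vf, LinearEquiv.apply_symm_apply]
  · rw [CartanGeometry.vf, CartanGeometry.vf, LinearEquiv.symm_apply_apply]

/-- If the right translation were not differentiable, its derivative would be `0` by convention, and
equivariance of `ω` would give `Ad(h⁻¹)Y = 0`. A single nonzero `Y` excludes this. -/
theorem CartanGeometry.mdiffAt_act (C : CartanGeometry m p M F P) (u : P) (h : groupH m p)
    (hY : Y ≠ 0) : MDifferentiableAt 𝓘(ℝ, F) 𝓘(ℝ, F) (fun v => C.act v h) u := by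
  by_contra hd
  obtain ⟨Z, hZ, hZ'⟩ := C.exists_ad u h Y
  rw [mfderiv_zero_of_not_mdifferentiableAt hd] at hZ'
  have h1 : Z = 0 := by
    have : (C.conn (C.act u h)).symm Z = 0 := hZ'.symm
    simpa using this
  apply hY
  rw [h1] at hZ
  refine Subtype.ext ?_
  have e1 : ((h : (Matrix (Idx m) (Idx m) ℝ)ˣ) : Matrix (Idx m) (Idx m) ℝ) *
    ((((h⁻¹ : groupH m p) : (Matrix (Idx m) (Idx m) ℝ)ˣ)) : Matrix (Idx m) (Idx m) ℝ) = 1 := by simp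
  have h2 := congrArg (fun A => ((h : (Matrix (Idx m) (Idx m) ℝ)ˣ) : Matrix (Idx m) (Idx m) ℝ) * A *
    ((((h⁻¹ : groupH m p) : (Matrix (Idx m) (Idx m) ℝ)ˣ)) : Matrix (Idx m) (Idx m) ℝ)) hZ
  simp only [Matrix.mul_assoc, e1, Matrix.mul_one] at h2
  rw [← Matrix.mul_assoc _ _ (Y : Matrix (Idx m) (Idx m) ℝ), e1, Matrix.one_mul] at h2
  simpa using h2.symm

/-- `(R_h)_* ω⁻¹(Y) = ω⁻¹(Ad(h⁻¹) Y)`. -/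
theorem CartanGeometry.L_comp_act (h : groupH m p) (hY : Y ≠ 0) {Z : soAlg m p}
    (hZ : (Z : Matrix (Idx m) (Idx m) ℝ) = ((h⁻¹ : groupH m p) : (Matrix (Idx m) (Idx m) ℝ)ˣ) *
        (Y : Matrix (Idx m) (Idx m) ℝ) * ((h : (Matrix (Idx m) (Idx m) ℝ)ˣ)))
    (hΦ : MDifferentiableAt 𝓘(ℝ, F) 𝓘(ℝ, ℝ) Φ (C.act u h)) :
    C.L Y (fun v => Φ (C.act v h)) u = C.L Z Φ (C.act u h) := by
  obtain ⟨Z', h1, h2⟩ := C.exists_ad u h Y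
  have h3 : Z' = Z := Subtype.ext (h1.trans hZ.symm)
  subst h3
  have h4 := mfderiv_comp u hΦ (C.mdiffAt_act u h hY)
  have h5 := congrArg (fun A => A (C.vf Y u)) h4
  refine h5.trans ?_
  show mfderiv 𝓘(ℝ, F) 𝓘(ℝ, ℝ) Φ (C.act u h) (mfderiv 𝓘(ℝ, F) 𝓘(ℝ, F) (fun v => C.act v h) u
    (C.vf Y u)) = _
  rw [h2]
  rfl

theorem fderiv_fderiv_symm {E : Type*} [NormedAddCommGroup E] [NormedSpace ℝ E] {f : E → ℝ} {x : E}
    (hf : ContDiffAt ℝ ∞ f x) (a b : E) :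
    fderiv ℝ (fun z => fderiv ℝ f z a) x b = fderiv ℝ (fun z => fderiv ℝ f z b) x a := by
  have hs := hf.isSymmSndFDerivAt (n := ∞) (by
    rw [minSmoothness_of_isRCLikeNormedField]; exact WithTop.coe_le_coe.2 (le_top : (2 : ℕ∞) ≤ ⊤))
  have hd : DifferentiableAt ℝ (fderiv ℝ f) x :=
    (hf.fderiv_right (m := 1) (by norm_cast)).differentiableAt (by simp)
  rw [fderiv_clm_apply hd (differentiableAt_const _), fderiv_clm_apply hd (differentiableAt_const _)]
  simp [hs a b]

/-- The commutator of a vertical derivation with an arbitrary one. -/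
theorem CartanGeometry.Sm.L_comm_vert (h : C.Sm O Φ) (hX : IsVert X) (hu : u ∈ O) :
    C.L X (C.L Y Φ) u = C.L Y (C.L X Φ) u + C.L (soBr X Y) Φ u := by
  -- The zero vector is set apart because the differentiability of right translations is extracted
  -- from a nonzero `Y`.
  rcases eq_or_ne Y 0 with rfl | hY
  · have h0 : ∀ v Θ, C.L (0 : soAlg m p) Θ v = 0 := fun v Θ => by
      have := C.L_smul_left (Φ := Θ) (u := v) (X := (0 : soAlg m p)) 0
      simpa using this
    have h1 : soBr X 0 = 0 := Subtype.ext (by simp [soBr])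
    rw [h0, h1, h0, CartanGeometry.L_congr (Ψ := fun _ => 0) (Filter.Eventually.of_forall
      fun v => h0 v Φ), C.L_const, add_zero]
  obtain ⟨c, hc⟩ := hX.exists_flow
  obtain ⟨γ, hγs, hγ0, hγ⟩ := C.exists_curve_L u Y
  have hc0 := flow_zero hc
  -- the two-parameter family
  let κ : Euc 2 → P := fun x => C.act (γ (x 0)) (c (x 1))
  have hκ : ContMDiff (𝓡 2) 𝓘(ℝ, F) ∞ κ := by
    refine C.contMDiff_act 2 (fun x => γ (x 0)) (fun x => c (x 1)) ?_ ?_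
    · exact hγs.comp (EuclideanSpace.proj (𝕜 := ℝ) (0 : Fin 2)).contDiff.contMDiff
    · intro a b
      simp only [hc]
      exact (contDiff_exp_entry (X : Matrix (Idx m) (Idx m) ℝ) a b).comp
        (EuclideanSpace.proj (𝕜 := ℝ) (1 : Fin 2)).contDiff
  let f : Euc 2 → ℝ := fun x => Φ (κ x)
  let pt : ℝ → ℝ → Euc 2 := fun s t => !₂[s, t]
  have hκpt : ∀ s t, κ (pt s t) = C.act (γ s) (c t) := fun s t => by simp [κ, pt]
  have hpt0 : pt 0 0 = 0 := by ext i; fin_cases i <;> simp [pt]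
  have hκ0 : κ 0 = u := by rw [← hpt0, hκpt, hc0, C.act_one, hγ0]
  have hO : IsOpen (κ ⁻¹' O) := h.isOpen.preimage hκ.continuous
  have h0O : (0 : Euc 2) ∈ κ ⁻¹' O := by show κ 0 ∈ O; rw [hκ0]; exact hu
  have hf : ContDiffOn ℝ ∞ f (κ ⁻¹' O) :=
    (h.smooth.comp hκ.contMDiffOn (fun x hx => hx)).contDiffOn
  have hfd : ∀ x ∈ κ ⁻¹' O, HasFDerivAt f (fderiv ℝ f x) x := fun x hx =>
    ((hf.contDiffAt (hO.mem_nhds hx)).differentiableAt (by simp)).hasFDerivAt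
  let e0 : Euc 2 := EuclideanSpace.single 0 1
  let e1 : Euc 2 := EuclideanSpace.single 1 1
  have hpt : ∀ s t, pt s t = s • e0 + t • e1 := by
    intro s t; ext i; fin_cases i <;> simp [pt, e0, e1]
  have hd0 : ∀ s t, HasDerivAt (fun r => pt r t) e0 s := fun s t => by
    simp only [hpt]
    simpa using ((hasDerivAt_id s).smul_const e0).add_const (t • e1)
  have hd1 : ∀ s t, HasDerivAt (fun r => pt s r) e1 t := fun s t => by
    simp only [hpt]
    simpa using ((hasDerivAt_id t).smul_const e1).const_add (s • e0)
  have hev0 : ∀ᶠ s in 𝓝 (0 : ℝ), pt s 0 ∈ κ ⁻¹' O :=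
    (hd0 0 0).continuousAt.eventually_mem (hO.mem_nhds (by rw [hpt0]; exact h0O))
  have hev1 : ∀ᶠ t in 𝓝 (0 : ℝ), pt 0 t ∈ κ ⁻¹' O :=
    (hd1 0 0).continuousAt.eventually_mem (hO.mem_nhds (by rw [hpt0]; exact h0O))
  -- The derivative in the direction of the group parameter is the vertical derivation at `γ s`.
  have hP1 : ∀ᶠ s in 𝓝 (0 : ℝ), fderiv ℝ f (pt s 0) e1 = C.L X Φ (γ s) := by
    filter_upwards [hev0] with s hs
    have h1 : HasDerivAt (fun t => f (pt s t)) (fderiv ℝ f (pt s 0) e1) 0 :=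
      HasFDerivAt.comp_hasDerivAt (f := fun r => pt s r) (0 : ℝ) (hfd _ hs) (hd1 s 0)
    have hs' : C.act (γ s) (c 0) ∈ O := by rw [← hκpt]; exact hs
    have h2 := C.hasDerivAt_flow (u := γ s) hc 0 (h.mdiffAt hs')
    rw [hc0, C.act_one] at h2
    refine h1.unique (h2.congr_of_eventuallyEq (Filter.Eventually.of_forall fun t => ?_))
    simp only [f, hκpt]
  obtain ⟨π, hπ⟩ := exists_proj_soAlg (m := m) (p := p)
  -- This is `Ad(c(t)⁻¹)Y`, whose derivative at `0` is `-[X, Y]`.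
  let Z : ℝ → Matrix (Idx m) (Idx m) ℝ := fun t =>
    NormedSpace.exp (t • ((-X : soAlg m p) : Matrix (Idx m) (Idx m) ℝ)) *
      (Y : Matrix (Idx m) (Idx m) ℝ) * NormedSpace.exp (t • (X : Matrix (Idx m) (Idx m) ℝ))
  -- Expansion over fixed elements of `𝔤`, the projections of the matrix units, puts the dependence
  -- of `Ad(c(t)⁻¹)Y` on `t` into scalar coefficients.
  have hexp : ∀ (A : soAlg m p) v, C.L A Φ v
      = ∑ a, ∑ b, (A : Matrix (Idx m) (Idx m) ℝ) a b * C.L (π (Matrix.single a b 1)) Φ v := by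
    intro A v
    conv_lhs => rw [← hπ A, Matrix.matrix_eq_sum_single (A : Matrix (Idx m) (Idx m) ℝ)]
    rw [map_sum, C.L_sum_left]
    refine Finset.sum_congr rfl fun a _ => ?_
    rw [map_sum, C.L_sum_left]
    refine Finset.sum_congr rfl fun b _ => ?_
    rw [← C.L_smul_left, ← map_smul, Matrix.smul_single, smul_eq_mul, mul_one]
  have hP0 : ∀ᶠ t in 𝓝 (0 : ℝ), fderiv ℝ f (pt 0 t) e0
      = ∑ a, ∑ b, Z t a b * C.L (π (Matrix.single a b 1)) Φ (C.act u (c t)) := by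
    filter_upwards [hev1] with t ht
    have h1 : HasDerivAt (fun s => f (pt s t)) (fderiv ℝ f (pt 0 t) e0) 0 :=
      HasFDerivAt.comp_hasDerivAt (f := fun r => pt r t) (0 : ℝ) (hfd _ ht) (hd0 0 t)
    have ht' : C.act u (c t) ∈ O := by rw [← hγ0, ← hκpt]; exact ht
    obtain ⟨A, hA, hA'⟩ := C.exists_ad u (c t) Y
    have h3 := C.L_comp_act (c t) hY hA (h.mdiffAt ht')
    have h4 := hγ (fun v => Φ (C.act v (c t)))
      ((h.mdiffAt ht').comp u (C.mdiffAt_act u (c t) hY))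
    rw [h3, hexp A] at h4
    rw [coe_inv_flow hc, hc] at hA
    rw [hA] at h4
    refine h1.unique (h4.congr_of_eventuallyEq (Filter.Eventually.of_forall fun s => ?_))
    simp only [f, hκpt]
  -- The commutator formula is the equality of the mixed second derivatives of `Φ(γ(s) · c(t))` at
  -- the origin.
  have hsymm := fderiv_fderiv_symm (hf.contDiffAt (hO.mem_nhds h0O)) e1 e0
  have hdf : ∀ e, DifferentiableAt ℝ (fun z => fderiv ℝ f z e) 0 := fun e =>
    (((hf.contDiffAt (hO.mem_nhds h0O)).fderiv_right (m := 1) (by norm_cast)).differentiableAt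
      (by simp)).clm_apply (differentiableAt_const _)
  have hL : fderiv ℝ (fun z => fderiv ℝ f z e1) 0 e0 = C.L Y (C.L X Φ) u := by
    have h1 : HasDerivAt (fun s => fderiv ℝ f (pt s 0) e1)
        (fderiv ℝ (fun z => fderiv ℝ f z e1) 0 e0) 0 := by
      have := (hdf e1).hasFDerivAt
      exact HasFDerivAt.comp_hasDerivAt (f := fun r => pt r 0) (0 : ℝ)
        (by simp only [hpt0]; exact this) (hd0 0 0)
    exact (h1.congr_of_eventuallyEq (hP1.mono fun s hs => hs.symm)).unique
      (hγ _ ((h.L X).mdiffAt hu))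
  have hR : fderiv ℝ (fun z => fderiv ℝ f z e0) 0 e1
      = C.L X (C.L Y Φ) u - C.L (soBr X Y) Φ u := by
    have h1 : HasDerivAt (fun t => fderiv ℝ f (pt 0 t) e0)
        (fderiv ℝ (fun z => fderiv ℝ f z e0) 0 e1) 0 := by
      have := (hdf e0).hasFDerivAt
      exact HasFDerivAt.comp_hasDerivAt (f := fun r => pt 0 r) (0 : ℝ)
        (by simp only [hpt0]; exact this) (hd1 0 0)
    have hZ0 : Z 0 = Y := by simp [Z, NormedSpace.exp_zero]
    have hZ : ∀ a b, HasDerivAt (fun t => Z t a b)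
        (-(soBr X Y : Matrix (Idx m) (Idx m) ℝ) a b) 0 := by
      intro a b
      simp only [Z, Matrix.mul_apply]
      have h5 := fun i j => hasDerivAt_exp_entry
        ((-X : soAlg m p) : Matrix (Idx m) (Idx m) ℝ) 0 i j
      have h6 := fun i j => hasDerivAt_exp_entry (X : Matrix (Idx m) (Idx m) ℝ) 0 i j
      simp only [zero_smul, NormedSpace.exp_zero, Matrix.one_mul] at h5 h6
      have h7 := HasDerivAt.fun_sum (u := Finset.univ) fun (i : Idx m) _ =>
        (HasDerivAt.fun_sum (u := Finset.univ) fun (j : Idx m) _ =>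
          (h5 a j).mul_const ((Y : Matrix (Idx m) (Idx m) ℝ) j i)).mul (h6 i b)
      refine h7.congr_deriv ?_
      simp only [zero_smul, NormedSpace.exp_zero, Finset.sum_add_distrib]
      simp only [← Matrix.mul_apply, Matrix.one_mul, Matrix.mul_one, soBr, Submodule.coe_neg]
      simp [Matrix.sub_apply]
      ring
    have h8 : HasDerivAt (fun t => ∑ a, ∑ b, Z t a b *
        C.L (π (Matrix.single a b 1)) Φ (C.act u (c t)))
        (∑ a, ∑ b, (-(soBr X Y : Matrix (Idx m) (Idx m) ℝ) a b *
            C.L (π (Matrix.single a b 1)) Φ u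
          + (Y : Matrix (Idx m) (Idx m) ℝ) a b * C.L X (C.L (π (Matrix.single a b 1)) Φ) u)) 0 := by
      refine HasDerivAt.fun_sum fun a _ => HasDerivAt.fun_sum fun b _ => ?_
      have hu' : C.act u (c 0) ∈ O := by rw [hc0, C.act_one]; exact hu
      have h9 := C.hasDerivAt_flow hc 0 ((h.L (π (Matrix.single a b 1))).mdiffAt hu')
      refine ((hZ a b).mul h9).congr_deriv ?_
      rw [hc0, C.act_one, hZ0]
    have h11 : C.L X (C.L Y Φ) u
        = ∑ a, ∑ b, (Y : Matrix (Idx m) (Idx m) ℝ) a b *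
          C.L X (C.L (π (Matrix.single a b 1)) Φ) u := by
      rw [CartanGeometry.L_congr (Filter.Eventually.of_forall (hexp Y))]
      refine (CartanGeometry.Sm.L_sum (Θ := fun a v => ∑ b, (Y : Matrix (Idx m) (Idx m) ℝ) a b *
        C.L (π (Matrix.single a b 1)) Φ v) _ h.isOpen (fun a _ => CartanGeometry.Sm.sum _ h.isOpen
          fun b _ => (h.L _).const_mul _) hu).trans ?_
      refine Finset.sum_congr rfl fun a _ => ?_
      refine (CartanGeometry.Sm.L_sum (Θ := fun b v => (Y : Matrix (Idx m) (Idx m) ℝ) a b *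
        C.L (π (Matrix.single a b 1)) Φ v) _ h.isOpen (fun b _ => (h.L _).const_mul _) hu).trans ?_
      exact Finset.sum_congr rfl fun b _ => (h.L _).L_const_mul hu _
    rw [h11, hexp (soBr X Y)]
    refine (h1.congr_of_eventuallyEq (hP0.mono fun t ht => ht.symm)).unique (h8.congr_deriv ?_)
    simp only [Finset.sum_add_distrib, neg_mul, Finset.sum_neg_distrib]
    ring
  rw [hL, hR] at hsymm
  linarith

end Vertical

end Flow

/-! ### Commutators through the Lie bracket; functions constant along fibres and flows -/

section Curvature

variable {m p : ℕ} {M : Type*} [TopologicalSpace M] [ChartedSpace (Euc m) M]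
  {F : Type*} [NormedAddCommGroup F] [NormedSpace ℝ F] [FiniteDimensional ℝ F]
  {P : Type*} [TopologicalSpace P] [ChartedSpace F P] [IsManifold 𝓘(ℝ, F) ∞ P]
  {C : CartanGeometry m p M F P} {O : Set P} {Φ Ψ : P → ℝ} {u : P} {X Y : soAlg m p}

/-- The commutator of two derivations is the derivation along the Lie bracket. -/
theorem CartanGeometry.Sm.L_comm (h : C.Sm O Φ) (hu : u ∈ O) :
    C.L X (C.L Y Φ) u - C.L Y (C.L X Φ) u
      = C.L (C.conn u (VectorField.mlieBracket 𝓘(ℝ, F) (C.vf X) (C.vf Y) u)) Φ u := by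
  have : CompleteSpace F := FiniteDimensional.complete ℝ F
  set e := extChartAt 𝓘(ℝ, F) u with he
  let Φ' : F → ℝ := fun z => Φ (e.symm z)
  -- The fields are read in the chart at `u`, where the bracket is that of vector-valued functions.
  let V : soAlg m p → F → F := fun A =>
    VectorField.mpullbackWithin 𝓘(ℝ, F) 𝓘(ℝ, F) e.symm (C.vf A) (range 𝓘(ℝ, F))
  have hT : IsOpen e.target := isOpen_extChartAt_target u
  have hcs : ContMDiffOn 𝓘(ℝ, F) 𝓘(ℝ, F) ∞ e.symm e.target := contMDiffOn_extChartAt_symm u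
  have hW : IsOpen (e.target ∩ e.symm ⁻¹' O) := hcs.continuousOn.isOpen_inter_preimage hT h.isOpen
  have heu : e u ∈ e.target := mem_extChartAt_target u
  have heu' : e.symm (e u) = u := extChartAt_to_inv u
  have hmem : e u ∈ e.target ∩ e.symm ⁻¹' O := ⟨heu, by show e.symm (e u) ∈ O; rw [heu']; exact hu⟩
  have key : ∀ A : soAlg m p, ∀ Θ : P → ℝ, C.Sm O Θ → ∀ z ∈ e.target ∩ e.symm ⁻¹' O,
      fderiv ℝ (fun z => Θ (e.symm z)) z (V A z) = C.L A Θ (e.symm z) := by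
    intro A Θ hΘ z hz
    have h1 : MDifferentiableAt 𝓘(ℝ, F) 𝓘(ℝ, F) e.symm z :=
      (hcs.contMDiffAt (hT.mem_nhds hz.1)).mdifferentiableAt (by simp)
    have h2 := mfderiv_comp z (hΘ.mdiffAt hz.2) h1
    have h3 : mfderiv 𝓘(ℝ, F) 𝓘(ℝ, F) e.symm z (V A z) = C.vf A (e.symm z) := by
      have h4 := isInvertible_mfderivWithin_extChartAt_symm (I := 𝓘(ℝ, F)) hz.1
      have h5 : mfderivWithin 𝓘(ℝ, F) 𝓘(ℝ, F) e.symm (range 𝓘(ℝ, F)) z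
          = mfderiv 𝓘(ℝ, F) 𝓘(ℝ, F) e.symm z := by
        rw [modelWithCornersSelf_coe, range_id, mfderivWithin_univ]
      simp only [V, VectorField.mpullbackWithin_apply]
      rw [h5] at h4 ⊢
      exact h4.self_apply_inverse _
    have h6 := congrArg (fun B => B (V A z)) h2
    rw [mfderiv_eq_fderiv] at h6
    refine h6.trans ?_
    show mfderiv 𝓘(ℝ, F) 𝓘(ℝ, ℝ) Θ (e.symm z) (mfderiv 𝓘(ℝ, F) 𝓘(ℝ, F) e.symm z (V A z)) = _
    rw [h3]
    rfl
  have hsm : ContDiffAt ℝ ∞ Φ' (e u) :=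
    ((h.smooth.comp (hcs.mono inter_subset_left) (fun z hz => hz.2)).contDiffOn).contDiffAt
      (hW.mem_nhds hmem)
  have hV : ∀ A, DifferentiableAt ℝ (V A) (e u) := by
    intro A
    have h1 : MDifferentiableWithinAt 𝓘(ℝ, F) 𝓘(ℝ, F).tangent
        (fun v => (⟨v, C.vf A v⟩ : TangentBundle 𝓘(ℝ, F) P)) univ u :=
      ((C.contMDiff_conn A).mdifferentiableAt (by simp)).mdifferentiableWithinAt
    have : IsManifold 𝓘(ℝ, F) 2 P := IsManifold.of_le (n := ∞)
      (WithTop.coe_le_coe.2 (le_top : (2 : ℕ∞) ≤ ⊤))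
    have h2 := h1.differentiableWithinAt_mpullbackWithin_vectorField
    have h3 : (extChartAt 𝓘(ℝ, F) u).symm ⁻¹' univ ∩ range 𝓘(ℝ, F) = univ := by simp
    rw [h3] at h2
    exact differentiableWithinAt_univ.1 h2
  have hb := VectorField.fderiv_apply_lieBracket_of_isSymmSndFDerivAt (V := V X) (W := V Y)
    (hsm.of_le (WithTop.coe_le_coe.2 (le_top : (2 : ℕ∞) ≤ ⊤)))
    (hsm.isSymmSndFDerivAt (by
      rw [minSmoothness_of_isRCLikeNormedField]
      exact WithTop.coe_le_coe.2 (le_top : (2 : ℕ∞) ≤ ⊤))) (hV Y) (hV X)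
  have hsecond : ∀ A B : soAlg m p, fderiv ℝ (fun z => fderiv ℝ Φ' z (V B z)) (e u) (V A (e u))
      = C.L A (C.L B Φ) u := by
    intro A B
    have h1 : (fun z => fderiv ℝ Φ' z (V B z)) =ᶠ[𝓝 (e u)] fun z => C.L B Φ (e.symm z) :=
      Filter.eventually_of_mem (hW.mem_nhds hmem) fun z hz => key B Φ h z hz
    rw [h1.fderiv_eq, key A _ (h.L B) _ hmem, heu']
  rw [hsecond, hsecond] at hb
  rw [← hb]
  let b : F := VectorField.lieBracket ℝ (V X) (V Y) (e u)
  have h7 : VectorField.mlieBracket 𝓘(ℝ, F) (C.vf X) (C.vf Y) u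
      = (mfderiv 𝓘(ℝ, F) 𝓘(ℝ, F) e u).inverse b := by
    have h3 : (extChartAt 𝓘(ℝ, F) u).symm ⁻¹' univ ∩ range 𝓘(ℝ, F) = univ := by simp
    have h4 : VectorField.lieBracketWithin ℝ (V X) (V Y) univ (e u) = b := by
      rw [VectorField.lieBracketWithin_univ]
    rw [← VectorField.mlieBracketWithin_univ, VectorField.mlieBracketWithin_apply, h3]
    exact congrArg (fun w : F => (mfderiv 𝓘(ℝ, F) 𝓘(ℝ, F) e u).inverse w) h4
  have h8 : C.L (C.conn u (VectorField.mlieBracket 𝓘(ℝ, F) (C.vf X) (C.vf Y) u)) Φ u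
      = mfderiv 𝓘(ℝ, F) 𝓘(ℝ, ℝ) Φ u (VectorField.mlieBracket 𝓘(ℝ, F) (C.vf X) (C.vf Y) u) := by
    rw [CartanGeometry.L, CartanGeometry.vf, LinearEquiv.symm_apply_apply]
  rw [h8, h7]
  let A : F →L[ℝ] ℝ := mfderiv 𝓘(ℝ, F) 𝓘(ℝ, ℝ) Φ u
  let D : F →L[ℝ] F := mfderiv 𝓘(ℝ, F) 𝓘(ℝ, F) e u
  have h9 : fderiv ℝ Φ' (e u) = A := by
    have := (h.mdiffAt hu).hasMFDerivAt.2
    simp only [modelWithCornersSelf_coe, Set.range_id] at this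
    have h10 : HasFDerivAt Φ' A (e u) := hasFDerivWithinAt_univ.1 this
    exact h10.fderiv
  -- At its base point the preferred chart has the identity as derivative, in the model for the
  -- tangent space.
  have h11 : D.inverse b = b := by
    have hD : D = ContinuousLinearMap.id ℝ F := mfderiv_extChartAt_self
    rw [hD, ContinuousLinearMap.inverse_id]
    rfl
  show fderiv ℝ Φ' (e u) b = A (D.inverse b)
  rw [h9, h11]

omit [FiniteDimensional ℝ F] in
/-- Vertical derivations kill the functions that are constant on the fibres. -/
theorem CartanGeometry.Sm.L_vert_eq_zero (h : C.Sm O Φ) (hu : u ∈ O) (hX : IsVert X)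
    (hinv : ∀ a : groupH m p, Φ (C.act u a) = Φ u) : C.L X Φ u = 0 := by
  obtain ⟨c, hc⟩ := hX.exists_flow
  have h0 : C.act u (c 0) = u := by rw [flow_zero hc, C.act_one]
  have h1 := C.hasDerivAt_flow (u := u) hc 0 (h.mdiffAt (by rw [h0]; exact hu))
  simp only [hinv] at h1
  rw [h0] at h1
  exact h1.unique (hasDerivAt_const _ _)

omit [FiniteDimensional ℝ F] in
/-- A function that is killed by `L X` is constant along the flow of `X`. -/
theorem CartanGeometry.Sm.flow_const (h : C.Sm O Φ) {c : ℝ → groupH m p}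
    (hc : ∀ t : ℝ, ((c t : (Matrix (Idx m) (Idx m) ℝ)ˣ) : Matrix (Idx m) (Idx m) ℝ)
      = NormedSpace.exp (t • (X : Matrix (Idx m) (Idx m) ℝ)))
    (hO : ∀ t, C.act u (c t) ∈ O) (h0 : ∀ v ∈ O, C.L X Φ v = 0) (t : ℝ) :
    Φ (C.act u (c t)) = Φ u := by
  have h1 : ∀ t, HasDerivAt (fun s => Φ (C.act u (c s))) 0 t := fun t => by
    have := C.hasDerivAt_flow (u := u) hc t (h.mdiffAt (hO t))
    rwa [h0 _ (hO t)] at this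
  have h2 := is_const_of_deriv_eq_zero (fun t => (h1 t).differentiableAt)
    (fun t => (h1 t).deriv) t 0
  simpa [flow_zero hc, C.act_one] using h2

end Curvature

/-! ### The grading of `𝔤` -/

section Decomposition

variable {m p : ℕ}

/-- The `𝔤₁`-component of an element of `𝔤`. -/
def plusPart (X : soAlg m p) (a : Fin m) : ℝ := (X : Matrix (Idx m) (Idx m) ℝ) iInf (iMid a)

/-- The `𝔤₀`-component of an element of `𝔤`. -/
def zPart (X : soAlg m p) : Matrix (Fin m) (Fin m) ℝ := zeroPart (X : Matrix (Idx m) (Idx m) ℝ)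

/-- The `𝔤₋₁`-component of an element of `𝔤`. -/
def mPart (X : soAlg m p) : Fin m → ℝ := minusPart (X : Matrix (Idx m) (Idx m) ℝ)

theorem plusMat_mem (ξ : Fin m → ℝ) : plusMat m p ξ ∈ soAlg m p := by
  rw [mem_skewAdjointMatricesSubmodule, Matrix.IsSkewAdjoint, Matrix.IsAdjointPair]
  ext a b
  rcases a with a | a | a <;> rcases b with b | b | b <;>
    simp [Matrix.mul_apply, formJ, plusMat, Matrix.transpose_apply, Fintype.sum_sum_type,
      mul_comm]
  · rw [mul_left_comm, eta_mul_self, mul_one]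
  · rw [mul_left_comm, eta_mul_self, mul_one]

/-- The inclusion of `𝔤₁` in `𝔤`. -/
def gPlus (ξ : Fin m → ℝ) : soAlg m p := ⟨plusMat m p ξ, plusMat_mem ξ⟩

variable (X : soAlg m p)

theorem soAlg_iInf_iZero : (X : Matrix (Idx m) (Idx m) ℝ) iInf iZero = 0 := by
  have h := congrFun (congrFun (soAlg_transpose X) iZero) iZero
  simp [Matrix.mul_apply, formJ, Fintype.sum_sum_type] at h
  linarith

theorem soAlg_iMid_iZero (i : Fin m) : (X : Matrix (Idx m) (Idx m) ℝ) (iMid i) iZero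
    = eta p i * (X : Matrix (Idx m) (Idx m) ℝ) iInf (iMid i) := by
  have h := congrFun (congrFun (soAlg_transpose X) (iMid i)) iZero
  simp [Matrix.mul_apply, formJ, Fintype.sum_sum_type] at h
  rw [h, ← mul_assoc, eta_mul_self, one_mul]

variable {X}

/-- The adjoint action of `𝔤` on `𝔤₋₁`, up to the `𝔤₁`-component. -/
theorem exists_soBr_eVec (X : soAlg m p) (a : Fin m) : ∃ Y : soAlg m p, IsVert Y ∧
    zPart Y = -br p (Pi.single a 1) (plusPart X) ∧ plusPart Y = 0 ∧
    soBr X (eVec a) = (∑ j, zPart X j a • eVec j) + Y := by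
  -- By the grading, `[𝔤₋₁, 𝔤₋₁] = 0` and `[𝔤₀, 𝔤₋₁] ⊆ 𝔤₋₁`; what remains is the bracket with the
  -- `𝔤₁`-component, which lies in `𝔤₀`.
  refine ⟨soBr X (eVec a) - ∑ j, zPart X j a • eVec j, ?_, ?_, ?_, by abel⟩
  · intro i
    simp [minusPart, soBr, eVec, gMinus, zPart, zeroPart, Matrix.sub_apply,
      Matrix.sum_apply, Matrix.mul_apply, Fintype.sum_sum_type, minusMat, Pi.single_apply]
  · ext i j
    have h1 : (X : Matrix (Idx m) (Idx m) ℝ) (iMid i) iZero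
      = eta p i * (X : Matrix (Idx m) (Idx m) ℝ) iInf (iMid i) := soAlg_iMid_iZero X i
    simp [soBr, eVec, gMinus, zPart, zeroPart, Matrix.sub_apply,
      Matrix.sum_apply, Matrix.mul_apply, Fintype.sum_sum_type, minusMat, Pi.single_apply, br,
      plusPart, h1]
    split_ifs <;> simp_all <;> ring
  · funext i
    have h1 := soAlg_iInf_iZero X
    simp [soBr, eVec, gMinus, zPart, zeroPart, Matrix.sub_apply,
      Matrix.sum_apply, Matrix.mul_apply, Fintype.sum_sum_type, minusMat, Pi.single_apply,
      plusPart, h1]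

end Decomposition

/-! ### Vertical derivatives of the iterated derivatives of a density -/

section Equivariance

variable {m p : ℕ} {M : Type*} [TopologicalSpace M] [ChartedSpace (Euc m) M]
  {F : Type*} [NormedAddCommGroup F] [NormedSpace ℝ F]
  {P : Type*} [TopologicalSpace P] [ChartedSpace F P] [IsManifold 𝓘(ℝ, F) ∞ P]
  {C : CartanGeometry m p M F P} {O : Set P} {Φ : P → ℝ} {u : P} {X Y : soAlg m p} {n k : ℕ}
  {lam δ : ℝ}

theorem CartanGeometry.Sm.nablaPow (h : C.Sm O Φ) (n : ℕ) (i : Fin n → Fin m) :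
    C.Sm O (C.nablaPow Φ n i) := by
  induction n with
  | zero => exact h
  | succ n ih => exact (ih (Fin.tail i)).L (eVec (i 0))

theorem CartanGeometry.nablaPow_cons (a : Fin m) (i : Fin n → Fin m) :
    C.nablaPow Φ (n + 1) (Fin.cons a i) = C.L (eVec a) (C.nablaPow Φ n i) := by
  show C.lieD _ _ = _
  rw [Fin.cons_zero, Fin.tail_cons]
  rfl

/-- The commutator of a vertical derivation with `L_{ω⁻¹(e_a)}`. -/
theorem CartanGeometry.Sm.L_eVec_comm (h : C.Sm O Φ) (hX : IsVert X) (hu : u ∈ O) {a : Fin m}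
    (hY : soBr X (eVec a) = (∑ j, zPart X j a • eVec j) + Y) :
    C.L X (C.L (eVec a) Φ) u = C.L (eVec a) (C.L X Φ) u
      + ∑ j, zPart X j a * C.L (eVec j) Φ u + C.L Y Φ u := by
  rw [h.L_comm_vert hX hu, hY, C.L_add_left, C.L_sum_left, ← add_assoc]
  simp only [C.L_smul_left]

/-- The contraction of `ic h T` with the preceding component of `D`. -/
def lower (h : Fin m → ℝ) : (n : ℕ) → Ten m n → ((j : ℕ) → Ten m j) → ℝ
  | 0, _, _ => 0
  | n + 1, T, D => ∑ i, ic h T i * D n i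

/-- Here the bracket acts on the slots after the frozen one only: each of the `n` slots gives `2`,
and the weight `lam` gives `lam * m`. -/
theorem sum_rho_br_cons {T : Ten m (n + 1)} (hT : T ∈ stf (etaMat m p) (n + 1)) (h : Fin m → ℝ)
    (i : Fin n → Fin m) :
    ∑ a, rho (-lam) (-br p (Pi.single a 1) h) (fun i => T (Fin.cons a i)) i
      = -(2 * n + lam * m) * ic h T i := by
  have h1 := sum_der_br hT h i
  simp only [rho_eq, der_neg, Pi.sub_apply, Pi.neg_apply, Pi.smul_apply, smul_eq_mul,
    Matrix.trace_neg, trace_br, Finset.sum_sub_distrib, Finset.sum_neg_distrib, h1]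
  rw [ic, Finset.mul_sum, Finset.mul_sum, ← Finset.sum_neg_distrib, ← Finset.sum_sub_distrib]
  refine Finset.sum_congr rfl fun a _ => ?_
  ring

/-- The vertical derivatives of the iterated derivatives of a density, contracted with a trace-free
symmetric tensor. -/
theorem CartanGeometry.sum_mul_L_nablaPow (hO : IsOpen O) (hΦ : C.Sm O Φ)
    (hL : ∀ X : soAlg m p, IsVert X → ∀ v ∈ O, C.L X Φ v = lam * (zPart X).trace * Φ v) (n : ℕ) :
    ∀ (X : soAlg m p), IsVert X → ∀ T ∈ stf (etaMat m p) n, ∀ v ∈ O,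
    ∑ i, T i * C.L X (C.nablaPow Φ n i) v
      = ∑ i, rho (-lam) (zPart X) T i * C.nablaPow Φ n i v
        - n * (lam * m + n - 1) * lower (plusPart X) n T (fun j i => C.nablaPow Φ j i v) := by
  induction n with
  | zero =>
    intro X hX T hT v hv
    simp [lower, rho_eq, der, CartanGeometry.nablaPow, hL X hX v hv]
    ring
  | succ n ih =>
    intro X hX T hT v hv
    have hD : ∀ i, C.Sm O (C.nablaPow Φ n i) := hΦ.nablaPow n
    -- The vertical field is moved past the outermost derivative. The remainder lies in `𝔤₀`, so the
    -- induction hypothesis applies to it without its lower-order term.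
    have h1 : ∀ a, ∑ i : Fin n → Fin m, T (Fin.cons a i) *
        C.L X (C.nablaPow Φ (n + 1) (Fin.cons a i)) v
        = C.L (eVec a) (fun v => ∑ i, T (Fin.cons a i) * C.L X (C.nablaPow Φ n i) v) v
          + ∑ j, ∑ i : Fin n → Fin m, zPart X j a * T (Fin.cons a i) *
            C.nablaPow Φ (n + 1) (Fin.cons j i) v
          + ∑ i, rho (-lam) (-br p (Pi.single a 1) (plusPart X)) (fun i => T (Fin.cons a i)) i
            * C.nablaPow Φ n i v := by
      intro a
      obtain ⟨Y, hY, hY1, hY2, hYe⟩ := exists_soBr_eVec X a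
      have h3 := fun i => (hD i).L_eVec_comm hX hv hYe
      have h4 := ih Y hY _ (stf_cons hT a) v hv
      have h5 : ∀ D, lower (0 : Fin m → ℝ) n (fun i => T (Fin.cons a i)) D = 0 := by
        intro D
        cases n <;> simp [lower, ic]
      rw [hY1, hY2, h5, mul_zero, sub_zero] at h4
      rw [← h4, CartanGeometry.Sm.L_sum _ hO (fun i _ => ((hD i).L X).const_mul _) hv,
        Finset.sum_comm (γ := Fin m), ← Finset.sum_add_distrib, ← Finset.sum_add_distrib]
      refine Finset.sum_congr rfl fun i _ => ?_
      rw [C.nablaPow_cons, h3, ((hD i).L X).L_const_mul hv, mul_add, mul_add, Finset.mul_sum]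
      congr 2
      refine Finset.sum_congr rfl fun j _ => ?_
      rw [C.nablaPow_cons]
      ring
    let w : Fin m → P → ℝ := fun a w => lower (plusPart X) n (fun i => T (Fin.cons a i))
      (fun j i => C.nablaPow Φ j i w)
    -- The factor `n` stays on both sides to cover degree `0`, where `lower` is zero by definition.
    have h8 : (∀ a, C.Sm O (w a)) ∧ n * ∑ a, C.L (eVec a) (w a) v
        = n * ∑ i, ic (plusPart X) T i * C.nablaPow Φ n i v := by
      cases n with
      | zero => exact ⟨fun a => CartanGeometry.Sm.const C hO 0, by simp⟩
      | succ n =>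
        have hs := fun a (i : Fin n → Fin m) => (hΦ.nablaPow n i).const_mul (ic (plusPart X)
          (fun i => T (Fin.cons a i)) i)
        refine ⟨fun a => CartanGeometry.Sm.sum _ hO fun i _ => hs a i, ?_⟩
        rw [sum_cons]
        congr 1
        refine Finset.sum_congr rfl fun a _ => ?_
        refine (CartanGeometry.Sm.L_sum _ hO (fun i _ => hs a i) hv).trans ?_
        refine Finset.sum_congr rfl fun i _ => ?_
        rw [(hΦ.nablaPow n i).L_const_mul hv, C.nablaPow_cons]
        congr 1
        exact Finset.sum_congr rfl fun b _ => by rw [stf_swap hT]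
    have h6 : ∀ a, C.L (eVec a) (fun v => ∑ i : Fin n → Fin m, T (Fin.cons a i) *
        C.L X (C.nablaPow Φ n i) v) v
        = ∑ i, rho (-lam) (zPart X) (fun i => T (Fin.cons a i)) i *
            C.nablaPow Φ (n + 1) (Fin.cons a i) v
          - n * (lam * m + n - 1) * C.L (eVec a) (w a) v := by
      intro a
      have h7 : ∀ v ∈ O, ∑ i : Fin n → Fin m, T (Fin.cons a i) * C.L X (C.nablaPow Φ n i) v
          = ∑ i, (rho (-lam) (zPart X) (fun i => T (Fin.cons a i)) i * C.nablaPow Φ n i v)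
            + (-(n * (lam * m + n - 1))) * w a v := fun v hv => by
        rw [ih X hX _ (stf_cons hT a) v hv]; ring
      rw [CartanGeometry.L_congr_on hO hv h7]
      rw [CartanGeometry.Sm.L_add (CartanGeometry.Sm.sum _ hO fun i _ => (hD i).const_mul _)
        ((h8.1 a).const_mul _) hv, (h8.1 a).L_const_mul hv,
        CartanGeometry.Sm.L_sum _ hO (fun i _ => (hD i).const_mul _) hv]
      have h9 : ∀ i, C.L (eVec a) (fun w => rho (-lam) (zPart X) (fun i => T (Fin.cons a i)) i *
          C.nablaPow Φ n i w) v = rho (-lam) (zPart X) (fun i => T (Fin.cons a i)) i *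
            C.nablaPow Φ (n + 1) (Fin.cons a i) v := fun i => by
        rw [(hD i).L_const_mul hv, C.nablaPow_cons]
      rw [Finset.sum_congr rfl fun i _ => h9 i]
      ring
    rw [sum_cons]
    simp only [h1, h6, Finset.sum_add_distrib, Finset.sum_sub_distrib, ← Finset.mul_sum]
    have h10 : ∑ a, ∑ i : Fin n → Fin m,
        rho (-lam) (-br p (Pi.single a 1) (plusPart X)) (fun i => T (Fin.cons a i)) i
            * C.nablaPow Φ n i v
        = -(2 * n + lam * m) * ∑ i, ic (plusPart X) T i * C.nablaPow Φ n i v := by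
      rw [Finset.sum_comm]
      simp only [← Finset.sum_mul, sum_rho_br_cons hT]
      rw [Finset.mul_sum]
      exact Finset.sum_congr rfl fun i _ => by ring
    have h11 : ∑ i, rho (-lam) (zPart X) T i * C.nablaPow Φ (n + 1) i v
        = ∑ a, ∑ i : Fin n → Fin m, rho (-lam) (zPart X) (fun i => T (Fin.cons a i)) i *
            C.nablaPow Φ (n + 1) (Fin.cons a i) v
          + ∑ a, ∑ j, ∑ i : Fin n → Fin m, zPart X j a * T (Fin.cons a i) *
            C.nablaPow Φ (n + 1) (Fin.cons j i) v := by
      rw [sum_cons, Finset.sum_comm (f := fun a j => ∑ i : Fin n → Fin m, zPart X j a *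
        T (Fin.cons a i) * C.nablaPow Φ (n + 1) (Fin.cons j i) v), ← Finset.sum_add_distrib]
      refine Finset.sum_congr rfl fun a _ => ?_
      rw [Finset.sum_comm, ← Finset.sum_add_distrib]
      refine Finset.sum_congr rfl fun i _ => ?_
      simp only [rho_eq, Pi.sub_apply, Pi.smul_apply, smul_eq_mul, der_cons, ← Finset.sum_mul]
      ring
    rw [h10, h11, lower]
    push_cast
    -- The coefficients add up as `n(λm + n - 1) + (2n + λm) = (n + 1)(λm + n)`.
    linear_combination (-(lam * m + n - 1)) * h8.2

end Equivariance

/-! ### Iterated invariant divergences and the invariance of the quantization -/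

section DivChain

variable {m p : ℕ} {M : Type*} [TopologicalSpace M] [ChartedSpace (Euc m) M]
  {F : Type*} [NormedAddCommGroup F] [NormedSpace ℝ F]
  {P : Type*} [TopologicalSpace P] [ChartedSpace F P] [IsManifold 𝓘(ℝ, F) ∞ P]
  {C : CartanGeometry m p M F P} {O : Set P} {Φ : P → ℝ} {u : P} {X Y : soAlg m p} {n k : ℕ}
  {lam δ : ℝ}

theorem linear_eq_sum (f : Ten m n →ₗ[ℝ] ℝ) (t : Ten m n) : f t = ∑ i, f (Pi.single i 1) * t i := by
  conv_lhs => rw [pi_eq_sum_univ' t, map_sum]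
  refine Finset.sum_congr rfl fun i _ => ?_
  rw [map_smul, smul_eq_mul, mul_comm]

theorem CartanGeometry.sm_linear {t : P → Ten m n} (hO : IsOpen O)
    (ht : ∀ i, C.Sm O fun v => t v i) (f : Ten m n →ₗ[ℝ] ℝ) : C.Sm O fun v => f (t v) := by
  rw [funext fun v => linear_eq_sum f (t v)]
  exact CartanGeometry.Sm.sum _ hO fun i _ => (ht i).const_mul _

theorem CartanGeometry.L_linear {t : P → Ten m n} (hO : IsOpen O)
    (ht : ∀ i, C.Sm O fun v => t v i) (hu : u ∈ O) (f : Ten m n →ₗ[ℝ] ℝ) :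
    C.L X (fun v => f (t v)) u = f (fun i => C.L X (fun v => t v i) u) := by
  rw [linear_eq_sum f (fun i => C.L X (fun v => t v i) u)]
  rw [funext fun v => linear_eq_sum f (t v), CartanGeometry.Sm.L_sum _ hO (fun i _ => (ht i).const_mul _) hu]
  exact Finset.sum_congr rfl fun i _ => (ht i).L_const_mul hu _

/-- The derivatives of a function with values in a subspace belong to the subspace. -/
theorem CartanGeometry.L_mem {t : P → Ten m n} (hO : IsOpen O) (ht : ∀ i, C.Sm O fun v => t v i)
    (hu : u ∈ O) {W : Submodule ℝ (Ten m n)} (hW : ∀ v ∈ O, t v ∈ W) :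
    (fun i => C.L X (fun v => t v i) u) ∈ W := by
  by_contra h
  -- A linear form that vanishes on the subspace commutes with the derivation, so it also vanishes
  -- on the derivative.
  obtain ⟨f, hf, hfW⟩ := Submodule.exists_le_ker_of_notMem h
  apply hf
  rw [← CartanGeometry.L_linear hO ht hu f,
    CartanGeometry.L_congr_on (Ψ := fun _ => 0) hO hu (fun v hv => hfW (hW v hv)), C.L_const]

/-- The linear form `T ↦ rho δ B T i`. -/
def rhoForm (δ : ℝ) (B : Matrix (Fin m) (Fin m) ℝ) (i : Fin n → Fin m) : Ten m n →ₗ[ℝ] ℝ where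
  toFun T := rho δ B T i
  map_add' S T := by
    simp only [rho, Pi.add_apply, mul_add, Finset.sum_add_distrib]; ring
  map_smul' c T := by
    simp only [rho, Pi.smul_apply, smul_eq_mul, RingHom.id_apply, mul_sub, Finset.mul_sum]
    congr 1
    · exact Finset.sum_congr rfl fun a _ => Finset.sum_congr rfl fun j _ => by ring
    · ring

variable (C) in
/-- The chain of the iterated invariant divergences of an equivariant trace-free symmetric
function. -/
structure CartanGeometry.DivChain (O : Set P) (δ : ℝ) (k : ℕ) (s : (n : ℕ) → P → Ten m n) :
    Prop where
  isOpen : IsOpen O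
  above : ∀ n, k < n → s n = 0
  top_smooth : ∀ i, C.Sm O fun u => s k u i
  top_mem : ∀ u ∈ O, s k u ∈ stf (etaMat m p) k
  top_vert : ∀ X : soAlg m p, IsVert X → ∀ u ∈ O, ∀ i,
    C.L X (fun v => s k v i) u = -rho δ (zPart X) (s k u) i
  step : ∀ n, n < k → ∀ u ∈ O, ∀ i,
    s n u i = ∑ a, C.L (eVec a) (fun v => s (n + 1) v (Fin.cons a i)) u

variable {s : (n : ℕ) → P → Ten m n}

theorem CartanGeometry.DivChain.smooth (h : C.DivChain O δ k s) (n : ℕ) (i : Fin n → Fin m) :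
    C.Sm O fun u => s n u i := by
  rcases lt_or_ge k n with hn | hn
  · rw [h.above n hn]; exact CartanGeometry.Sm.const C h.isOpen 0
  · induction hn using Nat.decreasingInduction with
    | self => exact h.top_smooth i
    | of_succ n hn ih =>
      exact (CartanGeometry.Sm.sum _ h.isOpen fun a _ => (ih (Fin.cons a i)).L (eVec a)).congr
        fun v hv => h.step n hn v hv i

theorem CartanGeometry.DivChain.mem (h : C.DivChain O δ k s) (n : ℕ) :
    ∀ u ∈ O, s n u ∈ stf (etaMat m p) n := by
  rcases lt_or_ge k n with hn | hn
  · rw [h.above n hn]; exact fun u _ => Submodule.zero_mem _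
  · induction hn using Nat.decreasingInduction with
    | self => exact h.top_mem
    | of_succ n hn ih =>
      intro u hu
      have h1 : s n u = ∑ a, fun i => C.L (eVec a) (fun v => s (n + 1) v (Fin.cons a i)) u := by
        funext i; rw [h.step n hn u hu i, Finset.sum_apply]
      rw [h1]
      exact Submodule.sum_mem _ fun a _ => stf_cons
        (CartanGeometry.L_mem (X := eVec a) h.isOpen (h.smooth (n + 1)) hu ih) a

/-- The vertical derivatives of the iterated divergences. -/
theorem CartanGeometry.DivChain.vert (h : C.DivChain O δ k s) (n : ℕ) (hn : n ≤ k) :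
    ∀ X : soAlg m p, IsVert X → ∀ u ∈ O, ∀ i, C.L X (fun v => s n v i) u
      = -rho δ (zPart X) (s n u) i
        + (k - n) * (m + k + n - 1 - m * δ) * ic (plusPart X) (s (n + 1) u) i := by
  induction hn using Nat.decreasingInduction with
  | self => intro X hX u hu i; rw [h.top_vert X hX u hu i]; ring
  | of_succ n hn ih =>
    intro X hX u hu i
    have hs := h.smooth (n + 1)
    let A : Fin m → Ten m (n + 1) := fun a i => C.L (eVec a) (fun v => s (n + 1) v i) u
    have h1 : C.L X (fun v => s n v i) u = ∑ a, (C.L (eVec a)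
          (C.L X (fun v => s (n + 1) v (Fin.cons a i))) u
        + ∑ j, zPart X j a * A j (Fin.cons a i)
        + rho δ (br p (Pi.single a 1) (plusPart X)) (s (n + 1) u) (Fin.cons a i)) := by
      rw [CartanGeometry.L_congr_on h.isOpen hu (fun v hv => h.step n hn v hv i),
        CartanGeometry.Sm.L_sum _ h.isOpen (fun a _ => (hs _).L _) hu]
      refine Finset.sum_congr rfl fun a _ => ?_
      obtain ⟨Y, hY, hY1, hY2, hYe⟩ := exists_soBr_eVec X a
      rw [(hs _).L_eVec_comm hX hu hYe, ih Y hY u hu, hY1, hY2]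
      simp [rho_eq, der_neg, ic, A]
      ring
    have h2 : ∀ a, C.L (eVec a) (C.L X (fun v => s (n + 1) v (Fin.cons a i))) u
        = -rho δ (zPart X) (A a) (Fin.cons a i)
          + (k - (n + 1)) * (m + k + (n + 1) - 1 - m * δ) *
            C.L (eVec a) (fun v => ic (plusPart X) (s (n + 2) v) (Fin.cons a i)) u := by
      intro a
      have h3 : ∀ v ∈ O, C.L X (fun v => s (n + 1) v (Fin.cons a i)) v
          = (-1) * rho δ (zPart X) (s (n + 1) v) (Fin.cons a i)
          + (k - (n + 1)) * (m + k + (n + 1) - 1 - m * δ) *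
            ic (plusPart X) (s (n + 2) v) (Fin.cons a i) := fun v hv => by
        rw [ih X hX v hv]; push_cast; ring
      have h4 : C.Sm O fun v => rho δ (zPart X) (s (n + 1) v) (Fin.cons a i) :=
        CartanGeometry.sm_linear h.isOpen hs (rhoForm δ (zPart X) (Fin.cons a i))
      have h5 : C.Sm O fun v => ic (plusPart X) (s (n + 2) v) (Fin.cons a i) :=
        CartanGeometry.Sm.sum _ h.isOpen fun b _ => (h.smooth (n + 2) _).const_mul _
      rw [CartanGeometry.L_congr_on h.isOpen hu h3,
        CartanGeometry.Sm.L_add (h4.const_mul _) (h5.const_mul _) hu, h4.L_const_mul hu,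
        h5.L_const_mul hu]
      have h6 := CartanGeometry.L_linear (X := eVec a) h.isOpen hs hu
        (rhoForm δ (zPart X) (Fin.cons a i))
      have h7 : C.L (eVec a) (fun v => rho δ (zPart X) (s (n + 1) v) (Fin.cons a i)) u
        = rho δ (zPart X) (A a) (Fin.cons a i) := h6
      rw [h7]; ring
    -- The factor is kept because the divergence relation one degree higher requires `n + 1 < k`;
    -- for `n + 1 = k` both sides are zero.
    have h8 : ((k : ℝ) - (n + 1)) * ∑ a,
        C.L (eVec a) (fun v => ic (plusPart X) (s (n + 2) v) (Fin.cons a i)) u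
        = (k - (n + 1)) * ic (plusPart X) (s (n + 1) u) i := by
      rcases Nat.lt_or_ge (n + 1) k with hk | hk
      · congr 1
        have h9 : ∀ a, C.L (eVec a) (fun v => ic (plusPart X) (s (n + 2) v) (Fin.cons a i)) u
            = ∑ b, plusPart X b * C.L (eVec a) (fun v => s (n + 2) v (Fin.cons a (Fin.cons b i))) u
            := by
          intro a
          have h10 : ∀ v ∈ O, ic (plusPart X) (s (n + 2) v) (Fin.cons a i)
              = ∑ b, plusPart X b * s (n + 2) v (Fin.cons a (Fin.cons b i)) := fun v hv =>
            Finset.sum_congr rfl fun b _ => by rw [stf_swap (h.mem (n + 2) v hv)]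
          rw [CartanGeometry.L_congr_on h.isOpen hu h10, CartanGeometry.Sm.L_sum _ h.isOpen
            (fun b _ => (h.smooth (n + 2) _).const_mul _) hu]
          exact Finset.sum_congr rfl fun b _ => (h.smooth (n + 2) _).L_const_mul hu _
        simp only [h9]
        rw [Finset.sum_comm, ic]
        refine Finset.sum_congr rfl fun b _ => ?_
        rw [h.step (n + 1) hk u hu, Finset.mul_sum]
      · have : (k : ℝ) = n + 1 := by exact_mod_cast (le_antisymm hk hn)
        rw [this]; ring
    have h11 : s n u = ∑ a, fun i => A a (Fin.cons a i) := by
      funext i; rw [h.step n hn u hu i, Finset.sum_apply]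
    have h12 : rho δ (zPart X) (s n u) i
        = ∑ a, (rho δ (zPart X) (A a) (Fin.cons a i) - ∑ j, zPart X a j * A a (Fin.cons j i)) := by
      have h13 := map_sum (rhoForm δ (zPart X) i) (fun a i => A a (Fin.cons a i)) Finset.univ
      rw [← h11] at h13
      refine h13.trans (Finset.sum_congr rfl fun a _ => ?_)
      show rho δ (zPart X) (fun i => A a (Fin.cons a i)) i = _
      simp only [rho_eq, Pi.sub_apply, der_cons, Pi.smul_apply]
      ring
    rw [h1, h12]
    simp only [h2, Finset.sum_add_distrib, Finset.sum_sub_distrib, sum_rho_br δ (h.mem (n + 1) u hu),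
      Finset.sum_neg_distrib, ← Finset.mul_sum]
    rw [Finset.sum_comm (f := fun a j => zPart X a j * A a (Fin.cons j i))]
    -- The coefficients add up as `(k-n-1)(m+k+n-mδ) + (m+2n-mδ) = (k-n)(m+k+n-1-mδ)`.
    linear_combination (m + k + (n + 1) - 1 - m * δ : ℝ) * h8

theorem sm_opQ_aux (h : C.DivChain O δ k s) (hΦ : C.Sm O Φ) (n : ℕ) (i : Fin n → Fin m) (c : ℝ) :
    C.Sm O fun u => (c • s n u) i * C.nablaPow Φ n i u :=
  ((h.smooth n i).const_mul c).mul (hΦ.nablaPow n i)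

/-- The vertical derivatives of the quantization of `p^* S` by the modification. -/
theorem CartanGeometry.DivChain.L_opQ (hm : m ≠ 0) (hcrit : ¬ IsCritical m δ)
    (h : C.DivChain O δ k s) (hΦ : C.Sm O Φ)
    (hL : ∀ X : soAlg m p, IsVert X → ∀ v ∈ O, C.L X Φ v = lam * (zPart X).trace * Φ v)
    (hX : IsVert X) (hu : u ∈ O) :
    C.L X (C.opQ k (fun n u => coeffC m lam δ k (k - n) • s n u) Φ) u
      = (lam + δ) * (zPart X).trace *
        C.opQ k (fun n u => coeffC m lam δ k (k - n) • s n u) Φ u := by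
  have h1 : C.L X (C.opQ k (fun n u => coeffC m lam δ k (k - n) • s n u) Φ) u
      = ∑ n ∈ Finset.range (k + 1), coeffC m lam δ k (k - n) *
        ∑ i, (C.L X (fun v => s n v i) u * C.nablaPow Φ n i u
          + s n u i * C.L X (C.nablaPow Φ n i) u) := by
    refine (CartanGeometry.Sm.L_sum _ h.isOpen (fun n _ => CartanGeometry.Sm.sum _ h.isOpen
      fun i _ => sm_opQ_aux h hΦ n i _) hu).trans ?_
    refine Finset.sum_congr rfl fun n _ => ?_
    rw [CartanGeometry.Sm.L_sum _ h.isOpen (fun i _ => sm_opQ_aux h hΦ n i _) hu, Finset.mul_sum]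
    refine Finset.sum_congr rfl fun i _ => ?_
    simp only [Pi.smul_apply, smul_eq_mul]
    rw [CartanGeometry.Sm.L_mul ((h.smooth n i).const_mul _) (hΦ.nablaPow n i) hu,
      (h.smooth n i).L_const_mul hu]
    ring
  have h2 : ∀ n ∈ Finset.range (k + 1), ∑ i, (C.L X (fun v => s n v i) u * C.nablaPow Φ n i u
          + s n u i * C.L X (C.nablaPow Φ n i) u)
      = (lam + δ) * (zPart X).trace * ∑ i, s n u i * C.nablaPow Φ n i u
        + (k - n) * (m + k + n - 1 - m * δ) *
          ∑ i, ic (plusPart X) (s (n + 1) u) i * C.nablaPow Φ n i u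
        - n * (lam * m + n - 1) *
          lower (plusPart X) n (s n u) (fun j i => C.nablaPow Φ j i u) := by
    intro n hn
    have hn' : n ≤ k := Nat.lt_succ_iff.1 (Finset.mem_range.1 hn)
    rw [Finset.sum_add_distrib, CartanGeometry.sum_mul_L_nablaPow h.isOpen hΦ hL n X hX _
      (h.mem n u hu) u hu, ← add_sub_assoc, ← Finset.sum_add_distrib, Finset.mul_sum,
      Finset.mul_sum, ← Finset.sum_add_distrib]
    congr 1
    refine Finset.sum_congr rfl fun i _ => ?_
    rw [h.vert n hn' X hX u hu i]
    simp only [rho_eq, Pi.sub_apply, Pi.smul_apply, smul_eq_mul]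
    ring
  -- The contraction produced by the symbol in degree `n` cancels the one produced by the density in
  -- degree `n + 1`. After the shift of the index the top term on one side and the bottom term on
  -- the other vanish by their factors `k - n` and `n`, and the rest is `coeffC_succ`.
  have h3 : ∑ n ∈ Finset.range (k + 1), coeffC m lam δ k (k - n) *
      ((k - n) * (m + k + n - 1 - m * δ) *
          ∑ i, ic (plusPart X) (s (n + 1) u) i * C.nablaPow Φ n i u)
      = ∑ n ∈ Finset.range (k + 1), coeffC m lam δ k (k - n) * (n * (lam * m + n - 1) *
          lower (plusPart X) n (s n u) (fun j i => C.nablaPow Φ j i u)) := by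
    rw [Finset.sum_range_succ, Finset.sum_range_succ']
    simp only [sub_self, zero_mul, mul_zero, add_zero, Nat.cast_zero]
    refine Finset.sum_congr rfl fun n hn => ?_
    have hn' : n < k := Finset.mem_range.1 hn
    have hm' : (m : ℝ) ≠ 0 := Nat.cast_ne_zero.2 hm
    have h4 := coeffC_succ hm lam hcrit (k := k) (l := k - (n + 1)) (by omega)
    rw [show k - (n + 1) + 1 = k - n by omega] at h4
    have e1 : ((k - (n + 1) : ℕ) : ℝ) = k - (n + 1) := by
      rw [Nat.cast_sub (by omega)]; push_cast; ring
    have e2 : (m : ℝ) * gam m δ (2 * k - 1 - (k - n : ℕ)) = m + k + n - 1 - m * δ := by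
      rw [gam, Nat.cast_sub hn'.le]; push_cast; field_simp; ring
    rw [e1, e2] at h4
    rw [lower]
    push_cast
    linear_combination (∑ i, ic (plusPart X) (s (n + 1) u) i * C.nablaPow Φ n i u) * h4
  have h5 : C.opQ k (fun n u => coeffC m lam δ k (k - n) • s n u) Φ u
      = ∑ n ∈ Finset.range (k + 1), coeffC m lam δ k (k - n) *
          ∑ i, s n u i * C.nablaPow Φ n i u := by
    refine Finset.sum_congr rfl fun n _ => ?_
    rw [Finset.mul_sum]
    exact Finset.sum_congr rfl fun i _ => by simp only [Pi.smul_apply, smul_eq_mul]; ring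
  rw [h1, Finset.sum_congr rfl fun n hn => by rw [h2 n hn, mul_sub, mul_add]]
  rw [Finset.sum_sub_distrib, Finset.sum_add_distrib, h3, add_sub_cancel_right, h5, Finset.mul_sum]
  exact Finset.sum_congr rfl fun n _ => by ring

end DivChain

/-! ### Existence and uniqueness of the modification `Ŝ` -/

section Modification

variable {m p : ℕ} {M : Type*} [TopologicalSpace M] [ChartedSpace (Euc m) M]
  {F : Type*} [NormedAddCommGroup F] [NormedSpace ℝ F]
  {P : Type*} [TopologicalSpace P] [ChartedSpace F P] [IsManifold 𝓘(ℝ, F) ∞ P]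
  {C : CartanGeometry m p M F P} {Φ : P → ℝ} {u : P} {n k : ℕ}
  {lam δ : ℝ} {s : (n : ℕ) → P → Ten m n}

/-- `opN` on trace-free symmetric functions is a multiple of the invariant divergence. -/
theorem CartanGeometry.opN_stf {t : P → Ten m (n + 1)} (ht : ∀ i, C.Sm univ fun v => t v i)
    (hW : ∀ v, t v ∈ stf (etaMat m p) (n + 1)) :
    C.opN lam t u = (-2 * ((n + 1) * (lam * m + n)) : ℝ) •
      fun i => ∑ a, C.L (eVec a) (fun v => t v (Fin.cons a i)) u := by
  funext i
  simp only [CartanGeometry.opN, Pi.smul_apply, Finset.sum_apply, smul_eq_mul]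
  rw [mul_assoc, Finset.mul_sum (a := ((n : ℝ) + 1) * (lam * m + n))]
  congr 1
  refine Finset.sum_congr rfl fun a _ => ?_
  have h1 : (fun i => C.lieD a (fun v => t v i) u) ∈ stf (etaMat m p) (n + 1) :=
    CartanGeometry.L_mem (X := eVec a) isOpen_univ ht (mem_univ u) fun v _ => hW v
  rw [gammaMap_stf lam _ h1]
  simp [ic, killingDual, Pi.single_apply, CartanGeometry.lieD_eq]

theorem casEig_sub_ne_zero (hm : m ≠ 0) (hcrit : ¬ IsCritical m δ) (hn : n < k) :
    casEig m δ k - casEig m δ n ≠ 0 := by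
  have h1 := casEig_sub hm δ (k := k) (l := k - n) (by omega)
  rw [show k - (k - n) = n by omega] at h1
  rw [h1]
  have h2 := gam_ne_zero hcrit (k := k) (l := k - n) (by omega) (by omega)
  have h3 : ((k - n : ℕ) : ℝ) ≠ 0 := Nat.cast_ne_zero.2 (by omega)
  have h4 : (m : ℝ) ≠ 0 := Nat.cast_ne_zero.2 hm
  refine mul_ne_zero (mul_ne_zero (by norm_num) h3) (mul_ne_zero h4 h2)

/-- For `n < k` this is the recursion of the numbers `C_{k,l}`. For `n ≥ k` both sides vanish, as
the chain is zero above `k` and the eigenvalue difference is zero at `k`. -/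
theorem CartanGeometry.DivChain.opN_eq (hm : m ≠ 0) (hcrit : ¬ IsCritical m δ)
    (h : C.DivChain univ δ k s) (n : ℕ) (u : P) :
    C.opN lam (fun u => coeffC m lam δ k (k - (n + 1)) • s (n + 1) u) u
      = (casEig m δ k - casEig m δ n) • coeffC m lam δ k (k - n) • s n u := by
  rw [CartanGeometry.opN_stf (t := fun u => coeffC m lam δ k (k - (n + 1)) • s (n + 1) u)
    (fun i => (h.smooth (n + 1) i).const_mul _)
    fun v => Submodule.smul_mem _ _ (h.mem (n + 1) v (mem_univ v))]
  funext i
  simp only [Pi.smul_apply, smul_eq_mul]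
  have h1 : ∀ a, C.L (eVec a) (fun v => coeffC m lam δ k (k - (n + 1)) *
      s (n + 1) v (Fin.cons a i)) u = coeffC m lam δ k (k - (n + 1)) *
        C.L (eVec a) (fun v => s (n + 1) v (Fin.cons a i)) u := fun a =>
    (h.smooth (n + 1) _).L_const_mul (mem_univ u) _
  simp only [h1, ← Finset.mul_sum]
  rcases lt_trichotomy n k with hn | rfl | hn
  · rw [← h.step n hn u (mem_univ u) i]
    have h2 := casEig_sub hm δ (k := k) (l := k - n) (by omega)
    rw [show k - (k - n) = n by omega] at h2
    rw [h2]
    have h4 := coeffC_succ hm lam hcrit (k := k) (l := k - (n + 1)) (by omega)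
    rw [show k - (n + 1) + 1 = k - n by omega] at h4
    have e1 : ((k - (n + 1) : ℕ) : ℝ) = k - (n + 1) := by
      rw [Nat.cast_sub (by omega)]; push_cast; ring
    rw [e1] at h4
    rw [Nat.cast_sub hn.le]
    linear_combination (2 * s n u i) * h4
  · rw [h.above (n + 1) (by omega), sub_self]
    simp [CartanGeometry.L_const]
  · rw [h.above (n + 1) (by omega), h.above n hn]
    simp [CartanGeometry.L_const]

/-- The modification of an equivariant trace-free symmetric function. -/
theorem CartanGeometry.DivChain.isModification (hm : m ≠ 0) (hcrit : ¬ IsCritical m δ)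
    (h : C.DivChain univ δ k s) : C.IsModification lam δ k (s k)
      (fun n u => coeffC m lam δ k (k - n) • s n u) where
  top := by simp [coeffC_zero]
  above n hn := by simp [h.above n hn]; rfl
  smooth n idx := contMDiffOn_univ.1 ((h.smooth n idx).const_mul _).smooth
  mem_tree n hn := by
    induction hn using Nat.decreasingInduction with
    | self =>
      intro u
      rw [Nat.sub_self]
      show _ ∈ traceFree p k
      rw [traceFree_eq_stf]
      exact Submodule.smul_mem _ _ (h.mem k u (mem_univ u))
    | of_succ n hn ih =>
      intro u
      -- A nonzero multiple of the component is a sum of maps `γ(ε^a)` applied to derivatives of the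
      -- next component, and derivatives of a function stay in the subspace of its values.
      rw [← Submodule.smul_mem_iff _ (casEig_sub_ne_zero hm hcrit hn), ← h.opN_eq hm hcrit,
        show k - n = k - (n + 1) + 1 by omega]
      refine Submodule.smul_mem _ _ (Submodule.sum_mem _ fun a _ => Submodule.subset_span ?_)
      refine ⟨_, _, ?_, rfl⟩
      exact CartanGeometry.L_mem (X := eVec a) isOpen_univ
        (fun i => (h.smooth (n + 1) i).const_mul _) (mem_univ u) fun v _ => ih v
  eigen := by
    refine ⟨casEig m δ k, fun v hv => ?_, fun n u => ?_⟩
    · rw [traceFree_eq_stf] at hv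
      exact casimir_stf δ hv
    · rw [h.opN_eq hm hcrit, casimir_stf δ (Submodule.smul_mem _ _ (h.mem n u (mem_univ u))),
        ← add_smul, add_sub_cancel]

/-- Needed when there are no nonzero trace-free tensors of degree `k`, which can happen for small
`m`; the constant `α` of the eigenvalue equation is then not determined. -/
theorem tree_eq_bot (h : traceFree (m := m) p k = ⊥) (lam : ℝ) (d n : ℕ) (hd : n + d = k) :
    tree (m := m) p lam d n = ⊥ := by
  induction d generalizing n with
  | zero => rw [← hd] at h; exact h
  | succ d ih =>
    refine eq_bot_iff.2 (Submodule.span_le.2 ?_)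
    rintro _ ⟨h, T', hT', rfl⟩
    rw [ih (n + 1) (by omega)] at hT'
    rw [(Submodule.mem_bot ℝ).1 hT']
    show _ = _
    funext i
    simp [gammaMap]

/-- A nonzero trace-free tensor forces `α` to be the eigenvalue in degree `k`. Since the Casimir
operator is a scalar on each degree of the tree, the equation then determines each component from
the next one. -/
theorem CartanGeometry.IsModification.unique (hm : m ≠ 0) (hcrit : ¬ IsCritical m δ)
    {T₀ : P → Ten m k} {T T' : (n : ℕ) → P → Ten m n} (h : C.IsModification lam δ k T₀ T)
    (h' : C.IsModification lam δ k T₀ T') : T = T' := by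
  funext n
  rcases lt_or_ge k n with hn | hn
  · rw [h.above n hn, h'.above n hn]
  by_cases hb : traceFree (m := m) p k = ⊥
  · funext u
    have h1 := h.mem_tree n hn u
    have h2 := h'.mem_tree n hn u
    rw [tree_eq_bot hb lam _ _ (by omega)] at h1 h2
    rw [(Submodule.mem_bot ℝ).1 h1, (Submodule.mem_bot ℝ).1 h2]
  have key : ∀ T : (n : ℕ) → P → Ten m n, C.IsModification lam δ k T₀ T → ∀ n, n < k → ∀ u,
      T n u = (casEig m δ k - casEig m δ n)⁻¹ • C.opN lam (T (n + 1)) u := by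
    intro T h n hn u
    obtain ⟨α, hα, he⟩ := h.eigen
    obtain ⟨v, hv, hv0⟩ := Submodule.exists_mem_ne_zero_of_ne_bot hb
    have h1 := hα v hv
    rw [traceFree_eq_stf] at hv
    rw [casimir_stf δ hv] at h1
    have h2 := smul_left_injective ℝ hv0 h1
    have h3 := he n u
    rw [casimir_stf δ (tree_le_stf lam _ _ (h.mem_tree n hn.le u)), ← h2] at h3
    rw [eq_inv_smul_iff₀ (casEig_sub_ne_zero hm hcrit hn), sub_smul, ← h3, add_sub_cancel_left]
  induction hn using Nat.decreasingInduction with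
  | self => rw [h.top, h'.top]
  | of_succ n hn ih =>
    funext u
    rw [key T h n hn u, key T' h' n hn u, ih]

/-- The components of `T₀` in degree `k`, and zero in the other degrees. -/
def singleP (k : ℕ) (T₀ : P → Ten m k) : (n : ℕ) → P → Ten m n := fun n u i =>
  if h : k = n then T₀ u (i ∘ Fin.cast h) else 0

/-- The invariant divergence of a graded tensor. -/
def CartanGeometry.divP (C : CartanGeometry m p M F P) (t : (n : ℕ) → P → Ten m n) :
    (n : ℕ) → P → Ten m n := fun n u i =>
  ∑ a, C.L (eVec a) (fun v => t (n + 1) v (Fin.cons a i)) u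

theorem CartanGeometry.exists_divChain (C : CartanGeometry m p M F P) {T₀ : P → Ten m k}
    (hs : ∀ i, C.Sm univ fun u => T₀ u i) (hst : ∀ u, T₀ u ∈ stf (etaMat m p) k)
    (hv : ∀ X : soAlg m p, IsVert X → ∀ u i,
      C.L X (fun v => T₀ v i) u = -rho δ (zPart X) (T₀ u) i) :
    ∃ s, C.DivChain univ δ k s ∧ s k = T₀ := by
  have h0 : C.divP^[k - k] (singleP k T₀) k = T₀ := by
    rw [Nat.sub_self]
    funext u i
    simp only [Function.iterate_zero, id_eq, singleP, dif_pos]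
    rfl
  -- Degree `n` is reached after `k - n` divergences. Above `k` the truncated difference is `0`,
  -- which leaves the vanishing components of `singleP`.
  refine ⟨fun n => C.divP^[k - n] (singleP k T₀) n, ⟨isOpen_univ, ?_, ?_, ?_, ?_, ?_⟩, h0⟩
  · intro n hn
    rw [Nat.sub_eq_zero_of_le hn.le]
    funext u i
    simp only [Function.iterate_zero, id_eq, singleP, dif_neg hn.ne]
    rfl
  · simpa only [h0] using hs
  · simpa only [h0] using fun u _ => hst u
  · simp only [h0]
    exact fun X hX u _ i => hv X hX u i
  · intro n hn u _ i
    rw [show k - n = (k - (n + 1)) + 1 by omega, Function.iterate_succ_apply']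
    rfl

end Modification

/-! ### Derivatives of determinants, their powers, and inverse matrices -/

section MatrixCalculus

variable {m : ℕ} {A : ℝ → Matrix (Fin m) (Fin m) ℝ} {A' : Matrix (Fin m) (Fin m) ℝ} {t : ℝ}

/-- Differentiating the permutation expansion column by column gives determinants with one column
replaced, and these are the diagonal entries of `adjugate * A'` by Cramer's rule. -/
theorem hasDerivAt_det (hA : ∀ i j, HasDerivAt (fun r => A r i j) (A' i j) t) :
    HasDerivAt (fun r => (A r).det) ((A t).adjugate * A').trace t := by
  have h1 : HasDerivAt (fun r => ∑ σ : Equiv.Perm (Fin m), (Equiv.Perm.sign σ : ℝ) *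
      ∏ i, A r (σ i) i) (∑ σ : Equiv.Perm (Fin m), (Equiv.Perm.sign σ : ℝ) *
        ∑ i, (∏ j ∈ Finset.univ.erase i, A t (σ j) j) • A' (σ i) i) t :=
    HasDerivAt.fun_sum fun σ _ => (HasDerivAt.fun_finsetProd fun i _ => hA (σ i) i).const_mul _
  have h2 : (fun r => (A r).det) = fun r => ∑ σ : Equiv.Perm (Fin m), (Equiv.Perm.sign σ : ℝ) *
      ∏ i, A r (σ i) i := by
    funext r
    rw [Matrix.det_apply']
  rw [h2]
  refine h1.congr_deriv ?_
  have h3 : ((A t).adjugate * A').trace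
      = ∑ i, ((A t).updateCol i (fun j => A' j i)).det := by
    simp only [Matrix.trace, Matrix.diag_apply]
    refine Finset.sum_congr rfl fun i _ => ?_
    rw [← Matrix.cramer_apply, Matrix.cramer_eq_adjugate_mulVec]
    rfl
  rw [h3]
  simp only [Matrix.det_apply', Finset.mul_sum]
  rw [Finset.sum_comm]
  refine Finset.sum_congr rfl fun i _ => Finset.sum_congr rfl fun σ _ => ?_
  congr 1
  rw [← Finset.prod_erase_mul _ _ (Finset.mem_univ i), smul_eq_mul]
  congr 1
  · refine Finset.prod_congr rfl fun j hj => ?_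
    rw [Matrix.updateCol_ne (Finset.ne_of_mem_erase hj)]
  · rw [Matrix.updateCol_self]

/-- `Real.log` ignores signs, so the absolute value disappears and smoothness off zero becomes
visible. -/
theorem abs_rpow_eq {x : ℝ} (hx : x ≠ 0) (lam : ℝ) : |x| ^ lam = Real.exp (Real.log x * lam) := by
  rw [Real.rpow_def_of_pos (abs_pos.2 hx), Real.log_abs]

/-- Jacobi's formula for the powers of the determinant. -/
theorem hasDerivAt_abs_det_rpow (hA : ∀ i j, HasDerivAt (fun r => A r i j) (A' i j) t)
    (h0 : (A t).det ≠ 0) (lam : ℝ) :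
    HasDerivAt (fun r => |(A r).det| ^ lam)
      (lam * ((A t)⁻¹ * A').trace * |(A t).det| ^ lam) t := by
  have h1 := hasDerivAt_det hA
  have h2 := ((h1.log h0).mul_const lam).exp
  have h3 : (fun r => |(A r).det| ^ lam) =ᶠ[𝓝 t] fun r => Real.exp (Real.log (A r).det * lam) := by
    filter_upwards [h1.continuousAt.eventually_ne h0] with r hr
    exact abs_rpow_eq hr lam
  refine (h2.congr_of_eventuallyEq h3).congr_deriv ?_
  rw [abs_rpow_eq h0, Matrix.inv_def, Matrix.smul_mul, Matrix.trace_smul, Ring.inverse_eq_inv',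
    smul_eq_mul]
  field_simp

open scoped Matrix.Norms.Operator in
theorem hasDerivAt_inv_entry (hA : ∀ i j, HasDerivAt (fun r => A r i j) (A' i j) t)
    (h0 : (A t).det ≠ 0) (i j : Fin m) :
    HasDerivAt (fun r => (A r)⁻¹ i j) (-((A t)⁻¹ * A' * (A t)⁻¹) i j) t := by
  have hM : HasDerivAt A A' t := by
    have h1 : HasDerivAt (fun r => ∑ i, ∑ j, A r i j • Matrix.single i j (1 : ℝ))
        (∑ i, ∑ j, A' i j • Matrix.single i j (1 : ℝ)) t :=
      HasDerivAt.fun_sum fun i _ => HasDerivAt.fun_sum fun j _ => (hA i j).smul_const _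
    have h2 : ∀ B : Matrix (Fin m) (Fin m) ℝ, ∑ i, ∑ j, B i j • Matrix.single i j (1 : ℝ) = B := by
      intro B
      conv_rhs => rw [Matrix.matrix_eq_sum_single B]
      simp [Matrix.smul_single]
    simpa only [h2] using h1
  have hu : IsUnit (A t) := (Matrix.isUnit_iff_isUnit_det _).2 (isUnit_iff_ne_zero.2 h0)
  have h1 := hasFDerivAt_ringInverse (𝕜 := ℝ) hu.unit
  have h2 : HasDerivAt (fun r => Ring.inverse (A r)) _ t := h1.comp_hasDerivAt t hM
  have h3 : HasFDerivAt (fun B : Matrix (Fin m) (Fin m) ℝ => B i j)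
    (LinearMap.toContinuousLinearMap (Matrix.entryLinearMap ℝ ℝ i j)) (Ring.inverse (A t)) :=
    (LinearMap.toContinuousLinearMap (Matrix.entryLinearMap ℝ ℝ i j)).hasFDerivAt
  have h4 := h3.comp_hasDerivAt t h2
  have h5 : ((fun B : Matrix (Fin m) (Fin m) ℝ => B i j) ∘ fun r => Ring.inverse (A r))
      = fun r => (A r)⁻¹ i j := by
    funext r
    simp only [Function.comp_apply, Matrix.nonsing_inv_eq_ringInverse]
  rw [h5] at h4
  refine h4.congr_deriv ?_
  simp [Matrix.coe_units_inv]
  rfl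

theorem contDiff_det : ContDiff ℝ ∞ fun B : Fin m → Fin m → ℝ => (Matrix.of B).det := by
  simp only [Matrix.det_apply', Matrix.of_apply]
  fun_prop

theorem contDiffOn_abs_det_rpow (lam : ℝ) :
    ContDiffOn ℝ ∞ (fun B : Fin m → Fin m → ℝ => |(Matrix.of B).det| ^ lam)
      {B | (Matrix.of B).det ≠ 0} := by
  have h1 : ContDiffOn ℝ ∞ (fun B : Fin m → Fin m → ℝ =>
      Real.exp (Real.log (Matrix.of B).det * lam)) {B | (Matrix.of B).det ≠ 0} :=
    ((contDiff_det.contDiffOn.log fun B hB => hB).mul contDiffOn_const).exp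
  exact h1.congr fun B hB => abs_rpow_eq hB lam

theorem contDiffOn_inv_entry (i j : Fin m) :
    ContDiffOn ℝ ∞ (fun B : Fin m → Fin m → ℝ => (Matrix.of B)⁻¹ i j)
      {B | (Matrix.of B).det ≠ 0} := by
  have h1 : ContDiff ℝ ∞ fun B : Fin m → Fin m → ℝ => (Matrix.of B).adjugate i j := by
    simp only [Matrix.adjugate_apply, Matrix.det_apply']
    refine ContDiff.sum fun σ _ => contDiff_const.mul (contDiff_prod fun a _ => ?_)
    simp only [Matrix.updateRow_apply]
    split_ifs
    · exact contDiff_const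
    · simp only [Matrix.of_apply]; fun_prop
  have h2 : ContDiffOn ℝ ∞ (fun B : Fin m → Fin m → ℝ =>
      ((Matrix.of B).det)⁻¹ * (Matrix.of B).adjugate i j) {B | (Matrix.of B).det ≠ 0} :=
    (contDiff_det.contDiffOn.inv fun B hB => hB).mul h1.contDiffOn
  refine h2.congr fun B _ => ?_
  rw [Matrix.inv_def, Ring.inverse_eq_inv']
  rfl

end MatrixCalculus

/-! ### Change of frame for all the indices of a tensor -/

section Transform

variable {m n : ℕ}

/-- The action of a matrix on all the indices of a tensor. -/
def tr (A : Matrix (Fin m) (Fin m) ℝ) (T : Ten m n) : Ten m n := fun j =>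
  ∑ i : Fin n → Fin m, (∏ a, A (i a) (j a)) * T i

variable (A B K G G' : Matrix (Fin m) (Fin m) ℝ)

theorem tr_cons (T : Ten m (n + 1)) (c : Fin m) (j : Fin n → Fin m) :
    tr A T (Fin.cons c j) = ∑ b, A b c * tr A (fun i => T (Fin.cons b i)) j := by
  simp only [tr]
  rw [sum_cons]
  refine Finset.sum_congr rfl fun b _ => ?_
  rw [Finset.mul_sum]
  refine Finset.sum_congr rfl fun i _ => ?_
  rw [Fin.prod_univ_succ]
  simp only [Fin.cons_zero, Fin.cons_succ]
  ring

theorem tr_zero (T : Ten m 0) : tr A T = T := by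
  funext j
  simp [tr, Subsingleton.elim _ j]

theorem tr_add (S T : Ten m n) : tr A (S + T) = tr A S + tr A T := by
  funext j
  simp [tr, mul_add, Finset.sum_add_distrib]

theorem tr_smul (c : ℝ) (T : Ten m n) : tr A (c • T) = c • tr A T := by
  funext j
  simp only [tr, Pi.smul_apply, smul_eq_mul, Finset.mul_sum]
  exact Finset.sum_congr rfl fun i _ => by ring

theorem tr_sum {ι : Type*} (s : Finset ι) (T : ι → Ten m n) :
    tr A (∑ x ∈ s, T x) = ∑ x ∈ s, tr A (T x) := by
  funext j
  simp only [tr, Finset.sum_apply, Finset.mul_sum]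
  exact Finset.sum_comm

theorem tr_tr (T : Ten m n) : tr A (tr B T) = tr (B * A) T := by
  funext j
  simp only [tr, Matrix.mul_apply, Finset.mul_sum]
  rw [Finset.sum_comm]
  refine Finset.sum_congr rfl fun l _ => ?_
  rw [Finset.prod_univ_sum, Fintype.piFinset_univ, Finset.sum_mul]
  refine Finset.sum_congr rfl fun i _ => ?_
  rw [Finset.prod_mul_distrib]
  ring

theorem tr_one (T : Ten m n) : tr 1 T = T := by
  funext j
  simp only [tr, Matrix.one_apply]
  rw [Finset.sum_eq_single j]
  · simp
  · intro i _ hij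
    obtain ⟨a, ha⟩ := Function.ne_iff.1 hij
    rw [Finset.prod_eq_zero (Finset.mem_univ a) (if_neg ha), zero_mul]
  · simp

theorem sum_mul_tr (S T : Ten m n) : ∑ j, S j * tr A T j = ∑ i, tr A.transpose S i * T i := by
  simp only [tr, Finset.mul_sum, Finset.sum_mul, Matrix.transpose_apply]
  rw [Finset.sum_comm]
  exact Finset.sum_congr rfl fun i _ => Finset.sum_congr rfl fun j _ => by ring

theorem tr_mem_sym {T : Ten m n} (hT : ∀ (s : Equiv.Perm (Fin n)) i, T (i ∘ s) = T i)
    (s : Equiv.Perm (Fin n)) (j : Fin n → Fin m) : tr A T (j ∘ s) = tr A T j := by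
  simp only [tr]
  rw [← (Equiv.arrowCongr s (Equiv.refl (Fin m))).symm.sum_comp]
  refine Finset.sum_congr rfl fun i _ => ?_
  have h1 : (Equiv.arrowCongr s (Equiv.refl (Fin m))).symm i = i ∘ s := rfl
  rw [h1, hT]
  congr 1
  exact Equiv.prod_comp s fun a => A (i a) (j a)

variable {A G G'}

/-- Transformation of the trace-free symmetric tensors. -/
theorem tr_mem_stf {c : ℝ} (h : A * G' * A.transpose = c • G) {T : Ten m n} (hT : T ∈ stf G n) :
    tr A T ∈ stf G' n := by
  match n, T, hT with
  | 0, T, hT => exact mem_stf_zero _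
  | 1, T, hT => exact mem_stf_one _
  | n + 2, T, hT =>
    refine mem_stf_of_cons_cons (tr_mem_sym A hT.1) fun j => ?_
    simp only [tr_cons]
    -- The trace with `G'` of the transformed tensor is the transform of the trace with `G`, up to
    -- `c`.
    have h1 : ∀ b d, ∑ x, ∑ y, G' x y * (A b x * A d y) = c * G b d := by
      intro b d
      have := congrFun (congrFun h b) d
      simp only [Matrix.mul_apply, Matrix.transpose_apply, Matrix.smul_apply, smul_eq_mul] at this
      rw [← this, Finset.sum_comm]
      refine Finset.sum_congr rfl fun y _ => ?_
      rw [Finset.sum_mul]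
      exact Finset.sum_congr rfl fun x _ => by ring
    have h2 : ∑ x, ∑ y, G' x y * ∑ b, A b x * ∑ d, A d y *
        tr A (fun i => T (Fin.cons b (Fin.cons d i))) j
        = ∑ b, ∑ d, (∑ x, ∑ y, G' x y * (A b x * A d y)) *
          tr A (fun i => T (Fin.cons b (Fin.cons d i))) j := by
      simp only [Finset.mul_sum, Finset.sum_mul]
      rw [sum_comm_four]
      exact Finset.sum_congr rfl fun b _ => Finset.sum_congr rfl fun d _ =>
        Finset.sum_congr rfl fun x _ => Finset.sum_congr rfl fun y _ => by ring
    rw [h2]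
    simp only [h1]
    have h3 : tr A (∑ b, ∑ d, G b d • fun i => T (Fin.cons b (Fin.cons d i))) j = 0 := by
      have h4 : (∑ b, ∑ d, G b d • fun i => T (Fin.cons b (Fin.cons d i))) = 0 := by
        funext i
        simpa using stf_trace hT i
      rw [h4]
      simp [tr]
    rw [tr_sum, Finset.sum_apply] at h3
    rw [show (0 : ℝ) = c * 0 by ring, ← h3, Finset.mul_sum]
    refine Finset.sum_congr rfl fun b _ => ?_
    rw [tr_sum, Finset.sum_apply, Finset.mul_sum]
    refine Finset.sum_congr rfl fun d _ => ?_
    rw [tr_smul]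
    simp only [Pi.smul_apply, smul_eq_mul]
    ring

section Derivative

variable {A : ℝ → Matrix (Fin m) (Fin m) ℝ} {A' K : Matrix (Fin m) (Fin m) ℝ} {t : ℝ}
  {T : ℝ → Ten m n} {T' : Ten m n}

theorem hasDerivAt_tr (hA : ∀ i j, HasDerivAt (fun r => A r i j) (A' i j) t)
    (hT : ∀ i, HasDerivAt (fun r => T r i) (T' i) t) (j : Fin n → Fin m) :
    HasDerivAt (fun r => tr (A r) (T r) j)
      (∑ b, ∑ i : Fin n → Fin m, (∏ a ∈ Finset.univ.erase b, A t (i a) (j a)) *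
        A' (i b) (j b) * T t i + tr (A t) T' j) t := by
  simp only [tr]
  have h1 := HasDerivAt.fun_sum (u := Finset.univ) fun (i : Fin n → Fin m) _ =>
    (HasDerivAt.fun_finsetProd (u := Finset.univ) fun a _ => hA (i a) (j a)).mul (hT i)
  refine h1.congr_deriv ?_
  simp only [Finset.sum_add_distrib, Finset.sum_mul, smul_eq_mul]
  rw [Finset.sum_comm]

/-- If `A` moves by `A K`, then `Kᵀ` acts as a derivation on the transformed tensor. If it moves by
`K A`, as in the companion lemma, `Kᵀ` acts on the tensor before the transformation. -/
theorem hasDerivAt_tr_right (hA : ∀ i j, HasDerivAt (fun r => A r i j) ((A t * K) i j) t)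
    (hT : ∀ i, HasDerivAt (fun r => T r i) (T' i) t) (j : Fin n → Fin m) :
    HasDerivAt (fun r => tr (A r) (T r) j)
      (der K.transpose (tr (A t) (T t)) j + tr (A t) T' j) t := by
  refine (hasDerivAt_tr hA hT j).congr_deriv ?_
  congr 1
  simp only [der, tr]
  refine Finset.sum_congr rfl fun b _ => ?_
  simp only [Finset.mul_sum]
  rw [Finset.sum_comm]
  refine Finset.sum_congr rfl fun i _ => ?_
  rw [Matrix.mul_apply, Finset.mul_sum, Finset.sum_mul]
  refine Finset.sum_congr rfl fun l _ => ?_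
  have h1 : ∏ a ∈ Finset.univ.erase b, A t (i a) (Function.update j b l a)
      = ∏ a ∈ Finset.univ.erase b, A t (i a) (j a) :=
    Finset.prod_congr rfl fun a ha => by rw [Function.update_of_ne (Finset.ne_of_mem_erase ha)]
  rw [← Finset.prod_erase_mul Finset.univ (fun a => A t (i a) (Function.update j b l a))
    (Finset.mem_univ b), Function.update_self, Matrix.transpose_apply, h1]
  ring

theorem hasDerivAt_tr_left (hA : ∀ i j, HasDerivAt (fun r => A r i j) ((K * A t) i j) t)
    (hT : ∀ i, HasDerivAt (fun r => T r i) (T' i) t) (j : Fin n → Fin m) :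
    HasDerivAt (fun r => tr (A r) (T r) j) (tr (A t) (der K.transpose (T t) + T') j) t := by
  refine (hasDerivAt_tr hA hT j).congr_deriv ?_
  rw [tr_add, Pi.add_apply]
  congr 1
  simp only [der, tr, Finset.mul_sum]
  conv_rhs => rw [Finset.sum_comm]
  refine Finset.sum_congr rfl fun b _ => ?_
  have h1 : ∀ i : Fin n → Fin m, (∏ a ∈ Finset.univ.erase b, A t (i a) (j a)) *
      (K * A t) (i b) (j b) * T t i = ∑ l, (∏ a ∈ Finset.univ.erase b, A t (i a) (j a)) *
      (K (i b) l * A t l (j b)) * T t i := by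
    intro i
    rw [Matrix.mul_apply, Finset.mul_sum, Finset.sum_mul]
  simp only [h1]
  rw [sum_update_swap b]
  refine Finset.sum_congr rfl fun i _ => Finset.sum_congr rfl fun l _ => ?_
  have h2 : ∏ a ∈ Finset.univ.erase b, A t (Function.update i b l a) (j a)
      = ∏ a ∈ Finset.univ.erase b, A t (i a) (j a) :=
    Finset.prod_congr rfl fun a ha => by rw [Function.update_of_ne (Finset.ne_of_mem_erase ha)]
  rw [← Finset.prod_erase_mul Finset.univ (fun a => A t (i a) (j a)) (Finset.mem_univ b),
    Function.update_self, Matrix.transpose_apply, h2]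
  ring

end Derivative

end Transform

/-! ### Coordinates as functions on `P`, their jacobian, and the passage to components -/

section Coordinates

variable {m p : ℕ} {M : Type*} [TopologicalSpace M] [ChartedSpace (Euc m) M]
  {F : Type*} [NormedAddCommGroup F] [NormedSpace ℝ F]
  {P : Type*} [TopologicalSpace P] [ChartedSpace F P] [IsManifold 𝓘(ℝ, F) ∞ P]
  {C : CartanGeometry m p M F P} {O : Set P} {Φ : P → ℝ} {u : P} {X Y : soAlg m p} {n k : ℕ}
  {lam δ : ℝ} {A B : P → Matrix (Fin m) (Fin m) ℝ}

variable (C) in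
/-- The entries of `A` are smooth on `O`. -/
def CartanGeometry.SmM (O : Set P) (A : P → Matrix (Fin m) (Fin m) ℝ) : Prop :=
  ∀ i j, C.Sm O fun v => A v i j

variable (C) in
/-- The entrywise derivative of a matrix-valued function. -/
def CartanGeometry.LM (X : soAlg m p) (A : P → Matrix (Fin m) (Fin m) ℝ) (u : P) :
    Matrix (Fin m) (Fin m) ℝ := Matrix.of fun i j => C.L X (fun v => A v i j) u

theorem CartanGeometry.SmM.mul (hO : IsOpen O) (hA : C.SmM O A) (hB : C.SmM O B) :
    C.SmM O fun v => A v * B v := fun i j => by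
  simp only [Matrix.mul_apply]
  exact Sm.sum _ hO fun l _ => (hA i l).mul (hB l j)

theorem CartanGeometry.SmM.transpose (hA : C.SmM O A) : C.SmM O fun v => (A v).transpose :=
  fun i j => hA j i

theorem CartanGeometry.SmM.contMDiffOn (hA : C.SmM O A) :
    ContMDiffOn 𝓘(ℝ, F) 𝓘(ℝ, Fin m → Fin m → ℝ) ∞ (fun v i j => A v i j) O :=
  contMDiffOn_pi_space.2 fun i => contMDiffOn_pi_space.2 fun j => (hA i j).smooth

theorem CartanGeometry.SmM.inv (hO : IsOpen O) (hA : C.SmM O A) (h0 : ∀ v ∈ O, (A v).det ≠ 0) :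
    C.SmM O fun v => (A v)⁻¹ := fun i j =>
  Sm.comp hO (contDiffOn_inv_entry i j) hA.contMDiffOn h0

theorem CartanGeometry.SmM.abs_det_rpow (hO : IsOpen O) (hA : C.SmM O A)
    (h0 : ∀ v ∈ O, (A v).det ≠ 0) (lam : ℝ) : C.Sm O fun v => |(A v).det| ^ lam :=
  Sm.comp hO (contDiffOn_abs_det_rpow lam) hA.contMDiffOn h0

theorem CartanGeometry.LM_mul (hO : IsOpen O) (hA : C.SmM O A) (hB : C.SmM O B) (hu : u ∈ O) :
    C.LM X (fun v => A v * B v) u = C.LM X A u * B u + A u * C.LM X B u := by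
  ext i j
  simp only [CartanGeometry.LM, Matrix.of_apply, Matrix.add_apply, Matrix.mul_apply]
  rw [Sm.L_sum _ hO (fun l _ => (hA i l).mul (hB l j)) hu, ← Finset.sum_add_distrib]
  exact Finset.sum_congr rfl fun l _ => (hA i l).L_mul (hB l j) hu

theorem CartanGeometry.LM_transpose : C.LM X (fun v => (A v).transpose) u = (C.LM X A u).transpose :=
  rfl

theorem CartanGeometry.LM_inv (hO : IsOpen O) (hA : C.SmM O A) (h0 : ∀ v ∈ O, (A v).det ≠ 0)
    (hu : u ∈ O) : C.LM X (fun v => (A v)⁻¹) u = -((A u)⁻¹ * C.LM X A u * (A u)⁻¹) := by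
  ext i j
  obtain ⟨γ, -, rfl, hγ⟩ := C.exists_curve_L u X
  refine (hγ _ ((hA.inv hO h0 i j).mdiffAt hu)).unique ?_
  exact hasDerivAt_inv_entry (A := fun s => A (γ s)) (fun i j => hγ _ ((hA i j).mdiffAt hu))
    (h0 _ hu) i j

/-- The vertical part of an element of `𝔤`. -/
def vertPart (X : soAlg m p) : soAlg m p := X - ∑ a, mPart X a • eVec a

theorem isVert_vertPart (X : soAlg m p) : IsVert (vertPart X) := fun i => by
  simp [minusPart, vertPart, eVec, gMinus, mPart, Matrix.sub_apply, Matrix.sum_apply, minusMat,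
    Pi.single_apply]

theorem CartanGeometry.L_eq_add : C.L X Φ u
    = ∑ a, mPart X a * C.L (eVec a) Φ u + C.L (vertPart X) Φ u := by
  conv_lhs => rw [show X = ∑ a, mPart X a • eVec a + vertPart X by simp [vertPart]]
  rw [C.L_add_left, C.L_sum_left]
  simp only [C.L_smul_left]

variable (C) in
/-- The jacobian matrix of the coordinate functions `x`. -/
def CartanGeometry.jac (x : P → Euc m) (u : P) : Matrix (Fin m) (Fin m) ℝ :=
  Matrix.of fun i a => C.L (eVec a) (fun v => x v i) u

variable (C) in
/-- The velocity of the map `β` in the direction of the coordinate `c`. -/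
def CartanGeometry.vel (β : Euc m → P) (c : Fin m) (y : Euc m) : soAlg m p :=
  C.conn (β y) (mfderiv (𝓡 m) 𝓘(ℝ, F) β y (EuclideanSpace.single c (1 : ℝ)))

theorem CartanGeometry.pd_comp {β : Euc m → P} (hβ : ContMDiff (𝓡 m) 𝓘(ℝ, F) ∞ β) {y : Euc m}
    (hΦ : C.Sm O Φ) (hy : β y ∈ O) (c : Fin m) :
    pd c (fun z => Φ (β z)) y = C.L (C.vel β c y) Φ (β y) := by
  have h1 : mfderiv (𝓡 m) 𝓘(ℝ, ℝ) (Φ ∘ β) y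
      = (mfderiv 𝓘(ℝ, F) 𝓘(ℝ, ℝ) Φ (β y)).comp (mfderiv (𝓡 m) 𝓘(ℝ, F) β y) :=
    mfderiv_comp y (hΦ.mdiffAt hy) (hβ.mdifferentiable (by simp) y)
  have h2 : pd c (fun z => Φ (β z)) y
      = mfderiv (𝓡 m) 𝓘(ℝ, ℝ) (Φ ∘ β) y (EuclideanSpace.single c (1 : ℝ)) := by
    rw [mfderiv_eq_fderiv]; rfl
  rw [h2, h1]
  simp only [CartanGeometry.L, CartanGeometry.vf, CartanGeometry.vel,
    LinearEquiv.symm_apply_apply]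
  rfl

variable (C) in
/-- Local coordinates on `M`, as functions on the part `O` of `P`. -/
structure CartanGeometry.Coord (O : Set P) (x : P → Euc m) : Prop where
  isOpen : IsOpen O
  smooth : ∀ i, C.Sm O fun u => x u i
  act_mem : ∀ u ∈ O, ∀ h, C.act u h ∈ O
  act_eq : ∀ u ∈ O, ∀ h, x (C.act u h) = x u
  sect : ∀ u ∈ O, ∃ β : Euc m → P, ContMDiff (𝓡 m) 𝓘(ℝ, F) ∞ β ∧ β (x u) = u ∧
    (∀ y, β y ∈ O) ∧ ∀ᶠ y in 𝓝 (x u), x (β y) = y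

variable {x : P → Euc m}

theorem CartanGeometry.Coord.smM_jac (h : C.Coord O x) : C.SmM O (C.jac x) := fun i a =>
  (h.smooth i).L (eVec a)

theorem CartanGeometry.Coord.L_vert (h : C.Coord O x) (hX : IsVert X) (hu : u ∈ O) (i : Fin m) :
    C.L X (fun v => x v i) u = 0 :=
  (h.smooth i).L_vert_eq_zero hu hX fun a => by rw [h.act_eq u hu]

/-- The identity `x ∘ β = id` is differentiated; the vertical part of the velocity does not move
`x`. -/
theorem CartanGeometry.Coord.jac_mul (h : C.Coord O x) {β : Euc m → P}
    (hβ : ContMDiff (𝓡 m) 𝓘(ℝ, F) ∞ β) {y : Euc m} (hy : β y ∈ O) (hx : ∀ᶠ z in 𝓝 y, x (β z) = z) :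
    C.jac x (β y) * (Matrix.of fun a c => mPart (C.vel β c y) a) = 1 := by
  ext i c
  have h1 := CartanGeometry.pd_comp hβ (h.smooth i) hy c
  have h2 : pd c (fun z => x (β z) i) y = if i = c then 1 else 0 := by
    have h3 : (fun z => x (β z) i) =ᶠ[𝓝 y] fun z => z i := by
      filter_upwards [hx] with z hz
      rw [hz]
    have h4 : HasFDerivAt (fun z : Euc m => z i) (EuclideanSpace.proj (𝕜 := ℝ) i) y :=
      (EuclideanSpace.proj (𝕜 := ℝ) i).hasFDerivAt
    simp only [pd]
    rw [h3.fderiv_eq, h4.fderiv]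
    simp
  rw [h2, C.L_eq_add, h.L_vert (isVert_vertPart _) hy, add_zero] at h1
  rw [Matrix.mul_apply, Matrix.one_apply, h1]
  exact Finset.sum_congr rfl fun a _ => mul_comm _ _

theorem CartanGeometry.Coord.det (h : C.Coord O x) : ∀ u ∈ O, (C.jac x u).det ≠ 0 := by
  intro u hu
  obtain ⟨β, hβ, h0, -, hx⟩ := h.sect u hu
  have h1 := h.jac_mul hβ (y := x u) (by rw [h0]; exact hu) hx
  rw [h0] at h1
  exact (Matrix.isUnit_det_of_right_inverse h1).ne_zero

theorem CartanGeometry.Coord.mPart_vel (h : C.Coord O x) {β : Euc m → P}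
    (hβ : ContMDiff (𝓡 m) 𝓘(ℝ, F) ∞ β) {y : Euc m} (hy : β y ∈ O) (hx : ∀ᶠ z in 𝓝 y, x (β z) = z)
    (c a : Fin m) : mPart (C.vel β c y) a = (C.jac x (β y))⁻¹ a c := by
  rw [Matrix.inv_eq_right_inv (h.jac_mul hβ hy hx)]
  rfl

/-- Vertical fields annihilate coordinates, so commuting past `ω⁻¹(e_a)` leaves only the action of
the `𝔤₀`-component on `𝔤₋₁`. -/
theorem CartanGeometry.Coord.LM_jac (h : C.Coord O x) (hX : IsVert X) (hu : u ∈ O) :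
    C.LM X (C.jac x) u = C.jac x u * zPart X := by
  ext i a
  obtain ⟨Y, hY, -, -, hb⟩ := exists_soBr_eVec X a
  have h1 := (h.smooth i).L_eVec_comm hX hu hb
  rw [h.L_vert hY hu, add_zero, C.L_congr_on h.isOpen hu fun v hv => h.L_vert hX hv i,
    C.L_const, zero_add] at h1
  simp only [CartanGeometry.LM, CartanGeometry.jac, Matrix.of_apply, Matrix.mul_apply]
  rw [h1]
  exact Finset.sum_congr rfl fun a _ => mul_comm _ _

/-- The components in the coordinate frame of a contravariant tensor density on `P`. -/
def trS (δ : ℝ) (E : Matrix (Fin m) (Fin m) ℝ) (T : Ten m n) : Ten m n :=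
  |E.det| ^ (-δ) • tr E.transpose T

/-- The components in the coordinate frame of a covariant tensor density on `P`. -/
def trD (lam : ℝ) (E : Matrix (Fin m) (Fin m) ℝ) (T : Ten m n) : Ten m n :=
  |E.det| ^ (-lam) • tr E⁻¹ T

theorem tr_zero_right (K : Matrix (Fin m) (Fin m) ℝ) : tr K (0 : Ten m n) = 0 := by
  funext j
  simp [tr]

variable {E : P → Matrix (Fin m) (Fin m) ℝ} {Θ : P → Ten m n} {K : Matrix (Fin m) (Fin m) ℝ}

theorem sm_trS (hO : IsOpen O) (hE : C.SmM O E) (h0 : ∀ v ∈ O, (E v).det ≠ 0)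
    (hΘ : ∀ i, C.Sm O fun v => Θ v i) (j : Fin n → Fin m) :
    C.Sm O fun v => trS δ (E v) (Θ v) j := by
  refine (hE.abs_det_rpow hO h0 _).mul (CartanGeometry.Sm.sum _ hO fun i _ => ?_)
  exact CartanGeometry.Sm.mul ⟨hO, contMDiffOn_finsetProd fun a _ => (hE (j a) (i a)).smooth⟩ (hΘ i)

theorem sm_trD (hO : IsOpen O) (hE : C.SmM O E) (h0 : ∀ v ∈ O, (E v).det ≠ 0)
    (hΘ : ∀ i, C.Sm O fun v => Θ v i) (j : Fin n → Fin m) :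
    C.Sm O fun v => trD lam (E v) (Θ v) j := by
  refine (hE.abs_det_rpow hO h0 _).mul (CartanGeometry.Sm.sum _ hO fun i _ => ?_)
  exact CartanGeometry.Sm.mul
    ⟨hO, contMDiffOn_finsetProd fun a _ => (hE.inv hO h0 (i a) (j a)).smooth⟩ (hΘ i)

/-- Two motions of the jacobian occur: right multiplication along the fibres, with `K` in `𝔤₀`, and
left multiplication in horizontal directions, with `K` the connection coefficients. In the first
case `K` acts on the tensor in the frame of `P`, in the second on its coordinate components. Symbols
and densities each need both. -/
theorem L_trS_of_right (hO : IsOpen O) (hE : C.SmM O E) (h0 : ∀ v ∈ O, (E v).det ≠ 0)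
    (hΘ : ∀ i, C.Sm O fun v => Θ v i) (hu : u ∈ O) (hK : C.LM X E u = E u * K)
    (j : Fin n → Fin m) : C.L X (fun v => trS δ (E v) (Θ v) j) u
      = trS δ (E u) (rho δ K (Θ u) + fun i => C.L X (fun v => Θ v i) u) j := by
  have h1 := (sm_trS (δ := δ) hO hE h0 hΘ j).mdiffAt hu
  obtain ⟨γ, -, rfl, hγ⟩ := C.exists_curve_L u X
  refine (hγ _ h1).unique ?_
  have hA : ∀ i j, HasDerivAt (fun s => E (γ s) i j) ((E (γ 0) * K) i j) 0 := fun i j => by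
    rw [← hK]; exact hγ _ ((hE i j).mdiffAt hu)
  have h2 := hasDerivAt_abs_det_rpow (A := fun s => E (γ s)) hA (h0 _ hu) (-δ)
  have h3 := hasDerivAt_tr_left (A := fun s => (E (γ s)).transpose) (K := K.transpose)
    (fun i j => by rw [← Matrix.transpose_mul]; exact hA j i)
    (fun i => hγ _ ((hΘ i).mdiffAt hu)) j
  refine (h2.mul h3).congr_deriv ?_
  rw [← Matrix.mul_assoc, Matrix.nonsing_inv_mul _ (isUnit_iff_ne_zero.2 (h0 _ hu)),
    Matrix.one_mul, rho_eq, Matrix.transpose_transpose, sub_eq_add_neg, ← neg_smul]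
  simp only [trS, tr_add, tr_smul, Pi.add_apply, Pi.smul_apply, smul_eq_mul]
  ring

theorem L_trS_of_left (hO : IsOpen O) (hE : C.SmM O E) (h0 : ∀ v ∈ O, (E v).det ≠ 0)
    (hΘ : ∀ i, C.Sm O fun v => Θ v i) (hu : u ∈ O) (hK : C.LM X E u = -(K * E u))
    (j : Fin n → Fin m) : C.L X (fun v => trS δ (E v) (Θ v) j) u
      = - rho δ K (trS δ (E u) (Θ u)) j + trS δ (E u) (fun i => C.L X (fun v => Θ v i) u) j := by
  have h1 := (sm_trS (δ := δ) hO hE h0 hΘ j).mdiffAt hu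
  obtain ⟨γ, -, rfl, hγ⟩ := C.exists_curve_L u X
  refine (hγ _ h1).unique ?_
  have hA : ∀ i j, HasDerivAt (fun s => E (γ s) i j) ((-(K * E (γ 0))) i j) 0 := fun i j => by
    rw [← hK]; exact hγ _ ((hE i j).mdiffAt hu)
  have h2 := hasDerivAt_abs_det_rpow (A := fun s => E (γ s)) hA (h0 _ hu) (-δ)
  have h3 := hasDerivAt_tr_right (A := fun s => (E (γ s)).transpose) (K := -K.transpose)
    (fun i j => by
      rw [Matrix.mul_neg, ← Matrix.transpose_mul, ← Matrix.transpose_neg]; exact hA j i)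
    (fun i => hγ _ ((hΘ i).mdiffAt hu)) j
  refine (h2.mul h3).congr_deriv ?_
  have h4 : ((E (γ 0))⁻¹ * -(K * E (γ 0))).trace = -K.trace := by
    rw [Matrix.mul_neg, Matrix.trace_neg, Matrix.trace_mul_comm, Matrix.mul_assoc,
      Matrix.mul_nonsing_inv _ (isUnit_iff_ne_zero.2 (h0 _ hu)), Matrix.mul_one]
  have h5 : der (-K.transpose).transpose (tr (E (γ 0)).transpose (Θ (γ 0))) j
      = -der K (tr (E (γ 0)).transpose (Θ (γ 0))) j := by
    rw [Matrix.transpose_neg, Matrix.transpose_transpose, der_neg]; rfl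
  have h6 : der K (trS δ (E (γ 0)) (Θ (γ 0))) j
      = |(E (γ 0)).det| ^ (-δ) * der K (tr (E (γ 0)).transpose (Θ (γ 0))) j := by
    simp only [der, trS, Pi.smul_apply, smul_eq_mul, Finset.mul_sum]
    exact Finset.sum_congr rfl fun a _ => Finset.sum_congr rfl fun b _ => by ring
  rw [h4, h5, rho_eq, Pi.sub_apply, h6]
  simp only [trS, Pi.smul_apply, smul_eq_mul]
  ring

theorem L_trD_of_right (hO : IsOpen O) (hE : C.SmM O E) (h0 : ∀ v ∈ O, (E v).det ≠ 0)
    (hΘ : ∀ i, C.Sm O fun v => Θ v i) (hu : u ∈ O) (hK : C.LM X E u = E u * K)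
    (j : Fin n → Fin m) : C.L X (fun v => trD lam (E v) (Θ v) j) u
      = trD lam (E u) (-rho (-lam) K.transpose (Θ u) + fun i => C.L X (fun v => Θ v i) u) j := by
  have h1 := (sm_trD (lam := lam) hO hE h0 hΘ j).mdiffAt hu
  have hF := C.LM_inv (X := X) hO hE h0 hu
  have hI := hE.inv hO h0
  obtain ⟨γ, -, rfl, hγ⟩ := C.exists_curve_L u X
  refine (hγ _ h1).unique ?_
  have hA : ∀ i j, HasDerivAt (fun s => E (γ s) i j) ((E (γ 0) * K) i j) 0 := fun i j => by
    rw [← hK]; exact hγ _ ((hE i j).mdiffAt hu)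
  have h2 := hasDerivAt_abs_det_rpow (A := fun s => E (γ s)) hA (h0 _ hu) (-lam)
  have h7 : (E (γ 0))⁻¹ * (E (γ 0) * K) = K := by
    rw [← Matrix.mul_assoc, Matrix.nonsing_inv_mul _ (isUnit_iff_ne_zero.2 (h0 _ hu)),
    Matrix.one_mul]
  rw [hK, h7] at hF
  have h3 := hasDerivAt_tr_left (A := fun s => (E (γ s))⁻¹) (K := -K)
    (fun i j => by rw [Matrix.neg_mul, ← hF]; exact hγ _ ((hI i j).mdiffAt hu))
    (fun i => hγ _ ((hΘ i).mdiffAt hu)) j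
  refine (h2.mul h3).congr_deriv ?_
  rw [h7, rho_eq, Matrix.transpose_neg, der_neg, Matrix.trace_transpose, neg_sub, sub_eq_add_neg]
  simp only [trD, tr_add, tr_smul, Pi.add_apply, Pi.smul_apply, smul_eq_mul]
  ring

theorem L_trD_of_left (hO : IsOpen O) (hE : C.SmM O E) (h0 : ∀ v ∈ O, (E v).det ≠ 0)
    (hΘ : ∀ i, C.Sm O fun v => Θ v i) (hu : u ∈ O) (hK : C.LM X E u = -(K * E u))
    (j : Fin n → Fin m) : C.L X (fun v => trD lam (E v) (Θ v) j) u
      = rho (-lam) K.transpose (trD lam (E u) (Θ u)) j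
        + trD lam (E u) (fun i => C.L X (fun v => Θ v i) u) j := by
  have h1 := (sm_trD (lam := lam) hO hE h0 hΘ j).mdiffAt hu
  have hF := C.LM_inv (X := X) hO hE h0 hu
  have hI := hE.inv hO h0
  obtain ⟨γ, -, rfl, hγ⟩ := C.exists_curve_L u X
  refine (hγ _ h1).unique ?_
  have hA : ∀ i j, HasDerivAt (fun s => E (γ s) i j) ((-(K * E (γ 0))) i j) 0 := fun i j => by
    rw [← hK]; exact hγ _ ((hE i j).mdiffAt hu)
  have h2 := hasDerivAt_abs_det_rpow (A := fun s => E (γ s)) hA (h0 _ hu) (-lam)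
  have h8 : K * E (γ 0) * (E (γ 0))⁻¹ = K := by
    rw [Matrix.mul_assoc, Matrix.mul_nonsing_inv _ (isUnit_iff_ne_zero.2 (h0 _ hu)),
      Matrix.mul_one]
  have h7 : -((E (γ 0))⁻¹ * -(K * E (γ 0)) * (E (γ 0))⁻¹) = (E (γ 0))⁻¹ * K := by
    rw [Matrix.mul_neg, Matrix.neg_mul, neg_neg, Matrix.mul_assoc, h8]
  rw [hK, h7] at hF
  have h3 := hasDerivAt_tr_right (A := fun s => (E (γ s))⁻¹) (K := K)
    (fun i j => by rw [← hF]; exact hγ _ ((hI i j).mdiffAt hu))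
    (fun i => hγ _ ((hΘ i).mdiffAt hu)) j
  refine (h2.mul h3).congr_deriv ?_
  have h4 : ((E (γ 0))⁻¹ * -(K * E (γ 0))).trace = -K.trace := by
    rw [Matrix.mul_neg, Matrix.trace_neg, Matrix.trace_mul_comm, h8]
  have h6 : der K.transpose (trD lam (E (γ 0)) (Θ (γ 0))) j
      = |(E (γ 0)).det| ^ (-lam) * der K.transpose (tr (E (γ 0))⁻¹ (Θ (γ 0))) j := by
    simp only [der, trD, Pi.smul_apply, smul_eq_mul, Finset.mul_sum]
    exact Finset.sum_congr rfl fun a _ => Finset.sum_congr rfl fun b _ => by ring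
  rw [h4, rho_eq, Pi.sub_apply, h6, Matrix.trace_transpose]
  simp only [trD, Pi.smul_apply, smul_eq_mul]
  ring

end Coordinates

/-! ### Connection coefficients defined by the points of `P` -/

section Gauge

variable {m p : ℕ} {M : Type*} [TopologicalSpace M] [ChartedSpace (Euc m) M]
  {F : Type*} [NormedAddCommGroup F] [NormedSpace ℝ F]
  {P : Type*} [TopologicalSpace P] [ChartedSpace F P] [IsManifold 𝓘(ℝ, F) ∞ P]
  {C : CartanGeometry m p M F P} {O : Set P} {Φ : P → ℝ} {u : P} {X Y V : soAlg m p} {n k : ℕ}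
  {lam δ : ℝ} {x : P → Euc m} {G : Euc m → Matrix (Fin m) (Fin m) ℝ} {Ω Ω' : Set (Euc m)}
  {β : Euc m → P}

variable (C) in
/-- The second derivatives of the coordinate function `x i`. -/
def CartanGeometry.hess (x : P → Euc m) (i : Fin m) (u : P) : Matrix (Fin m) (Fin m) ℝ :=
  Matrix.of fun a b => C.L (eVec a) (fun v => C.jac x v i b) u

variable (C) in
/-- The connection coefficients with upper index `i` determined by a point of `P`. -/
def CartanGeometry.chr (x : P → Euc m) (i : Fin m) (u : P) : Matrix (Fin m) (Fin m) ℝ :=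
  -((C.jac x u)⁻¹.transpose * C.hess x i u * (C.jac x u)⁻¹)

variable (C) in
/-- The matrices of connection coefficients in the direction of a coordinate. -/
def CartanGeometry.chrDir (x : P → Euc m) (c : Fin m) (u : P) : Matrix (Fin m) (Fin m) ℝ :=
  Matrix.of fun i d => C.chr x i u c d

variable (C) in
/-- The horizontal vector that lifts the coordinate vector `∂_c`. -/
def CartanGeometry.hor (x : P → Euc m) (c : Fin m) (u : P) : soAlg m p :=
  ∑ a, (C.jac x u)⁻¹ a c • eVec a

theorem CartanGeometry.L_hor (c : Fin m) : C.L (C.hor x c u) Φ u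
    = ∑ a, (C.jac x u)⁻¹ a c * C.L (eVec a) Φ u := by
  rw [CartanGeometry.hor, C.L_sum_left]
  simp only [C.L_smul_left]

theorem CartanGeometry.Coord.smM_hess (h : C.Coord O x) (i : Fin m) : C.SmM O (C.hess x i) :=
  fun a b => (h.smM_jac i b).L (eVec a)

theorem CartanGeometry.Coord.smM_inv (h : C.Coord O x) : C.SmM O fun v => (C.jac x v)⁻¹ :=
  h.smM_jac.inv h.isOpen h.det

theorem CartanGeometry.SmM.neg {A : P → Matrix (Fin m) (Fin m) ℝ} (hA : C.SmM O A) :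
    C.SmM O fun v => -A v := fun i j =>
  ((hA i j).const_mul (-1)).congr fun v _ => by simp

theorem CartanGeometry.LM_neg {A : P → Matrix (Fin m) (Fin m) ℝ} (hA : C.SmM O A) (hu : u ∈ O) :
    C.LM X (fun v => -A v) u = -C.LM X A u := by
  ext i j
  have h1 := (hA i j).L_const_mul (X := X) hu (-1)
  simp only [neg_one_mul] at h1
  exact h1

theorem CartanGeometry.LM_congr {A B : P → Matrix (Fin m) (Fin m) ℝ} (hO : IsOpen O) (hu : u ∈ O)
    (h : ∀ v ∈ O, A v = B v) : C.LM X A u = C.LM X B u := by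
  ext i j
  exact C.L_congr_on hO hu fun v hv => by rw [h v hv]

theorem CartanGeometry.Coord.smM_chr (h : C.Coord O x) (i : Fin m) : C.SmM O (C.chr x i) :=
  ((h.smM_inv.transpose.mul h.isOpen (h.smM_hess i)).mul h.isOpen h.smM_inv).neg

theorem CartanGeometry.Coord.inv_mul (h : C.Coord O x) (hu : u ∈ O) :
    (C.jac x u)⁻¹ * C.jac x u = 1 :=
  Matrix.nonsing_inv_mul _ (isUnit_iff_ne_zero.2 (h.det u hu))

theorem CartanGeometry.Coord.mul_inv (h : C.Coord O x) (hu : u ∈ O) :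
    C.jac x u * (C.jac x u)⁻¹ = 1 :=
  Matrix.mul_nonsing_inv _ (isUnit_iff_ne_zero.2 (h.det u hu))

theorem CartanGeometry.Coord.hess_eq (h : C.Coord O x) (i : Fin m) (hu : u ∈ O) :
    C.hess x i u = -((C.jac x u).transpose * C.chr x i u * C.jac x u) := by
  have h1 := h.inv_mul hu
  have h2 : (C.jac x u).transpose * (C.jac x u)⁻¹.transpose = 1 := by
    rw [← Matrix.transpose_mul, h1, Matrix.transpose_one]
  calc C.hess x i u = ((C.jac x u).transpose * (C.jac x u)⁻¹.transpose) * C.hess x i u *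
        ((C.jac x u)⁻¹ * C.jac x u) := by rw [h1, h2, Matrix.one_mul, Matrix.mul_one]
    _ = _ := by simp only [CartanGeometry.chr]; noncomm_ring

/-- The derivative of the jacobian in the horizontal directions. -/
theorem CartanGeometry.Coord.LM_hor_jac (h : C.Coord O x) (hu : u ∈ O) (c : Fin m) :
    C.LM (C.hor x c u) (C.jac x) u = -(C.chrDir x c u * C.jac x u) := by
  ext i b
  have h1 : C.chr x i u * C.jac x u = -((C.jac x u)⁻¹.transpose * C.hess x i u) := by
    rw [CartanGeometry.chr, Matrix.neg_mul, Matrix.mul_assoc, h.inv_mul hu, Matrix.mul_one]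
  have h2 := congrFun (congrFun h1 c) b
  have h3 : (C.chrDir x c u * C.jac x u) i b = (C.chr x i u * C.jac x u) c b := rfl
  rw [Matrix.neg_apply, h3, h2, Matrix.neg_apply, neg_neg, Matrix.mul_apply]
  simp only [CartanGeometry.LM, Matrix.of_apply]
  rw [C.L_hor]
  rfl

/-- As `𝔤₋₁` is abelian, the curvature on `𝔤₋₁` reduces to minus the value of `ω` on a bracket of
vector fields. -/
theorem eVec_mul_comm (a b : Fin m) :
    ((eVec a : soAlg m p) : Matrix (Idx m) (Idx m) ℝ) * (eVec b : soAlg m p)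
      - ((eVec b : soAlg m p) : Matrix (Idx m) (Idx m) ℝ) * (eVec a : soAlg m p) = 0 := by
  ext i j
  rcases i with i | i | i <;> rcases j with j | j | j <;>
    simp [eVec, gMinus, minusMat, Matrix.mul_apply, Fintype.sum_sum_type, Pi.single_apply]
  split_ifs <;> simp_all

variable (C) in
/-- Minus the curvature. -/
def CartanGeometry.bracket (a b : Fin m) (u : P) : soAlg m p :=
  C.conn u (VectorField.mlieBracket 𝓘(ℝ, F) (C.vf (eVec a)) (C.vf (eVec b)) u)

theorem CartanGeometry.IsNormal.isVert (hC : C.IsNormal) (a b : Fin m) (u : P) :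
    IsVert (C.bracket a b u) := fun i => by
  have h := hC.1 u a b i
  rw [CartanGeometry.curvature, eVec_mul_comm, zero_sub] at h
  simpa [minusPart, CartanGeometry.bracket] using h

theorem CartanGeometry.IsNormal.sum_zPart (hC : C.IsNormal) (b c : Fin m) (u : P) :
    ∑ a, zPart (C.bracket a b u) a c = 0 := by
  have h := hC.2 u b c
  have h1 : ∀ a, zeroPart (C.curvature (eVec a) (eVec b) u) a c = -zPart (C.bracket a b u) a c := by
    intro a
    rw [CartanGeometry.curvature, eVec_mul_comm, zero_sub]
    simp only [zeroPart, zPart, Matrix.of_apply, Matrix.neg_apply, CartanGeometry.bracket]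
    ring
  simp only [h1, Finset.sum_neg_distrib, neg_eq_zero] at h
  exact h

section Finite
variable [FiniteDimensional ℝ F]

/-- Without torsion the bracket of `ω⁻¹(e_a)` and `ω⁻¹(e_b)` is vertical, hence annihilates the
coordinates. -/
theorem CartanGeometry.Coord.hess_symm (h : C.Coord O x) (hC : C.IsNormal) (hu : u ∈ O)
    (i a b : Fin m) : C.hess x i u a b = C.hess x i u b a := by
  have h1 := (h.smooth i).L_comm (X := eVec a) (Y := eVec b) hu
  rw [show C.conn u _ = C.bracket a b u from rfl, h.L_vert (hC.isVert a b u) hu, sub_eq_zero] at h1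
  exact h1

theorem CartanGeometry.Coord.chr_symm (h : C.Coord O x) (hC : C.IsNormal) (hu : u ∈ O)
    (i c d : Fin m) : C.chr x i u c d = C.chr x i u d c := by
  have h1 : (C.hess x i u).transpose = C.hess x i u := by
    ext a b; exact h.hess_symm hC hu i b a
  have h2 : (C.chr x i u).transpose = C.chr x i u := by
    simp only [CartanGeometry.chr, Matrix.transpose_neg, Matrix.transpose_mul, h1,
      Matrix.transpose_transpose, Matrix.mul_assoc]
  exact (congrFun (congrFun h2 d) c).symm ▸ rfl

end Finite

theorem CartanGeometry.Coord.LM_vert_inv (h : C.Coord O x) (hV : IsVert V) (hu : u ∈ O) :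
    C.LM V (fun v => (C.jac x v)⁻¹) u = -(zPart V * (C.jac x u)⁻¹) := by
  rw [C.LM_inv h.isOpen h.smM_jac h.det hu, h.LM_jac hV hu, ← Matrix.mul_assoc, h.inv_mul hu,
    Matrix.one_mul]

/-- The field `V` is commuted past both derivatives. The first two terms are the tensorial action of
`𝔤₀`; the last bracket is the action of `[V, e_a]`, with `V` in `𝔤₁`, on the jacobian. -/
theorem CartanGeometry.Coord.LM_vert_hess (h : C.Coord O x) (hV : IsVert V) (hu : u ∈ O)
    (i : Fin m) : C.LM V (C.hess x i) u
      = C.hess x i u * zPart V + (zPart V).transpose * C.hess x i u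
        + ((∑ l, C.jac x u i l * (eta p l * plusPart V l)) • etaMat m p
          - Matrix.vecMulVec (C.jac x u i) (plusPart V)
          - Matrix.vecMulVec (plusPart V) (C.jac x u i)) := by
  ext a b
  obtain ⟨Y, hY, hz, -, hb⟩ := exists_soBr_eVec V a
  have h1 := (h.smM_jac i b).L_eVec_comm hV hu hb
  have h2 : ∀ v ∈ O, C.L V (fun w => C.jac x w i b) v
      = ∑ l, zPart V l b * C.jac x v i l := fun v hv => by
    have := congrFun (congrFun (h.LM_jac hV hv) i) b
    simp only [CartanGeometry.LM, Matrix.of_apply, Matrix.mul_apply] at this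
    rw [this]
    exact Finset.sum_congr rfl fun l _ => mul_comm _ _
  have h3 : C.L Y (fun w => C.jac x w i b) u = (C.jac x u * zPart Y) i b :=
    congrFun (congrFun (h.LM_jac hY hu) i) b
  rw [C.L_congr_on h.isOpen hu h2, CartanGeometry.Sm.L_sum _ h.isOpen
    (fun l _ => (h.smM_jac i l).const_mul _) hu, h3, hz] at h1
  simp only [(h.smM_jac i _).L_const_mul hu] at h1
  have h4 : (C.jac x u * -br p (Pi.single a 1) (plusPart V)) i b
      = (∑ l, C.jac x u i l * (eta p l * plusPart V l)) * (if a = b then eta p a else 0)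
        - C.jac x u i a * plusPart V b - plusPart V a * C.jac x u i b := by
    simp only [Matrix.neg_apply, Matrix.mul_apply, br_single, mul_neg, mul_sub, mul_add,
      Finset.sum_neg_distrib, Finset.sum_sub_distrib, Finset.sum_add_distrib]
    have e1 : ∑ l, C.jac x u i l * (if l = a then plusPart V b else 0)
        = C.jac x u i a * plusPart V b := by simp
    have e2 : ∑ l, C.jac x u i l * (if l = b then plusPart V a else 0)
        = C.jac x u i b * plusPart V a := by simp
    rw [e1, e2]
    by_cases hab : a = b
    · subst hab
      simp only [if_true, Finset.sum_mul]
      have : ∀ l, C.jac x u i l * (eta p l * plusPart V l * eta p a)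
          = C.jac x u i l * (eta p l * plusPart V l) * eta p a := fun l => by ring
      simp only [this]
      ring
    · have hba : ¬ b = a := fun e => hab e.symm
      simp [hab, hba]
      ring
  rw [h4] at h1
  simp only [Matrix.add_apply, Matrix.sub_apply, Matrix.smul_apply, etaMat, Matrix.diagonal_apply,
    Matrix.vecMulVec_apply, smul_eq_mul, Matrix.mul_apply, Matrix.transpose_apply]
  refine h1.trans ?_
  have e3 : ∑ l, zPart V l b * C.L (eVec a) (fun v => C.jac x v i l) u
      = ∑ l, C.hess x i u a l * zPart V l b := Finset.sum_congr rfl fun l _ => mul_comm _ _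
  rw [e3]
  simp only [CartanGeometry.hess, Matrix.of_apply]

/-- The connection coefficients depend on the point of the fibre only through the
`𝔤₁`-component. -/
theorem CartanGeometry.Coord.LM_vert_chr (h : C.Coord O x) (hV : IsVert V) (hu : u ∈ O)
    (i c d : Fin m) : C.LM V (C.chr x i) u c d
      = (if i = c then ∑ b, plusPart V b * (C.jac x u)⁻¹ b d else 0)
        + (if i = d then ∑ b, plusPart V b * (C.jac x u)⁻¹ b c else 0)
        - (∑ l, C.jac x u i l * (eta p l * plusPart V l)) *
          ((C.jac x u)⁻¹.transpose * etaMat m p * (C.jac x u)⁻¹) c d := by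
  have hF := h.smM_inv
  have h1 := h.smM_hess i
  have e1 : C.LM V (C.chr x i) u = -((C.jac x u)⁻¹.transpose *
      ((∑ l, C.jac x u i l * (eta p l * plusPart V l)) • etaMat m p
          - Matrix.vecMulVec (C.jac x u i) (plusPart V)
          - Matrix.vecMulVec (plusPart V) (C.jac x u i)) * (C.jac x u)⁻¹) := by
    have e2 := C.LM_neg (X := V) ((hF.transpose.mul h.isOpen h1).mul h.isOpen hF) hu
    rw [C.LM_mul h.isOpen (hF.transpose.mul h.isOpen h1) hF hu,
      C.LM_mul h.isOpen hF.transpose h1 hu, C.LM_transpose, h.LM_vert_inv hV hu,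
      h.LM_vert_hess hV hu, Matrix.transpose_neg, Matrix.transpose_mul] at e2
    refine e2.trans ?_
    noncomm_ring
  rw [e1]
  have e3 : Matrix.vecMul (C.jac x u i) (C.jac x u)⁻¹ = fun d => if i = d then 1 else 0 := by
    funext d
    have := congrFun (congrFun (h.mul_inv hu) i) d
    rw [Matrix.one_apply] at this
    exact this
  have e4 : (C.jac x u)⁻¹.transpose.mulVec (C.jac x u i) = fun d => if i = d then 1 else 0 := by
    rw [Matrix.mulVec_transpose, e3]
  rw [Matrix.mul_sub, Matrix.mul_sub, Matrix.sub_mul, Matrix.sub_mul, Matrix.mul_smul,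
    Matrix.smul_mul, Matrix.mul_vecMulVec, Matrix.mul_vecMulVec, Matrix.vecMulVec_mul,
    Matrix.vecMulVec_mul, e3, e4, Matrix.mulVec_transpose]
  simp only [Matrix.neg_apply, Matrix.sub_apply, Matrix.smul_apply, Matrix.vecMulVec_apply,
    Matrix.vecMul, dotProduct, smul_eq_mul, ite_mul, mul_ite, one_mul, zero_mul, mul_one, mul_zero]
  ring

end Gauge

/-! ### The Levi-Civita connection and the Ricci tensor along an adapted section -/

section Ricci

variable {m p : ℕ} {M : Type*} [TopologicalSpace M] [ChartedSpace (Euc m) M]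
  {F : Type*} [NormedAddCommGroup F] [NormedSpace ℝ F]
  {P : Type*} [TopologicalSpace P] [ChartedSpace F P] [IsManifold 𝓘(ℝ, F) ∞ P]
  {C : CartanGeometry m p M F P} {O : Set P} {Φ : P → ℝ} {u : P} {X Y V : soAlg m p} {n k : ℕ}
  {lam δ : ℝ} {x : P → Euc m} {G : Euc m → Matrix (Fin m) (Fin m) ℝ} {Ω Ω' : Set (Euc m)}
  {β : Euc m → P} {y : Euc m}

variable (C) in
/-- Coordinates in which the metric of the conformal structure is `G`. -/
structure CartanGeometry.ConfCoord (O : Set P) (x : P → Euc m)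
    (G : Euc m → Matrix (Fin m) (Fin m) ℝ) (Ω : Set (Euc m)) : Prop extends C.Coord O x where
  metric : IsMetricOn G Ω
  maps : ∀ u ∈ O, x u ∈ Ω
  conf : ∀ u ∈ O, ∃ s : ℝ, s ≠ 0 ∧
    (C.jac x u).transpose * G (x u) * C.jac x u = s • etaMat m p

variable (C) in
/-- The factor by which the frames determined by the points of `P` fail to be orthonormal. -/
def CartanGeometry.scale (x : P → Euc m) (G : Euc m → Matrix (Fin m) (Fin m) ℝ) (u : P) : ℝ :=
  (1 / (m : ℝ)) * ∑ a, eta p a * ((C.jac x u).transpose * G (x u) * C.jac x u) a a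

theorem CartanGeometry.scale_eq (hm : m ≠ 0) {s : ℝ}
    (hs : (C.jac x u).transpose * G (x u) * C.jac x u = s • etaMat m p) : C.scale x G u = s := by
  have hm' : (m : ℝ) ≠ 0 := Nat.cast_ne_zero.2 hm
  rw [CartanGeometry.scale, hs]
  have : ∀ a : Fin m, eta p a * (s • etaMat m p) a a = s := fun a => by
    rw [Matrix.smul_apply, etaMat, Matrix.diagonal_apply_eq, smul_eq_mul, mul_left_comm,
      eta_mul_self, mul_one]
  simp only [this, Finset.sum_const, Finset.card_univ, Fintype.card_fin, nsmul_eq_mul]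
  field_simp

theorem CartanGeometry.ConfCoord.scale_ne (h : C.ConfCoord O x G Ω) (hm : m ≠ 0) (hu : u ∈ O) :
    C.scale x G u ≠ 0 := by
  obtain ⟨s, hs0, hs⟩ := h.conf u hu
  rwa [C.scale_eq hm hs]

theorem CartanGeometry.ConfCoord.conf_scale (h : C.ConfCoord O x G Ω) (hm : m ≠ 0) (hu : u ∈ O) :
    (C.jac x u).transpose * G (x u) * C.jac x u = C.scale x G u • etaMat m p := by
  obtain ⟨s, -, hs⟩ := h.conf u hu
  rw [C.scale_eq hm hs, hs]

theorem CartanGeometry.Coord.sm_comp (h : C.Coord O x) {f : Euc m → ℝ} (hf : ContDiffOn ℝ ∞ f Ω)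
    (hx : ∀ u ∈ O, x u ∈ Ω) : C.Sm O fun u => f (x u) := by
  have h1 : ContDiffOn ℝ ∞ (fun z : Fin m → ℝ => f ((EuclideanSpace.equiv (Fin m) ℝ).symm z))
      ((EuclideanSpace.equiv (Fin m) ℝ).symm ⁻¹' Ω) :=
    hf.comp (EuclideanSpace.equiv (Fin m) ℝ).symm.contDiff.contDiffOn fun z hz => hz
  exact CartanGeometry.Sm.comp (Θ := fun v i => x v i) h.isOpen h1
    (CartanGeometry.Sm.pi h.smooth) hx

theorem CartanGeometry.ConfCoord.smM_metric (h : C.ConfCoord O x G Ω) :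
    C.SmM O fun u => G (x u) := fun i j => h.sm_comp (h.metric.smooth i j) h.maps

theorem CartanGeometry.ConfCoord.smM_form (h : C.ConfCoord O x G Ω) :
    C.SmM O fun u => (C.jac x u).transpose * G (x u) * C.jac x u :=
  (h.smM_jac.transpose.mul h.isOpen h.smM_metric).mul h.isOpen h.smM_jac

theorem CartanGeometry.ConfCoord.sm_scale (h : C.ConfCoord O x G Ω) : C.Sm O (C.scale x G) :=
  (CartanGeometry.Sm.sum _ h.isOpen fun a _ => (h.smM_form a a).const_mul _).const_mul _

variable (C) in
/-- A section over `Ω'` along which the horizontal derivatives of `scale` vanish. -/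
structure CartanGeometry.GaugeSection (O : Set P) (x : P → Euc m)
    (G : Euc m → Matrix (Fin m) (Fin m) ℝ) (Ω' : Set (Euc m)) (β : Euc m → P) : Prop where
  isOpen : IsOpen Ω'
  smooth : ContMDiff (𝓡 m) 𝓘(ℝ, F) ∞ β
  mem : ∀ y ∈ Ω', β y ∈ O
  x_eq : ∀ y ∈ Ω', x (β y) = y
  flat : ∀ y ∈ Ω', ∀ b, C.L (eVec b) (C.scale x G) (β y) = 0

/-- A coordinate derivative along the section is a horizontal derivative plus a vertical one,
because the `𝔤₋₁`-component of the velocity is the inverse jacobian. -/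
theorem CartanGeometry.GaugeSection.pd_eq (hβ : C.GaugeSection O x G Ω' β) (h : C.Coord O x)
    (hy : y ∈ Ω') (hΦ : C.Sm O Φ) (c : Fin m) : pd c (fun z => Φ (β z)) y
      = C.L (C.hor x c (β y)) Φ (β y) + C.L (vertPart (C.vel β c y)) Φ (β y) := by
  rw [CartanGeometry.pd_comp hβ.smooth hΦ (hβ.mem y hy), C.L_eq_add, C.L_hor]
  congr 1
  refine Finset.sum_congr rfl fun a _ => ?_
  rw [h.mPart_vel hβ.smooth (hβ.mem y hy)
    (Filter.eventually_of_mem (hβ.isOpen.mem_nhds hy) hβ.x_eq)]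

section Finite
variable [FiniteDimensional ℝ F]

/-- In the gauge `scale = 1`, the connection coefficients are the Christoffel symbols. -/
theorem CartanGeometry.GaugeSection.chr_eq (hβ : C.GaugeSection O x G Ω' β)
    (h : C.ConfCoord O x G Ω) (hC : C.IsNormal) (hm : m ≠ 0) (hy : y ∈ Ω') (i c d : Fin m) :
    C.chr x i (β y) c d = christoffel G i c d y := by
  have hu := hβ.mem y hy
  have hxy := hβ.x_eq y hy
  have hyΩ : y ∈ Ω := hxy ▸ h.maps _ hu
  refine h.metric.eq_christoffel hyΩ (fun i c d => C.chr x i (β y) c d)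
    (fun i c d => h.chr_symm hC hu i c d) (fun a b c => ?_) i c d
  have h1 : pd c (fun z => G z a b) y = C.LM (C.hor x c (β y)) (fun v => G (x v)) (β y) a b := by
    have h2 := hβ.pd_eq h.toCoord hy (h.smM_metric a b) c
    rw [(h.smM_metric a b).L_vert_eq_zero hu (isVert_vertPart _)
      fun g => congrArg (fun z => G z a b) (h.act_eq _ hu g), add_zero] at h2
    have h3 : pd c (fun z => G (x (β z)) a b) y = pd c (fun z => G z a b) y :=
      pd_congr hβ.isOpen (fun z hz => by rw [hβ.x_eq z hz]) hy c
    rw [← h3, h2]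
    rfl
  -- The matrix `Eᵀ G E` is `scale` times a constant matrix, and the horizontal derivatives of
  -- `scale` vanish on the section. Expanding the product gives metric compatibility of the
  -- coefficients; with their symmetry, the Levi-Civita connection is recognized.
  have h3 : C.LM (C.hor x c (β y)) (fun v => (C.jac x v).transpose * G (x v) * C.jac x v) (β y)
      = 0 := by
    rw [C.LM_congr h.isOpen hu (fun v hv => h.conf_scale hm hv)]
    ext a b
    simp only [CartanGeometry.LM, Matrix.of_apply, Matrix.smul_apply, smul_eq_mul, mul_comm _
      (etaMat m p a b), Matrix.zero_apply]
    rw [h.sm_scale.L_const_mul hu, C.L_hor]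
    simp [hβ.flat y hy]
  rw [C.LM_mul h.isOpen (h.smM_jac.transpose.mul h.isOpen h.smM_metric) h.smM_jac hu,
    C.LM_mul h.isOpen h.smM_jac.transpose h.smM_metric hu, C.LM_transpose, h.LM_hor_jac hu] at h3
  set E := C.jac x (β y)
  set K := C.chrDir x c (β y) with hK
  set D := C.LM (C.hor x c (β y)) (fun v => G (x v)) (β y)
  rw [hxy] at h3
  have h4 : E * E⁻¹ = 1 := h.mul_inv hu
  have h4' : E⁻¹.transpose * E.transpose = 1 := by
    rw [← Matrix.transpose_mul, h4, Matrix.transpose_one]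
  have h5 : D = K.transpose * G y + G y * K := by
    have h6 : E.transpose * (D - K.transpose * G y - G y * K) * E = 0 := by
      rw [← h3, Matrix.transpose_neg, Matrix.transpose_mul]
      noncomm_ring
    have h7 : D - K.transpose * G y - G y * K = 0 := by
      calc D - K.transpose * G y - G y * K
          = (E⁻¹.transpose * E.transpose) * (D - K.transpose * G y - G y * K) * (E * E⁻¹) := by
            rw [h4, h4', Matrix.one_mul, Matrix.mul_one]
        _ = E⁻¹.transpose * (E.transpose * (D - K.transpose * G y - G y * K) * E) * E⁻¹ := by
            noncomm_ring
        _ = 0 := by rw [h6, Matrix.mul_zero, Matrix.zero_mul]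
    rw [sub_sub, sub_eq_zero] at h7
    exact h7
  rw [h1, h5, Matrix.add_apply, Matrix.mul_apply, Matrix.mul_apply]
  congr 1
  exact Finset.sum_congr rfl fun e _ => mul_comm _ _

omit [FiniteDimensional ℝ F] in
theorem CartanGeometry.Coord.LM_hor_hess (h : C.Coord O x) (hu : u ∈ O) (i f : Fin m) :
    (C.jac x u)⁻¹.transpose * C.LM (C.hor x f u) (C.hess x i) u * (C.jac x u)⁻¹
      = (C.chrDir x f u).transpose * C.chr x i u - C.LM (C.hor x f u) (C.chr x i) u
        + C.chr x i u * C.chrDir x f u := by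
  have hE := h.smM_jac
  have hc := h.smM_chr i
  rw [C.LM_congr h.isOpen hu (fun v hv => h.hess_eq i hv),
    C.LM_neg ((hE.transpose.mul h.isOpen hc).mul h.isOpen hE) hu,
    C.LM_mul h.isOpen (hE.transpose.mul h.isOpen hc) hE hu,
    C.LM_mul h.isOpen hE.transpose hc hu, C.LM_transpose, h.LM_hor_jac hu]
  set E := C.jac x u
  set K := C.chrDir x f u
  set D := C.LM (C.hor x f u) (C.chr x i) u
  have h4 : E * E⁻¹ = 1 := h.mul_inv hu
  have h4' : E⁻¹.transpose * E.transpose = 1 := by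
    rw [← Matrix.transpose_mul, h4, Matrix.transpose_one]
  calc _ = (E⁻¹.transpose * E.transpose) * (K.transpose * C.chr x i u - D + C.chr x i u * K) *
        (E * E⁻¹) := by
        rw [Matrix.transpose_neg, Matrix.transpose_mul]; noncomm_ring
    _ = _ := by rw [h4, h4', Matrix.one_mul, Matrix.mul_one]

/-- The normality of the connection, in coordinates. -/
theorem CartanGeometry.Coord.normality (h : C.Coord O x) (hC : C.IsNormal) (hu : u ∈ O)
    (c g : Fin m) :
    ∑ i, (((C.jac x u)⁻¹.transpose * C.LM (C.hor x i u) (C.hess x i) u * (C.jac x u)⁻¹) c g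
      - ((C.jac x u)⁻¹.transpose * C.LM (C.hor x c u) (C.hess x i) u * (C.jac x u)⁻¹) i g) = 0 := by
  set E := C.jac x u with hE
  have h1 : ∀ i f c', (E⁻¹.transpose * C.LM (C.hor x f u) (C.hess x i) u * E⁻¹) c' g
      = ∑ b, (∑ a, ∑ e, E⁻¹ a c' * E⁻¹ e f *
        C.L (eVec e) (C.L (eVec a) fun v => C.jac x v i b) u) * E⁻¹ b g := by
    intro i f c'
    rw [Matrix.mul_apply]
    refine Finset.sum_congr rfl fun b _ => ?_
    rw [Matrix.mul_apply]
    congr 1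
    refine Finset.sum_congr rfl fun a _ => ?_
    simp only [CartanGeometry.LM, Matrix.of_apply, Matrix.transpose_apply]
    rw [C.L_hor, Finset.mul_sum]
    exact Finset.sum_congr rfl fun e _ => by rw [mul_assoc]; rfl
  -- The antisymmetrized third derivatives of a coordinate are a commutator acting on the jacobian,
  -- that is, the `𝔤₀`-component of a bracket that is vertical for lack of torsion.
  have h2 : ∀ i b a e, C.L (eVec e) (C.L (eVec a) fun v => C.jac x v i b) u
      - C.L (eVec a) (C.L (eVec e) fun v => C.jac x v i b) u
      = ∑ l, E i l * zPart (C.bracket e a u) l b := by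
    intro i b a e
    rw [(h.smM_jac i b).L_comm hu]
    exact congrFun (congrFun (h.LM_jac (hC.isVert e a u) hu) i) b
  have h3 : ∀ i, (E⁻¹.transpose * C.LM (C.hor x i u) (C.hess x i) u * E⁻¹) c g
      - (E⁻¹.transpose * C.LM (C.hor x c u) (C.hess x i) u * E⁻¹) i g
      = ∑ b, ((∑ a, ∑ e, E⁻¹ a c * E⁻¹ e i *
          C.L (eVec e) (C.L (eVec a) fun v => C.jac x v i b) u)
        - ∑ a, ∑ e, E⁻¹ a i * E⁻¹ e c * C.L (eVec e) (C.L (eVec a) fun v => C.jac x v i b) u) *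
          E⁻¹ b g := by
    intro i
    rw [h1, h1, ← Finset.sum_sub_distrib]
    exact Finset.sum_congr rfl fun b _ => (sub_mul _ _ _).symm
  rw [Finset.sum_congr rfl fun i _ => h3 i, Finset.sum_comm]
  refine Finset.sum_eq_zero fun b _ => ?_
  rw [← Finset.sum_mul]
  have h4 : ∀ i ∈ Finset.univ, (∑ a, ∑ e, E⁻¹ a c * E⁻¹ e i *
        C.L (eVec e) (C.L (eVec a) fun v => C.jac x v i b) u)
      - ∑ a, ∑ e, E⁻¹ a i * E⁻¹ e c * C.L (eVec e) (C.L (eVec a) fun v => C.jac x v i b) u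
      = ∑ a, E⁻¹ a c * ∑ e, ∑ l, (E⁻¹ e i * E i l) * zPart (C.bracket e a u) l b := by
    intro i _
    rw [Finset.sum_comm (f := fun a e => E⁻¹ a i * E⁻¹ e c *
      C.L (eVec e) (C.L (eVec a) fun v => C.jac x v i b) u), ← Finset.sum_sub_distrib]
    refine Finset.sum_congr rfl fun a _ => ?_
    rw [← Finset.sum_sub_distrib, Finset.mul_sum]
    refine Finset.sum_congr rfl fun e _ => ?_
    rw [show ∀ q, ∑ l, (E⁻¹ e i * E i l) * zPart (C.bracket e a u) l q
      = E⁻¹ e i * ∑ l, E i l * zPart (C.bracket e a u) l q from fun q => by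
        rw [Finset.mul_sum]; exact Finset.sum_congr rfl fun l _ => mul_assoc _ _ _, ← h2]
    ring
  rw [Finset.sum_congr rfl h4, Finset.sum_comm]
  -- Contracting `E⁻¹` with `E` leaves the Ricci-type trace of the curvature, which normality makes
  -- zero.
  have h5 : ∀ a, ∑ i, E⁻¹ a c * ∑ e, ∑ l, (E⁻¹ e i * E i l) * zPart (C.bracket e a u) l b = 0 := by
    intro a
    rw [← Finset.mul_sum, Finset.sum_comm]
    have h6 : ∀ e, ∑ i, ∑ l, (E⁻¹ e i * E i l) * zPart (C.bracket e a u) l b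
        = zPart (C.bracket e a u) e b := by
      intro e
      rw [Finset.sum_comm]
      simp only [← Finset.sum_mul]
      have h7 : ∀ l, ∑ i, E⁻¹ e i * E i l = if e = l then 1 else 0 := fun l => by
        have := congrFun (congrFun (h.inv_mul hu) e) l
        rwa [Matrix.mul_apply, Matrix.one_apply] at this
      simp only [h7]
      simp
    simp only [h6, hC.sum_zPart, mul_zero]
  simp only [h5, Finset.sum_const_zero, zero_mul]

end Finite

variable (C) in
/-- The `𝔤₁`-component of the connection form along the section `β`. -/
def CartanGeometry.xi (x : P → Euc m) (β : Euc m → P) (y : Euc m) (c d : Fin m) : ℝ :=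
  ∑ b, plusPart (vertPart (C.vel β c y)) b * (C.jac x (β y))⁻¹ b d

section Finite
variable [FiniteDimensional ℝ F]

/-- In the normality condition each horizontal derivative of the coefficients is a partial
derivative of Christoffel symbols minus a vertical derivative. The former assemble into `ricci`; the
latter involve only `xi` and, through the trace, a multiple of the metric. The factor `τ` is
immaterial, as trace-free tensors do not see it. -/
theorem CartanGeometry.GaugeSection.ricci_eq (hβ : C.GaugeSection O x G Ω' β)
    (h : C.ConfCoord O x G Ω) (hC : C.IsNormal) (hm : m ≠ 0) (hy : y ∈ Ω') :
    ∃ τ : ℝ, ∀ c g, ricci G c g y + (1 - m) * C.xi x β y c g + C.xi x β y g c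
      - τ * ((C.jac x (β y))⁻¹.transpose * etaMat m p * (C.jac x (β y))⁻¹) c g = 0 := by
  have hu := hβ.mem y hy
  refine ⟨∑ i, ∑ l, C.jac x (β y) i l * (eta p l * plusPart (vertPart (C.vel β i y)) l),
    fun c g => ?_⟩
  have h0 := h.normality hC hu c g
  simp only [h.LM_hor_hess hu] at h0
  have hpd : ∀ f i c g, C.LM (C.hor x f (β y)) (C.chr x i) (β y) c g
      = pd f (christoffel G i c g) y
        - C.LM (vertPart (C.vel β f y)) (C.chr x i) (β y) c g := by
    intro f i c g
    have h1 := hβ.pd_eq h.toCoord hy (h.smM_chr i c g) f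
    rw [pd_congr hβ.isOpen (fun z hz => hβ.chr_eq h hC hm hz i c g) hy f] at h1
    rw [h1]
    simp only [CartanGeometry.LM, Matrix.of_apply]
    ring
  have hprod : ∀ i f c, (C.chr x i (β y) * C.chrDir x f (β y)) c g
      = ∑ a, christoffel G i c a y * christoffel G a f g y := by
    intro i f c
    rw [Matrix.mul_apply]
    exact Finset.sum_congr rfl fun a _ => by
      rw [hβ.chr_eq h hC hm hy, CartanGeometry.chrDir, Matrix.of_apply, hβ.chr_eq h hC hm hy]
  have hsym : ∀ i f c, ((C.chrDir x f (β y)).transpose * C.chr x i (β y)) c g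
      = ∑ a, christoffel G a f c y * christoffel G i a g y := by
    intro i f c
    rw [Matrix.mul_apply]
    exact Finset.sum_congr rfl fun a _ => by
      rw [hβ.chr_eq h hC hm hy, Matrix.transpose_apply, CartanGeometry.chrDir, Matrix.of_apply,
        hβ.chr_eq h hC hm hy]
  have hyΩ : y ∈ Ω := hβ.x_eq y hy ▸ h.maps _ hu
  simp only [Matrix.add_apply, Matrix.sub_apply, hpd, hprod, hsym] at h0
  have hv1 : ∑ i, C.LM (vertPart (C.vel β i y)) (C.chr x i) (β y) c g
      = C.xi x β y c g + C.xi x β y g c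
        - (∑ i, ∑ l, C.jac x (β y) i l * (eta p l * plusPart (vertPart (C.vel β i y)) l)) *
          ((C.jac x (β y))⁻¹.transpose * etaMat m p * (C.jac x (β y))⁻¹) c g := by
    simp only [h.LM_vert_chr (isVert_vertPart _) hu, Finset.sum_sub_distrib,
      Finset.sum_add_distrib, ← Finset.sum_mul, CartanGeometry.xi]
    simp
  have hv2 : ∑ i, C.LM (vertPart (C.vel β c y)) (C.chr x i) (β y) i g
      = m * C.xi x β y c g := by
    simp only [h.LM_vert_chr (isVert_vertPart _) hu, Finset.sum_sub_distrib,
      Finset.sum_add_distrib, if_true]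
    -- The metric term of the vertical derivative cancels one of the two `xi`-terms after lowering
    -- the raised index, so that exactly `m` copies survive.
    have h5 : ∑ i, (∑ l, C.jac x (β y) i l * (eta p l * plusPart (vertPart (C.vel β c y)) l)) *
          ((C.jac x (β y))⁻¹.transpose * etaMat m p * (C.jac x (β y))⁻¹) i g
        = C.xi x β y c g := by
      have h6 : ∀ i, ∑ l, C.jac x (β y) i l * (eta p l * plusPart (vertPart (C.vel β c y)) l)
          = (C.jac x (β y) * etaMat m p).mulVec (plusPart (vertPart (C.vel β c y))) i := by
        intro i
        simp only [Matrix.mulVec, dotProduct, etaMat, Matrix.mul_diagonal]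
        exact Finset.sum_congr rfl fun l _ => by ring
      have h7 : ((C.jac x (β y))⁻¹.transpose * etaMat m p * (C.jac x (β y))⁻¹).transpose *
          (C.jac x (β y) * etaMat m p) = (C.jac x (β y))⁻¹.transpose := by
        have h8 : etaMat m p * etaMat m p = 1 := by
          rw [etaMat, Matrix.diagonal_mul_diagonal]
          simp only [eta_mul_self, Matrix.diagonal_one]
        have h9 : (etaMat m p).transpose = etaMat m p := Matrix.diagonal_transpose _
        rw [Matrix.transpose_mul, Matrix.transpose_mul, Matrix.transpose_transpose, h9]
        calc _ = (C.jac x (β y))⁻¹.transpose * (etaMat m p * ((C.jac x (β y))⁻¹ * C.jac x (β y))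
              * etaMat m p) := by noncomm_ring
          _ = _ := by rw [h.inv_mul hu, Matrix.mul_one, h8, Matrix.mul_one]
      have h10 : ((C.jac x (β y))⁻¹.transpose * etaMat m p * (C.jac x (β y))⁻¹).transpose.mulVec
          ((C.jac x (β y) * etaMat m p).mulVec (plusPart (vertPart (C.vel β c y)))) g
          = (C.jac x (β y))⁻¹.transpose.mulVec (plusPart (vertPart (C.vel β c y))) g := by
        rw [Matrix.mulVec_mulVec, h7]
      simp only [h6, CartanGeometry.xi]
      refine (Eq.trans ?_ h10).trans ?_
      · simp only [Matrix.mulVec, dotProduct, Matrix.transpose_apply]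
        exact Finset.sum_congr rfl fun i _ => mul_comm _ _
      · simp only [Matrix.mulVec, dotProduct, Matrix.transpose_apply]
        exact Finset.sum_congr rfl fun i _ => mul_comm _ _
    rw [h5]
    simp [CartanGeometry.xi]
  have hr : ricci G c g y = ∑ i, (pd c (christoffel G i i g) y - pd i (christoffel G i c g) y
      + ∑ a, (christoffel G i c a y * christoffel G a i g y
        - christoffel G i i a y * christoffel G a c g y)) := rfl
  simp only [Finset.sum_add_distrib, Finset.sum_sub_distrib] at h0 hr
  have hs : ∑ i, ∑ a, christoffel G a i c y * christoffel G i a g y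
      = ∑ i, ∑ a, christoffel G a c i y * christoffel G i a g y :=
    Finset.sum_congr rfl fun i _ => Finset.sum_congr rfl fun a _ => by
      rw [h.metric.christoffel_symm hyΩ a i c]
  rw [hv1, hv2, hs] at h0
  rw [hr]
  linarith

omit [FiniteDimensional ℝ F] in
theorem CartanGeometry.ConfCoord.metric_eq (h : C.ConfCoord O x G Ω) (hm : m ≠ 0) (hu : u ∈ O) :
    G (x u) = C.scale x G u • ((C.jac x u)⁻¹.transpose * etaMat m p * (C.jac x u)⁻¹) := by
  have h4 : C.jac x u * (C.jac x u)⁻¹ = 1 := h.mul_inv hu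
  have h4' : (C.jac x u)⁻¹.transpose * (C.jac x u).transpose = 1 := by
    rw [← Matrix.transpose_mul, h4, Matrix.transpose_one]
  calc G (x u) = ((C.jac x u)⁻¹.transpose * (C.jac x u).transpose) * G (x u) *
        (C.jac x u * (C.jac x u)⁻¹) := by rw [h4, h4', Matrix.one_mul, Matrix.mul_one]
    _ = (C.jac x u)⁻¹.transpose * ((C.jac x u).transpose * G (x u) * C.jac x u) *
        (C.jac x u)⁻¹ := by noncomm_ring
    _ = _ := by rw [h.conf_scale hm hu, Matrix.mul_smul, Matrix.smul_mul]

/-- On trace-free symmetric tensors, `xi` acts as minus the tensor `r`. -/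
theorem CartanGeometry.GaugeSection.sum_xi (hβ : C.GaugeSection O x G Ω' β)
    (h : C.ConfCoord O x G Ω) (hC : C.IsNormal) (hm : 3 ≤ m) (hy : y ∈ Ω') {T : Ten m (n + 2)}
    (hT : T ∈ stf (G y) (n + 2)) (j : Fin n → Fin m) :
    ∑ c, ∑ d, C.xi x β y c d * T (Fin.cons c (Fin.cons d j))
      = -∑ c, ∑ d, rTen G c d y * T (Fin.cons c (Fin.cons d j)) := by
  have hm0 : m ≠ 0 := by omega
  have hu := hβ.mem y hy
  obtain ⟨τ, hτ⟩ := hβ.ricci_eq h hC hm0 hy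
  have h1 : G y = C.scale x G (β y) •
      ((C.jac x (β y))⁻¹.transpose * etaMat m p * (C.jac x (β y))⁻¹) := by
    rw [← h.metric_eq hm0 hu, hβ.x_eq y hy]
  have h3 : ∑ c, ∑ d, ((C.jac x (β y))⁻¹.transpose * etaMat m p * (C.jac x (β y))⁻¹) c d *
      T (Fin.cons c (Fin.cons d j)) = 0 := by
    have h5 := stf_trace hT j
    rw [h1] at h5
    refine (mul_eq_zero.1 (Eq.trans ?_ h5)).resolve_left (h.scale_ne hm0 hu)
    simp only [Finset.mul_sum]
    exact Finset.sum_congr rfl fun c _ => Finset.sum_congr rfl fun d _ => (mul_assoc _ _ _).symm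
  have h6 : ∑ c, ∑ d, C.xi x β y d c * T (Fin.cons c (Fin.cons d j))
      = ∑ c, ∑ d, C.xi x β y c d * T (Fin.cons c (Fin.cons d j)) := by
    rw [Finset.sum_comm]
    exact Finset.sum_congr rfl fun c _ => Finset.sum_congr rfl fun d _ => by
      rw [stf_swap hT]
  have h7 : ∀ c d, ricci G c d y * T (Fin.cons c (Fin.cons d j))
      = (m - 1) * (C.xi x β y c d * T (Fin.cons c (Fin.cons d j)))
        - C.xi x β y d c * T (Fin.cons c (Fin.cons d j))
        + τ * (((C.jac x (β y))⁻¹.transpose * etaMat m p * (C.jac x (β y))⁻¹) c d *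
      T (Fin.cons c (Fin.cons d j))) := by
    intro c d
    linear_combination (T (Fin.cons c (Fin.cons d j))) * hτ c d
  -- Against a symmetric tensor `xi` and its transpose agree, so `(m - 1) - 1 = m - 2` remains, the
  -- denominator of `r` up to sign. It is nonzero since `m ≥ 3`.
  have h8 : ∑ c, ∑ d, ricci G c d y * T (Fin.cons c (Fin.cons d j))
      = (m - 2) * ∑ c, ∑ d, C.xi x β y c d * T (Fin.cons c (Fin.cons d j)) := by
    simp only [h7, Finset.sum_add_distrib, Finset.sum_sub_distrib, ← Finset.mul_sum]
    rw [h3, h6]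
    ring
  have h9 : ∑ c, ∑ d, rTen G c d y * T (Fin.cons c (Fin.cons d j))
      = (1 / (2 - (m : ℝ))) * ∑ c, ∑ d, ricci G c d y * T (Fin.cons c (Fin.cons d j)) := by
    simp only [rTen, Finset.mul_sum]
    exact Finset.sum_congr rfl fun c _ => Finset.sum_congr rfl fun d _ => by ring
  have hm3 : (3 : ℝ) ≤ m := by exact_mod_cast hm
  have hm2 : (2 - (m : ℝ)) ≠ 0 := by intro e; linarith
  rw [h9, h8]
  field_simp
  ring

end Finite

end Ricci

/-! ### Recursions along an adapted section and the local formula -/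

section LocalFormula

variable {m p : ℕ} {M : Type*} [TopologicalSpace M] [ChartedSpace (Euc m) M]
  {F : Type*} [NormedAddCommGroup F] [NormedSpace ℝ F]
  {P : Type*} [TopologicalSpace P] [ChartedSpace F P] [IsManifold 𝓘(ℝ, F) ∞ P]
  {C : CartanGeometry m p M F P} {O : Set P} {Φ : P → ℝ} {u : P} {n k : ℕ}
  {lam δ : ℝ} {x : P → Euc m} {G : Euc m → Matrix (Fin m) (Fin m) ℝ} {Ω Ω' : Set (Euc m)}
  {β : Euc m → P} {y : Euc m} {Θ : P → Ten m n} {E : Matrix (Fin m) (Fin m) ℝ}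

theorem trS_sum {ι : Type*} (s : Finset ι) (c : ι → ℝ) (T : ι → Ten m n) (i : Fin n → Fin m) :
    trS δ E (fun j => ∑ a ∈ s, c a * T a j) i = ∑ a ∈ s, c a * trS δ E (T a) i := by
  simp only [trS, tr, Pi.smul_apply, smul_eq_mul, Finset.mul_sum]
  rw [Finset.sum_comm]
  exact Finset.sum_congr rfl fun _ _ => Finset.sum_congr rfl fun _ _ => by ring

theorem trD_sum {ι : Type*} (s : Finset ι) (c : ι → ℝ) (T : ι → Ten m n) (i : Fin n → Fin m) :
    trD lam E (fun j => ∑ a ∈ s, c a * T a j) i = ∑ a ∈ s, c a * trD lam E (T a) i := by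
  simp only [trD, tr, Pi.smul_apply, smul_eq_mul, Finset.mul_sum]
  rw [Finset.sum_comm]
  exact Finset.sum_congr rfl fun _ _ => Finset.sum_congr rfl fun _ _ => by ring

theorem tr_sum_mul {ι : Type*} (s : Finset ι) (c : ι → ℝ) (T : ι → Ten m n) (i : Fin n → Fin m) :
    tr E (fun j => ∑ a ∈ s, c a * T a j) i = ∑ a ∈ s, c a * tr E (T a) i := by
  simp only [tr, Finset.mul_sum]
  rw [Finset.sum_comm]
  exact Finset.sum_congr rfl fun _ _ => Finset.sum_congr rfl fun _ _ => by ring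

theorem trS_cons (T : Ten m (n + 1)) (c : Fin m) (j : Fin n → Fin m) :
    trS δ E T (Fin.cons c j) = ∑ b, E c b * trS δ E (fun i => T (Fin.cons b i)) j := by
  simp only [trS, Pi.smul_apply, smul_eq_mul, tr_cons, Finset.mul_sum, Matrix.transpose_apply]
  exact Finset.sum_congr rfl fun _ _ => by ring

theorem trD_cons (T : Ten m (n + 1)) (c : Fin m) (j : Fin n → Fin m) :
    trD lam E T (Fin.cons c j) = ∑ b, E⁻¹ b c * trD lam E (fun i => T (Fin.cons b i)) j := by
  simp only [trD, Pi.smul_apply, smul_eq_mul, tr_cons, Finset.mul_sum]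
  exact Finset.sum_congr rfl fun _ _ => by ring

theorem sum_mul_trD (S T : Ten m n) : ∑ j, S j * trD lam E T j
    = |E.det| ^ (-lam) * ∑ j, tr E⁻¹.transpose S j * T j := by
  rw [← sum_mul_tr, Finset.mul_sum]
  exact Finset.sum_congr rfl fun _ _ => by simp only [trD, Pi.smul_apply, smul_eq_mul]; ring

/-- The matrices acting on dual indices are inverse to each other, so only the density weights
remain. -/
theorem sum_trS_mul_trD (hE : E.det ≠ 0) (S T : Ten m n) :
    ∑ j, trS δ E S j * trD lam E T j = |E.det| ^ (-(lam + δ)) * ∑ j, S j * T j := by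
  have h1 : E.transpose * E⁻¹.transpose = 1 := by
    rw [← Matrix.transpose_mul, Matrix.nonsing_inv_mul _ (isUnit_iff_ne_zero.2 hE),
      Matrix.transpose_one]
  rw [sum_mul_trD, trS, tr_smul, tr_tr, h1, tr_one, neg_add, Real.rpow_add (abs_pos.2 hE),
    mul_assoc]
  congr 1
  rw [Finset.mul_sum]
  exact Finset.sum_congr rfl fun _ _ => by simp only [Pi.smul_apply, smul_eq_mul]; ring

theorem CartanGeometry.GaugeSection.contDiffOn (hβ : C.GaugeSection O x G Ω' β) (hΦ : C.Sm O Φ) :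
    ContDiffOn ℝ ∞ (fun y => Φ (β y)) Ω' :=
  contMDiffOn_iff_contDiffOn.1 (hΦ.smooth.comp hβ.smooth.contMDiffOn hβ.mem)

section Finite
variable [FiniteDimensional ℝ F]

theorem CartanGeometry.GaugeSection.chrMat_eq (hβ : C.GaugeSection O x G Ω' β)
    (h : C.ConfCoord O x G Ω) (hC : C.IsNormal) (hm : m ≠ 0) (hy : y ∈ Ω') (c : Fin m) :
    chrMat G c y = C.chrDir x c (β y) := by
  ext i d
  exact (hβ.chr_eq h hC hm hy i c d).symm

/-- The horizontal derivative of the jacobian produces the connection terms with the sign that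
cancels those of `∇`. The vertical correction measures the failure of `Θ` to be equivariant. -/
theorem CartanGeometry.GaugeSection.nablaContra_trS (hβ : C.GaugeSection O x G Ω' β)
    (h : C.ConfCoord O x G Ω) (hC : C.IsNormal) (hm : m ≠ 0) (hy : y ∈ Ω')
    (hΘ : ∀ i, C.Sm O fun v => Θ v i) (c : Fin m) (i : Fin n → Fin m) :
    nablaContra G δ (fun z => trS δ (C.jac x (β z)) (Θ (β z))) c y i
      = trS δ (C.jac x (β y)) (fun i => C.L (C.hor x c (β y)) (fun v => Θ v i) (β y)) i
        + trS δ (C.jac x (β y)) (rho δ (zPart (vertPart (C.vel β c y))) (Θ (β y))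
          + fun i => C.L (vertPart (C.vel β c y)) (fun v => Θ v i) (β y)) i := by
  have hu := hβ.mem y hy
  rw [nablaContra_eq, hβ.pd_eq h.toCoord hy (sm_trS h.isOpen h.smM_jac h.det hΘ i),
    L_trS_of_left h.isOpen h.smM_jac h.det hΘ hu (h.LM_hor_jac hu c),
    L_trS_of_right h.isOpen h.smM_jac h.det hΘ hu (h.LM_jac (isVert_vertPart _) hu),
    hβ.chrMat_eq h hC hm hy, rho_eq δ (C.chrDir x c (β y))]
  simp only [Pi.sub_apply, Pi.smul_apply, smul_eq_mul]
  ring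

theorem CartanGeometry.GaugeSection.nablaCo_trD (hβ : C.GaugeSection O x G Ω' β)
    (h : C.ConfCoord O x G Ω) (hC : C.IsNormal) (hm : m ≠ 0) (hy : y ∈ Ω')
    (hΘ : ∀ i, C.Sm O fun v => Θ v i) (c : Fin m) (i : Fin n → Fin m) :
    nablaCo G lam (fun z => trD lam (C.jac x (β z)) (Θ (β z))) c y i
      = trD lam (C.jac x (β y)) (fun i => C.L (C.hor x c (β y)) (fun v => Θ v i) (β y)) i
        + trD lam (C.jac x (β y)) (-rho (-lam) (zPart (vertPart (C.vel β c y))).transpose (Θ (β y))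
          + fun i => C.L (vertPart (C.vel β c y)) (fun v => Θ v i) (β y)) i := by
  have hu := hβ.mem y hy
  rw [nablaCo_eq, hβ.pd_eq h.toCoord hy (sm_trD h.isOpen h.smM_jac h.det hΘ i),
    L_trD_of_left h.isOpen h.smM_jac h.det hΘ hu (h.LM_hor_jac hu c),
    L_trD_of_right h.isOpen h.smM_jac h.det hΘ hu (h.LM_jac (isVert_vertPart _) hu),
    hβ.chrMat_eq h hC hm hy, rho_eq (-lam) (C.chrDir x c (β y)).transpose, Matrix.trace_transpose]
  simp only [Pi.sub_apply, Pi.smul_apply, smul_eq_mul]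
  ring

/-- By `DivChain.vert` the failure of equivariance is a contraction with the `𝔤₁`-component. Summed
over directions it is a contraction with `xi`, hence with `-r`. The coefficient is that of `T₂` on
degree `n + 2`. -/
theorem CartanGeometry.GaugeSection.divTen_trS (hβ : C.GaugeSection O x G Ω' β)
    (h : C.ConfCoord O x G Ω) (hC : C.IsNormal) (hm : 3 ≤ m) (hy : y ∈ Ω')
    {s : (n : ℕ) → P → Ten m n} (hs : C.DivChain O δ k s) (hn : n + 1 ≤ k) (i : Fin n → Fin m) :
    divTen G δ (fun z => trS δ (C.jac x (β z)) (s (n + 1) (β z))) y i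
      = trS δ (C.jac x (β y)) (s n (β y)) i
        - (k - (n + 1 : ℕ)) * (m + k + (n + 1 : ℕ) - 1 - m * δ) *
          ∑ c, ∑ d, rTen G c d y *
            trS δ (C.jac x (β y)) (s (n + 2) (β y)) (Fin.cons c (Fin.cons d i)) := by
  have hm0 : m ≠ 0 := by omega
  have hu := hβ.mem y hy
  have hinv : ∀ a b, ∑ c, (C.jac x (β y))⁻¹ a c * C.jac x (β y) c b = if a = b then 1 else 0 := by
    intro a b
    have := congrFun (congrFun (h.inv_mul hu) a) b
    rwa [Matrix.mul_apply, Matrix.one_apply] at this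
  have hst : trS δ (C.jac x (β y)) (s (n + 2) (β y)) ∈ stf (G y) (n + 2) := by
    refine Submodule.smul_mem _ _ (tr_mem_stf (c := C.scale x G (β y)) ?_ (hs.mem (n + 2) _ hu))
    have := h.conf_scale hm0 hu
    rwa [hβ.x_eq y hy] at this
  have h1 := hβ.sum_xi h hC hm hy hst i
  set κ : ℝ := (k - (n + 1 : ℕ)) * (m + k + (n + 1 : ℕ) - 1 - m * δ) with hκ
  have h2 : ∑ c, trS δ (C.jac x (β y))
      (fun i => C.L (C.hor x c (β y)) (fun v => s (n + 1) v i) (β y)) (Fin.cons c i)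
      = trS δ (C.jac x (β y)) (s n (β y)) i := by
    have e1 : s n (β y) = fun i => ∑ a, (1 : ℝ) *
        C.L (eVec a) (fun v => s (n + 1) v (Fin.cons a i)) (β y) := by
      funext i
      simp only [one_mul]
      exact hs.step n (by omega) _ hu i
    rw [e1, trS_sum]
    simp only [trS_cons, C.L_hor, trS_sum, one_mul]
    rw [Finset.sum_comm]
    refine Finset.sum_congr rfl fun b _ => ?_
    have e2 : ∀ a c, C.jac x (β y) c b * ((C.jac x (β y))⁻¹ a c *
        trS δ (C.jac x (β y)) (fun j => C.L (eVec a) (fun v => s (n + 1) v (Fin.cons b j)) (β y)) i)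
        = ((C.jac x (β y))⁻¹ a c * C.jac x (β y) c b) *
        trS δ (C.jac x (β y)) (fun j => C.L (eVec a) (fun v => s (n + 1) v (Fin.cons b j)) (β y)) i :=
      fun a c => by ring
    simp only [Finset.mul_sum, e2]
    rw [Finset.sum_comm]
    simp only [← Finset.sum_mul, hinv]
    simp
  have h3 : ∀ c, rho δ (zPart (vertPart (C.vel β c y))) (s (n + 1) (β y))
      + (fun i => C.L (vertPart (C.vel β c y)) (fun v => s (n + 1) v i) (β y))
      = κ • ic (plusPart (vertPart (C.vel β c y))) (s (n + 2) (β y)) := by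
    intro c
    funext i
    have := hs.vert (n + 1) hn _ (isVert_vertPart (C.vel β c y)) _ hu i
    simp only [Pi.add_apply, Pi.smul_apply, smul_eq_mul, this]
    ring
  have h4 : ∑ c, ∑ d, C.xi x β y c d *
        trS δ (C.jac x (β y)) (s (n + 2) (β y)) (Fin.cons c (Fin.cons d i))
      = ∑ c, trS δ (C.jac x (β y)) (ic (plusPart (vertPart (C.vel β c y))) (s (n + 2) (β y)))
          (Fin.cons c i) := by
    refine Finset.sum_congr rfl fun c _ => ?_
    rw [trS_cons]
    simp only [ic, trS_sum]
    have e1 : ∀ d, C.xi x β y c d *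
        trS δ (C.jac x (β y)) (s (n + 2) (β y)) (Fin.cons c (Fin.cons d i))
        = ∑ b, ∑ a, ∑ a', ((C.jac x (β y))⁻¹ a d * C.jac x (β y) d a') *
          (C.jac x (β y) c b * plusPart (vertPart (C.vel β c y)) a *
          trS δ (C.jac x (β y)) (fun j => s (n + 2) (β y) (Fin.cons b (Fin.cons a' j))) i) := by
      intro d
      simp only [CartanGeometry.xi, trS_cons, Finset.sum_mul, Finset.mul_sum]
      refine Finset.sum_congr rfl fun b _ => ?_
      rw [Finset.sum_comm]
      exact Finset.sum_congr rfl fun a _ => Finset.sum_congr rfl fun a' _ => by ring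
    simp only [e1]
    rw [Finset.sum_comm]
    refine Finset.sum_congr rfl fun b _ => ?_
    rw [Finset.sum_comm, Finset.mul_sum]
    refine Finset.sum_congr rfl fun a _ => ?_
    rw [Finset.sum_comm]
    simp only [← Finset.sum_mul, hinv]
    simp only [ite_mul, one_mul, zero_mul, Finset.sum_ite_eq, Finset.mem_univ, if_true]
    have e2 : (fun j => s (n + 2) (β y) (Fin.cons b (Fin.cons a j)))
        = fun j => s (n + 2) (β y) (Fin.cons a (Fin.cons b j)) := by
      funext j
      exact stf_swap (hs.mem (n + 2) _ hu) b a j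
    rw [e2]
    ring
  have h5 : divTen G δ (fun z => trS δ (C.jac x (β z)) (s (n + 1) (β z))) y i
      = ∑ c, trS δ (C.jac x (β y))
      (fun i => C.L (C.hor x c (β y)) (fun v => s (n + 1) v i) (β y)) (Fin.cons c i)
      + κ * ∑ c, trS δ (C.jac x (β y))
          (ic (plusPart (vertPart (C.vel β c y))) (s (n + 2) (β y))) (Fin.cons c i) := by
    rw [Finset.mul_sum, ← Finset.sum_add_distrib]
    refine Finset.sum_congr rfl fun c _ => ?_
    rw [hβ.nablaContra_trS h hC hm0 hy (hs.smooth (n + 1)) c (Fin.cons c i), h3]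
    simp only [trS, tr_smul, Pi.smul_apply, smul_eq_mul]
    ring
  rw [h5, h2, ← h4, h1]
  ring

theorem sum_mul_rho (δ : ℝ) (B : Matrix (Fin m) (Fin m) ℝ) (S T : Ten m n) :
    ∑ i, S i * rho δ B.transpose T i = ∑ i, rho δ B S i * T i := by
  simp only [rho_eq, Pi.sub_apply, Pi.smul_apply, smul_eq_mul, mul_sub, sub_mul,
    Finset.sum_sub_distrib, sum_mul_der, Matrix.transpose_transpose, Matrix.trace_transpose]
  congr 1
  exact Finset.sum_congr rfl fun _ _ => by ring

theorem CartanGeometry.GaugeSection.nablaPow_succ (hβ : C.GaugeSection O x G Ω' β)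
    (h : C.ConfCoord O x G Ω) (hC : C.IsNormal) (hm : m ≠ 0) (hy : y ∈ Ω') (hΦ : C.Sm O Φ)
    (c : Fin m) (j : Fin n → Fin m) :
    trD lam (C.jac x (β y)) (fun i => C.nablaPow Φ (n + 1) i (β y)) (Fin.cons c j)
      = nablaCo G lam (fun z => trD lam (C.jac x (β z)) fun i => C.nablaPow Φ n i (β z)) c y j
        - trD lam (C.jac x (β y)) (-rho (-lam) (zPart (vertPart (C.vel β c y))).transpose
            (fun i => C.nablaPow Φ n i (β y))
          + fun i => C.L (vertPart (C.vel β c y)) (C.nablaPow Φ n i) (β y)) j := by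
  rw [hβ.nablaCo_trD (Θ := fun v i => C.nablaPow Φ n i v) h hC hm hy (fun i => hΦ.nablaPow n i) c j,
    add_sub_cancel_right, trD_cons]
  simp only [C.nablaPow_cons, C.L_hor, trD_sum]

/-- Dual to `divTen_trS`, but stated after pairing with a trace-free tensor, since the vertical
derivatives of the iterated derivatives are known only in that form. The coefficient is that of `T₁`
on degree `n`. -/
theorem CartanGeometry.GaugeSection.sum_mul_nablaPow (hβ : C.GaugeSection O x G Ω' β)
    (h : C.ConfCoord O x G Ω) (hC : C.IsNormal) (hm : 3 ≤ m) (hy : y ∈ Ω') (hΦ : C.Sm O Φ)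
    (hL : ∀ X : soAlg m p, IsVert X → ∀ v ∈ O, C.L X Φ v = lam * (zPart X).trace * Φ v)
    {T : Ten m (n + 2)} (hT : T ∈ stf (G y) (n + 2)) :
    ∑ c, ∑ j : Fin (n + 1) → Fin m, T (Fin.cons c j) *
        trD lam (C.jac x (β y)) (fun i => C.nablaPow Φ (n + 2) i (β y)) (Fin.cons c j)
      = ∑ c, ∑ j, T (Fin.cons c j) * nablaCo G lam
          (fun z => trD lam (C.jac x (β z)) fun i => C.nablaPow Φ (n + 1) i (β z)) c y j
        + (-lam * m - n) * (n + 1) *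
          ∑ j, (∑ a, ∑ b, rTen G a b y * T (Fin.cons a (Fin.cons b j))) *
            trD lam (C.jac x (β y)) (fun i => C.nablaPow Φ n i (β y)) j := by
  have hm0 : m ≠ 0 := by omega
  have hu := hβ.mem y hy
  set E := C.jac x (β y) with hE
  have hs0 := h.scale_ne hm0 hu
  have hmem : ∀ c, tr E⁻¹.transpose (fun i => T (Fin.cons c i)) ∈ stf (etaMat m p) (n + 1) := by
    intro c
    refine tr_mem_stf (c := (C.scale x G (β y))⁻¹) ?_ (stf_cons hT c)
    have := h.metric_eq hm0 hu
    rw [hβ.x_eq y hy] at this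
    rw [Matrix.transpose_transpose, this, smul_smul, inv_mul_cancel₀ hs0, one_smul]
  have h1 : ∀ c, ∑ j, T (Fin.cons c j) * trD lam E
      (-rho (-lam) (zPart (vertPart (C.vel β c y))).transpose
            (fun i => C.nablaPow Φ (n + 1) i (β y))
          + fun i => C.L (vertPart (C.vel β c y)) (C.nablaPow Φ (n + 1) i) (β y)) j
      = -((n + 1) * (lam * m + n)) * (|E.det| ^ (-lam) * ∑ j, ic (plusPart (vertPart (C.vel β c y)))
        (tr E⁻¹.transpose (fun i => T (Fin.cons c i))) j * C.nablaPow Φ n j (β y)) := by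
    intro c
    have e1 := C.sum_mul_L_nablaPow h.isOpen hΦ hL (n + 1) _ (isVert_vertPart (C.vel β c y)) _
      (hmem c) _ hu
    rw [sum_mul_trD]
    simp only [Pi.add_apply, Pi.neg_apply, mul_add, mul_neg, Finset.sum_add_distrib,
      Finset.sum_neg_distrib, sum_mul_rho, e1, lower]
    push_cast
    ring
  have h2 : ∑ c, ∑ j, ic (plusPart (vertPart (C.vel β c y)))
        (tr E⁻¹.transpose (fun i => T (Fin.cons c i))) j * C.nablaPow Φ n j (β y)
      = -∑ j, tr E⁻¹.transpose (fun i => ∑ a, ∑ b, rTen G a b y *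
          T (Fin.cons a (Fin.cons b i))) j * C.nablaPow Φ n j (β y) := by
    rw [Finset.sum_comm, ← Finset.sum_neg_distrib]
    refine Finset.sum_congr rfl fun j _ => ?_
    rw [← Finset.sum_mul, ← neg_mul]
    congr 1
    have e2 : tr E⁻¹.transpose (fun i => ∑ c, ∑ d, C.xi x β y c d * T (Fin.cons c (Fin.cons d i))) j
        = -tr E⁻¹.transpose (fun i => ∑ a, ∑ b, rTen G a b y * T (Fin.cons a (Fin.cons b i))) j := by
      simp only [hβ.sum_xi h hC hm hy hT, tr, mul_neg, Finset.sum_neg_distrib]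
    rw [← e2]
    have e3 : tr E⁻¹.transpose (fun i => ∑ c, ∑ d, C.xi x β y c d *
        T (Fin.cons c (Fin.cons d i))) j = ∑ c, ∑ d, C.xi x β y c d *
          tr E⁻¹.transpose (fun i => T (Fin.cons c (Fin.cons d i))) j := by
      have := tr_sum_mul (E := E⁻¹.transpose) Finset.univ (fun _ : Fin m => (1 : ℝ))
        (fun c i => ∑ d, C.xi x β y c d * T (Fin.cons c (Fin.cons d i))) j
      simp only [one_mul] at this
      rw [this]
      exact Finset.sum_congr rfl fun c _ => tr_sum_mul _ _ _ _
    rw [e3]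
    refine Finset.sum_congr rfl fun c _ => ?_
    simp only [ic, tr_cons, CartanGeometry.xi, Finset.mul_sum, Finset.sum_mul,
      Matrix.transpose_apply]
    rw [Finset.sum_comm]
    exact Finset.sum_congr rfl fun d _ => Finset.sum_congr rfl fun b _ => by ring
  have h3 : ∑ c, ∑ j : Fin (n + 1) → Fin m, T (Fin.cons c j) *
        trD lam E (fun i => C.nablaPow Φ (n + 2) i (β y)) (Fin.cons c j)
      = ∑ c, ∑ j, T (Fin.cons c j) * nablaCo G lam
          (fun z => trD lam (C.jac x (β z)) fun i => C.nablaPow Φ (n + 1) i (β z)) c y j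
        - ∑ c, ∑ j, T (Fin.cons c j) * trD lam E
      (-rho (-lam) (zPart (vertPart (C.vel β c y))).transpose
            (fun i => C.nablaPow Φ (n + 1) i (β y))
          + fun i => C.L (vertPart (C.vel β c y)) (C.nablaPow Φ (n + 1) i) (β y)) j := by
    rw [← Finset.sum_sub_distrib]
    refine Finset.sum_congr rfl fun c _ => ?_
    rw [← Finset.sum_sub_distrib]
    refine Finset.sum_congr rfl fun j _ => ?_
    rw [← mul_sub, ← hβ.nablaPow_succ h hC hm0 hy hΦ c j]
  rw [h3]
  simp only [h1, ← Finset.mul_sum]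
  rw [h2, sum_mul_trD]
  ring

/-- The quantization along a section in the gauge `scale = 1`. -/
theorem CartanGeometry.GaugeSection.opQ_eq (hβ : C.GaugeSection O x G Ω' β)
    (h : C.ConfCoord O x G Ω) (hC : C.IsNormal) (hm : 3 ≤ m) (hΦ : C.Sm O Φ)
    (hL : ∀ X : soAlg m p, IsVert X → ∀ v ∈ O, C.L X Φ v = lam * (zPart X).trace * Φ v)
    {s : (n : ℕ) → P → Ten m n} (hs : C.DivChain O δ k s)
    {B : Fin m → Fin m → Euc m → ℝ} (hB : ∀ a b, ContDiffOn ℝ ∞ (B a b) Ω)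
    (hBr : ∀ y ∈ Ω, ∀ n, ∀ T ∈ stf (G y) (n + 2), ∀ j : Fin n → Fin m,
      ∑ a, ∑ b, B a b y * T (Fin.cons a (Fin.cons b j))
        = ∑ a, ∑ b, rTen G a b y * T (Fin.cons a (Fin.cons b j)))
    {S f : GField m} (hS : SmoothG Ω S) (hf : SmoothG Ω f) (hSk : ∀ n, n ≠ k → S n = 0)
    (hf0 : ∀ n, n ≠ 0 → f n = 0)
    (hSs : ∀ u ∈ O, S k (x u) = trS δ (C.jac x u) (s k u))
    (hfs : ∀ u ∈ O, f 0 (x u) = trD lam (C.jac x u) fun _ => Φ u) (hy : y ∈ Ω') :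
    C.opQ k (fun n u => coeffC m lam δ k (k - n) • s n u) Φ (β y)
      = |(C.jac x (β y)).det| ^ (lam + δ) * formula G B lam δ k S f y := by
  have hm0 : m ≠ 0 := by omega
  have hmR : (m : ℝ) ≠ 0 := Nat.cast_ne_zero.2 hm0
  have hsub : Ω' ⊆ Ω := fun z hz => hβ.x_eq z hz ▸ h.maps _ (hβ.mem z hz)
  have hG : IsMetricOn G Ω' := ⟨hβ.isOpen, fun i j => (h.metric.smooth i j).mono hsub,
    fun z hz => h.metric.symm z (hsub hz), fun z hz => h.metric.det z (hsub hz)⟩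
  have hu := hβ.mem y hy
  have hgam : (m : ℝ) * gam m δ (2 * k - 2) = m + (2 * k - 2) - m * δ := by
    rw [gam]; push_cast; field_simp
  -- The two families are the coordinate components, along the section, of the iterated divergences
  -- and of the iterated derivatives.
  have key := hG.formula_eq (k := k) (lam := lam) (δ := δ) (fun a b => (hB a b).mono hsub)
    (fun z hz => hBr z (hsub hz)) (fun n i => (hS n i).mono hsub)
    (fun n i => (hf n i).mono hsub) hSk hf0
    (s := fun n z => trS δ (C.jac x (β z)) (s n (β z)))
    (t := fun n z => trD lam (C.jac x (β z)) fun i => C.nablaPow Φ n i (β z))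
    (fun n i => hβ.contDiffOn (sm_trS h.isOpen h.smM_jac h.det (hs.smooth n) i))
    (fun n i => hβ.contDiffOn (sm_trD (Θ := fun v i => C.nablaPow Φ n i v) h.isOpen h.smM_jac h.det
      (fun i => hΦ.nablaPow n i) i))
    (fun n _ z hz => by
      have hv := hβ.mem z hz
      refine Submodule.smul_mem _ _ (tr_mem_stf (c := C.scale x G (β z)) ?_ (hs.mem n _ hv))
      have := h.conf_scale hm0 hv
      rwa [hβ.x_eq z hz] at this)
    (fun z hz => by rw [← hSs _ (hβ.mem z hz), hβ.x_eq z hz])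
    (fun n hn z hz i => by
      rw [hβ.divTen_trS h hC hm hz hs hn.le i, ← hn]
      push_cast
      ring)
    (fun n hn z hz i => by
      rw [hβ.divTen_trS h hC hm hz hs (by omega) i, hgam]
      push_cast
      ring)
    (fun z hz => by
      have := hfs _ (hβ.mem z hz)
      rw [hβ.x_eq z hz] at this
      exact this.symm)
    (fun _ z hz c j => by
      rw [hβ.nablaPow_succ h hC hm0 hz hΦ c j]
      have e : (-rho (-lam) (zPart (vertPart (C.vel β c z))).transpose
            (fun i : Fin 0 → Fin m => C.nablaPow Φ 0 i (β z))
          + fun i => C.L (vertPart (C.vel β c z)) (C.nablaPow Φ 0 i) (β z)) = 0 := by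
        funext i
        have e1 := hL _ (isVert_vertPart (C.vel β c z)) _ (hβ.mem z hz)
        simp only [Pi.add_apply, Pi.neg_apply, rho, CartanGeometry.nablaPow, e1,
          Matrix.trace_transpose, Finset.univ_eq_empty, Finset.sum_empty, Pi.zero_apply]
        ring
      rw [e]
      simp only [trD, tr_zero_right, smul_zero, Pi.zero_apply, sub_zero])
    (fun n _ z hz T hT => hβ.sum_mul_nablaPow h hC hm hz hΦ hL hT) hy
  rw [key]
  simp only [sum_trS_mul_trD (h.det _ hu)]
  rw [Finset.mul_sum, CartanGeometry.opQ,
    -- `Q_ω` is summed over the degree `n`, the formula over `l = k - n`.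
    ← Finset.sum_range_reflect (fun n => ∑ i, (coeffC m lam δ k (k - n) • s n (β y)) i *
      C.nablaPow Φ n i (β y))]
  refine Finset.sum_congr rfl fun l hl => ?_
  have hl' : l ≤ k := Nat.lt_succ_iff.1 (Finset.mem_range.1 hl)
  have e1 : k + 1 - 1 - l = k - l := by omega
  have e2 : k - (k - l) = l := by omega
  have e3 : |(C.jac x (β y)).det| ^ (lam + δ) * |(C.jac x (β y)).det| ^ (-(lam + δ)) = 1 := by
    rw [← Real.rpow_add (abs_pos.2 (h.det _ hu)), add_neg_cancel, Real.rpow_zero]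
  rw [e1, e2]
  calc _ = coeffC m lam δ k l * ∑ i, s (k - l) (β y) i * C.nablaPow Φ (k - l) i (β y) := by
        rw [Finset.mul_sum]
        exact Finset.sum_congr rfl fun i _ => by
          simp only [Pi.smul_apply, smul_eq_mul]; ring
    _ = (|(C.jac x (β y)).det| ^ (lam + δ) * |(C.jac x (β y)).det| ^ (-(lam + δ))) *
        (coeffC m lam δ k l * ∑ i, s (k - l) (β y) i * C.nablaPow Φ (k - l) i (β y)) := by
        rw [e3, one_mul]
    _ = _ := by ring

end Finite
end LocalFormula

/-! ### Existence of adapted sections; the formula at every point of `P` -/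

section GaugeExistence

open scoped Matrix.Norms.Operator in
theorem contDiff_exp_entry_comp {ι E : Type*} [Fintype ι] [DecidableEq ι] [NormedAddCommGroup E]
    [NormedSpace ℝ E] {A : E → Matrix ι ι ℝ} (hA : ∀ i j, ContDiff ℝ ∞ fun y => A y i j)
    (a b : ι) : ContDiff ℝ ∞ (fun y => NormedSpace.exp (A y) a b) := by
  have h1 : ContDiff ℝ ∞ (fun A : Matrix ι ι ℝ => A a b) :=
    (LinearMap.toContinuousLinearMap (Matrix.entryLinearMap ℝ ℝ a b)).contDiff
  have h2 : ContDiff ℝ ∞ (NormedSpace.exp : Matrix ι ι ℝ → Matrix ι ι ℝ) :=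
    contDiff_iff_contDiffAt.2 fun A => (NormedSpace.exp_analytic (𝕂 := ℝ) A).contDiffAt
  have h3 : ContDiff ℝ ∞ A := by
    have h4 : A = fun y => ∑ i, ∑ j, A y i j • Matrix.single i j (1 : ℝ) := by
      funext y
      conv_lhs => rw [Matrix.matrix_eq_sum_single (A y)]
      simp [Matrix.smul_single]
    rw [h4]
    exact ContDiff.sum fun i _ => ContDiff.sum fun j _ => (hA i j).smul contDiff_const
  exact h1.comp (h2.comp h3)

variable {m p : ℕ} {M : Type*} [TopologicalSpace M] [ChartedSpace (Euc m) M]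
  {F : Type*} [NormedAddCommGroup F] [NormedSpace ℝ F]
  {P : Type*} [TopologicalSpace P] [ChartedSpace F P] [IsManifold 𝓘(ℝ, F) ∞ P]
  {C : CartanGeometry m p M F P} {O : Set P} {Φ : P → ℝ} {u : P} {V : soAlg m p} {n k : ℕ}
  {lam δ : ℝ} {x : P → Euc m} {G : Euc m → Matrix (Fin m) (Fin m) ℝ} {Ω Ω' : Set (Euc m)}
  {β : Euc m → P} {y : Euc m}

theorem isVert_gPlus (ξ : Fin m → ℝ) : IsVert (gPlus ξ : soAlg m p) := fun i => by
  simp [minusPart, gPlus, plusMat]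

theorem zPart_gPlus (ξ : Fin m → ℝ) : zPart (gPlus ξ : soAlg m p) = 0 := by
  ext i j
  simp [zPart, zeroPart, gPlus, plusMat]

theorem plusPart_gPlus (ξ : Fin m → ℝ) : plusPart (gPlus ξ : soAlg m p) = ξ := by
  funext i
  simp [plusPart, gPlus, plusMat]

/-- The Gram matrix of the frame changes by `zᵀη + ηz` times `scale`, and `scale` is its normalized
`η`-trace. In particular `𝔤₁` does not change `scale`. -/
theorem CartanGeometry.ConfCoord.L_vert_scale (h : C.ConfCoord O x G Ω) (hm : m ≠ 0)
    (hV : IsVert V) (hu : u ∈ O) :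
    C.L V (C.scale x G) u = 2 / (m : ℝ) * (zPart V).trace * C.scale x G u := by
  have h1 : C.LM V (fun v => (C.jac x v).transpose * G (x v) * C.jac x v) u
      = C.scale x G u • ((zPart V).transpose * etaMat m p + etaMat m p * zPart V) := by
    have h2 : C.LM V (fun v => G (x v)) u = 0 := by
      ext i j
      exact (h.smM_metric i j).L_vert_eq_zero hu hV fun g => congrArg (fun z => G z i j)
        (h.act_eq _ hu g)
    rw [C.LM_mul h.isOpen (h.smM_jac.transpose.mul h.isOpen h.smM_metric) h.smM_jac hu,
      C.LM_mul h.isOpen h.smM_jac.transpose h.smM_metric hu, C.LM_transpose, h.LM_jac hV hu, h2]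
    have h3 := h.conf_scale hm hu
    calc _ = (zPart V).transpose * ((C.jac x u).transpose * G (x u) * C.jac x u)
          + ((C.jac x u).transpose * G (x u) * C.jac x u) * zPart V := by
          rw [Matrix.transpose_mul, Matrix.mul_zero, add_zero]; noncomm_ring
      _ = _ := by rw [h3, Matrix.mul_smul, Matrix.smul_mul, smul_add]
  have h4 : C.L V (C.scale x G) u = (1 / (m : ℝ)) * ∑ a, eta p a *
      C.LM V (fun v => (C.jac x v).transpose * G (x v) * C.jac x v) u a a := by
    have e1 : C.Sm O fun v => ∑ a, eta p a *
        ((C.jac x v).transpose * G (x v) * C.jac x v) a a :=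
      CartanGeometry.Sm.sum _ h.isOpen fun a _ => (h.smM_form a a).const_mul _
    refine (e1.L_const_mul hu _).trans ?_
    rw [CartanGeometry.Sm.L_sum _ h.isOpen (fun a _ => (h.smM_form a a).const_mul _) hu]
    congr 1
    exact Finset.sum_congr rfl fun a _ => (h.smM_form a a).L_const_mul hu _
  rw [h4, h1]
  have h5 : ∀ a, eta p a * (C.scale x G u • ((zPart V).transpose * etaMat m p
      + etaMat m p * zPart V)) a a = 2 * C.scale x G u * zPart V a a := by
    intro a
    simp only [Matrix.smul_apply, Matrix.add_apply, etaMat, Matrix.mul_diagonal,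
      Matrix.diagonal_mul, Matrix.transpose_apply, smul_eq_mul]
    linear_combination (2 * C.scale x G u * zPart V a a) * eta_mul_self (m := m) p a
  simp only [h5, ← Finset.mul_sum, Matrix.trace, Matrix.diag_apply]
  ring

/-- The bracket `[ξ, e_b]` has `𝔤₀`-trace `-m ξ_b`. The derivatives of `scale` therefore move along
`exp 𝔤₁` at a constant nonzero multiple of `ξ`, and can be brought to zero. -/
theorem CartanGeometry.ConfCoord.L_gPlus_L_scale (h : C.ConfCoord O x G Ω) (hm : m ≠ 0)
    (hu : u ∈ O) (ξ : Fin m → ℝ) (b : Fin m) :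
    C.L (gPlus ξ) (C.L (eVec b) (C.scale x G)) u = -2 * ξ b * C.scale x G u := by
  have hmR : (m : ℝ) ≠ 0 := Nat.cast_ne_zero.2 hm
  obtain ⟨Y, hY, hz, -, hb⟩ := exists_soBr_eVec (gPlus ξ : soAlg m p) b
  have h0 : ∀ v ∈ O, C.L (gPlus ξ) (C.scale x G) v = 0 := fun v hv => by
    rw [h.L_vert_scale hm (isVert_gPlus ξ) hv, zPart_gPlus, Matrix.trace_zero]; ring
  rw [h.sm_scale.L_eVec_comm (isVert_gPlus ξ) hu hb, C.L_congr_on h.isOpen hu h0, C.L_const,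
    h.L_vert_scale hm hY hu, hz, plusPart_gPlus, Matrix.trace_neg, trace_br, zPart_gPlus]
  simp only [Matrix.zero_apply, zero_mul, Finset.sum_const_zero]
  field_simp
  ring

/-- Through every point of `P`, up to the action of `exp 𝔤₁`, there is a section in the gauge
`scale = 1`. -/
theorem CartanGeometry.ConfCoord.exists_gaugeSection (h : C.ConfCoord O x G Ω) (hm : m ≠ 0)
    (hu : u ∈ O) : ∃ (Ω' : Set (Euc m)) (β : Euc m → P) (ξ : Fin m → ℝ) (c : ℝ → groupH m p),
      C.GaugeSection O x G Ω' β ∧ x u ∈ Ω' ∧ (∀ t : ℝ,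
        ((c t : (Matrix (Idx m) (Idx m) ℝ)ˣ) : Matrix (Idx m) (Idx m) ℝ)
      = NormedSpace.exp (t • ((gPlus ξ : soAlg m p) : Matrix (Idx m) (Idx m) ℝ))) ∧
      β (x u) = C.act u (c 1) := by
  obtain ⟨β, hβ, h0, hO, hx⟩ := h.sect u hu
  obtain ⟨Ω', hΩx, hΩ, hyΩ⟩ := eventually_nhds_iff.1 hx
  -- With `ξ_b = L_{e_b} scale / (2 scale)`, the flow at time `1` subtracts exactly the derivative
  -- `L_{e_b} scale`.
  have hflow : ∀ y, ∃ c : ℝ → groupH m p, ∀ t : ℝ,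
      ((c t : (Matrix (Idx m) (Idx m) ℝ)ˣ) : Matrix (Idx m) (Idx m) ℝ)
      = NormedSpace.exp (t • ((gPlus (fun b => C.L (eVec b) (C.scale x G) (β y) *
        (2 * C.scale x G (β y))⁻¹) : soAlg m p) : Matrix (Idx m) (Idx m) ℝ)) :=
    fun y => (isVert_gPlus _).exists_flow
  choose c hc using hflow
  have hsm : ∀ {Φ : P → ℝ}, C.Sm O Φ → ContDiff ℝ ∞ fun y => Φ (β y) := fun {Φ} hΦ =>
    contMDiff_iff_contDiff.1 (contMDiffOn_univ.1 (hΦ.smooth.comp hβ.contMDiffOn fun y _ => hO y))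
  have hs : ContDiff ℝ ∞ fun y => (2 * C.scale x G (β y))⁻¹ :=
    (contDiff_const.mul (hsm h.sm_scale)).inv fun y =>
      mul_ne_zero two_ne_zero (h.scale_ne hm (hO y))
  have hξ : ∀ b, ContDiff ℝ ∞ fun y => C.L (eVec b) (C.scale x G) (β y) *
      (2 * C.scale x G (β y))⁻¹ := fun b => (hsm (h.sm_scale.L _)).mul hs
  refine ⟨Ω', fun y => C.act (β y) (c y 1), _, c (x u), ⟨hΩ, ?_, fun y _ => h.act_mem _ (hO y) _,
    fun y hy => by rw [h.act_eq _ (hO y), hΩx y hy], fun y hy b => ?_⟩, hyΩ, hc (x u), congrArg (fun v => C.act v (c (x u) 1)) h0⟩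
  · refine C.contMDiff_act m β (fun y => c y 1) hβ fun a b => ?_
    simp only [hc, one_smul]
    refine contDiff_exp_entry_comp (fun i j => ?_) a b
    rcases i with i | i | i <;> rcases j with j | j | j <;>
      simp only [gPlus, plusMat, Matrix.of_apply]
    all_goals first
      | exact contDiff_const
      | exact hξ _
      | exact contDiff_const.mul (hξ _)
  · set ξ : Fin m → ℝ := fun b => C.L (eVec b) (C.scale x G) (β y) *
      (2 * C.scale x G (β y))⁻¹ with hξd
    have hmem : ∀ t, C.act (β y) (c y t) ∈ O := fun t => h.act_mem _ (hO y) _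
    have hcs : ∀ t, C.scale x G (C.act (β y) (c y t)) = C.scale x G (β y) :=
      h.sm_scale.flow_const (hc y) hmem fun v hv => by
        rw [h.L_vert_scale hm (isVert_gPlus ξ) hv, zPart_gPlus, Matrix.trace_zero]; ring
    -- Since `scale` is constant along the flow, its derivative in the direction `e_b` is affine in
    -- `t`.
    have hd : ∀ t, HasDerivAt (fun t => C.L (eVec b) (C.scale x G) (C.act (β y) (c y t))
        - t * (-2 * ξ b * C.scale x G (β y))) 0 t := fun t => by
      have h1 := C.hasDerivAt_flow (u := β y) (hc y) t ((h.sm_scale.L (eVec b)).mdiffAt (hmem t))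
      rw [h.L_gPlus_L_scale hm (hmem t), hcs] at h1
      have h2 := h1.sub ((hasDerivAt_id t).mul_const (-2 * ξ b * C.scale x G (β y)))
      refine h2.congr_deriv ?_
      ring
    have h3 := is_const_of_deriv_eq_zero (fun t => (hd t).differentiableAt)
      (fun t => (hd t).deriv) 1 0
    rw [flow_zero (hc y), C.act_one] at h3
    have h4 := h.scale_ne hm (hO y)
    have h5 : 2 * ξ b * C.scale x G (β y) = C.L (eVec b) (C.scale x G) (β y) := by
      rw [hξd]
      field_simp
    linarith

section Finite
variable [FiniteDimensional ℝ F]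

/-- The quantization in local coordinates. -/
theorem CartanGeometry.ConfCoord.opQ_eq (h : C.ConfCoord O x G Ω) (hC : C.IsNormal) (hm : 3 ≤ m)
    (hcrit : ¬ IsCritical m δ) (hΦ : C.Sm O Φ)
    (hL : ∀ X : soAlg m p, IsVert X → ∀ v ∈ O, C.L X Φ v = lam * (zPart X).trace * Φ v)
    {s : (n : ℕ) → P → Ten m n} (hs : C.DivChain O δ k s)
    {B : Fin m → Fin m → Euc m → ℝ} (hB : ∀ a b, ContDiffOn ℝ ∞ (B a b) Ω)
    (hBr : ∀ y ∈ Ω, ∀ n, ∀ T ∈ stf (G y) (n + 2), ∀ j : Fin n → Fin m,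
      ∑ a, ∑ b, B a b y * T (Fin.cons a (Fin.cons b j))
        = ∑ a, ∑ b, rTen G a b y * T (Fin.cons a (Fin.cons b j)))
    {S f : GField m} (hS : SmoothG Ω S) (hf : SmoothG Ω f) (hSk : ∀ n, n ≠ k → S n = 0)
    (hf0 : ∀ n, n ≠ 0 → f n = 0)
    (hSs : ∀ u ∈ O, S k (x u) = trS δ (C.jac x u) (s k u))
    (hfs : ∀ u ∈ O, f 0 (x u) = trD lam (C.jac x u) fun _ => Φ u) (hu : u ∈ O) :
    C.opQ k (fun n u => coeffC m lam δ k (k - n) • s n u) Φ u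
      = |(C.jac x u).det| ^ (lam + δ) * formula G B lam δ k S f (x u) := by
  have hm0 : m ≠ 0 := by omega
  obtain ⟨Ω', β, ξ, c, hβ, hx, hc, hβu⟩ := h.exists_gaugeSection hm0 hu
  have hmem : ∀ t, C.act u (c t) ∈ O := fun t => h.act_mem _ hu _
  have h1 := hβ.opQ_eq h hC hm hΦ hL hs hB hBr hS hf hSk hf0 hSs hfs hx
  -- Elements of `𝔤₁` have zero `𝔤₀`-component, so neither the jacobian nor `Q_ω` changes between
  -- `u` and the point of the section in its fibre.
  have h2 : C.jac x (β (x u)) = C.jac x u := by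
    ext i a
    rw [hβu]
    refine (h.smM_jac i a).flow_const hc hmem (fun v hv => ?_) 1
    have h3 := congrFun (congrFun (h.LM_jac (isVert_gPlus ξ) hv) i) a
    rw [zPart_gPlus, Matrix.mul_zero] at h3
    exact h3
  have h4 : C.Sm O (C.opQ k (fun n u => coeffC m lam δ k (k - n) • s n u) Φ) :=
    CartanGeometry.Sm.sum _ h.isOpen fun n _ => CartanGeometry.Sm.sum _ h.isOpen
      fun i _ => sm_opQ_aux hs hΦ n i _
  have h5 : C.opQ k (fun n u => coeffC m lam δ k (k - n) • s n u) Φ (β (x u))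
      = C.opQ k (fun n u => coeffC m lam δ k (k - n) • s n u) Φ u := by
    rw [hβu]
    refine h4.flow_const hc hmem (fun v hv => ?_) 1
    rw [hs.L_opQ hm0 hcrit hΦ hL (isVert_gPlus ξ) hv, zPart_gPlus, Matrix.trace_zero]
    ring
  rw [← h5, h1, h2]

end Finite
end GaugeExistence

/-! ### Charts of `M` as coordinates on `P` -/

section Charts

variable {m p : ℕ} {M : Type*} [TopologicalSpace M] [ChartedSpace (Euc m) M]
  {F : Type*} [NormedAddCommGroup F] [NormedSpace ℝ F]
  {P : Type*} [TopologicalSpace P] [ChartedSpace F P] [IsManifold 𝓘(ℝ, F) ∞ P]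
  {C : CartanGeometry m p M F P} {u : P} {g : Metric m M p}
  {φ : OpenPartialHomeomorph M (Euc m)} {y : Euc m}

/-- A smooth map of the whole space into a neighbourhood of `y`, equal to the identity near `y`. -/
theorem exists_cutoff {W : Set (Euc m)} (hW : W ∈ 𝓝 y) : ∃ κ : Euc m → Euc m,
    ContDiff ℝ ∞ κ ∧ (∀ z, κ z ∈ W) ∧ κ y = y ∧ ∀ᶠ z in 𝓝 y, κ z = z := by
  obtain ⟨ε, hε, hb⟩ := Metric.mem_nhds_iff.1 hW
  let f : ContDiffBump y := ⟨ε / 2, ε, half_pos hε, half_lt_self hε⟩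
  refine ⟨fun z => y + f z • (z - y), ?_, fun z => hb ?_, by simp, ?_⟩
  · exact contDiff_const.add (f.contDiff.smul (contDiff_id.sub contDiff_const))
  · rw [Metric.mem_ball, dist_eq_norm, add_sub_cancel_left, norm_smul,
      Real.norm_of_nonneg f.nonneg]
    by_cases hz : dist z y < ε
    · calc f z * ‖z - y‖ ≤ 1 * ‖z - y‖ := by gcongr; exact f.le_one
        _ = dist z y := by rw [one_mul, dist_eq_norm]
        _ < ε := hz
    · rw [f.zero_of_le_dist (not_lt.1 hz), zero_mul]
      exact hε
  · filter_upwards [f.eventuallyEq_one] with z hz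
    rw [hz]
    simp

theorem mdifferentiable_of_mem_maximalAtlas (hφ : φ ∈ IsManifold.maximalAtlas (𝓡 m) ∞ M) :
    φ.MDifferentiable (𝓡 m) (𝓡 m) :=
  ⟨(contMDiffOn_of_mem_maximalAtlas hφ).mdifferentiableOn (by simp),
    (contMDiffOn_symm_of_mem_maximalAtlas hφ).mdifferentiableOn (by simp)⟩

/-- The coordinates of a tangent vector. -/
def tangentCoord (φ : OpenPartialHomeomorph M (Euc m)) (x : M) (v : TangentSpace (𝓡 m) x) : Euc m :=
  mfderiv (𝓡 m) (𝓡 m) φ x v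

theorem euc_eq_sum (w : Euc m) : w = ∑ i, w i • EuclideanSpace.single i (1 : ℝ) := by
  ext j
  simp [Finset.sum_apply, Pi.single_apply]

theorem eq_sum_coordFrame (hφ : φ ∈ IsManifold.maximalAtlas (𝓡 m) ∞ M) (hy : y ∈ φ.target)
    (v : TangentSpace (𝓡 m) (φ.symm y)) :
    v = ∑ i, tangentCoord φ (φ.symm y) v i • coordFrame φ y i := by
  have h1 := (mdifferentiable_of_mem_maximalAtlas hφ).symm_comp_deriv (φ.map_target hy)
  rw [φ.right_inv hy] at h1
  have h2 : mfderiv (𝓡 m) (𝓡 m) φ.symm y (tangentCoord φ (φ.symm y) v) = v :=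
    congrArg (fun A : TangentSpace (𝓡 m) (φ.symm y) →L[ℝ] TangentSpace (𝓡 m) (φ.symm y) => A v) h1
  conv_lhs => rw [← h2, euc_eq_sum (tangentCoord φ (φ.symm y) v)]
  let A : Euc m →L[ℝ] Euc m := mfderiv (𝓡 m) (𝓡 m) φ.symm y
  have h3 := map_sum A (fun i => tangentCoord φ (φ.symm y) v i • EuclideanSpace.single i (1 : ℝ))
    Finset.univ
  simp only [map_smul] at h3
  exact h3

theorem linearIndependent_coordFrame (hφ : φ ∈ IsManifold.maximalAtlas (𝓡 m) ∞ M)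
    (hy : y ∈ φ.target) : LinearIndependent ℝ (coordFrame φ y) := by
  have h1 := (mdifferentiable_of_mem_maximalAtlas hφ).comp_symm_deriv hy
  let A : Euc m →L[ℝ] Euc m := mfderiv (𝓡 m) (𝓡 m) φ.symm y
  have h2 : Function.Injective A := by
    intro v w hvw
    let B : Euc m →L[ℝ] Euc m := mfderiv (𝓡 m) (𝓡 m) φ (φ.symm y)
    have h3 : ∀ v, B (A v) = v := fun v =>
      congrArg (fun A : TangentSpace (𝓡 m) y →L[ℝ] TangentSpace (𝓡 m) y => A v) h1
    rw [← h3 v, hvw, h3]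
  have h3 : LinearIndependent ℝ fun i : Fin m => (EuclideanSpace.single i (1 : ℝ) : Euc m) := by
    have h4 := (EuclideanSpace.basisFun (Fin m) ℝ).toBasis.linearIndependent
    have h5 : ⇑(EuclideanSpace.basisFun (Fin m) ℝ).toBasis
        = fun i : Fin m => (EuclideanSpace.single i (1 : ℝ) : Euc m) := by
      funext i
      simp
    rw [h5] at h4
    exact h4
  exact h3.map' A.toLinearMap (LinearMap.ker_eq_bot.2 h2)

/-- The chart `φ` as a function on `P`. -/
def CartanGeometry.crd (C : CartanGeometry m p M F P) (φ : OpenPartialHomeomorph M (Euc m))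
    (u : P) : Euc m := φ (C.proj u)

theorem CartanGeometry.contMDiffOn_crd (C : CartanGeometry m p M F P)
    (hφ : φ ∈ IsManifold.maximalAtlas (𝓡 m) ∞ M) :
    ContMDiffOn 𝓘(ℝ, F) (𝓡 m) ∞ (C.crd φ) (C.proj ⁻¹' φ.source) :=
  (contMDiffOn_of_mem_maximalAtlas hφ).comp C.contMDiff_proj.contMDiffOn fun _ hu => hu

theorem CartanGeometry.coord_crd (C : CartanGeometry m p M F P)
    (hφ : φ ∈ IsManifold.maximalAtlas (𝓡 m) ∞ M) :
    C.Coord (C.proj ⁻¹' φ.source) (C.crd φ) where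
  isOpen := φ.open_source.preimage C.contMDiff_proj.continuous
  smooth i := by
    refine ⟨φ.open_source.preimage C.contMDiff_proj.continuous, ?_⟩
    have h1 : ContDiff ℝ ∞ fun z : Euc m => z i :=
      (EuclideanSpace.proj i : Euc m →L[ℝ] ℝ).contDiff
    exact h1.contMDiff.comp_contMDiffOn (C.contMDiffOn_crd hφ)
  act_mem u hu h := by rwa [mem_preimage, C.proj_act]
  act_eq u hu h := by rw [CartanGeometry.crd, C.proj_act]; rfl
  sect u hu := by
    have hu' : C.proj u ∈ φ.source := hu
    obtain ⟨U, hU, hxU, s, hs, hps⟩ := C.local_section (C.proj u)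
    have hW : φ.target ∩ φ.symm ⁻¹' U ∈ 𝓝 (C.crd φ u) := by
      refine (φ.isOpen_inter_preimage_symm hU).mem_nhds ⟨φ.map_source hu', ?_⟩
      rw [mem_preimage, CartanGeometry.crd, φ.left_inv hu']
      exact hxU
    -- The local section is precomposed with the cutoff, which defines it on the whole model space
    -- without changing it near the point, and then translated by `h` so as to pass through `u`.
    obtain ⟨κ, hκ, hκW, hκy, hκe⟩ := exists_cutoff hW
    obtain ⟨h, hh, -⟩ := C.simply_transitive (s (C.proj u)) u (hps _ hxU)
    have hp : ∀ z, C.proj (s (φ.symm (κ z))) = φ.symm (κ z) := fun z => hps _ (hκW z).2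
    refine ⟨fun z => C.act (s (φ.symm (κ z))) h, ?_, ?_, fun z => ?_, ?_⟩
    · refine C.contMDiff_act m _ (fun _ => h) ?_ fun _ _ => contDiff_const
      have h1 := (contMDiffOn_symm_of_mem_maximalAtlas hφ).mono
        (inter_subset_left (s := φ.target) (t := φ.symm ⁻¹' U))
      have h2 := hs.comp h1 fun z hz => hz.2
      exact contMDiffOn_univ.1 (h2.comp hκ.contMDiff.contMDiffOn fun z _ => hκW z)
    · simp only
      rw [hκy, CartanGeometry.crd, φ.left_inv hu', hh]
    · rw [mem_preimage, C.proj_act, hp]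
      exact φ.map_target (hκW z).1
    · filter_upwards [hκe] with z hz
      rw [CartanGeometry.crd, C.proj_act, hp, φ.right_inv (hκW z).1, hz]

theorem CartanGeometry.tangentCoord_frame (C : CartanGeometry m p M F P)
    (hφ : φ ∈ IsManifold.maximalAtlas (𝓡 m) ∞ M) (hu : C.proj u ∈ φ.source) (i a : Fin m) :
    tangentCoord φ (C.proj u) (C.frame u a) i = C.jac (C.crd φ) u i a := by
  have hx : MDifferentiableAt 𝓘(ℝ, F) (𝓡 m) (C.crd φ) u :=
    ((C.contMDiffOn_crd hφ).contMDiffAt ((C.coord_crd hφ).isOpen.mem_nhds hu)).mdifferentiableAt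
      (by simp)
  have h1 : mfderiv 𝓘(ℝ, F) (𝓡 m) (C.crd φ) u
      = (mfderiv (𝓡 m) (𝓡 m) φ (C.proj u)).comp (mfderiv 𝓘(ℝ, F) (𝓡 m) C.proj u) :=
    mfderiv_comp u ((mdifferentiable_of_mem_maximalAtlas hφ).mdifferentiableAt hu)
      (C.contMDiff_proj.mdifferentiable (by simp) u)
  let ℓ : Euc m →L[ℝ] ℝ := EuclideanSpace.proj i
  have h2 : mfderiv 𝓘(ℝ, F) 𝓘(ℝ, ℝ) (fun v => C.crd φ v i) u
      = ℓ.comp (mfderiv 𝓘(ℝ, F) (𝓡 m) (C.crd φ) u) := by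
    have h3 := mfderiv_comp u (I'' := 𝓘(ℝ, ℝ)) (g := ℓ)
      ℓ.differentiableAt.mdifferentiableAt hx
    rw [mfderiv_eq_fderiv, ℓ.fderiv] at h3
    exact h3
  have h4 : C.jac (C.crd φ) u i a = mfderiv 𝓘(ℝ, F) 𝓘(ℝ, ℝ) (fun v => C.crd φ v i) u
    (C.vf (eVec a) u) := rfl
  rw [h4, h2, h1]
  rfl

/-- The matrix of a tuple of tangent vectors with respect to the coordinate frame. -/
def coordMatrix (φ : OpenPartialHomeomorph M (Euc m)) (x : M)
    (v : Fin m → TangentSpace (𝓡 m) x) : Matrix (Fin m) (Fin m) ℝ :=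
  Matrix.of fun i a => tangentCoord φ x (v a) i

theorem coordMatrix_changeFrame (x : M) (v : Fin m → TangentSpace (𝓡 m) x)
    (A : Matrix (Fin m) (Fin m) ℝ) :
    coordMatrix φ x (changeFrame v A) = coordMatrix φ x v * A := by
  ext i a
  let D : Euc m →L[ℝ] Euc m := mfderiv (𝓡 m) (𝓡 m) φ x
  let ℓ : Euc m →L[ℝ] ℝ := (EuclideanSpace.proj i : Euc m →L[ℝ] ℝ).comp D
  let w : Fin m → Euc m := v
  have h1 := map_sum ℓ (fun j => A j a • w j) Finset.univ
  simp only [map_smul, smul_eq_mul] at h1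
  rw [Matrix.mul_apply]
  exact h1.trans (Finset.sum_congr rfl fun j _ => mul_comm _ _)

/-- The equality of points is a hypothesis on a variable `x`; eliminating it avoids any
identification of tangent spaces at points that are merely equal. -/
theorem apply_eq_changeFrame_coordFrame {α : Sort*}
    (hφ : φ ∈ IsManifold.maximalAtlas (𝓡 m) ∞ M) (hy : y ∈ φ.target)
    (T : (x : M) → (Fin m → TangentSpace (𝓡 m) x) → α) :
    ∀ {x : M}, x = φ.symm y → ∀ v : Fin m → TangentSpace (𝓡 m) x,
      T x v = T (φ.symm y) (changeFrame (coordFrame φ y) (coordMatrix φ x v)) := by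
  rintro x rfl v
  congr 1
  funext a
  exact eq_sum_coordFrame hφ hy (v a)

theorem CartanGeometry.coordMatrix_frame (C : CartanGeometry m p M F P)
    (hφ : φ ∈ IsManifold.maximalAtlas (𝓡 m) ∞ M) (hu : C.proj u ∈ φ.source) :
    coordMatrix φ (C.proj u) (C.frame u) = C.jac (C.crd φ) u := by
  ext i a
  exact C.tangentCoord_frame hφ hu i a

theorem CartanGeometry.apply_frame (C : CartanGeometry m p M F P) {α : Sort*}
    (hφ : φ ∈ IsManifold.maximalAtlas (𝓡 m) ∞ M) (hu : C.proj u ∈ φ.source)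
    (T : (x : M) → (Fin m → TangentSpace (𝓡 m) x) → α) :
    T (C.proj u) (C.frame u) = T (φ.symm (C.crd φ u))
      (changeFrame (coordFrame φ (C.crd φ u)) (C.jac (C.crd φ) u)) := by
  rw [apply_eq_changeFrame_coordFrame hφ (φ.map_source hu) T (φ.left_inv hu).symm (C.frame u),
    C.coordMatrix_frame hφ hu]
  rfl

theorem CartanGeometry.exists_proj_eq (C : CartanGeometry m p M F P) (x : M) :
    ∃ u, C.proj u = x := by
  obtain ⟨U, -, hx, s, -, hs⟩ := C.local_section x
  exact ⟨s x, hs x hx⟩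

theorem linearIndependent_sum_smul {V : Type*} [AddCommGroup V] [Module ℝ V] {v : Fin m → V}
    (hv : LinearIndependent ℝ v) {A : Matrix (Fin m) (Fin m) ℝ} (hA : A.det ≠ 0) :
    LinearIndependent ℝ fun j => ∑ i, A i j • v i := by
  refine Fintype.linearIndependent_iff.2 fun c hc => ?_
  have h1 : ∑ i, (A.mulVec c) i • v i = 0 := by
    rw [← hc]
    simp only [Finset.smul_sum, Matrix.mulVec, dotProduct, Finset.sum_smul, smul_smul]
    rw [Finset.sum_comm]
    exact Finset.sum_congr rfl fun j _ => Finset.sum_congr rfl fun i _ => by rw [mul_comm]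
  exact congrFun (Matrix.eq_zero_of_mulVec_eq_zero hA
    (funext (Fintype.linearIndependent_iff.1 hv _ h1)))

theorem exists_eq_sum_smul {V : Type*} [AddCommGroup V] [Module ℝ V]
    (hV : Module.finrank ℝ V = m) {v w : Fin m → V} (hv : LinearIndependent ℝ v)
    (hw : LinearIndependent ℝ w) :
    ∃ A : Matrix (Fin m) (Fin m) ℝ, A.det ≠ 0 ∧ w = fun j => ∑ i, A i j • v i := by
  rcases Nat.eq_zero_or_pos m with rfl | hm
  · exact ⟨1, by simp, funext fun j => j.elim0⟩
  have : Nonempty (Fin m) := ⟨⟨0, hm⟩⟩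
  let b := basisOfLinearIndependentOfCardEqFinrank hv (by rw [hV, Fintype.card_fin])
  have hb : ∀ i, b i = v i := fun i => by simp [b]
  have h1 : ∀ j, ∑ i, b.toMatrix w i j • v i = w j := fun j => by
    simp only [← hb]
    exact b.sum_toMatrix_smul_self w j
  refine ⟨b.toMatrix w, fun h0 => ?_, funext fun j => (h1 j).symm⟩
  obtain ⟨c, hc, hc0⟩ := Matrix.exists_mulVec_eq_zero_iff.2 h0
  refine hc (funext (Fintype.linearIndependent_iff.1 hw c ?_))
  calc ∑ j, c j • w j = ∑ i, ((b.toMatrix w).mulVec c) i • v i := by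
        simp only [← h1, Finset.smul_sum, Matrix.mulVec, dotProduct, Finset.sum_smul, smul_smul]
        rw [Finset.sum_comm]
        exact Finset.sum_congr rfl fun j _ => Finset.sum_congr rfl fun i _ => by
          rw [mul_comm]
    _ = 0 := by simp [hc0]

theorem linearIndependent_changeFrame {x : M} {v : Fin m → TangentSpace (𝓡 m) x}
    (hv : LinearIndependent ℝ v) {A : Matrix (Fin m) (Fin m) ℝ} (hA : A.det ≠ 0) :
    LinearIndependent ℝ (changeFrame v A) := linearIndependent_sum_smul hv hA

theorem exists_eq_changeFrame {x : M} {v w : Fin m → TangentSpace (𝓡 m) x}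
    (hv : LinearIndependent ℝ v) (hw : LinearIndependent ℝ w) :
    ∃ A : Matrix (Fin m) (Fin m) ℝ, A.det ≠ 0 ∧ w = changeFrame v A :=
  exists_eq_sum_smul (finrank_euclideanSpace_fin (𝕜 := ℝ) (n := m)) hv hw

theorem CartanGeometry.linearIndependent_frame [IsManifold (𝓡 m) ∞ M]
    (C : CartanGeometry m p M F P) (u : P) :
    LinearIndependent ℝ (C.frame u) := by
  have hφ : chartAt (Euc m) (C.proj u) ∈ IsManifold.maximalAtlas (𝓡 m) ∞ M :=
    IsManifold.chart_mem_maximalAtlas _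
  have hu := mem_chart_source (Euc m) (C.proj u)
  have h := C.apply_frame hφ hu fun _ v => LinearIndependent ℝ v
  rw [h]
  exact linearIndependent_changeFrame
    (linearIndependent_coordFrame hφ ((chartAt (Euc m) (C.proj u)).map_source hu))
    ((C.coord_crd hφ).det u hu)

/-- Nondegeneracy of the components at `y` is read off at a point of `P` over it, where `Eᵀ G E` is
a nonzero multiple of `η`. -/
theorem CartanGeometry.confCoord_crd (C : CartanGeometry m p M F P)
    (hφ : φ ∈ IsManifold.maximalAtlas (𝓡 m) ∞ M) (hg : C.IsMetric g) :
    C.ConfCoord (C.proj ⁻¹' φ.source) (C.crd φ) (g.comp φ) φ.target := by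
  have hconf : ∀ u ∈ C.proj ⁻¹' φ.source, ∃ s : ℝ, s ≠ 0 ∧ (C.jac (C.crd φ) u).transpose *
      g.comp φ (C.crd φ u) * C.jac (C.crd φ) u = s • etaMat m p := by
    intro u hu
    obtain ⟨s, hs, h⟩ := hg u
    refine ⟨s, hs.ne', ?_⟩
    ext a b
    have h1 := C.apply_frame hφ hu fun x v => g.toFun x (v a) (v b)
    rw [h a b] at h1
    simp only [changeFrame, map_sum, map_smul, LinearMap.sum_apply, LinearMap.smul_apply,
      smul_eq_mul] at h1
    rw [Matrix.smul_apply, etaMat, Matrix.diagonal_apply, smul_eq_mul]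
    refine Eq.trans ?_ h1.symm
    simp only [Matrix.mul_apply, Matrix.transpose_apply, Finset.sum_mul, Finset.mul_sum]
    refine Finset.sum_congr rfl fun j _ => Finset.sum_congr rfl fun i _ => ?_
    simp only [Metric.comp, Matrix.of_apply]
    ring
  refine ⟨C.coord_crd hφ, ⟨φ.open_target, g.smooth φ hφ, fun y _ i j => g.symm _ _ _, ?_⟩,
    fun u hu => φ.map_source hu, hconf⟩
  intro y hy h0
  obtain ⟨u, hu⟩ := C.exists_proj_eq (φ.symm y)
  have hu' : C.proj u ∈ φ.source := by rw [hu]; exact φ.map_target hy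
  have hxu : C.crd φ u = y := by rw [CartanGeometry.crd, hu, φ.right_inv hy]
  obtain ⟨s, hs, h⟩ := hconf u hu'
  have h1 := congrArg Matrix.det h
  rw [hxu, Matrix.det_mul, Matrix.det_mul, h0, Matrix.det_smul, etaMat, Matrix.det_diagonal,
    mul_zero, zero_mul] at h1
  refine mul_ne_zero (pow_ne_zero _ hs) (Finset.prod_ne_zero_iff.2 fun i _ => ?_) h1.symm
  rw [eta]
  split_ifs <;> norm_num

end Charts

/-! ### Lifts of symbols and densities -/

section Lifts

variable {m p k n : ℕ} {M : Type*} [TopologicalSpace M] [ChartedSpace (Euc m) M]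
  {F : Type*} [NormedAddCommGroup F] [NormedSpace ℝ F]
  {P : Type*} [TopologicalSpace P] [ChartedSpace F P] [IsManifold 𝓘(ℝ, F) ∞ P]
  {C : CartanGeometry m p M F P} {O : Set P} {x : P → Euc m} {u : P} {X : soAlg m p}
  {lam δ : ℝ} {g : Metric m M p} {S : Symb m M δ k} {f : Density m M lam}
  {φ : OpenPartialHomeomorph M (Euc m)} {y : Euc m} {A B : Matrix (Fin m) (Fin m) ℝ}
  {Ω : Set (Euc m)}

theorem trS_mul (T : Ten m n) : trS δ A (trS δ B T) = trS δ (A * B) T := by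
  rw [trS, trS, trS, tr_smul, tr_tr, smul_smul, Matrix.det_mul, abs_mul,
    Real.mul_rpow (abs_nonneg _) (abs_nonneg _), Matrix.transpose_mul]

theorem trD_mul (T : Ten m n) : trD lam A (trD lam B T) = trD lam (A * B) T := by
  rw [trD, trD, trD, tr_smul, tr_tr, smul_smul, Matrix.det_mul, abs_mul,
    Real.mul_rpow (abs_nonneg _) (abs_nonneg _), Matrix.mul_inv_rev]

theorem trS_one (T : Ten m n) : trS δ 1 T = T := by
  rw [trS, Matrix.transpose_one, tr_one, Matrix.det_one, abs_one, Real.one_rpow, one_smul]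

theorem trD_one (T : Ten m n) : trD lam 1 T = T := by
  rw [trD, inv_one, tr_one, Matrix.det_one, abs_one, Real.one_rpow, one_smul]

theorem abs_det_inv_rpow (A : Matrix (Fin m) (Fin m) ℝ) (c : ℝ) : |A⁻¹.det| ^ (-c) = |A.det| ^ c := by
  rw [Matrix.det_nonsing_inv, Ring.inverse_eq_inv', abs_inv, Real.inv_rpow (abs_nonneg _),
    Real.rpow_neg (abs_nonneg _), inv_inv]

/-- The coordinate components depend on `x` alone, so their vertical derivatives vanish. Removing
the invertible transformation leaves the infinitesimal equivariance of `Θ`. -/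
theorem CartanGeometry.Coord.L_of_trS_invariant (h : C.Coord O x) {Θ : P → Ten m n}
    (hΘ : ∀ i, C.Sm O fun v => Θ v i) {T : Euc m → Ten m n}
    (hT : ∀ v ∈ O, T (x v) = trS δ (C.jac x v) (Θ v)) (hX : IsVert X) (hu : u ∈ O)
    (i : Fin n → Fin m) : C.L X (fun v => Θ v i) u = -rho δ (zPart X) (Θ u) i := by
  have h1 : trS δ (C.jac x u) (rho δ (zPart X) (Θ u) + fun i => C.L X (fun v => Θ v i) u) = 0 := by
    funext j
    rw [← L_trS_of_right h.isOpen h.smM_jac h.det hΘ hu (h.LM_jac hX hu) j,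
      (sm_trS h.isOpen h.smM_jac h.det hΘ j).L_vert_eq_zero hu hX fun a => ?_]
    · rfl
    · rw [← hT _ (h.act_mem u hu a), ← hT _ hu, h.act_eq u hu a]
  have h2 := congrArg (trS δ (C.jac x u)⁻¹) h1
  rw [trS_mul, h.inv_mul hu, trS_one, trS, tr_zero_right, smul_zero] at h2
  have h3 := congrFun h2 i
  rw [Pi.add_apply, Pi.zero_apply] at h3
  linarith

theorem CartanGeometry.Coord.L_of_trD_invariant (h : C.Coord O x) {Θ : P → Ten m n}
    (hΘ : ∀ i, C.Sm O fun v => Θ v i) {T : Euc m → Ten m n}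
    (hT : ∀ v ∈ O, T (x v) = trD lam (C.jac x v) (Θ v)) (hX : IsVert X) (hu : u ∈ O)
    (i : Fin n → Fin m) :
    C.L X (fun v => Θ v i) u = rho (-lam) (zPart X).transpose (Θ u) i := by
  have h1 : trD lam (C.jac x u)
      (-rho (-lam) (zPart X).transpose (Θ u) + fun i => C.L X (fun v => Θ v i) u) = 0 := by
    funext j
    rw [← L_trD_of_right h.isOpen h.smM_jac h.det hΘ hu (h.LM_jac hX hu) j,
      (sm_trD h.isOpen h.smM_jac h.det hΘ j).L_vert_eq_zero hu hX fun a => ?_]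
    · rfl
    · rw [← hT _ (h.act_mem u hu a), ← hT _ hu, h.act_eq u hu a]
  have h2 := congrArg (trD lam (C.jac x u)⁻¹) h1
  rw [trD_mul, h.inv_mul hu, trD_one, trD, tr_zero_right, smul_zero] at h2
  have h3 := congrFun h2 i
  rw [Pi.add_apply, Pi.neg_apply, Pi.zero_apply] at h3
  linarith

theorem single_self (t : Euc m → Ten m k) (y : Euc m) : GField.single k t k y = t y := by
  funext i
  simp only [GField.single, dif_pos]
  rfl

theorem single_of_ne (t : Euc m → Ten m k) (h : n ≠ k) : GField.single k t n = 0 := by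
  funext y i
  rw [GField.single, dif_neg h.symm]
  rfl

theorem smoothG_single {t : Euc m → Ten m k} (ht : SmoothTen Ω t) :
    SmoothG Ω (GField.single k t) := by
  intro n
  by_cases h : n = k
  · subst h
    intro i
    simp only [single_self]
    exact ht i
  · rw [single_of_ne t h]
    exact fun i => contDiffOn_const

theorem Symb.smoothG_graded (S : Symb m M δ k) (hφ : φ ∈ IsManifold.maximalAtlas (𝓡 m) ∞ M) :
    SmoothG φ.target (S.graded φ) := smoothG_single fun i => S.smooth φ hφ i

theorem Density.smoothG_graded (f : Density m M lam)
    (hφ : φ ∈ IsManifold.maximalAtlas (𝓡 m) ∞ M) :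
    SmoothG φ.target (f.graded φ) := smoothG_single fun _ => f.smooth φ hφ

theorem CartanGeometry.liftD_eq (C : CartanGeometry m p M F P)
    (hφ : φ ∈ IsManifold.maximalAtlas (𝓡 m) ∞ M) (hu : C.proj u ∈ φ.source) :
    C.liftD f u = |(C.jac (C.crd φ) u).det| ^ lam * f.comp φ (C.crd φ u) := by
  rw [CartanGeometry.liftD, C.apply_frame hφ hu f.toFun]
  exact f.equivariant _ _ (linearIndependent_coordFrame hφ (φ.map_source hu)) _
    ((C.coord_crd hφ).det u hu)

theorem CartanGeometry.liftS_eq (C : CartanGeometry m p M F P)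
    (hφ : φ ∈ IsManifold.maximalAtlas (𝓡 m) ∞ M) (hu : C.proj u ∈ φ.source) :
    C.liftS S u = trS δ (C.jac (C.crd φ) u)⁻¹ (S.graded φ k (C.crd φ u)) := by
  have hdet := (C.coord_crd hφ).det u hu
  have hy : C.crd φ u ∈ φ.target := φ.map_source hu
  funext i
  rw [CartanGeometry.liftS, C.apply_frame hφ hu fun x v => S.toFun x v i,
    S.equivariant _ _ (linearIndependent_coordFrame hφ hy) _ hdet i, trS,
    Pi.smul_apply, abs_det_inv_rpow, Symb.graded, single_self]
  rfl

theorem CartanGeometry.graded_symb (C : CartanGeometry m p M F P)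
    (hφ : φ ∈ IsManifold.maximalAtlas (𝓡 m) ∞ M) (hu : C.proj u ∈ φ.source) :
    S.graded φ k (C.crd φ u) = trS δ (C.jac (C.crd φ) u) (C.liftS S u) := by
  rw [C.liftS_eq hφ hu, trS_mul, (C.coord_crd hφ).mul_inv hu, trS_one]

theorem CartanGeometry.graded_density (C : CartanGeometry m p M F P)
    (hφ : φ ∈ IsManifold.maximalAtlas (𝓡 m) ∞ M) (hu : C.proj u ∈ φ.source) :
    f.graded φ 0 (C.crd φ u) = trD lam (C.jac (C.crd φ) u) fun _ => C.liftD f u := by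
  have h1 : (fun _ => C.liftD f u) = trD lam (C.jac (C.crd φ) u)⁻¹ (f.graded φ 0 (C.crd φ u)) := by
    funext i
    rw [trD, tr_zero, abs_det_inv_rpow, C.liftD_eq hφ hu,
      Density.graded, single_self]
    rfl
  rw [h1, trD_mul, (C.coord_crd hφ).mul_inv hu, trD_one]

theorem CartanGeometry.sm_liftS_on (C : CartanGeometry m p M F P) (S : Symb m M δ k)
    (hφ : φ ∈ IsManifold.maximalAtlas (𝓡 m) ∞ M) (i : Fin k → Fin m) :
    C.Sm (C.proj ⁻¹' φ.source) fun u => C.liftS S u i := by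
  have h := C.coord_crd hφ
  have h1 : ∀ v ∈ C.proj ⁻¹' φ.source, (C.jac (C.crd φ) v)⁻¹.det ≠ 0 := fun v hv h0 => by
    have h2 := congrArg Matrix.det (h.inv_mul hv)
    rw [Matrix.det_mul, h0, zero_mul, Matrix.det_one] at h2
    exact zero_ne_one h2
  refine (sm_trS (δ := δ) h.isOpen h.smM_inv h1 (fun j => h.sm_comp (S.smoothG_graded hφ k j)
    fun u hu => φ.map_source hu) i).congr fun v hv => ?_
  rw [C.liftS_eq hφ hv]

theorem CartanGeometry.sm_liftD_on (C : CartanGeometry m p M F P) (f : Density m M lam)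
    (hφ : φ ∈ IsManifold.maximalAtlas (𝓡 m) ∞ M) :
    C.Sm (C.proj ⁻¹' φ.source) (C.liftD f) := by
  have h := C.coord_crd hφ
  exact ((h.smM_jac.abs_det_rpow h.isOpen h.det lam).mul (h.sm_comp (f.smooth φ hφ)
    fun u hu => φ.map_source hu)).congr fun v hv => C.liftD_eq hφ hv

theorem CartanGeometry.L_liftD (C : CartanGeometry m p M F P) (f : Density m M lam)
    (hφ : φ ∈ IsManifold.maximalAtlas (𝓡 m) ∞ M) (hX : IsVert X) (hu : C.proj u ∈ φ.source) :
    C.L X (C.liftD f) u = lam * (zPart X).trace * C.liftD f u := by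
  have h1 := (C.coord_crd hφ).L_of_trD_invariant (Θ := fun v (_ : Fin 0 → Fin m) => C.liftD f v)
    (fun _ => C.sm_liftD_on f hφ) (T := f.graded φ 0) (fun v hv => C.graded_density hφ hv) hX hu
    Fin.elim0
  refine h1.trans ?_
  simp [rho]

theorem CartanGeometry.DivChain.mono {s : (n : ℕ) → P → Ten m n} (h : C.DivChain univ δ k s)
    (hO : IsOpen O) : C.DivChain O δ k s where
  isOpen := hO
  above := h.above
  top_smooth i := (h.top_smooth i).mono hO (subset_univ _)
  top_mem u _ := h.top_mem u (mem_univ u)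
  top_vert X hX u _ := h.top_vert X hX u (mem_univ u)
  step n hn u _ := h.step n hn u (mem_univ u)

theorem CartanGeometry.opQ_liftD [FiniteDimensional ℝ F] (hm : 3 ≤ m) (hC : C.IsNormal)
    (hg : C.IsMetric g) (hcrit : ¬ IsCritical m δ) {s : (n : ℕ) → P → Ten m n}
    (hs : C.DivChain univ δ k s) (hsk : s k = C.liftS S)
    (hφ : φ ∈ IsManifold.maximalAtlas (𝓡 m) ∞ M) {B : Fin m → Fin m → Euc m → ℝ}
    (hB : ∀ a b, ContDiffOn ℝ ∞ (B a b) φ.target)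
    (hBr : ∀ y ∈ φ.target, ∀ n, ∀ T ∈ stf (g.comp φ y) (n + 2), ∀ j : Fin n → Fin m,
      ∑ a, ∑ b, B a b y * T (Fin.cons a (Fin.cons b j))
        = ∑ a, ∑ b, rTen (g.comp φ) a b y * T (Fin.cons a (Fin.cons b j)))
    (hu : C.proj u ∈ φ.source) :
    C.opQ k (fun n u => coeffC m lam δ k (k - n) • s n u) (C.liftD f) u
      = |(C.jac (C.crd φ) u).det| ^ (lam + δ)
        * formula (g.comp φ) B lam δ k (S.graded φ) (f.graded φ) (C.crd φ u) := by
  have h := C.confCoord_crd hφ hg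
  exact h.opQ_eq hC hm hcrit (C.sm_liftD_on f hφ) (fun X hX v hv => C.L_liftD f hφ hX hv)
    (hs.mono h.isOpen) hB hBr (S.smoothG_graded hφ) (f.smoothG_graded hφ)
    (fun n hn => single_of_ne _ hn) (fun n hn => single_of_ne _ hn)
    (fun v hv => by rw [hsk]; exact C.graded_symb hφ hv) (fun v hv => C.graded_density hφ hv) hu

variable [IsManifold (𝓡 m) ∞ M]

theorem CartanGeometry.L_liftS (C : CartanGeometry m p M F P) (S : Symb m M δ k)
    (hX : IsVert X) (u : P) (i : Fin k → Fin m) :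
    C.L X (fun v => C.liftS S v i) u = -rho δ (zPart X) (C.liftS S u) i := by
  have hφ : chartAt (Euc m) (C.proj u) ∈ IsManifold.maximalAtlas (𝓡 m) ∞ M :=
    IsManifold.chart_mem_maximalAtlas _
  exact (C.coord_crd hφ).L_of_trS_invariant (C.sm_liftS_on S hφ)
    (fun v hv => C.graded_symb hφ hv) hX (mem_chart_source _ _) i

theorem CartanGeometry.sm_liftS (C : CartanGeometry m p M F P) (S : Symb m M δ k)
    (i : Fin k → Fin m) : C.Sm univ fun u => C.liftS S u i :=
  ⟨isOpen_univ, fun u _ => ((C.sm_liftS_on S (IsManifold.chart_mem_maximalAtlas (C.proj u))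
    i).contMDiffAt (mem_chart_source _ _)).contMDiffWithinAt⟩

/-- In the frames of `P` the metric is a positive multiple of `η`, so trace-freeness for `g` becomes
trace-freeness for `η`. -/
theorem CartanGeometry.liftS_mem_stf (C : CartanGeometry m p M F P) (hg : C.IsMetric g)
    (hS : S.IsTraceFree g) (u : P) : C.liftS S u ∈ stf (etaMat m p) k := by
  refine ⟨S.symm _ _, fun a b hab idx => ?_⟩
  obtain ⟨s, hs, h⟩ := hg u
  have h1 := hS _ _ (C.linearIndependent_frame u) a b hab idx
  simp only [h, mul_assoc, ← Finset.mul_sum] at h1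
  have h2 := (mul_eq_zero.1 h1).resolve_left hs.ne'
  rw [← h2]
  simp only [etaMat, Matrix.diagonal_apply]
  rfl

theorem CartanGeometry.exists_divChain_liftS (C : CartanGeometry m p M F P) (hg : C.IsMetric g)
    (hS : S.IsTraceFree g) : ∃ s, C.DivChain univ δ k s ∧ s k = C.liftS S :=
  C.exists_divChain (C.sm_liftS S) (C.liftS_mem_stf hg hS) fun _ hX => C.L_liftS S hX

end Lifts

/-! ### Smoothness of the right-hand side -/

section FormulaSmooth

variable {m k : ℕ} {G : Euc m → Matrix (Fin m) (Fin m) ℝ} {Ω : Set (Euc m)}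
  {B : Fin m → Fin m → Euc m → ℝ}

theorem IsMetricOn.formula_smooth (hG : IsMetricOn G Ω) (hB : ∀ a b, ContDiffOn ℝ ∞ (B a b) Ω)
    (lam δ : ℝ) {S f : GField m} (hS : SmoothG Ω S) (hf : SmoothG Ω f)
    (hSk : ∀ n, n ≠ k → S n = 0) (hf0 : ∀ n, n ≠ 0 → f n = 0) :
    ContDiffOn ℝ ∞ (formula G B lam δ k S f) Ω := by
  obtain ⟨W, U, sW, sU, -, -, -, -, -, h⟩ := hG.exists_factors hB lam δ hS hf hSk hf0
  refine ContDiffOn.congr (f := fun y => ∑ l ∈ Finset.range (k + 1),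
    coeffC m lam δ k l * ∑ i, W (k - l) y i * U (k - l) y i) ?_ fun y _ => h y
  exact ContDiffOn.sum fun l _ => contDiffOn_const.mul
    (ContDiffOn.sum fun i _ => (sW _ i).mul (sU _ i))

end FormulaSmooth

/-! ### Densities determined by functions on `P` -/

section Densities

variable {m p k : ℕ} {M : Type*} [TopologicalSpace M] [ChartedSpace (Euc m) M]
  [IsManifold (𝓡 m) ∞ M]
  {F : Type*} [NormedAddCommGroup F] [NormedSpace ℝ F]
  {P : Type*} [TopologicalSpace P] [ChartedSpace F P] [IsManifold 𝓘(ℝ, F) ∞ P]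
  {mu : ℝ}

/-- A density is determined by its lift. -/
theorem CartanGeometry.liftD_injective (C : CartanGeometry m p M F P) {h h' : Density m M mu}
    (he : ∀ u, C.liftD h u = C.liftD h' u) : h = h' := by
  have h1 : h.toFun = h'.toFun := by
    funext x v
    by_cases hv : LinearIndependent ℝ v
    · obtain ⟨u, rfl⟩ := C.exists_proj_eq x
      obtain ⟨A, hA, rfl⟩ := exists_eq_changeFrame (C.linearIndependent_frame u) hv
      rw [h.equivariant _ _ (C.linearIndependent_frame u) A hA,
        h'.equivariant _ _ (C.linearIndependent_frame u) A hA]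
      exact congrArg _ (he u)
    · rw [h.support x v hv, h'.support x v hv]
  cases h
  cases h'
  cases h1
  rfl

/-- A function on `P` which is given by a smooth density in every chart is the lift of a density. -/
theorem CartanGeometry.exists_liftD_eq (C : CartanGeometry m p M F P) {q : P → ℝ}
    {w : OpenPartialHomeomorph M (Euc m) → Euc m → ℝ}
    (hw : ∀ φ ∈ IsManifold.maximalAtlas (𝓡 m) ∞ M, ContDiffOn ℝ ∞ (w φ) φ.target)
    (hq : ∀ φ ∈ IsManifold.maximalAtlas (𝓡 m) ∞ M, ∀ u, C.proj u ∈ φ.source →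
      q u = |(C.jac (C.crd φ) u).det| ^ mu * w φ (C.crd φ u)) :
    ∃ h : Density m M mu, ∀ u, C.liftD h u = q u := by
  classical
  -- The value is defined by the preferred chart at the point; tuples that are not frames get `0`,
  -- as the structure requires.
  let T : (x : M) → (Fin m → TangentSpace (𝓡 m) x) → ℝ := fun x v =>
    if LinearIndependent ℝ v then |(coordMatrix (chartAt (Euc m) x) x v).det| ^ mu
      * w (chartAt (Euc m) x) (chartAt (Euc m) x x) else 0
  have hT : ∀ u, T (C.proj u) (C.frame u) = q u := fun u => by
    have hφ : chartAt (Euc m) (C.proj u) ∈ IsManifold.maximalAtlas (𝓡 m) ∞ M :=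
      IsManifold.chart_mem_maximalAtlas _
    have hu := mem_chart_source (Euc m) (C.proj u)
    simp only [T, if_pos (C.linearIndependent_frame u)]
    rw [hq _ hφ u hu, C.coordMatrix_frame hφ hu]
    rfl
  have hTe : ∀ x (v : Fin m → TangentSpace (𝓡 m) x), LinearIndependent ℝ v →
      ∀ A : Matrix (Fin m) (Fin m) ℝ, A.det ≠ 0 →
        T x (changeFrame v A) = |A.det| ^ mu * T x v := fun x v hv A hA => by
    simp only [T, if_pos hv, if_pos (linearIndependent_changeFrame hv hA)]
    rw [coordMatrix_changeFrame, Matrix.det_mul, abs_mul,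
      Real.mul_rpow (abs_nonneg _) (abs_nonneg _)]
    ring
  refine ⟨⟨T, hTe, fun x v hv => if_neg hv, fun φ hφ => (hw φ hφ).congr fun y hy => ?_⟩, hT⟩
  -- Another chart is compared with the preferred one through a point of `P` over the same base
  -- point: both describe the one number `q u`.
  obtain ⟨u, hu⟩ := C.exists_proj_eq (φ.symm y)
  have hu' : C.proj u ∈ φ.source := by rw [hu]; exact φ.map_target hy
  have hxu : C.crd φ u = y := by rw [CartanGeometry.crd, hu, φ.right_inv hy]
  have hdet := (C.coord_crd hφ).det u hu'
  have h1 := hT u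
  rw [hq φ hφ u hu', C.apply_frame hφ hu' T, hxu,
    hTe _ _ (linearIndependent_coordFrame hφ hy) _ hdet] at h1
  exact mul_left_cancel₀ (Real.rpow_pos_of_pos (abs_pos.2 hdet) mu).ne' h1

end Densities

end ConformalQuantization

end

/-! ### The theorem -/

open ConformalQuantization in
theorem mainTheorem2 {m p k : ℕ} (hm : 3 ≤ m) (hp : p ≤ m) (lam mu : ℝ)
    (hcrit : ¬ IsCritical m (mu - lam))
    {M : Type*} [TopologicalSpace M] [ChartedSpace (Euc m) M] [IsManifold (𝓡 m) ∞ M]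
    {F : Type*} [NormedAddCommGroup F] [NormedSpace ℝ F] [FiniteDimensional ℝ F]
    {P : Type*} [TopologicalSpace P] [ChartedSpace F P] [IsManifold 𝓘(ℝ, F) ∞ P]
    (C : CartanGeometry m p M F P) (hC : C.IsNormal)
    (g : Metric m M p) (hg : C.IsMetric g)
    (S : Symb m M (mu - lam) k) (hS : S.IsTraceFree g) (f : Density m M lam) :
    (∃! T : (n : ℕ) → P → Ten m n, C.IsModification lam (mu - lam) k (C.liftS S) T) ∧
    (∃! h : Density m M mu, C.IsQuantization S f h) ∧
    ∀ h : Density m M mu, C.IsQuantization S f h →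
      ∀ φ ∈ IsManifold.maximalAtlas (𝓡 m) ∞ M, ∀ y ∈ φ.target,
        h.comp φ y = formula (g.comp φ) (defTen (g.comp φ)) lam (mu - lam) k
          (S.graded φ) (f.graded φ) y ∧
        h.comp φ y = formula (g.comp φ) (rTen (g.comp φ)) lam (mu - lam) k
          (S.graded φ) (f.graded φ) y ∧
        (k = 2 → h.comp φ y = formula2 (g.comp φ) lam (mu - lam) (S.graded φ) (f.graded φ) y) ∧
        (k = 3 → h.comp φ y = formula3 (g.comp φ) lam (mu - lam) (S.graded φ) (f.graded φ) y) := by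
  have hm0 : m ≠ 0 := by omega
  obtain ⟨s, hs, hsk⟩ := C.exists_divChain_liftS hg hS
  have hT : C.IsModification lam (mu - lam) k (C.liftS S)
      (fun n u => coeffC m lam (mu - lam) k (k - n) • s n u) := by
    rw [← hsk]
    exact hs.isModification hm0 hcrit
  have hmetric : ∀ φ ∈ IsManifold.maximalAtlas (𝓡 m) ∞ M, IsMetricOn (g.comp φ) φ.target :=
    fun φ hφ => (C.confCoord_crd hφ hg).metric
  -- This version, with `r`, also produces the density and the formulas of low order; the version
  -- with `Γ` follows from the same local statement because only contractions with trace-free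
  -- tensors enter.
  have hr : ∀ φ ∈ IsManifold.maximalAtlas (𝓡 m) ∞ M, ∀ u, C.proj u ∈ φ.source →
      C.opQ k (fun n u => coeffC m lam (mu - lam) k (k - n) • s n u) (C.liftD f) u
        = |(C.jac (C.crd φ) u).det| ^ mu * formula (g.comp φ) (rTen (g.comp φ)) lam (mu - lam) k
          (S.graded φ) (f.graded φ) (C.crd φ u) := fun φ hφ u hu => by
    rw [C.opQ_liftD hm hC hg hcrit hs hsk hφ (hmetric φ hφ).rTen_smooth
      (fun _ _ _ _ _ _ => rfl) hu, add_sub_cancel]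
  have hd : ∀ φ ∈ IsManifold.maximalAtlas (𝓡 m) ∞ M, ∀ u, C.proj u ∈ φ.source →
      C.opQ k (fun n u => coeffC m lam (mu - lam) k (k - n) • s n u) (C.liftD f) u
        = |(C.jac (C.crd φ) u).det| ^ mu * formula (g.comp φ) (defTen (g.comp φ)) lam (mu - lam) k
          (S.graded φ) (f.graded φ) (C.crd φ u) := fun φ hφ u hu => by
    rw [C.opQ_liftD hm hC hg hcrit hs hsk hφ (hmetric φ hφ).defTen_smooth
      (fun _ _ _ _ hT j => defTen_contract hT j) hu, add_sub_cancel]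
  refine ⟨⟨_, hT, fun T' hT' => hT'.unique hm0 hcrit hT⟩, ?_, ?_⟩
  · obtain ⟨h, hh⟩ := C.exists_liftD_eq (w := fun φ => formula (g.comp φ) (rTen (g.comp φ)) lam
      (mu - lam) k (S.graded φ) (f.graded φ)) (fun φ hφ =>
        (hmetric φ hφ).formula_smooth (hmetric φ hφ).rTen_smooth lam (mu - lam)
          (S.smoothG_graded hφ) (f.smoothG_graded hφ) (fun n hn => single_of_ne _ hn)
          (fun n hn => single_of_ne _ hn)) hr
    refine ⟨h, ⟨_, hT, hh⟩, ?_⟩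
    rintro h' ⟨T', hT', hh'⟩
    rw [hT'.unique hm0 hcrit hT] at hh'
    exact C.liftD_injective fun u => by rw [hh, hh']
  · rintro h ⟨T', hT', hh⟩ φ hφ y hy
    -- Any modification used to define `h` is the explicit one, so the local formula applies to it.
    rw [hT'.unique hm0 hcrit hT] at hh
    obtain ⟨u, hu⟩ := C.exists_proj_eq (φ.symm y)
    have hu' : C.proj u ∈ φ.source := by rw [hu]; exact φ.map_target hy
    have hxu : C.crd φ u = y := by rw [CartanGeometry.crd, hu, φ.right_inv hy]
    have hdet : |(C.jac (C.crd φ) u).det| ^ mu ≠ 0 :=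
      (Real.rpow_pos_of_pos (abs_pos.2 ((C.coord_crd hφ).det u hu')) mu).ne'
    have h0 := hh u
    rw [C.liftD_eq hφ hu'] at h0
    have h1 := mul_left_cancel₀ hdet (h0.trans (hd φ hφ u hu'))
    have h2 := mul_left_cancel₀ hdet (h0.trans (hr φ hφ u hu'))
    rw [hxu] at h1 h2
    refine ⟨h1, h2, ?_, ?_⟩
    · rintro rfl
      rw [h2]
      exact (hmetric φ hφ).formula_two lam _ (S.smoothG_graded hφ) (f.smoothG_graded hφ)
        (fun n hn => single_of_ne _ hn) (fun n hn => single_of_ne _ hn) hy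
    · rintro rfl
      rw [h2]
      refine (hmetric φ hφ).formula_three lam _ (S.smoothG_graded hφ) (f.smoothG_graded hφ)
        (fun n hn => single_of_ne _ hn) (fun z hz => ?_) (fun n hn => single_of_ne _ hn) hy
      rw [Symb.graded, single_self]
      exact S.symm _ _
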